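/- Write $e(z)=e^{2\pi i z}$, $\zeta_8=e(1/8)$, $q^{r}=e(r\tau)$, and use principal branches of roots. Let $A\in\mathbb Z$, $C\in\mathbb N$ with $\gcd(A,C)=1$, $0<\frac AC<1$, let $a\in\{0,1,2,3\}$, and assume $\frac AC\ne\frac12$ when $a$ is odd. Put $\alpha=\frac{A}{2C}\tau+\frac a4$ and, for $\tau\in\mathbb H$, $$V_\alpha(\tau)=i^{a+1}q^{-\frac{(2A-C)^2}{8C^2}}\mu\left(2\alpha,\tfrac\tau2;\tau\right),\qquad \mu(u,v;\tau)=\frac{e^{\pi i u}}{\vartheta(v;\tau)}\sum_{n\in\mathbb Z}\frac{(-1)^ne^{2\pi i n v}q^{n(n+1)/2}}{1-e^{2\pi i u}q^n},$$ $$\vartheta(z;\tau)=\sum_{v\in\mathbb Z+\frac12}e^{\pi i v^2\tau+2\pi i v(z+\frac12)},\qquad g_{s,t}(\tau)=\sum_{v\in s+\mathbb Z}v\,e^{\pi i v^2\tau+2\pi i v t}\quad(s,t\in\mathbb R).$$ Let $S$ be the set of rationals $\frac hk$ in lowest terms with $h$ odd. Let $S_\alpha=\{\frac hk\in S: C\nmid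 h\}$ if $a$ is even, and $S_\alpha=\{\frac hk\in S: C\nmid 2h\}\cup\{\frac hk\in S: C\nmid h,\ 2\mid k\}$ if $a$ is odd. Let $G_\alpha\subset \mathrm{SL}_2(\mathbb Z)$ be generated by $\begin{pmatrix}1&0\\ r&1\end{pmatrix}$ and $\begin{pmatrix}1&s\\0&1\end{pmatrix}$, where $r=1$ for $a$ even, $r=2$ for $a$ odd, $s=C$ for $C$ even, $s=2C$ for $C$ odd. For $\tau=x\in S_\alpha$, put $$V_\alpha(x)=i^{a+1}e\left(-\tfrac{(2A-C)^2}{8C^2}x\right)\cdot i\,e^{\pi i x/4}\,g_2\left(i^ae^{\pi i Ax/C};e^{\pi i x}\right),\qquad g_2(z;q)=\sum_{n\ge0}\frac{(-q;q)_n\,q^{n(n+1)/2}}{(z;q)_{n+1}(z^{-1}q;q)_{n+1}} .$$ Then $V_\alpha$ is a quantum modular form of weight $\frac12$ on $S_\alpha$ with respect to $G_\alpha$. That is: for every $x\in S_\alpha$ no denominator in the (terminating) sum defining $V_\alpha(x)$ vanishes, and $V_\alpha(x+iy)\to V_\alpha(x)$ as $y\to0^+$; for $\gamma=\begin{pmatrix}*&*\\c&d\end{pmatrix}\in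 G_\alpha$ and $x\in S_\alpha$ with $cx+d\ne0$ one has $\gamma x\in S_\alpha$; and for every $\gamma\in G_\alpha$ there is $\varepsilon(\gamma)\in\mathbb C$ with $|\varepsilon(\gamma)|=1$ such that $$x\mapsto V_\alpha(x)-\varepsilon(\gamma)^{-1}(cx+d)^{-1/2}V_\alpha(\gamma x)\qquad (x\in S_\alpha,\ cx+d\neq 0)$$ is the restriction of a real-analytic function on $\{x\in\mathbb R: cx+d\ne0\}$, where $(cx+d)^{-1/2}$ is the limit of the principal value of $(c\tau+d)^{-1/2}$ as $\tau\to x$ in $\mathbb H$. Moreover, the following hold, the integrals being absolutely convergent along vertical lines. (1) If $a\in\{0,2\}$, then for all $\tau\in(\mathbb H\cup S_\alpha)\setminus\{-1\}$, $$V_\alpha(\tau)-\zeta_8^{-1}(\tau+1)^{-1/2}V_\alpha\left(\frac{\tau}{\tau+1}\right)=\frac{-i}{2}\,e\left(\frac{-A}{2C}\right)\int_1^{i\infty}\frac{g_{A/C,1/2}(z)}{\sqrt{-i(z+\tau)}}\,dz .$$ (2) If $a\in\{1,3\}$, then for all $\tau\in(\mathbb H\cup S_\alpha)\setminus\{-\frac12\}$,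 $$V_\alpha(\tau)-(2\tau+1)^{-1/2}V_\alpha\left(\frac{\tau}{2\tau+1}\right)=\frac{-i}{2}\int_{1/2}^{i\infty}\frac{g_{A/C,0}(z)}{\sqrt{-i(z+\tau)}}\,dz .$$ (3) For all $\tau\in\mathbb H\cup S_\alpha$: if $C$ is even, $$V_\alpha(\tau)-(-1)^{A+\frac C2}e\left(\frac C8\right)e\left(\frac{C(2A-C)^2}{8C^2}\right)V_\alpha(\tau+C)=0,$$ and if $C$ is odd, $$V_\alpha(\tau)+e\left(\frac C4\right)e\left(\frac{(2A-C)^2}{4C}\right)V_\alpha(\tau+2C)=0 .$$ -/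

import Mathlib

open Complex Filter Topology MeasureTheory
open scoped MatrixGroups

noncomputable section

namespace QuantumV

/-- `e(z) = exp (2 π i z)`. -/
def e (z : ℂ) : ℂ := cexp (2 * Real.pi * I * z)

/-- `ϑ(z;τ) = ∑_{v ∈ ℤ + 1/2} exp (π i v² τ + 2 π i v (z + 1/2))`. -/
def theta (z τ : ℂ) : ℂ :=
  ∑' n : ℤ, cexp (Real.pi * I * ((n : ℂ) + 1 / 2) ^ 2 * τ
    + 2 * Real.pi * I * ((n : ℂ) + 1 / 2) * (z + 1 / 2))

/-- Zwegers' function `μ(u,v;τ)`, for `Im τ > 0` and `u, v ∉ ℤ τ + ℤ`. -/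
def mu (u v τ : ℂ) : ℂ :=
  cexp (Real.pi * I * u) / theta v τ *
    ∑' n : ℤ, (-1 : ℂ) ^ n * e (n * v) * e ((n : ℂ) * (n + 1) / 2 * τ) / (1 - e u * e (n * τ))

/-- The finite Pochhammer symbol `(x;q)_n = ∏_{0 ≤ j < n} (1 - x q^j)`. -/
def qPoch (x q : ℂ) (n : ℕ) : ℂ := ∏ j ∈ Finset.range n, (1 - x * q ^ j)

/-- The denominator of the `n`-th term of `g₂(z;q)`. -/
def g2Denom (z q : ℂ) (n : ℕ) : ℂ := qPoch z q (n + 1) * qPoch (z⁻¹ * q) q (n + 1)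

/-- The `n`-th term of `g₂(z;q)`. -/
def g2Term (z q : ℂ) (n : ℕ) : ℂ := qPoch (-q) q n * q ^ (n * (n + 1) / 2) / g2Denom z q n

/-- The universal mock theta function
`g₂(z;q) = ∑_{n ≥ 0} (-q;q)_n q^{n(n+1)/2} / ((z;q)_{n+1} (z⁻¹q;q)_{n+1})`. -/
def g2 (z q : ℂ) : ℂ := ∑' n : ℕ, g2Term z q n

/-- No denominator of `g₂(z;q)` vanishes and the series converges. -/
def G2WellDefined (z q : ℂ) : Prop := (∀ n, g2Denom z q n ≠ 0) ∧ Summable (g2Term z q)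

/-- The point `α = A/(2C) τ + a/4`. -/
def alpha (A : ℤ) (C a : ℕ) (τ : ℂ) : ℂ := (A : ℂ) / (2 * C) * τ + (a : ℂ) / 4

/-- `μ(2α, τ/2; τ)` on the upper half-plane, and its value `i e^{π i τ/4} g₂(e^{2π i α}; e^{π i τ})`
at a rational point `τ` (where the series `g₂` terminates). -/
def muAlpha (A : ℤ) (C a : ℕ) (τ : ℂ) : ℂ :=
  if 0 < τ.im then mu (2 * alpha A C a τ) (τ / 2) τ
  else I * cexp (Real.pi * I * τ / 4) * g2 (e (alpha A C a τ)) (cexp (Real.pi * I * τ))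

/-- `V_α(τ) = i^{a+1} q^{-(2A-C)²/(8C²)} μ(2α, τ/2; τ)`, used for `τ` in the upper half-plane
and for rational `τ`. -/
def V (A : ℤ) (C a : ℕ) (τ : ℂ) : ℂ :=
  I ^ (a + 1) * e (-((2 * A - C : ℂ) ^ 2 / (8 * C ^ 2)) * τ) * muAlpha A C a τ

/-- The theta function `g_{a,b}(τ) = ∑_{v ∈ a + ℤ} v exp (π i v² τ + 2 π i v b)`. -/
def gTheta (a b : ℝ) (τ : ℂ) : ℂ :=
  ∑' n : ℤ, ((a : ℂ) + n) * cexp (Real.pi * I * ((a : ℂ) + n) ^ 2 * τ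
    + 2 * Real.pi * I * ((a : ℂ) + n) * b)

/-- The integrand of `∫_p^{i∞} g_{a,b}(z) (-i(z+τ))^{-1/2} dz` along `z = p + i t`, `t > 0`,
including `dz/dt = i`. -/
def periodIntegrand (p a b : ℝ) (τ : ℂ) (t : ℝ) : ℂ :=
  gTheta a b (p + t * I) / (-I * ((p + t * I) + τ)) ^ (1 / 2 : ℂ) * I

/-- The period integral `∫_p^{i∞} g_{a,b}(z) / √(-i(z+τ)) dz`. -/
def periodIntegral (p a b : ℝ) (τ : ℂ) : ℂ := ∫ t in Set.Ioi (0 : ℝ), periodIntegrand p a b τ t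

/-- Rationals with odd numerator in lowest terms. -/
def S : Set ℚ := {x | Odd x.num}

def SC1 (C : ℕ) : Set ℚ := {x | x ∈ S ∧ ¬ (C : ℤ) ∣ x.num}

def SC2 (C : ℕ) : Set ℚ := {x | x ∈ S ∧ ¬ (C : ℤ) ∣ 2 * x.num}

def Sev (C : ℕ) : Set ℚ := {x | x ∈ SC1 C ∧ Even x.den}

/-- The set `S_α`. -/
def Salpha (C a : ℕ) : Set ℚ := if Even a then SC1 C else SC2 C ∪ Sev C

/-- The matrix `(1 0; r 1)`. -/
def lowerMat (r : ℤ) : SL(2, ℤ) := ⟨!![1, 0; r, 1], by simp⟩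

/-- The matrix `(1 r; 0 1)`. -/
def upperMat (r : ℤ) : SL(2, ℤ) := ⟨!![1, r; 0, 1], by simp⟩

/-- The group `G_α`. -/
def Galpha (C a : ℕ) : Subgroup SL(2, ℤ) :=
  Subgroup.closure {lowerMat (if Even a then 1 else 2), upperMat (if Even C then C else 2 * C)}

/-- `c x + d`. -/
def den (γ : SL(2, ℤ)) (x : ℚ) : ℚ := γ 1 0 * x + γ 1 1

/-- `(a x + b) / (c x + d)`, used when `c x + d ≠ 0`. -/
def moeb (γ : SL(2, ℤ)) (x : ℚ) : ℚ := (γ 0 0 * x + γ 0 1) / den γ x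

/-- `(c x + d)^{-k}` at a rational `x` with `c x + d ≠ 0`: the limit of the principal value of
`(c τ + d)^{-k}` as `τ → x` in the upper half-plane. When `c < 0` the point `c τ + d` lies in the
lower half-plane, so that a negative `c x + d` has argument `-π` instead of `π`. -/
def autFactor (k : ℝ) (γ : SL(2, ℤ)) (x : ℚ) : ℂ :=
  if γ 1 0 < 0 then (starRingEnd ℂ) ((den γ x : ℂ) ^ (-k : ℂ)) else (den γ x : ℂ) ^ (-k : ℂ)

/-- `S` is a quantum set for `F` with respect to `G`: `F` is non-singular at the points of `S`,
in the sense that it tends vertically to the value `F x`, and `M x ∈ S` for `x ∈ S`, `M ∈ G`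
unless `M x = ∞`. -/
def IsQuantumSet (F : ℂ → ℂ) (S : Set ℚ) (G : Subgroup SL(2, ℤ)) : Prop :=
  (∀ x ∈ S, Tendsto (fun y : ℝ => F ((x : ℂ) + y * I)) (𝓝[>] 0) (𝓝 (F x))) ∧
  ∀ γ ∈ G, ∀ x ∈ S, den γ x ≠ 0 → moeb γ x ∈ S

/-- `f` is a quantum modular form of weight `k` on `S` with respect to `G`: for a multiplier `ε`
of absolute value one, each `x ↦ f(x) - ε(γ)⁻¹ (c x + d)^{-k} f(γ x)` is the restriction to `S` of
a function that is real analytic on the real line away from `γ⁻¹ ∞ = -d/c`. -/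
def IsQuantumModularForm (k : ℝ) (S : Set ℚ) (G : Subgroup SL(2, ℤ)) (f : ℚ → ℂ) : Prop :=
  (∀ γ ∈ G, ∀ x ∈ S, den γ x ≠ 0 → moeb γ x ∈ S) ∧
  ∃ ε : SL(2, ℤ) → ℂ, ∀ γ ∈ G, ‖ε γ‖ = 1 ∧
    ∃ Φ : ℝ → ℂ, AnalyticOnNhd ℝ Φ {x : ℝ | (γ 1 0 : ℝ) * x + γ 1 1 ≠ 0} ∧
      ∀ x ∈ S, den γ x ≠ 0 → f x - (ε γ)⁻¹ * autFactor k γ x * f (moeb γ x) = Φ x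

/-- The set `ℍ ∪ S_α`, as a subset of `ℂ`. -/
def domain (C a : ℕ) : Set ℂ := {τ | 0 < τ.im} ∪ (fun x : ℚ => (x : ℂ)) '' Salpha C a

end QuantumV

end

noncomputable section

namespace QuantumV

/-! ### The terminating series `g₂` at roots of unity -/

/-! Everything is reduced to B(x;τ) = μ(x + τ/2, τ/2; τ), which `mu_half_eq_sinSum` writes as a sum
of reciprocal sines divided by the theta constant `theta4`. Up to an exponential factor, V is the
value of B at x = (A/C - 1/2)τ + a/2.

Period integrals. In the variable x, B changes sign under x → x + 1, satisfies an inhomogeneous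
theta-type equation under x → x + τ, and has poles only at -τ/2 + ℤ + ℤτ. Its transform under τ →
τ/(rτ+1) and suitable Mordell integrals satisfy matching equations, and the residues cancel. The
remaining difference, multiplied by an odd theta function, is entire, doubly periodic and zero at
the origin, hence zero (`eq_zero_of_elliptic`). This yields `bFun_sub_bSlash_one` and
`bFun_sub_bSlash_two`. On the other side, the period integral of g is itself a Mordell integral:
write the weight (t - iT)^{-1/2} as a Gaussian integral, exchange the integrations, and take the
Laplace transform of the inverted theta series term by term (`integral_lineTheta_eq_mordell`).
Together these give (1) and (2) on the upper half-plane. Statement (3) is direct, since the Appell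
sum and `theta4` are unchanged by even translations.

Boundary values. At x = h/k with h odd, p = e^{πix} satisfies p^k = -1. After multiplication by
(-i(τ-x))^{1/2}, a Gaussian series with periodic coefficients tends to the mean of its coefficients
(`tendsto_periodic_gaussian`). Applied to the Appell sum and to `theta4`, this turns their quotient
into a finite Appell sum over a nonzero quadratic Gauss sum. That quotient is the terminating g₂,
because both solve the same q-difference equation in z, whose homogeneous form has only the zero
solution off the unit circle (`appellFin_eq`). The limits are proved nontangentially because a
fractional linear map does not preserve vertical lines. The identities on the upper half-plane then
pass to S_α.

Quantum modularity. Transporting the errors of the generators along a word could create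
singularities at intermediate points. Therefore V is first corrected by a multiple H of the part of
the period integral along the ray from -1/r + i/r to i∞, which is analytic across the real line. The
inversion of g along vertical lines shows that V - H is invariant under each generator up to a
factor of absolute value one and a multiple of an integral over a compact horizontal segment
(`almostInvariant_lower`, `almostInvariant_upper`). Every weight 1/2 translate of such an integral
extends analytically across every real point (`edgeAnalytic_segmentIntegral`), so this form of
invariance is stable under products and inverses and holds for the whole group. Restoring H leaves
γ⁻¹∞ as the only possible singularity on the real line. -/

lemma qPoch_succ (x q : ℂ) (n : ℕ) : qPoch x q (n + 1) = qPoch x q n * (1 - x * q ^ n) :=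
  Finset.prod_range_succ _ _

lemma qPoch_succ' (x q : ℂ) (n : ℕ) : qPoch x q (n + 1) = (1 - x) * qPoch (x * q) q n := by
  simp only [qPoch, Finset.prod_range_succ', pow_zero, mul_one]
  rw [mul_comm]
  congr 1
  exact Finset.prod_congr rfl fun j _ => by ring

lemma qPoch_ne_zero {x q : ℂ} (h : ∀ j : ℕ, x * q ^ j ≠ 1) (n : ℕ) : qPoch x q n ≠ 0 :=
  Finset.prod_ne_zero_iff.2 fun j _ => sub_ne_zero.2 (h j).symm

lemma qPoch_neg_eq_zero {q : ℂ} {k n : ℕ} (hk : 0 < k) (hq : q ^ k = -1) (hn : k ≤ n) :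
    qPoch (-q) q n = 0 := by
  refine Finset.prod_eq_zero (i := k - 1) (Finset.mem_range.2 (by omega)) ?_
  have : q * q ^ (k - 1) = q ^ k := by rw [← pow_succ']; congr 1; omega
  linear_combination this + hq

lemma pow_period {p : ℂ} {k : ℕ} (hp : p ^ k = -1) : p ^ (2 * k) = 1 := by
  rw [mul_comm, pow_mul, hp]; norm_num

/-- Powers of p have period 2k, so z⁻¹pⁿ = 1 would give z·p^((2k-1)n) = 1. -/
lemma inv_mul_pow_ne_one {p z : ℂ} {k : ℕ} (hk : 0 < k) (hp : p ^ k = -1)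
    (h : ∀ n : ℕ, z * p ^ n ≠ 1) (n : ℕ) : z⁻¹ * p ^ n ≠ 1 := by
  intro h1
  have hz : z ≠ 0 := by rintro rfl; simp at h1
  have hpn : p ^ n = z := by field_simp at h1; exact h1
  apply h ((2 * k - 1) * n)
  rw [← hpn, ← pow_add]
  have : n + (2 * k - 1) * n = 2 * k * n := by
    obtain ⟨m, rfl⟩ : ∃ m, k = m + 1 := ⟨k - 1, by omega⟩
    have : 2 * (m + 1) - 1 = 2 * m + 1 := by omega
    rw [this]; ring
  rw [this, pow_mul, pow_period hp, one_pow]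

lemma g2Denom_ne_zero {p z : ℂ} {k : ℕ} (hk : 0 < k) (hp : p ^ k = -1)
    (h : ∀ n : ℕ, z * p ^ n ≠ 1) (n : ℕ) : g2Denom z p n ≠ 0 := by
  refine mul_ne_zero (qPoch_ne_zero h _) (qPoch_ne_zero (fun j => ?_) _)
  rw [mul_assoc, ← pow_succ']
  exact inv_mul_pow_ne_one hk hp h (j + 1)

lemma g2Term_eq_zero {p : ℂ} (z : ℂ) {k n : ℕ} (hk : 0 < k) (hp : p ^ k = -1) (hn : k ≤ n) :
    g2Term z p n = 0 := by
  simp [g2Term, qPoch_neg_eq_zero hk hp hn]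

lemma g2_eq_sum {p : ℂ} (z : ℂ) {k : ℕ} (hk : 0 < k) (hp : p ^ k = -1) :
    g2 z p = ∑ n ∈ Finset.range k, g2Term z p n :=
  tsum_eq_sum fun n hn => g2Term_eq_zero z hk hp (by simpa using hn)

lemma g2WellDefined_of {p z : ℂ} {k : ℕ} (hk : 0 < k) (hp : p ^ k = -1)
    (h : ∀ n : ℕ, z * p ^ n ≠ 1) : G2WellDefined z p :=
  ⟨g2Denom_ne_zero hk hp h, summable_of_ne_finset_zero (s := Finset.range k)
    fun n hn => g2Term_eq_zero z hk hp (by simpa using hn)⟩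

/-- The sequence that telescopes `g₂(zq;q) + z² g₂(z;q)`. -/
def g2Tele (z q : ℂ) (n : ℕ) : ℂ :=
  z * (1 - z) * qPoch (-q) q n * q ^ (n * (n + 1) / 2) /
    (qPoch z q (n + 1) * qPoch (z⁻¹ * q) q n)

lemma triangle_succ (n : ℕ) : (n + 1) * (n + 1 + 1) / 2 = n * (n + 1) / 2 + (n + 1) := by
  have h : (n + 1) * (n + 1 + 1) = n * (n + 1) + (n + 1) * 2 := by ring
  rw [h, Nat.add_mul_div_right _ _ (by norm_num)]

/-- `g2Tele` is a telescoping certificate: once the common Pochhammer factors are extracted, what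
remains is an identity of rational functions in z and q^(n+1). -/
lemma g2Term_mul_add {q z : ℂ} (hz : z ≠ 0) (hq : q ≠ 0) (h : ∀ n : ℕ, z * q ^ n ≠ 1)
    (h' : ∀ n : ℕ, z⁻¹ * q ^ n ≠ 1) (n : ℕ) :
    g2Term (z * q) q n + z ^ 2 * g2Term z q n = g2Tele z q (n + 1) - g2Tele z q n := by
  have hz1 : 1 - z ≠ 0 := sub_ne_zero.2 (by simpa using (h 0).symm)
  have e1 : qPoch (z * q) q (n + 1) = qPoch z q (n + 1) * (1 - z * q ^ (n + 1)) / (1 - z) := by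
    rw [← qPoch_succ, qPoch_succ' z, mul_div_cancel_left₀ _ hz1]
  have e2 : qPoch ((z * q)⁻¹ * q) q (n + 1) = (1 - z⁻¹) * qPoch (z⁻¹ * q) q n := by
    rw [← qPoch_succ']; congr 1; field_simp
  have e3 : qPoch (z⁻¹ * q) q (n + 1) = qPoch (z⁻¹ * q) q n * (1 - z⁻¹ * q ^ (n + 1)) := by
    rw [qPoch_succ]; ring
  have e4 : qPoch z q (n + 1 + 1) = qPoch z q (n + 1) * (1 - z * q ^ (n + 1)) := qPoch_succ _ _ _
  have e5 : qPoch (-q) q (n + 1) = qPoch (-q) q n * (1 + q ^ (n + 1)) := by rw [qPoch_succ]; ring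
  have n1 : qPoch z q (n + 1) ≠ 0 := qPoch_ne_zero h _
  have n2 : qPoch (z⁻¹ * q) q n ≠ 0 :=
    qPoch_ne_zero (fun j => by rw [mul_assoc, ← pow_succ']; exact h' _) _
  have n3 : 1 - z * q ^ (n + 1) ≠ 0 := sub_ne_zero.2 (h _).symm
  have n4 : 1 - z⁻¹ * q ^ (n + 1) ≠ 0 := sub_ne_zero.2 (h' _).symm
  have n4' : z - q ^ (n + 1) ≠ 0 := by
    intro h0; apply n4; rw [← sub_eq_zero.1 h0]; field_simp; ring
  have n5 : 1 - z⁻¹ ≠ 0 := sub_ne_zero.2 (by simpa using (h' 0).symm)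
  have n5' : z - 1 ≠ 0 := fun h0 => hz1 (by linear_combination -h0)
  simp only [g2Term, g2Denom, g2Tele, e1, e2, e3, e4, e5, triangle_succ, pow_add q _ (n + 1)]
  generalize q ^ (n + 1) = X at *
  generalize qPoch z q (n + 1) = P at *
  generalize qPoch (z⁻¹ * q) q n = Q at *
  generalize qPoch (-q) q n = R at *
  generalize q ^ (n * (n + 1) / 2) = Y at *
  have hz1' : (1 - z⁻¹) = (z - 1) / z := by field_simp
  have hz2' : (1 - z⁻¹ * X) = (z - X) / z := by field_simp
  rw [hz1', hz2']
  have : z - 1 = -(1 - z) := by ring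
  rw [this]
  field_simp
  ring

/-- The telescoped sum has only two ends. The upper one vanishes because (-p;p)_k = 0, the lower one
is z. -/
lemma g2_mul_add {p z : ℂ} {k : ℕ} (hk : 0 < k) (hp : p ^ k = -1) (hz : z ≠ 0)
    (h : ∀ n : ℕ, z * p ^ n ≠ 1) : g2 (z * p) p + z ^ 2 * g2 z p = -z := by
  have hp0 : p ≠ 0 := by rintro rfl; simp [hk.ne'] at hp
  have hz1 : 1 - z ≠ 0 := sub_ne_zero.2 (by simpa using (h 0).symm)
  rw [g2_eq_sum _ hk hp, g2_eq_sum _ hk hp, Finset.mul_sum, ← Finset.sum_add_distrib,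
    Finset.sum_congr rfl fun n _ => g2Term_mul_add hz hp0 h (inv_mul_pow_ne_one hk hp h) n,
    Finset.sum_range_sub]
  have h1 : g2Tele z p k = 0 := by simp [g2Tele, qPoch_neg_eq_zero hk hp le_rfl]
  have h2 : g2Tele z p 0 = z := by
    simp only [g2Tele, qPoch, Finset.prod_range_zero, zero_add, Finset.prod_range_one]
    simp
    field_simp
  rw [h1, h2, zero_sub]

/-- The finite Appell sum over a period. -/
def appellFin (p z : ℂ) (k : ℕ) : ℂ :=
  z * ∑ n ∈ Finset.range (2 * k), (-1) ^ n * p ^ (n ^ 2 + 2 * n) / (1 - z ^ 2 * p ^ (2 * n))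

/-- The quadratic Gauss sum over a period. -/
def gaussFin (p : ℂ) (k : ℕ) : ℂ := ∑ n ∈ Finset.range (2 * k), (-1) ^ n * p ^ (n ^ 2)

lemma sum_range_shift {N : ℕ} {F : ℕ → ℂ} (hF : F N = F 0) :
    ∑ n ∈ Finset.range N, F (n + 1) = ∑ n ∈ Finset.range N, F n := by
  have := (Finset.sum_range_succ F N).symm.trans (Finset.sum_range_succ' F N)
  rw [hF] at this
  exact (add_right_cancel this).symm

/-- After a shift of the summation index, allowed by periodicity, the factor 1 - z²p^(2n) cancels
from the sum and leaves the Gauss sum. This is the equation of `g2_mul_add` multiplied by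
`gaussFin`. -/
lemma appellFin_mul_add {p z : ℂ} {k : ℕ} (hp : p ^ k = -1)
    (h : ∀ n : ℕ, z ^ 2 * p ^ (2 * n) ≠ 1) :
    appellFin p (z * p) k + z ^ 2 * appellFin p z k = -z * gaussFin p k := by
  set F : ℕ → ℂ := fun n => (-1) ^ n * p ^ (n ^ 2) / (1 - z ^ 2 * p ^ (2 * n)) with hF
  have hper : F (2 * k) = F 0 := by
    have h1 : p ^ ((2 * k) ^ 2) = 1 := by
      rw [sq, pow_mul, pow_period hp, one_pow]
    have h2 : p ^ (2 * (2 * k)) = 1 := by rw [mul_comm, pow_mul, pow_period hp, one_pow]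
    simp [hF, h1, h2]
  have e1 : appellFin p (z * p) k = -z * ∑ n ∈ Finset.range (2 * k), F n := by
    rw [← sum_range_shift hper, appellFin, Finset.mul_sum, Finset.mul_sum]
    refine Finset.sum_congr rfl fun n _ => ?_
    have : (z * p) ^ 2 * p ^ (2 * n) = z ^ 2 * p ^ (2 * (n + 1)) := by ring
    simp only [hF, this]
    rw [← mul_div_assoc, ← mul_div_assoc]
    congr 1
    ring
  rw [e1, appellFin, gaussFin, Finset.mul_sum, Finset.mul_sum, Finset.mul_sum, Finset.mul_sum,
    ← Finset.sum_add_distrib]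
  refine Finset.sum_congr rfl fun n _ => ?_
  have hn : 1 - z ^ 2 * p ^ (2 * n) ≠ 0 := sub_ne_zero.2 (h n).symm
  simp only [hF]
  field_simp
  ring

/-- Running once through the period 2k returns to z and multiplies d by z^(4k), which is not 1 off
the unit circle. -/
lemma eq_zero_of_mul_shift {p : ℂ} {k : ℕ} (hk : 0 < k) (hp : p ^ k = -1) (d : ℂ → ℂ)
    (hd : ∀ z : ℂ, z ≠ 0 → ‖z‖ ≠ 1 → d (z * p) = -z ^ 2 * d z) {z : ℂ} (hz : z ≠ 0)
    (hz1 : ‖z‖ ≠ 1) : d z = 0 := by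
  have hp1 : ‖p‖ = 1 := by
    have : ‖p‖ ^ k = 1 := by rw [← norm_pow, hp]; simp
    exact (pow_eq_one_iff_of_nonneg (norm_nonneg _) hk.ne').1 this
  have hp0 : p ≠ 0 := by rintro rfl; simp at hp1
  have key : ∀ m : ℕ, d (z * p ^ m) = (∏ j ∈ Finset.range m, -(z * p ^ j) ^ 2) * d z := by
    intro m
    induction m with
    | zero => simp
    | succ m ih =>
      rw [pow_succ, ← mul_assoc, hd _ (mul_ne_zero hz (pow_ne_zero _ hp0)) (by simpa [hp1] using hz1),
        ih, Finset.prod_range_succ]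
      ring
  have h2 := key (2 * k)
  rw [pow_period hp, mul_one] at h2
  have h3 : ∏ j ∈ Finset.range (2 * k), -(z * p ^ j) ^ 2 = z ^ (4 * k) := by
    have : ∀ j, -(z * p ^ j) ^ 2 = (-z ^ 2) * p ^ (2 * j) := fun j => by ring
    simp only [this, Finset.prod_mul_distrib, Finset.prod_const, Finset.card_range,
      Finset.prod_pow_eq_pow_sum]
    -- The exponents of p add up to 2k(2k-1), a multiple of the period, so only the power of z
    -- remains.
    rw [← Finset.mul_sum, Finset.sum_range_id, Nat.mul_div_cancel']
    · rw [pow_mul p, pow_period hp, one_pow, neg_pow]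
      simp only [even_two, Even.mul_right, Even.neg_pow, one_pow]
      ring
    · exact (Nat.even_mul_pred_self _).two_dvd
  rw [h3] at h2
  by_contra h0
  have h4 : z ^ (4 * k) = 1 := mul_right_cancel₀ h0 (by rw [← h2, one_mul])
  have : ‖z‖ ^ (4 * k) = 1 := by rw [← norm_pow, h4]; simp
  exact hz1 ((pow_eq_one_iff_of_nonneg (norm_nonneg _) (by omega)).1 this)

lemma mul_pow_ne_one_of_norm {p z : ℂ} (hp1 : ‖p‖ = 1) (hz1 : ‖z‖ ≠ 1) (n : ℕ) :
    z * p ^ n ≠ 1 := by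
  intro h
  apply hz1
  have := congrArg norm h
  simpa [hp1] using this

lemma norm_of_pow_eq {p : ℂ} {k : ℕ} (hk : 0 < k) (hp : p ^ k = -1) : ‖p‖ = 1 := by
  have : ‖p‖ ^ k = 1 := by rw [← norm_pow, hp]; simp
  exact (pow_eq_one_iff_of_nonneg (norm_nonneg _) hk.ne').1 this

lemma norm_sq_ne_one {z : ℂ} (hz1 : ‖z‖ ≠ 1) : ‖z ^ 2‖ ≠ 1 := by
  rw [norm_pow]
  exact fun h => hz1 ((pow_eq_one_iff_of_nonneg (norm_nonneg _) two_ne_zero).1 h)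

lemma appellFin_eq_of_norm {p z : ℂ} {k : ℕ} (hk : 0 < k) (hp : p ^ k = -1) (hz : z ≠ 0)
    (hz1 : ‖z‖ ≠ 1) : appellFin p z k = gaussFin p k * g2 z p := by
  have hp1 := norm_of_pow_eq hk hp
  refine sub_eq_zero.1 (eq_zero_of_mul_shift hk hp
    (fun z => appellFin p z k - gaussFin p k * g2 z p) (fun y hy hy1 => ?_) hz hz1)
  have h1 := appellFin_mul_add (z := y) hp fun n =>
    mul_pow_ne_one_of_norm hp1 (norm_sq_ne_one hy1) (2 * n)
  have h2 := g2_mul_add hk hp hy fun n => mul_pow_ne_one_of_norm hp1 hy1 n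
  linear_combination h1 - gaussFin p k * h2

/-- If the Gauss sum vanished, `appellFin` would vanish off the unit circle. But it has a pole at z
= 1: the terms n = 0 and n = k are singular there, and their contributions have the same sign. -/
lemma gaussFin_ne_zero {p : ℂ} {k : ℕ} (hk : 0 < k) (hp : p ^ k = -1)
    (hprim : ∀ n, 0 < n → n < k → p ^ (2 * n) ≠ 1) : gaussFin p k ≠ 0 := by
  intro h0
  have hp1 := norm_of_pow_eq hk hp
  have hf : ∀ z : ℂ, z ≠ 0 → ‖z‖ ≠ 1 → appellFin p z k = 0 := fun z hz hz1 => by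
    rw [appellFin_eq_of_norm hk hp hz hz1, h0, zero_mul]
  have hpk : ∀ n, k < n → n < 2 * k → p ^ (2 * n) ≠ 1 := by
    intro n h1 h2 h3
    apply hprim (n - k) (by omega) (by omega)
    have : p ^ (2 * n) = p ^ (2 * (n - k)) * p ^ (2 * k) := by rw [← pow_add]; congr 1; omega
    rw [← h3, this, pow_period hp, mul_one]
  -- Multiplication by 1 - r² isolates the pole at r = 1. For n = k the coefficient is (-1)^k p^(k²)
  -- = (-1)^k (-1)^k = 1, as for n = 0.
  have hterm : ∀ n ∈ Finset.range (2 * k), Tendsto (fun r : ℝ => (1 - (r : ℂ) ^ 2) *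
      ((-1) ^ n * p ^ (n ^ 2 + 2 * n) / (1 - (r : ℂ) ^ 2 * p ^ (2 * n)))) (𝓝[>] 1)
      (𝓝 (if n = 0 ∨ n = k then 1 else 0)) := by
    intro n hn
    have hn' := Finset.mem_range.1 hn
    split_ifs with hc
    · have hpn : p ^ (2 * n) = 1 := by
        rcases hc with rfl | rfl
        · simp
        · exact pow_period hp
      have hcoef : (-1 : ℂ) ^ n * p ^ (n ^ 2 + 2 * n) = 1 := by
        rw [pow_add, hpn, mul_one]
        rcases hc with rfl | rfl
        · simp
        · rw [sq, pow_mul, hp, ← mul_pow]; simp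
      refine tendsto_const_nhds.congr' ?_
      filter_upwards [self_mem_nhdsWithin] with r hr
      have hr' : (1 : ℝ) < r := hr
      have : (1 : ℂ) - (r : ℂ) ^ 2 ≠ 0 := by
        norm_cast; nlinarith
      rw [hcoef, hpn, mul_one]
      field_simp
    · push Not at hc
      have hpn : p ^ (2 * n) ≠ 1 := by
        rcases lt_trichotomy n k with h | h | h
        · exact hprim n (by omega) h
        · exact absurd h hc.2
        · exact hpk n h hn'
      have : ContinuousAt (fun r : ℝ => (1 - (r : ℂ) ^ 2) *
          ((-1) ^ n * p ^ (n ^ 2 + 2 * n) / (1 - (r : ℂ) ^ 2 * p ^ (2 * n)))) 1 := by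
        refine ContinuousAt.mul (by fun_prop) (ContinuousAt.div (by fun_prop) (by fun_prop) ?_)
        simpa [sub_eq_zero] using hpn.symm
      have h := this.tendsto.mono_left (nhdsWithin_le_nhds (s := Set.Ioi 1))
      simpa using h
  have hsum := tendsto_finsetSum _ hterm
  have hsum2 : Tendsto (fun r : ℝ => (1 - (r : ℂ) ^ 2) * (appellFin p r k / r)) (𝓝[>] 1)
      (𝓝 (∑ n ∈ Finset.range (2 * k), if n = 0 ∨ n = k then 1 else 0)) := by
    refine hsum.congr' ?_
    filter_upwards [self_mem_nhdsWithin] with r hr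
    have hr' : (1 : ℝ) < r := hr
    have : (r : ℂ) ≠ 0 := by norm_cast; linarith
    rw [← Finset.mul_sum, appellFin, mul_div_cancel_left₀ _ this]
  have hzero : Tendsto (fun r : ℝ => (1 - (r : ℂ) ^ 2) * (appellFin p r k / r)) (𝓝[>] 1)
      (𝓝 0) := by
    refine tendsto_const_nhds.congr' ?_
    filter_upwards [self_mem_nhdsWithin] with r hr
    have hr' : (1 : ℝ) < r := hr
    rw [hf r (by norm_cast; linarith) (by simp [abs_of_pos (zero_lt_one.trans hr')]; linarith)]
    simp
  have := tendsto_nhds_unique hsum2 hzero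
  rw [Finset.sum_eq_add_of_mem (a := 0) (b := k) (by simp; omega) (by simp; omega) hk.ne
    (fun c _ hc => by simp [hc.1, hc.2])] at this
  norm_num at this

/-- On the unit circle both sides are continuous along the ray through z, since no denominator
vanishes. The identity therefore follows from its validity at zr with r > 1. -/
lemma appellFin_eq {p z : ℂ} {k : ℕ} (hk : 0 < k) (hp : p ^ k = -1) (hz : z ≠ 0)
    (h : ∀ n : ℕ, z ^ 2 * p ^ (2 * n) ≠ 1) : appellFin p z k = gaussFin p k * g2 z p := by
  by_cases hz1 : ‖z‖ = 1
  swap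
  · exact appellFin_eq_of_norm hk hp hz hz1
  have h' : ∀ n : ℕ, z * p ^ n ≠ 1 := fun n hn => h n (by
    rw [show z ^ 2 * p ^ (2 * n) = (z * p ^ n) ^ 2 by ring, hn, one_pow])
  have hc1 : ContinuousAt (fun r : ℝ => appellFin p (z * r) k) 1 := by
    unfold appellFin
    refine ContinuousAt.mul (by fun_prop) (tendsto_finsetSum _ fun n _ => ?_)
    refine ContinuousAt.div (by fun_prop) (by fun_prop) ?_
    simpa [sub_eq_zero] using (h n).symm
  have hc2 : ContinuousAt (fun r : ℝ => g2 (z * r) p) 1 := by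
    simp only [g2_eq_sum _ hk hp, g2Term]
    refine tendsto_finsetSum _ fun n _ => ?_
    have hne : g2Denom (z * (1 : ℝ)) p n ≠ 0 := by
      simpa using g2Denom_ne_zero hk hp h' n
    refine ContinuousAt.div (by fun_prop) ?_ hne
    unfold g2Denom qPoch
    have : ContinuousAt (fun r : ℝ => (z * (r : ℂ))⁻¹) 1 :=
      ContinuousAt.inv₀ (by fun_prop) (by simpa using hz)
    refine ContinuousAt.mul (tendsto_finsetProd _ fun j _ => ?_)
      (tendsto_finsetProd _ fun j _ => ?_)
    · exact ContinuousAt.tendsto (by fun_prop)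
    · exact ContinuousAt.tendsto (by fun_prop)
  have hc3 : ContinuousAt (fun r : ℝ => gaussFin p k * g2 (z * r) p) 1 :=
    continuousAt_const.mul hc2
  have e : (fun r : ℝ => appellFin p (z * r) k) =ᶠ[𝓝[>] 1]
      fun r : ℝ => gaussFin p k * g2 (z * r) p := by
    filter_upwards [self_mem_nhdsWithin] with r hr
    have hr' : (1 : ℝ) < r := hr
    refine appellFin_eq_of_norm hk hp (mul_ne_zero hz (by norm_cast; linarith)) ?_
    rw [norm_mul, hz1, one_mul, norm_real, Real.norm_eq_abs, abs_of_pos (by linarith)]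
    linarith
  have t1 := hc1.tendsto.mono_left (nhdsWithin_le_nhds (s := Set.Ioi 1))
  have t2 := hc3.tendsto.mono_left (nhdsWithin_le_nhds (s := Set.Ioi 1))
  have := tendsto_nhds_unique (t1.congr' e) t2
  simpa using this

/-! ### Theta series and the Appell sum -/

/-- `∑ (-1)^n e^{π i n² τ}`. -/
def theta4 (τ : ℂ) : ℂ := ∑' n : ℤ, (-1 : ℂ) ^ n * cexp (Real.pi * I * (n : ℂ) ^ 2 * τ)

/-- `∑ (-1)^n e^{π i (n² + 2 n) τ} / (1 - e^{2 π i (u + n τ)})`. -/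
def appellSum (u τ : ℂ) : ℂ :=
  ∑' n : ℤ, (-1 : ℂ) ^ n * cexp (Real.pi * I * ((n : ℂ) ^ 2 + 2 * n) * τ) /
    (1 - cexp (2 * Real.pi * I * (u + n * τ)))

lemma exp_pi_mul_I_mul_int (n : ℤ) : cexp (Real.pi * I * n) = (-1 : ℂ) ^ n := by
  rw [mul_comm, exp_int_mul, exp_pi_mul_I]

lemma norm_neg_one_zpow (n : ℤ) : ‖(-1 : ℂ) ^ n‖ = 1 := by
  rw [norm_zpow]; simp

lemma theta4_eq_jacobiTheta₂ (τ : ℂ) : theta4 τ = jacobiTheta₂ (1 / 2) τ := by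
  refine tsum_congr fun n => ?_
  rw [jacobiTheta₂_term, ← exp_pi_mul_I_mul_int, ← Complex.exp_add]
  congr 1
  ring

lemma theta_half (τ : ℂ) :
    theta (τ / 2) τ = -I * cexp (-(Real.pi * I * τ / 4)) * theta4 τ := by
  rw [theta, theta4, ← tsum_mul_left, ← (Equiv.subRight (1 : ℤ)).tsum_eq]
  refine tsum_congr fun n => ?_
  have h1 : (-1 : ℂ) ^ n = cexp (Real.pi * I * n) := (exp_pi_mul_I_mul_int n).symm
  have h2 : -I = cexp (-(Real.pi / 2 * I)) := by
    rw [exp_neg, exp_pi_div_two_mul_I, inv_I]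
  rw [h1, h2, ← Complex.exp_add, ← Complex.exp_add, ← Complex.exp_add]
  congr 1
  simp only [Equiv.subRight_apply]
  push_cast
  ring

lemma mu_half (u τ : ℂ) : mu u (τ / 2) τ =
    I * cexp (Real.pi * I * τ / 4) * (cexp (Real.pi * I * u) * appellSum u τ / theta4 τ) := by
  have h : ∑' n : ℤ, (-1 : ℂ) ^ n * e (n * (τ / 2)) * e ((n : ℂ) * (n + 1) / 2 * τ) /
      (1 - e u * e (n * τ)) = appellSum u τ := by
    refine tsum_congr fun n => ?_
    simp only [e]
    rw [mul_assoc, ← Complex.exp_add, ← Complex.exp_add]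
    congr 3 <;> ring_nf
  rw [mu, h, theta_half, exp_neg]
  have : cexp (Real.pi * I * τ / 4) ≠ 0 := exp_ne_zero _
  by_cases h0 : theta4 τ = 0
  · simp [h0]
  field_simp
  linear_combination (-appellSum u τ) * I_sq

/-! ### Nontangential limits of Gaussian sums -/

/-- The filter of nontangential approach to the real point `x` in the upper half-plane. -/
def stolz (x K : ℝ) : Filter ℂ := 𝓝 (x : ℂ) ⊓ 𝓟 {τ : ℂ | 0 < τ.im ∧ ‖τ - x‖ ≤ K * τ.im}

lemma stolz_le (x K : ℝ) : stolz x K ≤ 𝓝 (x : ℂ) := inf_le_left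

lemma eventually_stolz (x K : ℝ) : ∀ᶠ τ : ℂ in stolz x K, 0 < τ.im ∧ ‖τ - x‖ ≤ K * τ.im :=
  mem_inf_of_right (mem_principal_self _)

lemma tendsto_stolz {ι : Type*} {l : Filter ι} {f : ι → ℂ} {x K : ℝ}
    (h1 : Tendsto f l (𝓝 (x : ℂ)))
    (h2 : ∀ᶠ i in l, 0 < (f i).im ∧ ‖f i - x‖ ≤ K * (f i).im) : Tendsto f l (stolz x K) :=
  tendsto_inf.2 ⟨h1, tendsto_principal.2 h2⟩

lemma tendsto_sub_stolz (x K : ℝ) : Tendsto (fun τ : ℂ => τ - x) (stolz x K) (stolz 0 K) := by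
  refine tendsto_stolz ?_ ?_
  · have : Tendsto (fun τ : ℂ => τ - x) (𝓝 (x : ℂ)) (𝓝 ((x : ℂ) - x)) :=
      (continuous_id.sub continuous_const).tendsto _
    simpa using this.mono_left (stolz_le x K)
  · filter_upwards [eventually_stolz x K] with τ hτ
    simpa using hτ

lemma tendsto_jacobiTheta₂_one (x : ℝ) :
    Tendsto (fun τ : ℂ => jacobiTheta₂ x τ) (comap im atTop) (𝓝 1) := by
  have hs : Summable fun n : ℤ => Real.exp (-Real.pi * (n : ℝ) ^ 2) := by
    have := (summable_jacobiTheta₂_term_iff 0 I).2 (by simp)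
    refine this.norm.congr fun n => ?_
    rw [norm_jacobiTheta₂_term]
    simp
  have h1 : ∑' n : ℤ, (if n = 0 then (1 : ℂ) else 0) = 1 := by simp
  rw [← h1]
  refine tendsto_tsum_of_dominated_convergence hs (fun n => ?_) ?_
  · split_ifs with hn
    · subst hn
      simpa [jacobiTheta₂_term] using tendsto_const_nhds
    · rw [tendsto_zero_iff_norm_tendsto_zero]
      simp only [norm_jacobiTheta₂_term, ofReal_im, mul_zero, sub_zero]
      refine Real.tendsto_exp_atBot.comp ?_
      have hn2 : (0 : ℝ) < Real.pi * (n : ℝ) ^ 2 := by positivity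
      have : Tendsto (fun τ : ℂ => (Real.pi * (n : ℝ) ^ 2) * τ.im) (comap im atTop) atTop :=
        tendsto_comap.const_mul_atTop hn2
      refine (tendsto_neg_atTop_atBot.comp this).congr fun τ => ?_
      simp
  · have : ∀ᶠ τ in comap im (atTop : Filter ℝ), 1 ≤ τ.im :=
      tendsto_comap.eventually (eventually_ge_atTop 1)
    filter_upwards [this] with τ hτ n
    rw [norm_jacobiTheta₂_term]
    simp only [ofReal_im, mul_zero, sub_zero]
    refine Real.exp_le_exp.2 ?_
    have : 0 ≤ Real.pi * (n : ℝ) ^ 2 := by positivity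
    nlinarith

lemma mul_cpow_of_arg {x y : ℂ} (hx : x ≠ 0) (hy : y ≠ 0)
    (h : x.arg + y.arg ∈ Set.Ioc (-Real.pi) Real.pi) (r : ℂ) : (x * y) ^ r = x ^ r * y ^ r := by
  rw [cpow_def_of_ne_zero hx, cpow_def_of_ne_zero hy, cpow_def_of_ne_zero (mul_ne_zero hx hy),
    Complex.log_mul hx hy h, add_mul, Complex.exp_add]

lemma ofReal_mul_cpow {x : ℝ} (hx : 0 < x) (y r : ℂ) :
    ((x : ℂ) * y) ^ r = (x : ℂ) ^ r * y ^ r := by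
  rcases eq_or_ne y 0 with rfl | hy
  · rcases eq_or_ne r 0 with rfl | hr
    · simp
    · simp [zero_cpow hr]
  · refine mul_cpow_of_arg (by exact_mod_cast hx.ne') hy ?_ r
    rw [arg_ofReal_of_nonneg hx.le, zero_add]
    exact arg_mem_Ioc y

lemma ofReal_sq_cpow_half {x : ℝ} (hx : 0 ≤ x) : (((x ^ 2 : ℝ)) : ℂ) ^ (1 / 2 : ℂ) = x := by
  have : (1 / 2 : ℂ) = ((1 / 2 : ℝ) : ℂ) := by push_cast; rfl
  rw [this, ← ofReal_cpow (by positivity), ← Real.sqrt_eq_rpow, Real.sqrt_sq hx]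

lemma summable_exp_neg_mul_int_sq {y : ℝ} (hy : 0 < y) :
    Summable fun n : ℤ => Real.exp (-Real.pi * y * (n : ℝ) ^ 2) := by
  have := (summable_jacobiTheta₂_term_iff 0 (y * I)).2 (by simpa using hy)
  refine this.norm.congr fun n => ?_
  rw [norm_jacobiTheta₂_term]
  simp
  ring

lemma norm_cexp_quadratic (n : ℤ) (w : ℂ) :
    ‖cexp (Real.pi * I * (n : ℂ) ^ 2 * w)‖ = Real.exp (-Real.pi * w.im * (n : ℝ) ^ 2) := by
  rw [norm_exp]
  congr 1
  have : Real.pi * I * (n : ℂ) ^ 2 * w = ((Real.pi * (n : ℝ) ^ 2 : ℝ) : ℂ) * (I * w) := by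
    push_cast; ring
  rw [this, re_ofReal_mul]
  simp
  ring

/-- A residue class modulo N gives a Jacobi theta function of N²w. Its inversion turns the limit w →
0 into a limit at i∞, where theta tends to 1. -/
lemma tsum_residue_gaussian {N j : ℕ} (hN : 0 < N) {w : ℂ} (hw : 0 < w.im) :
    (-I * w) ^ (1 / 2 : ℂ) * ∑' m : ℤ, cexp (Real.pi * I * ((m * N + j : ℤ) : ℂ) ^ 2 * w) =
      (N : ℂ)⁻¹ * jacobiTheta₂ ((j / N : ℝ) : ℂ) (-1 / ((N : ℂ) ^ 2 * w)) := by
  have hN0 : (N : ℂ) ≠ 0 := by exact_mod_cast hN.ne'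
  have hw0 : w ≠ 0 := by rintro rfl; simp at hw
  have h1 : ∑' m : ℤ, cexp (Real.pi * I * ((m * N + j : ℤ) : ℂ) ^ 2 * w) =
      cexp (Real.pi * I * j ^ 2 * w) * jacobiTheta₂ (j * N * w) ((N : ℂ) ^ 2 * w) := by
    rw [jacobiTheta₂, ← tsum_mul_left]
    refine tsum_congr fun m => ?_
    rw [jacobiTheta₂_term, ← Complex.exp_add]
    congr 1
    push_cast
    ring
  have h2 : (-I * ((N : ℂ) ^ 2 * w)) ^ (1 / 2 : ℂ) = N * (-I * w) ^ (1 / 2 : ℂ) := by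
    have h1 : -I * ((N : ℂ) ^ 2 * w) = (((N : ℝ) ^ 2 : ℝ) : ℂ) * (-I * w) := by push_cast; ring
    rw [h1, ofReal_mul_cpow (by positivity), ofReal_sq_cpow_half (by positivity)]
    simp
  have h3 : (-I * w) ^ (1 / 2 : ℂ) ≠ 0 := by
    rw [Ne, cpow_eq_zero_iff]
    simp [hw0]
  rw [h1, jacobiTheta₂_functional_equation, h2]
  have h4 : cexp (Real.pi * I * j ^ 2 * w) *
      cexp (-Real.pi * I * (j * N * w) ^ 2 / ((N : ℂ) ^ 2 * w)) = 1 := by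
    rw [← Complex.exp_add, ← Complex.exp_zero]
    congr 1
    field_simp
    ring
  have h5 : (j : ℂ) * N * w / ((N : ℂ) ^ 2 * w) = ((j / N : ℝ) : ℂ) := by
    push_cast
    field_simp
  rw [h5]
  generalize jacobiTheta₂ _ _ = J
  generalize (-I * w) ^ (1 / 2 : ℂ) = R at *
  calc _ = (R / R) * (N : ℂ)⁻¹ * (cexp (Real.pi * I * j ^ 2 * w) *
      cexp (-Real.pi * I * (j * N * w) ^ 2 / ((N : ℂ) ^ 2 * w))) * J := by field_simp
    _ = _ := by rw [h4, div_self h3]; ring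

/-- Here nontangential approach is essential: Im(-1/w) = Im w/|w|² is at least a constant times
1/|w| only if |w| is bounded by a multiple of Im w. -/
lemma tendsto_im_neg_inv_stolz {N : ℕ} (hN : 0 < N) (K : ℝ) :
    Tendsto (fun w : ℂ => -1 / ((N : ℂ) ^ 2 * w)) (stolz 0 K) (comap im atTop) := by
  rw [tendsto_comap_iff]
  have hK : 0 < |K| + 1 := by positivity
  have h1 : Tendsto (fun w : ℂ => ‖w‖) (stolz 0 K) (𝓝[>] 0) := by
    refine tendsto_nhdsWithin_iff.2 ⟨?_, ?_⟩
    · have : Tendsto (fun w : ℂ => ‖w‖) (𝓝 ((0 : ℝ) : ℂ)) (𝓝 0) := by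
        simpa using (continuous_norm (E := ℂ)).tendsto 0
      exact this.mono_left (stolz_le 0 K)
    · filter_upwards [eventually_stolz 0 K] with w hw
      refine norm_pos_iff.2 ?_
      rintro rfl
      simp at hw
  have h2 : Tendsto (fun w : ℂ => ((N : ℝ) ^ 2 * (|K| + 1))⁻¹ * ‖w‖⁻¹) (stolz 0 K) atTop :=
    (tendsto_inv_nhdsGT_zero.comp h1).const_mul_atTop (by positivity)
  refine tendsto_atTop_mono' _ ?_ h2
  filter_upwards [eventually_stolz 0 K] with w hw
  have hw0 : w ≠ 0 := by rintro rfl; simp at hw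
  have hn : 0 < ‖w‖ := norm_pos_iff.2 hw0
  have h3 : ‖w‖ ≤ (|K| + 1) * w.im := by
    have := hw.2
    simp only [ofReal_zero, sub_zero] at this
    nlinarith [le_abs_self K, hw.1]
  have h4 : (-1 / ((N : ℂ) ^ 2 * w)).im = w.im / ((N : ℝ) ^ 2 * ‖w‖ ^ 2) := by
    have : -1 / ((N : ℂ) ^ 2 * w) = ((-((N : ℝ) ^ 2)⁻¹ : ℝ) : ℂ) * w⁻¹ := by
      push_cast
      field_simp
    rw [this, im_ofReal_mul, inv_im, normSq_eq_norm_sq]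
    field_simp
  simp only [Function.comp_apply]
  rw [h4, ← mul_inv, inv_eq_one_div, div_le_div_iff₀ (by positivity) (by positivity)]
  have hN2 : (0 : ℝ) < (N : ℝ) ^ 2 := by positivity
  nlinarith [mul_le_mul_of_nonneg_left h3 (mul_pos hN2 hn).le]

/-- The mean value of a periodic function governs the nontangential growth of its theta series. -/
lemma tendsto_periodic_gaussian {N : ℕ} (hN : 0 < N) {c : ℤ → ℂ}
    (hc : Function.Periodic c (N : ℤ)) {M : ℝ} (hM : ∀ n, ‖c n‖ ≤ M) (K : ℝ) :
    Tendsto (fun w : ℂ => (-I * w) ^ (1 / 2 : ℂ) *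
      ∑' n : ℤ, c n * cexp (Real.pi * I * (n : ℂ) ^ 2 * w)) (stolz 0 K)
      (𝓝 ((N : ℂ)⁻¹ * ∑ j ∈ Finset.range N, c j)) := by
  have : NeZero N := ⟨hN.ne'⟩
  have key : ∀ w : ℂ, 0 < w.im → (-I * w) ^ (1 / 2 : ℂ) *
      ∑' n : ℤ, c n * cexp (Real.pi * I * (n : ℂ) ^ 2 * w) =
      ∑ j ∈ Finset.range N, c j * ((N : ℂ)⁻¹ *
        jacobiTheta₂ ((j / N : ℝ) : ℂ) (-1 / ((N : ℂ) ^ 2 * w))) := by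
    intro w hw
    have hs : Summable fun n : ℤ => c n * cexp (Real.pi * I * (n : ℂ) ^ 2 * w) := by
      refine Summable.of_norm_bounded ((summable_exp_neg_mul_int_sq hw).mul_left M) fun n => ?_
      rw [norm_mul, norm_cexp_quadratic]
      exact mul_le_mul_of_nonneg_right (hM n) (Real.exp_pos _).le
    rw [← (Int.divModEquiv N).symm.tsum_eq]
    have hs' := ((Int.divModEquiv N).symm.summable_iff).2 hs
    rw [((Equiv.prodComm _ _).tsum_eq _).symm, Summable.tsum_prod]
    · rw [tsum_fintype, Finset.mul_sum, Finset.sum_range]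
      refine Finset.sum_congr rfl fun j _ => ?_
      rw [← tsum_residue_gaussian hN hw, ← tsum_mul_left, ← tsum_mul_left, ← tsum_mul_left]
      refine tsum_congr fun m => ?_
      have hcm : c (m * N + j) = c j := by
        have := hc.int_mul m (j : ℤ)
        simpa [add_comm] using this
      simp only [Equiv.prodComm_apply, Prod.swap, Int.divModEquiv_symm_apply, hcm]
      push_cast
      ring_nf
    · exact ((Equiv.prodComm _ _).summable_iff).2 hs'
  have h2 : Tendsto (fun w : ℂ => ∑ j ∈ Finset.range N, c j * ((N : ℂ)⁻¹ *
        jacobiTheta₂ ((j / N : ℝ) : ℂ) (-1 / ((N : ℂ) ^ 2 * w)))) (stolz 0 K)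
      (𝓝 (∑ j ∈ Finset.range N, c j * ((N : ℂ)⁻¹ * 1))) :=
    tendsto_finsetSum _ fun j _ => ((tendsto_jacobiTheta₂_one _).comp
      (tendsto_im_neg_inv_stolz hN K)).const_mul _ |>.const_mul _
  rw [Finset.mul_sum]
  have h3 : ∀ j ∈ Finset.range N, (N : ℂ)⁻¹ * c j = c j * ((N : ℂ)⁻¹ * 1) := fun j _ => by ring
  rw [Finset.sum_congr rfl h3]
  refine h2.congr' ?_
  filter_upwards [eventually_stolz 0 K] with w hw
  exact (key w hw.1).symm

/-- Theta inversion produces the factor y^(-1/2) and a Gaussian series that decreases as y decreases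
to 0. -/
lemma tsum_exp_neg_mul_int_sq_le {y : ℝ} (hy : 0 < y) (hy1 : y ≤ 1) :
    ∑' n : ℤ, Real.exp (-Real.pi * y * (n : ℝ) ^ 2) ≤
      (Real.sqrt y)⁻¹ * ∑' n : ℤ, Real.exp (-Real.pi * 1 * (n : ℝ) ^ 2) := by
  have h := Real.tsum_exp_neg_mul_int_sq hy
  rw [h, ← Real.sqrt_eq_rpow, one_div]
  refine mul_le_mul_of_nonneg_left ?_ (by positivity)
  refine Summable.tsum_le_tsum (fun n => Real.exp_le_exp.2 ?_) ?_
    (summable_exp_neg_mul_int_sq one_pos)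
  · have h1 : 1 ≤ 1 / y := by rw [le_div_iff₀ hy]; simpa using hy1
    have : -Real.pi / y = -Real.pi * (1 / y) := by ring
    rw [this]
    have h2 : 0 ≤ Real.pi * (n : ℝ) ^ 2 := by positivity
    nlinarith
  · refine (summable_exp_neg_mul_int_sq (y := 1 / y) (by positivity)).congr fun n => ?_
    congr 1
    ring

/-- Half of the Gaussian absorbs the linear factor at the price of y^(-1/2). Together with the
y^(-1/2) of the remaining series this gives the O(1/y) of `tsum_abs_mul_exp_le`. -/
lemma abs_mul_exp_le {y : ℝ} (hy : 0 < y) (hy1 : y ≤ 1) (t : ℝ) :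
    (|t| + 1) * Real.exp (-Real.pi * y * t ^ 2) ≤
      2 * (Real.sqrt y)⁻¹ * Real.exp (-Real.pi * (y / 2) * t ^ 2) := by
  have hs : 0 < Real.sqrt y := Real.sqrt_pos.2 hy
  have hs1 : Real.sqrt y ≤ 1 := Real.sqrt_le_one.2 hy1
  have hsq : Real.sqrt y ^ 2 = y := Real.sq_sqrt hy.le
  have h1 : |t| * Real.sqrt y ≤ Real.exp (Real.pi * (y / 2) * t ^ 2) := by
    have h2 := Real.add_one_le_exp (Real.pi * (y / 2) * t ^ 2)
    have h3 : Real.pi * (y / 2) * t ^ 2 = Real.pi / 2 * (|t| * Real.sqrt y) ^ 2 := by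
      rw [mul_pow, hsq, sq_abs]; ring
    nlinarith [Real.pi_gt_three, sq_nonneg (|t| * Real.sqrt y - 1),
      sq_nonneg (|t| * Real.sqrt y)]
  have h4 : Real.sqrt y ≤ Real.exp (Real.pi * (y / 2) * t ^ 2) :=
    hs1.trans (Real.one_le_exp (by positivity))
  have h5 : Real.exp (-Real.pi * (y / 2) * t ^ 2) =
      Real.exp (Real.pi * (y / 2) * t ^ 2) * Real.exp (-Real.pi * y * t ^ 2) := by
    rw [← Real.exp_add]; congr 1; ring
  rw [h5, ← mul_assoc]
  refine mul_le_mul_of_nonneg_right ?_ (Real.exp_pos _).le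
  rw [mul_assoc, mul_comm (Real.sqrt y)⁻¹, ← mul_assoc, ← div_eq_mul_inv, le_div_iff₀ hs]
  linarith

lemma summable_abs_mul_exp {y : ℝ} (hy : 0 < y) (hy1 : y ≤ 1) :
    Summable fun n : ℤ => (|(n : ℝ)| + 1) * Real.exp (-Real.pi * y * (n : ℝ) ^ 2) :=
  Summable.of_nonneg_of_le (fun n => by positivity) (fun n => abs_mul_exp_le hy hy1 n)
    ((summable_exp_neg_mul_int_sq (half_pos hy)).mul_left _)

lemma tsum_abs_mul_exp_le : ∃ c : ℝ, ∀ y : ℝ, 0 < y → y ≤ 1 →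
    ∑' n : ℤ, (|(n : ℝ)| + 1) * Real.exp (-Real.pi * y * (n : ℝ) ^ 2) ≤ c / y := by
  refine ⟨2 * Real.sqrt 2 * ∑' n : ℤ, Real.exp (-Real.pi * 1 * (n : ℝ) ^ 2), fun y hy hy1 => ?_⟩
  refine (Summable.tsum_le_tsum (fun n : ℤ => abs_mul_exp_le hy hy1 n)
    (summable_abs_mul_exp hy hy1)
    ((summable_exp_neg_mul_int_sq (half_pos hy)).mul_left _)).trans ?_
  rw [tsum_mul_left]
  have h1 := tsum_exp_neg_mul_int_sq_le (half_pos hy) (by linarith)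
  have h2 : 0 ≤ 2 * (Real.sqrt y)⁻¹ := by positivity
  refine (mul_le_mul_of_nonneg_left h1 h2).trans (le_of_eq ?_)
  rw [Real.sqrt_div hy.le, inv_div]
  have : (Real.sqrt y)⁻¹ * (Real.sqrt 2 / Real.sqrt y) = Real.sqrt 2 / y := by
    rw [inv_mul_eq_div, div_div, Real.mul_self_sqrt hy.le]
  calc _ = 2 * ((Real.sqrt y)⁻¹ * (Real.sqrt 2 / Real.sqrt y)) *
      ∑' n : ℤ, Real.exp (-Real.pi * 1 * (n : ℝ) ^ 2) := by ring
    _ = _ := by rw [this]; ring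

section

/-! ### Nontangential limits of the Appell sum -/

/-- For small ζ the denominator stays near 1 - Y, hence away from 0. For larger ζ the sector
condition forces |Re ζ| to be large, so the modulus of Y e^ζ stays away from 1. -/
lemma div_one_sub_lipschitz {δ K : ℝ} (hδ : 0 < δ) (hδ1 : δ ≤ 1) (hK : 0 < K) :
    ∃ c : ℝ, 0 ≤ c ∧ ∀ Y ζ : ℂ, ‖Y‖ = 1 → δ ≤ ‖1 - Y‖ → ‖ζ‖ ≤ K * |ζ.re| →
      1 - Y * cexp ζ ≠ 0 ∧
      ‖Y * cexp ζ / (1 - Y * cexp ζ) - Y / (1 - Y)‖ ≤ c * ‖ζ‖ := by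
  set η := δ / (4 * K) with hη
  have hη0 : 0 < η := by positivity
  have hη1 : 0 < 1 - Real.exp (-η) := by
    have := Real.exp_lt_one_iff.2 (neg_lt_zero.2 hη0); linarith
  have hB : 0 < 8 / (δ * (1 - Real.exp (-η))) := by positivity
  refine ⟨(4 / δ + 8 / (δ * (1 - Real.exp (-η)))) / δ, by positivity, fun Y ζ hY hY1 hζ => ?_⟩
  have h1Y : 1 - Y ≠ 0 := by
    intro h; rw [h, norm_zero] at hY1; linarith
  have hnorm : ‖Y * cexp ζ‖ = Real.exp ζ.re := by rw [norm_mul, hY, one_mul, norm_exp]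
  have key : 1 - Y * cexp ζ ≠ 0 ∧ ‖cexp ζ - 1‖ / ‖1 - Y * cexp ζ‖ ≤
      (4 / δ + 8 / (δ * (1 - Real.exp (-η)))) * ‖ζ‖ := by
    rcases le_or_gt ‖ζ‖ (δ / 4) with hs | hs
    · have h2 : ‖cexp ζ - 1‖ ≤ 2 * ‖ζ‖ := norm_exp_sub_one_le (by linarith)
      have h3 : δ / 2 ≤ ‖1 - Y * cexp ζ‖ := by
        have : 1 - Y = (1 - Y * cexp ζ) + Y * (cexp ζ - 1) := by ring
        have h4 := norm_add_le (1 - Y * cexp ζ) (Y * (cexp ζ - 1))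
        rw [← this, norm_mul, hY, one_mul] at h4
        linarith
      have hpos : 0 < ‖1 - Y * cexp ζ‖ := by linarith
      refine ⟨norm_pos_iff.1 hpos, ?_⟩
      rw [div_le_iff₀ hpos]
      have h5 : 2 * ‖ζ‖ = (4 / δ * ‖ζ‖) * (δ / 2) := by field_simp; ring
      have h6 : 4 / δ * ‖ζ‖ * (δ / 2) ≤ 4 / δ * ‖ζ‖ * ‖1 - Y * cexp ζ‖ :=
        mul_le_mul_of_nonneg_left h3 (by positivity)
      have h7 : 0 ≤ 8 / (δ * (1 - Real.exp (-η))) * ‖ζ‖ * ‖1 - Y * cexp ζ‖ := by positivity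
      nlinarith
    · have hre : η < |ζ.re| := by
        rw [hη, div_lt_iff₀ (by positivity)]
        linarith
      have h8 : 2 / (1 - Real.exp (-η)) ≤
          (4 / δ + 8 / (δ * (1 - Real.exp (-η)))) * ‖ζ‖ := by
        have e1 : 8 / (δ * (1 - Real.exp (-η))) * (δ / 4) = 2 / (1 - Real.exp (-η)) := by
          field_simp; norm_num
        have e2 : 8 / (δ * (1 - Real.exp (-η))) * (δ / 4) ≤
            8 / (δ * (1 - Real.exp (-η))) * ‖ζ‖ := mul_le_mul_of_nonneg_left hs.le hB.le
        have e3 : 0 ≤ 4 / δ * ‖ζ‖ := by positivity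
        rw [add_mul]; linarith
      have h9 : ‖cexp ζ - 1‖ ≤ Real.exp ζ.re + 1 := by
        have := norm_sub_le (cexp ζ) 1
        rwa [norm_exp, norm_one] at this
      rcases le_or_gt 0 ζ.re with hr | hr
      · rw [abs_of_nonneg hr] at hre
        have h10 : Real.exp ζ.re - 1 ≤ ‖1 - Y * cexp ζ‖ := by
          have := norm_sub_norm_le (Y * cexp ζ) 1
          rw [hnorm, norm_one, norm_sub_rev] at this
          exact this
        have h11 : 1 < Real.exp ζ.re := Real.one_lt_exp_iff.2 (by linarith)
        have hpos : 0 < ‖1 - Y * cexp ζ‖ := by linarith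
        refine ⟨norm_pos_iff.1 hpos, le_trans ?_ h8⟩
        rw [div_le_div_iff₀ hpos hη1]
        have h12 : Real.exp (-η) * Real.exp ζ.re ≥ 1 := by
          rw [← Real.exp_add]; exact Real.one_le_exp (by linarith)
        nlinarith [norm_nonneg (cexp ζ - 1), Real.exp_pos (-η)]
      · rw [abs_of_neg hr] at hre
        have h10 : 1 - Real.exp ζ.re ≤ ‖1 - Y * cexp ζ‖ := by
          have := norm_sub_norm_le 1 (Y * cexp ζ)
          rwa [hnorm, norm_one] at this
        have h11 : Real.exp ζ.re ≤ Real.exp (-η) := Real.exp_le_exp.2 (by linarith)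
        have hpos : 0 < ‖1 - Y * cexp ζ‖ := by linarith
        refine ⟨norm_pos_iff.1 hpos, le_trans ?_ h8⟩
        rw [div_le_div_iff₀ hpos hη1]
        nlinarith [norm_nonneg (cexp ζ - 1)]
  refine ⟨key.1, ?_⟩
  have e1 : Y * cexp ζ / (1 - Y * cexp ζ) - Y / (1 - Y) =
      Y * (cexp ζ - 1) / (1 - Y * cexp ζ) / (1 - Y) := by
    have := key.1
    field_simp
    ring
  rw [e1, norm_div, norm_div, norm_mul, hY, one_mul, div_le_iff₀ (by linarith)]
  calc _ ≤ _ := key.2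
    _ = (4 / δ + 8 / (δ * (1 - Real.exp (-η)))) / δ * ‖ζ‖ * δ := by field_simp
    _ ≤ _ := mul_le_mul_of_nonneg_left hY1 (by positivity)

lemma exists_pos_le_of_periodic {N : ℕ} (hN : 0 < N) {F : ℤ → ℝ}
    (hF : Function.Periodic F (N : ℤ)) (hpos : ∀ n, 0 < F n) : ∃ δ, 0 < δ ∧ δ ≤ 1 ∧ ∀ n, δ ≤ F n := by
  obtain ⟨j, _, hj⟩ := Finset.exists_min_image (Finset.range N) (fun j : ℕ => F j)
    ⟨0, Finset.mem_range.2 hN⟩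
  refine ⟨min (F j) 1, lt_min (hpos _) one_pos, min_le_right _ _, fun n => ?_⟩
  have h0 : 0 ≤ n % (N : ℤ) := Int.emod_nonneg _ (by omega)
  have h1 : n % (N : ℤ) < N := Int.emod_lt_of_pos _ (by omega)
  have h2 := hj (n % (N : ℤ)).toNat (Finset.mem_range.2 (by omega))
  have h3 : F (n % (N : ℤ)) = F n := by
    have := hF.int_mul (n / N) (n % N)
    rw [← this]
    congr 1
    simpa [mul_comm] using Int.emod_add_mul_ediv n N
  rw [Int.toNat_of_nonneg h0, h3] at h2
  exact (min_le_left _ _).trans h2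

lemma cexp_int_mul_eq (n : ℤ) (w : ℂ) : cexp (Real.pi * I * n * w) = cexp (Real.pi * I * w) ^ n := by
  rw [← exp_int_mul]; congr 1; ring

lemma cexp_sq_mul_eq (n : ℤ) (w : ℂ) :
    cexp (Real.pi * I * (n : ℂ) ^ 2 * w) = cexp (Real.pi * I * w) ^ (n ^ 2) := by
  rw [← cexp_int_mul_eq]; push_cast; rfl

section limit

variable {x : ℝ} {k : ℕ}

lemma zpow_period {p : ℂ} (hp : p ^ k = -1) (m : ℤ) : p ^ ((2 * k : ℤ) * m) = 1 := by
  have h := pow_period hp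
  rw [zpow_mul]
  have : p ^ (2 * k : ℤ) = 1 := by exact_mod_cast h
  rw [this, one_zpow]

lemma periodic_gauss (hp : cexp (Real.pi * I * x) ^ k = -1) :
    Function.Periodic (fun n : ℤ => (-1 : ℂ) ^ n * cexp (Real.pi * I * (n : ℂ) ^ 2 * x))
      ((2 * k : ℕ) : ℤ) := by
  intro n
  have hp0 : cexp (Real.pi * I * x) ≠ 0 := exp_ne_zero _
  simp only [cexp_sq_mul_eq]
  have h1 : (n + ((2 * k : ℕ) : ℤ)) ^ 2 = n ^ 2 + (2 * k : ℤ) * (2 * n + 2 * k) := by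
    push_cast; ring
  rw [h1, zpow_add₀ hp0, zpow_period hp, mul_one, zpow_add₀ (by norm_num)]
  congr 1
  have : (-1 : ℂ) ^ ((2 * k : ℕ) : ℤ) = 1 := by rw [zpow_natCast, pow_mul]; norm_num
  rw [this, mul_one]

lemma periodic_pole (hp : cexp (Real.pi * I * x) ^ k = -1) (y : ℂ) :
    Function.Periodic (fun n : ℤ => cexp (2 * Real.pi * I * (y + n * x))) ((2 * k : ℕ) : ℤ) := by
  intro n
  have : 2 * Real.pi * I * (y + ((n + ((2 * k : ℕ) : ℤ) : ℤ) : ℂ) * x) =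
      2 * Real.pi * I * (y + n * x) + Real.pi * I * ((2 * k : ℤ) * 2 : ℤ) * x := by
    push_cast; ring
  simp only [this]
  rw [Complex.exp_add, cexp_int_mul_eq, zpow_period hp, mul_one]

lemma norm_cexp_real (t : ℝ) : ‖cexp (2 * Real.pi * I * t)‖ = 1 := by
  have : 2 * Real.pi * I * t = ((2 * Real.pi * t : ℝ) : ℂ) * I := by push_cast; ring
  rw [this, norm_exp_ofReal_mul_I]

lemma norm_cpow_half (w : ℂ) : ‖(-I * w) ^ (1 / 2 : ℂ)‖ = Real.sqrt ‖w‖ := by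
  have : (1 / 2 : ℂ) = ((1 / 2 : ℝ) : ℂ) := by push_cast; rfl
  rw [this, norm_cpow_real, Real.sqrt_eq_rpow]
  simp

lemma tendsto_theta4 (hk : 0 < k) (hp : cexp (Real.pi * I * x) ^ k = -1) (K : ℝ) :
    Tendsto (fun τ : ℂ => (-I * (τ - x)) ^ (1 / 2 : ℂ) * theta4 τ) (stolz x K)
      (𝓝 (((2 * k : ℕ) : ℂ)⁻¹ * gaussFin (cexp (Real.pi * I * x)) k)) := by
  have h := (tendsto_periodic_gaussian (N := 2 * k) (by omega) (periodic_gauss hp) (M := 1)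
    (fun n => by rw [norm_mul, norm_neg_one_zpow, norm_cexp_quadratic]; simp) K).comp
    (tendsto_sub_stolz x K)
  have hg : gaussFin (cexp (Real.pi * I * x)) k = ∑ j ∈ Finset.range (2 * k),
      (-1 : ℂ) ^ (j : ℤ) * cexp (Real.pi * I * ((j : ℤ) : ℂ) ^ 2 * x) := by
    refine Finset.sum_congr rfl fun j _ => ?_
    rw [cexp_sq_mul_eq]
    norm_cast
  rw [hg]
  refine h.congr fun τ => ?_
  simp only [Function.comp_apply, theta4]
  congr 1
  refine tsum_congr fun n => ?_
  rw [mul_assoc, ← Complex.exp_add]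
  congr 2
  ring

/-- With w = τ - x, the denominators are replaced by their values at x, after which the coefficients
are periodic and `tendsto_periodic_gaussian` applies. The n-th replacement costs O(|w|(|n|+1)), and
summing against the Gaussian gives O(|w|/Im w), which is bounded nontangentially. The factor
|w|^(1/2) then sends the error to 0. -/
lemma tendsto_appellSum (hk : 0 < k) (hp : cexp (Real.pi * I * x) ^ k = -1) {s t K : ℝ}
    (hK : 0 < K) (hY : ∀ n : ℤ, cexp (2 * Real.pi * I * ((s * x + t : ℝ) + n * x)) ≠ 1) :
    Tendsto (fun τ : ℂ => (-I * (τ - x)) ^ (1 / 2 : ℂ) *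
        (cexp (2 * Real.pi * I * (s * τ + t)) * appellSum (s * τ + t) τ)) (stolz x K)
      (𝓝 (((2 * k : ℕ) : ℂ)⁻¹ * (cexp (Real.pi * I * (s * x + t)) *
        appellFin (cexp (Real.pi * I * x)) (cexp (Real.pi * I * (s * x + t))) k))) := by
  set p := cexp (Real.pi * I * x) with hpdef
  set Y : ℤ → ℂ := fun n => cexp (2 * Real.pi * I * ((s * x + t : ℝ) + n * x)) with hYdef
  have hYper : Function.Periodic Y ((2 * k : ℕ) : ℤ) := periodic_pole hp _
  have hYn : ∀ n, ‖Y n‖ = 1 := fun n => by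
    have := norm_cexp_real (s * x + t + n * x)
    simpa [hYdef] using this
  obtain ⟨δ, hδ, hδ1, hδY⟩ := exists_pos_le_of_periodic (N := 2 * k) (F := fun n => ‖1 - Y n‖)
    (by omega) (fun n => by simp only [hYper n])
    (fun n => norm_pos_iff.2 (sub_ne_zero.2 (hY n).symm))
  obtain ⟨c, hc0, hc⟩ := div_one_sub_lipschitz hδ hδ1 hK
  obtain ⟨c', hc'⟩ := tsum_abs_mul_exp_le
  have h1Y : ∀ n, 1 - Y n ≠ 0 := fun n => sub_ne_zero.2 (hY n).symm
  set c0 : ℤ → ℂ := fun n => (-1 : ℂ) ^ n * cexp (Real.pi * I * (n : ℂ) ^ 2 * x) with hc0def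
  have hc0n : ∀ n, ‖c0 n‖ = 1 := fun n => by
    simp only [hc0def]; rw [norm_mul, norm_neg_one_zpow, norm_cexp_quadratic]; simp
  have hper : Function.Periodic (fun n => c0 n * (Y n / (1 - Y n))) ((2 * k : ℕ) : ℤ) := fun n => by
    simp only [hYper n, periodic_gauss hp n, c0]
  have hM : ∀ n, ‖c0 n * (Y n / (1 - Y n))‖ ≤ 1 / δ := fun n => by
    rw [norm_mul, hc0n, one_mul, norm_div, hYn]
    exact one_div_le_one_div_of_le hδ (hδY n)
  have hmain := (tendsto_periodic_gaussian (N := 2 * k) (by omega) hper hM K).comp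
    (tendsto_sub_stolz x K)
  have hfin : ∑ j ∈ Finset.range (2 * k), c0 (j : ℤ) * (Y (j : ℤ) / (1 - Y (j : ℤ))) =
      cexp (Real.pi * I * (s * x + t)) * appellFin p (cexp (Real.pi * I * (s * x + t))) k := by
    rw [appellFin, Finset.mul_sum, Finset.mul_sum]
    refine Finset.sum_congr rfl fun j _ => ?_
    have e1 : Y (j : ℤ) = cexp (Real.pi * I * (s * x + t)) ^ 2 * p ^ (2 * j) := by
      simp only [hYdef, hpdef]
      rw [← exp_nat_mul, ← exp_nat_mul, ← Complex.exp_add]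
      congr 1; push_cast; ring
    have e2 : c0 (j : ℤ) = (-1) ^ j * p ^ (j ^ 2) := by
      simp only [hc0def]; rw [cexp_sq_mul_eq]; norm_cast
    rw [e2, e1, pow_add]
    ring
  rw [← hfin]
  have hval : ∀ τ : ℂ, 0 < τ.im → ‖τ - x‖ ≤ K * τ.im → τ.im ≤ 1 →
      ‖(-I * (τ - x)) ^ (1 / 2 : ℂ) *
        (cexp (2 * Real.pi * I * (s * τ + t)) * appellSum (s * τ + t) τ) -
      (-I * (τ - x)) ^ (1 / 2 : ℂ) * ∑' n : ℤ, c0 n * (Y n / (1 - Y n)) *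
        cexp (Real.pi * I * (n : ℂ) ^ 2 * (τ - x))‖ ≤
      (c * (2 * Real.pi * (|s| + 1)) * (c' * K)) * Real.sqrt ‖τ - x‖ := by
    intro τ hτ hτK hτ1
    set w : ℂ := τ - x with hw
    have hwim : w.im = τ.im := by simp [hw]
    have hx : (x : ℂ) = τ - w := by simp [hw]
    have hYτ : ∀ n : ℤ, cexp (2 * Real.pi * I * (s * τ + t + n * τ)) =
        Y n * cexp (2 * Real.pi * I * ((s + n) * w)) := fun n => by
      simp only [hYdef]
      rw [← Complex.exp_add]
      congr 1
      push_cast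
      rw [hx]
      ring
    have hb : ∀ n : ℤ, 1 - Y n * cexp (2 * Real.pi * I * ((s + n) * w)) ≠ 0 ∧
        ‖Y n * cexp (2 * Real.pi * I * ((s + n) * w)) /
          (1 - Y n * cexp (2 * Real.pi * I * ((s + n) * w))) - Y n / (1 - Y n)‖ ≤
        c * (2 * Real.pi * (|s| + 1)) * ‖w‖ * (|(n : ℝ)| + 1) := fun n => by
      have e1 : (2 * Real.pi * I * ((s + n) * w) : ℂ) =
          ((2 * Real.pi * (s + n) : ℝ) : ℂ) * (I * w) := by push_cast; ring
      have e2 : ‖(2 * Real.pi * I * ((s + n) * w) : ℂ)‖ = 2 * Real.pi * |s + n| * ‖w‖ := by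
        rw [e1, norm_mul, norm_mul, norm_I, one_mul, norm_real, Real.norm_eq_abs, abs_mul,
          abs_of_pos Real.two_pi_pos]
      have e3 : |(2 * Real.pi * I * ((s + n) * w) : ℂ).re| = 2 * Real.pi * |s + n| * w.im := by
        rw [e1, re_ofReal_mul, abs_mul, abs_mul, abs_of_pos Real.two_pi_pos]
        simp [abs_of_pos (hwim ▸ hτ)]
      -- The exponent is a real multiple of iw, so the nontangential condition on w is exactly the
      -- sector condition on ζ.
      obtain ⟨g1, g2⟩ := hc (Y n) (2 * Real.pi * I * ((s + n) * w)) (hYn n) (hδY n) (by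
        rw [e2, e3, hwim]
        have : 0 ≤ 2 * Real.pi * |s + n| := by positivity
        nlinarith)
      refine ⟨g1, g2.trans ?_⟩
      rw [e2]
      have h3 : |s + n| ≤ (|s| + 1) * (|(n : ℝ)| + 1) := by
        have := abs_add_le s n
        nlinarith [abs_nonneg s, abs_nonneg (n : ℝ), mul_nonneg (abs_nonneg s) (abs_nonneg (n : ℝ))]
      have h4 : c * (2 * Real.pi * |s + n| * ‖w‖) = (c * (2 * Real.pi) * ‖w‖) * |s + n| := by ring
      rw [h4]
      refine (mul_le_mul_of_nonneg_left h3 (by positivity)).trans (le_of_eq ?_)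
      ring
    have hgs : ∀ n : ℤ, ‖c0 n * (Y n * cexp (2 * Real.pi * I * ((s + n) * w)) /
          (1 - Y n * cexp (2 * Real.pi * I * ((s + n) * w))) - Y n / (1 - Y n)) *
          cexp (Real.pi * I * (n : ℂ) ^ 2 * w)‖ ≤
        (c * (2 * Real.pi * (|s| + 1)) * ‖w‖) *
          ((|(n : ℝ)| + 1) * Real.exp (-Real.pi * τ.im * (n : ℝ) ^ 2)) := fun n => by
      rw [norm_mul, norm_mul, hc0n, one_mul, norm_cexp_quadratic, hwim,
        ← mul_assoc (c * (2 * Real.pi * (|s| + 1)) * ‖w‖)]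
      exact mul_le_mul_of_nonneg_right (hb n).2 (Real.exp_pos _).le
    have hsum1 := (summable_abs_mul_exp hτ hτ1).mul_left (c * (2 * Real.pi * (|s| + 1)) * ‖w‖)
    have hsumE : Summable fun n : ℤ => c0 n * (Y n * cexp (2 * Real.pi * I * ((s + n) * w)) /
          (1 - Y n * cexp (2 * Real.pi * I * ((s + n) * w))) - Y n / (1 - Y n)) *
          cexp (Real.pi * I * (n : ℂ) ^ 2 * w) := Summable.of_norm_bounded hsum1 hgs
    have hsum0 : Summable fun n : ℤ => c0 n * (Y n / (1 - Y n)) *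
        cexp (Real.pi * I * (n : ℂ) ^ 2 * w) := by
      refine Summable.of_norm_bounded
        ((summable_exp_neg_mul_int_sq hτ).mul_left (1 / δ)) fun n => ?_
      rw [norm_mul, norm_cexp_quadratic, hwim]
      exact mul_le_mul_of_nonneg_right (hM n) (Real.exp_pos _).le
    have e0 : cexp (2 * Real.pi * I * (s * τ + t)) * appellSum (s * τ + t) τ =
        ∑' n : ℤ, (c0 n * (Y n * cexp (2 * Real.pi * I * ((s + n) * w)) /
          (1 - Y n * cexp (2 * Real.pi * I * ((s + n) * w))) - Y n / (1 - Y n)) *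
          cexp (Real.pi * I * (n : ℂ) ^ 2 * w) + c0 n * (Y n / (1 - Y n)) *
        cexp (Real.pi * I * (n : ℂ) ^ 2 * w)) := by
      rw [appellSum, ← tsum_mul_left]
      refine tsum_congr fun n => ?_
      have e4 : c0 n * cexp (Real.pi * I * (n : ℂ) ^ 2 * w) =
          (-1) ^ n * cexp (Real.pi * I * (n : ℂ) ^ 2 * τ) := by
        simp only [hc0def]
        rw [mul_assoc, ← Complex.exp_add]
        congr 2
        rw [hx]; ring
      have e5 : cexp (2 * Real.pi * I * (s * τ + t)) *
          cexp (Real.pi * I * ((n : ℂ) ^ 2 + 2 * n) * τ) =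
          cexp (Real.pi * I * (n : ℂ) ^ 2 * τ) *
            (Y n * cexp (2 * Real.pi * I * ((s + n) * w))) := by
        rw [← hYτ, ← Complex.exp_add, ← Complex.exp_add]
        congr 1; ring
      rw [hYτ]
      calc _ = (-1) ^ n * (cexp (2 * Real.pi * I * (s * τ + t)) *
          cexp (Real.pi * I * ((n : ℂ) ^ 2 + 2 * n) * τ)) /
          (1 - Y n * cexp (2 * Real.pi * I * ((s + n) * w))) := by ring
        _ = ((-1) ^ n * cexp (Real.pi * I * (n : ℂ) ^ 2 * τ)) *
            (Y n * cexp (2 * Real.pi * I * ((s + n) * w)) /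
              (1 - Y n * cexp (2 * Real.pi * I * ((s + n) * w)))) := by rw [e5]; ring
        _ = _ := by rw [← e4]; ring
    rw [e0, hsumE.tsum_add hsum0, ← mul_sub, add_sub_cancel_right, norm_mul, norm_cpow_half]
    have h6 : ‖∑' n : ℤ, c0 n * (Y n * cexp (2 * Real.pi * I * ((s + n) * w)) /
          (1 - Y n * cexp (2 * Real.pi * I * ((s + n) * w))) - Y n / (1 - Y n)) *
          cexp (Real.pi * I * (n : ℂ) ^ 2 * w)‖ ≤
        (c * (2 * Real.pi * (|s| + 1)) * ‖w‖) * (c' / τ.im) := by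
      refine (tsum_of_norm_bounded hsum1.hasSum hgs).trans ?_
      rw [tsum_mul_left]
      exact mul_le_mul_of_nonneg_left (hc' _ hτ hτ1) (by positivity)
    have hc'0 : 0 ≤ c' := by
      have h7 := hc' 1 one_pos le_rfl
      have : 0 ≤ ∑' n : ℤ, (|(n : ℝ)| + 1) * Real.exp (-Real.pi * 1 * (n : ℝ) ^ 2) :=
        tsum_nonneg fun n => by positivity
      linarith
    have h8 : (c * (2 * Real.pi * (|s| + 1)) * ‖w‖) * (c' / τ.im) ≤
        c * (2 * Real.pi * (|s| + 1)) * (c' * K) := by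
      have h9 : ‖w‖ * (c' / τ.im) ≤ c' * K := by
        rw [mul_div_assoc', div_le_iff₀ hτ]
        nlinarith
      have : 0 ≤ c * (2 * Real.pi * (|s| + 1)) := by positivity
      nlinarith
    rw [mul_comm]
    exact mul_le_mul_of_nonneg_right (h6.trans h8) (Real.sqrt_nonneg _)
  have herr : Tendsto (fun τ : ℂ => (-I * (τ - x)) ^ (1 / 2 : ℂ) *
        (cexp (2 * Real.pi * I * (s * τ + t)) * appellSum (s * τ + t) τ) -
      (-I * (τ - x)) ^ (1 / 2 : ℂ) * ∑' n : ℤ, c0 n * (Y n / (1 - Y n)) *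
        cexp (Real.pi * I * (n : ℂ) ^ 2 * (τ - x))) (stolz x K) (𝓝 0) := by
    have hlim : Tendsto (fun τ : ℂ => (c * (2 * Real.pi * (|s| + 1)) * (c' * K)) *
        Real.sqrt ‖τ - x‖) (stolz x K) (𝓝 0) := by
      have hcont : Continuous fun τ : ℂ => (c * (2 * Real.pi * (|s| + 1)) * (c' * K)) *
        Real.sqrt ‖τ - x‖ := by fun_prop
      have := hcont.tendsto (x : ℂ)
      simp only [sub_self, norm_zero, Real.sqrt_zero, mul_zero] at this
      exact this.mono_left (stolz_le x K)
    refine squeeze_zero_norm' ?_ hlim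
    have him : ∀ᶠ τ : ℂ in stolz x K, τ.im ≤ 1 := by
      have : Tendsto im (𝓝 (x : ℂ)) (𝓝 0) := by
        simpa using continuous_im.tendsto (x : ℂ)
      have h2 := (this.mono_left (stolz_le x K)).eventually (ge_mem_nhds one_pos)
      exact h2
    filter_upwards [eventually_stolz x K, him] with τ h1 h2
    exact hval τ h1.1 h1.2 h2
  have := herr.add hmain
  rw [zero_add] at this
  refine this.congr fun τ => ?_
  simp only [Function.comp_apply]
  ring

/-- The square roots and the factor 1/(2k) cancel in the quotient, leaving `appellFin` over
`gaussFin`, which `appellFin_eq` identifies with g₂. -/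
lemma tendsto_appell_quotient (hk : 0 < k) (hp : cexp (Real.pi * I * x) ^ k = -1)
    (hprim : ∀ n, 0 < n → n < k → cexp (Real.pi * I * x) ^ (2 * n) ≠ 1) {s t K : ℝ} (hK : 0 < K)
    (hY : ∀ n : ℤ, cexp (2 * Real.pi * I * ((s * x + t : ℝ) + n * x)) ≠ 1) :
    Tendsto (fun τ : ℂ => cexp (Real.pi * I * (s * τ + t)) * appellSum (s * τ + t) τ / theta4 τ)
      (stolz x K) (𝓝 (g2 (cexp (Real.pi * I * (s * x + t))) (cexp (Real.pi * I * x)))) := by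
  set z := cexp (Real.pi * I * (s * x + t)) with hz
  set p := cexp (Real.pi * I * x) with hpdef
  have hz0 : z ≠ 0 := exp_ne_zero _
  have hg := gaussFin_ne_zero hk hp hprim
  have h2k : ((2 * k : ℕ) : ℂ) ≠ 0 := by exact_mod_cast (by omega)
  have hfin : appellFin p z k = gaussFin p k * g2 z p := by
    refine appellFin_eq hk hp hz0 fun n hn => hY n ?_
    rw [← hn, hz, hpdef, ← exp_nat_mul, ← exp_nat_mul, ← Complex.exp_add]
    congr 1
    push_cast; ring
  have h1 := (tendsto_appellSum hk hp hK hY).div (tendsto_theta4 hk hp K)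
    (mul_ne_zero (inv_ne_zero h2k) hg)
  have h2 : Tendsto (fun τ : ℂ => cexp (-(Real.pi * I * (s * τ + t)))) (stolz x K) (𝓝 z⁻¹) := by
    have hcont : Continuous fun τ : ℂ => cexp (-(Real.pi * I * (s * τ + t))) := by fun_prop
    have := (hcont.tendsto (x : ℂ)).mono_left (stolz_le x K)
    rwa [Complex.exp_neg] at this
  have h3 := h2.mul h1
  have e1 : z⁻¹ * (((2 * k : ℕ) : ℂ)⁻¹ * (z * appellFin p z k) /
      (((2 * k : ℕ) : ℂ)⁻¹ * gaussFin p k)) = g2 z p := by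
    rw [hfin]; field_simp
  rw [← e1]
  refine h3.congr' ?_
  filter_upwards [eventually_stolz x K] with τ hτ
  have hw : (-I * (τ - x)) ^ (1 / 2 : ℂ) ≠ 0 := by
    rw [Ne, cpow_eq_zero_iff, not_and_or]
    left
    intro h
    have : τ - x = 0 := by simpa using h
    have h4 : (τ - x).im = 0 := by rw [this]; rfl
    simp at h4
    linarith [hτ.1]
  simp only [Pi.div_apply]
  rw [mul_div_mul_left _ _ hw, ← mul_div_assoc, ← mul_assoc, ← Complex.exp_add]
  congr 3
  ring

end limit

end

section

/-! ### The set `S_α` and the group `G_α` -/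

/-- Membership in `S_α` in terms of a coprime pair. -/
def SPair (C a : ℕ) (h k : ℤ) : Prop :=
  Odd h ∧ ((Even a ∧ ¬ (C : ℤ) ∣ h) ∨
    (Odd a ∧ (¬ (C : ℤ) ∣ 2 * h ∨ (¬ (C : ℤ) ∣ h ∧ Even k))))

lemma mem_Salpha_iff {C a : ℕ} {x : ℚ} : x ∈ Salpha C a ↔ SPair C a x.num x.den := by
  by_cases ha : Even a
  · have ha' : ¬ Odd a := Nat.not_odd_iff_even.2 ha
    simp [Salpha, SPair, SC1, S, ha, ha']
  · have ha' : Odd a := Nat.not_even_iff_odd.1 ha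
    simp only [Salpha, SPair, SC1, SC2, Sev, S, ha, ha', if_false, Set.mem_union, Set.mem_ofPred_eq,
      false_and, true_and, false_or, Int.even_coe_nat]
    tauto

lemma SPair_neg {C a : ℕ} {h k : ℤ} : SPair C a (-h) (-k) ↔ SPair C a h k := by
  simp [SPair]

lemma div_mem_Salpha {C a : ℕ} {h k : ℤ} (hc : IsCoprime h k) (hk : k ≠ 0) :
    ((h : ℚ) / k) ∈ Salpha C a ↔ SPair C a h k := by
  rw [mem_Salpha_iff]
  rcases lt_or_gt_of_ne hk with hk | hk
  · have h1 : ((h : ℚ) / k) = ((-h : ℤ) : ℚ) / ((-k : ℤ) : ℚ) := by push_cast; rw [neg_div_neg_eq]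
    have hc' : Nat.Coprime (-h).natAbs (-k).natAbs := by
      rw [Int.natAbs_neg, Int.natAbs_neg]
      exact Int.isCoprime_iff_gcd_eq_one.1 hc
    have h2 := Rat.num_div_eq_of_coprime (a := -h) (b := -k) (by omega) hc'
    have h3 := Rat.den_div_eq_of_coprime (a := -h) (b := -k) (by omega) hc'
    rw [h1, h2, h3, SPair_neg]
  · have hc' : Nat.Coprime h.natAbs k.natAbs := Int.isCoprime_iff_gcd_eq_one.1 hc
    rw [Rat.num_div_eq_of_coprime hk hc', Rat.den_div_eq_of_coprime hk hc']

/-- The translation length `C` or `2C`. -/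
def width (C : ℕ) : ℤ := if Even C then C else 2 * C

lemma even_width (C : ℕ) : Even (width C) := by
  unfold width
  split_ifs with h
  · exact_mod_cast h
  · simp

lemma dvd_width (C : ℕ) : (C : ℤ) ∣ width C := by
  unfold width
  split_ifs
  · exact dvd_rfl
  · exact dvd_mul_left _ _

/-- The congruences satisfied by the elements of `G_α`. -/
def GCong (C a : ℕ) (γ : SL(2, ℤ)) : Prop :=
  width C ∣ γ 0 1 ∧ width C ∣ γ 0 0 - 1 ∧ width C ∣ γ 1 1 - 1 ∧ (Odd a → (2 : ℤ) ∣ γ 1 0)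

lemma GCong_of_mem {C a : ℕ} {γ : SL(2, ℤ)} (hγ : γ ∈ Galpha C a) : GCong C a γ := by
  have hw : (if Even C then (C : ℤ) else 2 * C) = width C := rfl
  unfold Galpha at hγ
  induction hγ using Subgroup.closure_induction with
  | mem x hx =>
    rcases hx with rfl | rfl
    · refine ⟨by simp [lowerMat], by simp [lowerMat], by simp [lowerMat], fun h => ?_⟩
      simp [lowerMat, Nat.not_even_iff_odd.2 h]
    · refine ⟨by simp [upperMat, hw], by simp [upperMat], by simp [upperMat], fun h => ?_⟩
      simp [upperMat]
  | one => simp [GCong]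
  | mul x y _ _ hx hy =>
    obtain ⟨x1, x2, x3, x4⟩ := hx
    obtain ⟨y1, y2, y3, y4⟩ := hy
    simp only [GCong, Matrix.SpecialLinearGroup.coe_mul, Matrix.mul_apply, Fin.sum_univ_two]
    refine ⟨?_, ?_, ?_, fun h => ?_⟩
    · exact dvd_add (Dvd.dvd.mul_left y1 _) (Dvd.dvd.mul_right x1 _)
    · have : x 0 0 * y 0 0 + x 0 1 * y 1 0 - 1 =
        (x 0 0 - 1) * y 0 0 + (y 0 0 - 1) + x 0 1 * y 1 0 := by ring
      rw [this]
      exact dvd_add (dvd_add (Dvd.dvd.mul_right x2 _) y2) (Dvd.dvd.mul_right x1 _)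
    · have : x 1 0 * y 0 1 + x 1 1 * y 1 1 - 1 =
        x 1 0 * y 0 1 + (x 1 1 - 1) * y 1 1 + (y 1 1 - 1) := by ring
      rw [this]
      exact dvd_add (dvd_add (Dvd.dvd.mul_left y1 _) (Dvd.dvd.mul_right x3 _)) y3
    · exact dvd_add (Dvd.dvd.mul_right (x4 h) _) (Dvd.dvd.mul_left (y4 h) _)
  | inv x _ hx =>
    obtain ⟨x1, x2, x3, x4⟩ := hx
    simp only [GCong, Matrix.SpecialLinearGroup.coe_inv, Matrix.adjugate_fin_two]
    refine ⟨?_, ?_, ?_, fun h => ?_⟩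
    · simpa using x1
    · simpa using x3
    · simpa using x2
    · simpa using x4 h

/-- The new numerator is congruent to the old one modulo the even multiple `width C` of C, so its
parity and its divisibility properties by C are unchanged. For odd a the lower left entry is even,
so an even denominator stays even. -/
lemma moeb_mem {C a : ℕ} {γ : SL(2, ℤ)} (hγ : GCong C a γ) {x : ℚ} (hx : x ∈ Salpha C a)
    (hd : den γ x ≠ 0) : moeb γ x ∈ Salpha C a := by
  obtain ⟨g1, g2, g3, g4⟩ := hγ
  have hdet : γ 0 0 * γ 1 1 - γ 0 1 * γ 1 0 = 1 := by
    have := γ.det_coe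
    rwa [Matrix.det_fin_two] at this
  set h : ℤ := γ 0 0 * x.num + γ 0 1 * x.den with hh
  set k : ℤ := γ 1 0 * x.num + γ 1 1 * x.den with hk
  have hxd : (x.den : ℚ) ≠ 0 := by exact_mod_cast x.den_ne_zero
  have hxe : x = x.num / x.den := x.num_div_den.symm
  have hden : den γ x = (k : ℚ) / x.den := by
    rw [den, hk]
    push_cast
    rw [eq_div_iff hxd]
    nth_rewrite 1 [hxe]
    field_simp
  have hk0 : k ≠ 0 := by
    rintro h0
    rw [hden, h0] at hd
    simp at hd
  have hm : moeb γ x = (h : ℚ) / k := by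
    have hk0' : (k : ℚ) ≠ 0 := by exact_mod_cast hk0
    rw [moeb, hden, div_eq_div_iff (by positivity) hk0']
    rw [hh]
    push_cast
    nth_rewrite 1 [hxe]
    field_simp
  have hcop : IsCoprime x.num (x.den : ℤ) := by
    rw [Int.isCoprime_iff_gcd_eq_one]
    exact x.reduced
  have hc : IsCoprime h k := by
    obtain ⟨u, v, huv⟩ := hcop
    refine ⟨u * γ 1 1 - v * γ 1 0, v * γ 0 0 - u * γ 0 1, ?_⟩
    rw [hh, hk]
    linear_combination huv + (u * x.num + v * x.den) * hdet
  rw [hm, div_mem_Salpha hc hk0]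
  rw [mem_Salpha_iff] at hx
  obtain ⟨q, hq⟩ : width C ∣ h - x.num := by
    have : h - x.num = (γ 0 0 - 1) * x.num + γ 0 1 * x.den := by rw [hh]; ring
    rw [this]
    exact dvd_add (Dvd.dvd.mul_right g2 _) (Dvd.dvd.mul_right g1 _)
  have hCh : ∀ m : ℤ, (C : ℤ) ∣ m * h ↔ (C : ℤ) ∣ m * x.num := fun m => by
    have : m * h = m * x.num + width C * (m * q) := by linear_combination m * hq
    rw [this]
    exact dvd_add_left (Dvd.dvd.mul_right (dvd_width C) _)
  have hCh1 : (C : ℤ) ∣ h ↔ (C : ℤ) ∣ x.num := by simpa using hCh 1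
  have hodd : Odd h := by
    have : h = x.num + width C * q := by linear_combination hq
    rw [this]
    exact hx.1.add_even ((even_width C).mul_right _)
  refine ⟨hodd, ?_⟩
  rw [hCh1, hCh 2]
  rcases hx.2 with h1 | ⟨ha, h2⟩
  · exact Or.inl h1
  · refine Or.inr ⟨ha, h2.imp_right fun h3 => ⟨h3.1, ?_⟩⟩
    rw [hk]
    exact (((even_iff_two_dvd.2 (g4 ha)).mul_right _)).add (h3.2.mul_left _)

lemma upperMat_mem (C a : ℕ) : upperMat (width C) ∈ Galpha C a :=
  Subgroup.subset_closure (Or.inr rfl)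

lemma lowerMat_mem (C a : ℕ) : lowerMat (if Even a then 1 else 2) ∈ Galpha C a :=
  Subgroup.subset_closure (Or.inl rfl)

lemma add_width_mem {C a : ℕ} {x : ℚ} (hx : x ∈ Salpha C a) : x + width C ∈ Salpha C a := by
  have := moeb_mem (GCong_of_mem (upperMat_mem C a)) hx (by simp [den, upperMat])
  simpa [moeb, den, upperMat] using this

/-! ### Radial limits of `V` -/

section arith

variable {A : ℤ} {C a : ℕ} {x : ℚ}

lemma cexp_pow_den (hx : Odd x.num) : cexp (Real.pi * I * ((x : ℝ) : ℂ)) ^ x.den = -1 := by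
  have h1 : ((x.den : ℕ) : ℂ) * (Real.pi * I * ((x : ℝ) : ℂ)) = Real.pi * I * (x.num : ℤ) := by
    have : (x.den : ℂ) * (x : ℂ) = x.num := by exact_mod_cast Rat.den_mul_eq_num x
    push_cast
    linear_combination (Real.pi * I) * this
  rw [← exp_nat_mul, h1, exp_pi_mul_I_mul_int, hx.neg_one_zpow]

lemma cexp_two_pi_eq_one_iff (y : ℝ) : cexp (2 * Real.pi * I * y) = 1 ↔ ∃ m : ℤ, y = m := by
  rw [exp_eq_one_iff]
  refine exists_congr fun m => ?_
  have hpi : (2 * Real.pi * I : ℂ) ≠ 0 := two_pi_I_ne_zero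
  rw [mul_comm (m : ℂ), mul_right_inj' hpi]
  exact_mod_cast Iff.rfl

lemma cexp_pow_two_mul_ne_one {n : ℕ} (hn : 0 < n) (hnk : n < x.den) :
    cexp (Real.pi * I * ((x : ℝ) : ℂ)) ^ (2 * n) ≠ 1 := by
  intro h
  have h1 : ((2 * n : ℕ) : ℂ) * (Real.pi * I * ((x : ℝ) : ℂ)) =
      2 * Real.pi * I * ((n * x : ℝ) : ℂ) := by push_cast; ring
  rw [← exp_nat_mul, h1, cexp_two_pi_eq_one_iff] at h
  obtain ⟨m, hm⟩ := h
  have hm' : (n : ℚ) * x = m := by exact_mod_cast hm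
  have hxd : (x.den : ℚ) ≠ 0 := by exact_mod_cast x.den_ne_zero
  have h2 : (n : ℤ) * x.num = m * x.den := by
    have : (n : ℚ) * x.num = m * x.den := by
      rw [← hm', ← Rat.den_mul_eq_num x]; ring
    exact_mod_cast this
  have h3 : (x.den : ℤ) ∣ n * x.num := ⟨m, by rw [h2]; ring⟩
  have hcop : IsCoprime (x.den : ℤ) x.num := by
    rw [Int.isCoprime_iff_gcd_eq_one, Int.gcd_comm]
    exact x.reduced
  have h4 : (x.den : ℤ) ∣ n := hcop.dvd_of_dvd_mul_right h3
  have := Nat.le_of_dvd hn (by exact_mod_cast h4)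
  omega

/-- At x = h/k a pole would mean 2h(A + nC) = Ck(2m - a), and A + nC is prime to C. For even a this
forces C ∣ h. For odd a it forces C ∣ 2h, and C ∣ h if k is even. These are the cases that S_α
excludes. -/
lemma pole_ne_one (hC : 0 < C) (hAC : Int.gcd A C = 1) (hx : x ∈ Salpha C a) (n : ℤ) :
    cexp (2 * Real.pi * I * (((A / C : ℝ) * (x : ℝ) + (a / 2 : ℝ) : ℝ) + n * ((x : ℝ) : ℂ))) ≠ 1 := by
  intro h
  have h1 : (((A / C : ℝ) * (x : ℝ) + (a / 2 : ℝ) : ℝ) : ℂ) + n * ((x : ℝ) : ℂ) =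
      (((A / C : ℝ) * (x : ℝ) + (a / 2 : ℝ) + n * x : ℝ) : ℂ) := by push_cast; ring
  rw [h1, cexp_two_pi_eq_one_iff] at h
  obtain ⟨m, hm⟩ := h
  have hm' : (A / C : ℚ) * x + a / 2 + n * x = m := by
    have : (((A / C : ℚ) * x + a / 2 + n * x : ℚ) : ℝ) = ((m : ℚ) : ℝ) := by
      push_cast; linarith
    exact Rat.cast_injective this
  have hC0 : (C : ℚ) ≠ 0 := by exact_mod_cast hC.ne'
  have hk0 : (x.den : ℚ) ≠ 0 := by exact_mod_cast x.den_ne_zero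
  have h2 : 2 * x.num * (A + n * C) = (C : ℤ) * x.den * (2 * m - a) := by
    have : (2 : ℚ) * x.num * (A + n * C) = C * x.den * (2 * m - a) := by
      rw [← hm', ← Rat.den_mul_eq_num x]
      field_simp
      ring
    exact_mod_cast this
  have hcop : IsCoprime (C : ℤ) (A + n * C) := by
    have : IsCoprime (C : ℤ) A := by
      rw [Int.isCoprime_iff_gcd_eq_one, Int.gcd_comm]; exact hAC
    exact this.add_mul_right_right n
  rw [mem_Salpha_iff] at hx
  rcases hx.2 with ⟨ha, h3⟩ | ⟨ha, h3⟩
  · obtain ⟨b, hb⟩ := ha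
    apply h3
    apply hcop.dvd_of_dvd_mul_right
    refine ⟨x.den * (m - b), ?_⟩
    rw [hb] at h2
    push_cast at h2
    linarith
  · rcases h3 with h3 | ⟨h3, hk⟩
    · apply h3
      apply hcop.dvd_of_dvd_mul_right
      exact ⟨x.den * (2 * m - a), by rw [h2]; ring⟩
    · obtain ⟨b, hb⟩ := hk
      apply h3
      apply hcop.dvd_of_dvd_mul_right
      refine ⟨b * (2 * m - a), ?_⟩
      rw [hb] at h2
      linarith

lemma odd_num (hx : x ∈ Salpha C a) : Odd x.num := (mem_Salpha_iff.1 hx).1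

lemma e_alpha (A : ℤ) (C a : ℕ) (τ : ℂ) :
    e (alpha A C a τ) = cexp (Real.pi * I * ((A / C : ℝ) * τ + (a / 2 : ℝ))) := by
  rw [e, alpha]
  congr 1
  push_cast
  ring

theorem g2WellDefined (hC : 0 < C) (hAC : Int.gcd A C = 1) (hx : x ∈ Salpha C a) :
    G2WellDefined (e (alpha A C a x)) (cexp (Real.pi * I * x)) := by
  have hp := cexp_pow_den (odd_num hx)
  rw [ofReal_ratCast] at hp
  -- A vanishing factor zpⁿ = 1 of g₂ would also give (zpⁿ)² = 1, a pole of the Appell sum.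
  refine g2WellDefined_of x.den_pos hp fun n hn => pole_ne_one hC hAC hx n ?_
  rw [e_alpha] at hn
  have := congrArg (· ^ 2) hn
  simp only [one_pow] at this
  rw [← this, mul_pow, ← pow_mul, ← exp_nat_mul, ← exp_nat_mul, ← Complex.exp_add]
  congr 1
  push_cast
  ring

lemma V_of_im_pos (A : ℤ) (C a : ℕ) {τ : ℂ} (hτ : 0 < τ.im) :
    V A C a τ = I ^ (a + 1) * e (-((2 * A - C : ℂ) ^ 2 / (8 * C ^ 2)) * τ) *
      (I * cexp (Real.pi * I * τ / 4) *
        (cexp (Real.pi * I * ((A / C : ℝ) * τ + (a / 2 : ℝ))) *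
          appellSum ((A / C : ℝ) * τ + (a / 2 : ℝ)) τ / theta4 τ)) := by
  have h : 2 * alpha A C a τ = (A / C : ℝ) * τ + (a / 2 : ℝ) := by
    rw [alpha]; push_cast; ring
  rw [V, muAlpha, if_pos hτ, h, mu_half]

/-- Nontangential limits of `V` at the points of `S_α`. -/
theorem tendsto_V (hC : 0 < C) (hAC : Int.gcd A C = 1) (hx : x ∈ Salpha C a) {K : ℝ}
    (hK : 0 < K) : Tendsto (V A C a) (stolz x K) (𝓝 (V A C a x)) := by
  have h1 := tendsto_appell_quotient x.den_pos (cexp_pow_den (odd_num hx))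
    (fun n => cexp_pow_two_mul_ne_one) hK (pole_ne_one hC hAC hx)
  have h2 : V A C a x = I ^ (a + 1) * e (-((2 * A - C : ℂ) ^ 2 / (8 * C ^ 2)) * x) *
      (I * cexp (Real.pi * I * x / 4) *
        g2 (cexp (Real.pi * I * ((A / C : ℝ) * ((x : ℝ) : ℂ) + (a / 2 : ℝ))))
          (cexp (Real.pi * I * ((x : ℝ) : ℂ)))) := by
    have : ¬ 0 < (x : ℂ).im := by
      have : (x : ℂ) = ((x : ℝ) : ℂ) := by simp
      rw [this, ofReal_im]; exact lt_irrefl 0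
    rw [V, muAlpha, if_neg this, e_alpha, ofReal_ratCast]
  have h3 : Tendsto (fun τ : ℂ => I ^ (a + 1) * e (-((2 * A - C : ℂ) ^ 2 / (8 * C ^ 2)) * τ))
      (stolz x K) (𝓝 (I ^ (a + 1) * e (-((2 * A - C : ℂ) ^ 2 / (8 * C ^ 2)) * x))) := by
    have hc : Continuous fun τ : ℂ =>
        I ^ (a + 1) * e (-((2 * A - C : ℂ) ^ 2 / (8 * C ^ 2)) * τ) := by
      unfold e; fun_prop
    have := (hc.tendsto ((x : ℝ) : ℂ)).mono_left (stolz_le x K)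
    rwa [ofReal_ratCast] at this
  have h4 : Tendsto (fun τ : ℂ => I * cexp (Real.pi * I * τ / 4))
      (stolz x K) (𝓝 (I * cexp (Real.pi * I * x / 4))) := by
    have hc : Continuous fun τ : ℂ => I * cexp (Real.pi * I * τ / 4) := by fun_prop
    have := (hc.tendsto ((x : ℝ) : ℂ)).mono_left (stolz_le x K)
    rwa [ofReal_ratCast] at this
  rw [h2]
  refine (h3.mul (h4.mul h1)).congr' ?_
  filter_upwards [eventually_stolz x K] with τ hτ
  rw [V_of_im_pos A C a hτ.1]

lemma tendsto_vertical (x : ℝ) :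
    Tendsto (fun y : ℝ => (x : ℂ) + y * I) (𝓝[>] 0) (stolz x 1) := by
  refine tendsto_stolz ?_ ?_
  · have hc : Continuous fun y : ℝ => (x : ℂ) + y * I := by fun_prop
    have := (hc.tendsto 0).mono_left (nhdsWithin_le_nhds (s := Set.Ioi 0))
    simpa using this
  · filter_upwards [self_mem_nhdsWithin] with y hy
    have hy' : 0 < y := hy
    simp [hy', abs_of_pos hy']

theorem tendsto_V_vertical (hC : 0 < C) (hAC : Int.gcd A C = 1) (hx : x ∈ Salpha C a) :
    Tendsto (fun y : ℝ => V A C a ((x : ℂ) + y * I)) (𝓝[>] 0) (𝓝 (V A C a x)) := by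
  have := (tendsto_V hC hAC hx one_pos).comp (tendsto_vertical x)
  simpa [Function.comp_def] using this

/-! ### Translations -/

lemma theta4_add_even {N : ℤ} (hN : Even N) (τ : ℂ) : theta4 (τ + N) = theta4 τ := by
  refine tsum_congr fun n => ?_
  obtain ⟨M, rfl⟩ := hN
  have : Real.pi * I * (n : ℂ) ^ 2 * (τ + ((M + M : ℤ) : ℂ)) =
      Real.pi * I * (n : ℂ) ^ 2 * τ + ((n ^ 2 * M : ℤ) : ℂ) * (2 * Real.pi * I) := by
    push_cast; ring
  rw [this, Complex.exp_add, exp_int_mul_two_pi_mul_I, mul_one]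

lemma appellSum_add_even {N : ℤ} (hN : Even N) (M : ℤ) (u τ : ℂ) :
    appellSum (u + M) (τ + N) = appellSum u τ := by
  refine tsum_congr fun n => ?_
  obtain ⟨L, rfl⟩ := hN
  have h1 : Real.pi * I * ((n : ℂ) ^ 2 + 2 * n) * (τ + ((L + L : ℤ) : ℂ)) =
      Real.pi * I * ((n : ℂ) ^ 2 + 2 * n) * τ + (((n ^ 2 + 2 * n) * L : ℤ) : ℂ) * (2 * Real.pi * I) := by
    push_cast; ring
  have h2 : 2 * Real.pi * I * (u + M + n * (τ + ((L + L : ℤ) : ℂ))) =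
      2 * Real.pi * I * (u + n * τ) + ((M + n * (L + L) : ℤ) : ℂ) * (2 * Real.pi * I) := by
    push_cast; ring
  rw [h1, h2, Complex.exp_add, Complex.exp_add, exp_int_mul_two_pi_mul_I, exp_int_mul_two_pi_mul_I,
    mul_one, mul_one]

lemma V_add_even (A : ℤ) (C a : ℕ) {N M : ℤ} (hN : Even N) (hM : (A / C : ℂ) * N = M) {τ : ℂ}
    (hτ : 0 < τ.im) : V A C a (τ + N) =
      e (-((2 * A - C : ℂ) ^ 2 / (8 * C ^ 2)) * N) * cexp (Real.pi * I * N / 4) *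
        cexp (Real.pi * I * M) * V A C a τ := by
  have hτ' : 0 < (τ + N).im := by simpa using hτ
  have h1 : ((A / C : ℝ) : ℂ) * (τ + N) + ((a / 2 : ℝ) : ℂ) =
      ((A / C : ℝ) : ℂ) * τ + ((a / 2 : ℝ) : ℂ) + M := by
    rw [← hM]; push_cast; ring
  rw [V_of_im_pos A C a hτ, V_of_im_pos A C a hτ', h1, theta4_add_even hN, appellSum_add_even hN]
  have h2 : Real.pi * I * (((A / C : ℝ) : ℂ) * τ + ((a / 2 : ℝ) : ℂ) + M) =
      Real.pi * I * (((A / C : ℝ) : ℂ) * τ + ((a / 2 : ℝ) : ℂ)) + Real.pi * I * M := by ring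
  have h3 : Real.pi * I * (τ + N) / 4 = Real.pi * I * τ / 4 + Real.pi * I * N / 4 := by ring
  rw [h2, h3, Complex.exp_add, Complex.exp_add]
  simp only [e]
  rw [mul_add, mul_add, Complex.exp_add]
  ring

lemma V_add_of_even (A : ℤ) (a : ℕ) (hC : 0 < C) (hCe : Even C) {τ : ℂ} (hτ : 0 < τ.im) :
    V A C a τ - (-1 : ℂ) ^ (A + (C : ℤ) / 2) * e (C / 8)
      * e (C * (2 * A - C) ^ 2 / (8 * C ^ 2)) * V A C a (τ + C) = 0 := by
  have hC0 : (C : ℂ) ≠ 0 := by exact_mod_cast hC.ne'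
  have h := V_add_even A C a (N := C) (M := A) (by exact_mod_cast hCe)
    (by push_cast; field_simp) hτ
  rw [Int.cast_natCast] at h
  rw [h, sub_eq_zero]
  obtain ⟨c, rfl⟩ := hCe
  have hc : ((c + c : ℕ) : ℤ) / 2 = c := by push_cast; omega
  rw [hc, ← exp_pi_mul_I_mul_int]
  simp only [e]
  -- The quadratic terms cancel and the exponents add up to 2πi(A + c).
  have key : cexp (Real.pi * I * ((A + c : ℤ) : ℂ)) * cexp (2 * Real.pi * I * ((c + c : ℕ) / 8)) *
      cexp (2 * Real.pi * I * ((c + c : ℕ) * (2 * A - (c + c : ℕ)) ^ 2 / (8 * (c + c : ℕ) ^ 2))) *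
      (cexp (2 * Real.pi * I * (-((2 * A - (c + c : ℕ) : ℂ) ^ 2 / (8 * (c + c : ℕ) ^ 2)) *
        (c + c : ℕ))) * cexp (Real.pi * I * (c + c : ℕ) / 4) * cexp (Real.pi * I * A)) = 1 := by
    simp only [← Complex.exp_add]
    rw [exp_eq_one_iff]
    refine ⟨A + c, ?_⟩
    push_cast
    ring
  calc _ = 1 * V A (c + c) a τ := (one_mul _).symm
    _ = _ := by rw [← key]; ring

lemma V_add_of_odd (A : ℤ) (a : ℕ) (hC : 0 < C) (hCo : Odd C) {τ : ℂ} (hτ : 0 < τ.im) :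
    V A C a τ + e (C / 4) * e ((2 * A - C) ^ 2 / (4 * C)) * V A C a (τ + 2 * C) = 0 := by
  have hC0 : (C : ℂ) ≠ 0 := by exact_mod_cast hC.ne'
  have h := V_add_even A C a (N := 2 * C) (M := 2 * A) (by simp)
    (by push_cast; field_simp) hτ
  push_cast at h
  rw [h]
  simp only [e]
  have key : cexp (2 * Real.pi * I * (C / 4)) * cexp (2 * Real.pi * I * ((2 * A - C) ^ 2 / (4 * C))) *
      (cexp (2 * Real.pi * I * (-((2 * A - C : ℂ) ^ 2 / (8 * C ^ 2)) * (2 * C))) *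
        cexp (Real.pi * I * (2 * C) / 4) * cexp (Real.pi * I * (2 * A))) = -1 := by
    simp only [← Complex.exp_add]
    obtain ⟨c, rfl⟩ := hCo
    have : 2 * Real.pi * I * (((2 * c + 1 : ℕ) : ℂ) / 4) +
        2 * Real.pi * I * ((2 * A - ((2 * c + 1 : ℕ) : ℂ)) ^ 2 / (4 * ((2 * c + 1 : ℕ) : ℂ))) +
      (2 * Real.pi * I * (-((2 * A - ((2 * c + 1 : ℕ) : ℂ)) ^ 2 / (8 * ((2 * c + 1 : ℕ) : ℂ) ^ 2)) *
        (2 * ((2 * c + 1 : ℕ) : ℂ))) + Real.pi * I * (2 * ((2 * c + 1 : ℕ) : ℂ)) / 4 +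
        Real.pi * I * (2 * A)) = Real.pi * I + ((c + A : ℤ) : ℂ) * (2 * Real.pi * I) := by
      field_simp
      push_cast
      ring
    rw [this, Complex.exp_add, exp_int_mul_two_pi_mul_I, exp_pi_mul_I, mul_one]
  calc _ = V A C a τ + -1 * V A C a τ := by rw [← key]; ring
    _ = 0 := by ring

/-- Extension of an identity from vertical lines to the boundary point `x`. -/
lemma V_shift_boundary (hC : 0 < C) (hAC : Int.gcd A C = 1) (hx : x ∈ Salpha C a) {c : ℂ}
    (h : ∀ τ : ℂ, 0 < τ.im → V A C a τ + c * V A C a (τ + width C) = 0) :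
    V A C a x + c * V A C a (x + width C) = 0 := by
  have h1 := tendsto_V_vertical hC hAC hx
  have h2 := tendsto_V_vertical hC hAC (add_width_mem hx)
  have h3 := h1.add (h2.const_mul c)
  have h4 : V A C a ((x + width C : ℚ) : ℂ) = V A C a (x + width C) := by push_cast; rfl
  rw [h4] at h3
  refine tendsto_nhds_unique h3 (tendsto_const_nhds.congr' ?_)
  filter_upwards [self_mem_nhdsWithin] with y hy
  have hy' : 0 < y := hy
  have := h ((x : ℂ) + y * I) (by
    have : (x : ℂ) = ((x : ℝ) : ℂ) := by simp
    rw [this]; simp [hy'])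
  rw [← this]
  congr 3
  push_cast
  ring

theorem V_translation (hC : 0 < C) (hAC : Int.gcd A C = 1) {τ : ℂ} (hτ : τ ∈ domain C a) :
    (Even C → V A C a τ - (-1 : ℂ) ^ (A + (C : ℤ) / 2) * e (C / 8)
        * e (C * (2 * A - C) ^ 2 / (8 * C ^ 2)) * V A C a (τ + C) = 0) ∧
    (Odd C → V A C a τ + e (C / 4) * e ((2 * A - C) ^ 2 / (4 * C)) * V A C a (τ + 2 * C) = 0) := by
  rcases hτ with hτ | ⟨x, hx, rfl⟩
  · exact ⟨fun h => V_add_of_even A a hC h hτ, fun h => V_add_of_odd A a hC h hτ⟩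
  · refine ⟨fun h => ?_, fun h => ?_⟩
    · have hw : width C = C := if_pos h
      have := V_shift_boundary (c := -((-1 : ℂ) ^ (A + (C : ℤ) / 2) * e (C / 8)
        * e (C * (2 * A - C) ^ 2 / (8 * C ^ 2)))) hC hAC hx (fun τ hτ => by
        rw [← V_add_of_even A a hC h hτ, hw]; push_cast; ring)
      rw [hw] at this
      rw [← this]; push_cast; ring
    · have hw : width C = 2 * C := if_neg (Nat.not_even_iff_odd.2 h)
      have := V_shift_boundary (c := e (C / 4) * e ((2 * A - C) ^ 2 / (4 * C))) hC hAC hx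
        (fun τ hτ => by rw [← V_add_of_odd A a hC h hτ, hw]; push_cast; ring)
      rw [hw] at this
      rw [← this]; push_cast; ring

end arith

end

/-! ### Sums of reciprocal sines -/

/-- `x` is not a pole of the reciprocal sines `1 / sin (π (x + (n + 1/2) τ))`. -/
def Regular (τ x : ℂ) : Prop := ∀ n : ℤ, Complex.sin (Real.pi * (x + (n + 1 / 2) * τ)) ≠ 0

/-- `∑ (-1)^n e^{π i (n + 1/2)² τ} / sin (π (x + (n + 1/2) τ))`. -/
def sinSum (x τ : ℂ) : ℂ :=
  ∑' n : ℤ, (-1 : ℂ) ^ n * cexp (Real.pi * I * ((n : ℂ) + 1 / 2) ^ 2 * τ) /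
    Complex.sin (Real.pi * (x + (n + 1 / 2) * τ))

lemma appellSum_eq_sinSum (x τ : ℂ) :
    cexp (Real.pi * I * (x + τ / 2)) * appellSum (x + τ / 2) τ =
      I / 2 * cexp (-(Real.pi * I * τ / 4)) * sinSum x τ := by
  rw [appellSum, sinSum, ← tsum_mul_left, ← tsum_mul_left]
  refine tsum_congr fun n => ?_
  set y := x + (n + 1 / 2) * τ with hy
  have h1 : x + τ / 2 + n * τ = y := by rw [hy]; ring
  have h2 : 1 - cexp (2 * Real.pi * I * y) =
      -2 * I * cexp (Real.pi * I * y) * Complex.sin (Real.pi * y) := by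
    have e1 : cexp (2 * Real.pi * I * y) = cexp (Real.pi * y * I) * cexp (Real.pi * y * I) := by
      rw [← Complex.exp_add]; congr 1; ring
    have e2 : cexp (Real.pi * y * I) * cexp (-(Real.pi * y) * I) = 1 := by
      rw [← Complex.exp_add, ← Complex.exp_zero]; congr 1; ring
    have e3 : Real.pi * I * y = Real.pi * y * I := by ring
    rw [Complex.sin, e1, e3]
    linear_combination (-1 : ℂ) * e2 + (cexp (Real.pi * y * I) * cexp (-(Real.pi * y) * I) -
      cexp (Real.pi * y * I) * cexp (Real.pi * y * I)) * I_sq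
  rw [h1, h2]
  have e4 : cexp (Real.pi * I * (x + τ / 2)) * cexp (Real.pi * I * ((n : ℂ) ^ 2 + 2 * n) * τ) =
      cexp (-(Real.pi * I * τ / 4)) * cexp (Real.pi * I * ((n : ℂ) + 1 / 2) ^ 2 * τ) *
        cexp (Real.pi * I * y) := by
    rw [← Complex.exp_add, ← Complex.exp_add, ← Complex.exp_add, hy]
    congr 1; ring
  have hE : cexp (Real.pi * I * y) ≠ 0 := exp_ne_zero _
  generalize Complex.sin (Real.pi * y) = S at *
  -- At a pole both quotients are 0 by the convention for division by zero, so no regularity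
  -- assumption is needed.
  rcases eq_or_ne S 0 with rfl | hS
  · simp
  rw [← mul_div_assoc, ← mul_div_assoc, div_eq_div_iff (by simp [hE, hS]) hS]
  linear_combination (-1 : ℂ) ^ n * S * e4 + (-1 : ℂ) ^ n * S * cexp (-(Real.pi * I * τ / 4)) *
    cexp (Real.pi * I * ((n : ℂ) + 1 / 2) ^ 2 * τ) * cexp (Real.pi * I * y) * I_sq

lemma mu_half_eq_sinSum (x τ : ℂ) :
    mu (x + τ / 2) (τ / 2) τ = -(1 / 2) * sinSum x τ / theta4 τ := by
  rw [mu_half, appellSum_eq_sinSum]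
  have : cexp (Real.pi * I * τ / 4) * cexp (-(Real.pi * I * τ / 4)) = 1 := by
    rw [← Complex.exp_add, ← Complex.exp_zero]; congr 1; ring
  rw [← mul_div_assoc]
  congr 1
  linear_combination (I ^ 2 / 2 * sinSum x τ) * this + sinSum x τ / 2 * I_sq

lemma abs_im_le_norm_sin (z : ℂ) : |z.im| ≤ ‖Complex.sin z‖ := by
  have h1 : Complex.sin z = (cexp (-z * I) - cexp (z * I)) * I / 2 := rfl
  have h2 : ‖cexp (-z * I)‖ = Real.exp z.im := by rw [norm_exp]; simp
  have h3 : ‖cexp (z * I)‖ = Real.exp (-z.im) := by rw [norm_exp]; simp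
  have h4 : ‖Complex.sin z‖ = ‖cexp (-z * I) - cexp (z * I)‖ / 2 := by
    rw [h1, norm_div, norm_mul]; simp
  rw [h4, le_div_iff₀ two_pos]
  have h5 := abs_norm_sub_norm_le (cexp (-z * I)) (cexp (z * I))
  rw [h2, h3] at h5
  refine le_trans ?_ h5
  have key : ∀ t : ℝ, 0 ≤ t → t * 2 ≤ Real.exp t - Real.exp (-t) := by
    intro t ht
    have := Real.self_le_sinh_iff.2 ht
    rw [Real.sinh_eq] at this
    linarith
  rcases le_total 0 z.im with h | h
  · rw [abs_of_nonneg h]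
    exact (key _ h).trans (le_abs_self _)
  · rw [abs_of_nonpos h, abs_sub_comm]
    have := key (-z.im) (by linarith)
    rw [neg_neg] at this
    exact this.trans (le_abs_self _)

lemma sin_pi_ne_zero_of_im {y : ℂ} (hy : y.im ≠ 0) : Complex.sin (Real.pi * y) ≠ 0 := by
  intro h
  have := abs_im_le_norm_sin (Real.pi * y)
  rw [h, norm_zero, im_ofReal_mul, abs_mul] at this
  have h2 : 0 < |Real.pi| * |y.im| := mul_pos (abs_pos.2 Real.pi_ne_zero) (abs_pos.2 hy)
  linarith

lemma one_le_norm_sin {y : ℂ} (hy : 1 ≤ |y.im|) : 1 ≤ ‖Complex.sin (Real.pi * y)‖ := by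
  have := abs_im_le_norm_sin (Real.pi * y)
  rw [im_ofReal_mul, abs_mul, abs_of_pos Real.pi_pos] at this
  nlinarith [Real.pi_gt_three]

/-- For large |n| the argument has imaginary part at least 1 in absolute value, which bounds the
sine below uniformly; the finitely many other terms are handled by continuity. Allowing c n = 0 lets
a single singular term be removed from the series. -/
lemma eventually_sin_bound {τ : ℂ} (hτ : 0 < τ.im) {c : ℤ → ℂ} {x₀ : ℂ}
    (h : ∀ n : ℤ, c n = 0 ∨ Complex.sin (Real.pi * (x₀ + (n + 1 / 2) * τ)) ≠ 0) :
    ∃ M : ℝ, 0 ≤ M ∧ ∀ᶠ x in 𝓝 x₀, ∀ n : ℤ, c n = 0 ∨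
      (Complex.sin (Real.pi * (x + (n + 1 / 2) * τ)) ≠ 0 ∧
        ‖(Complex.sin (Real.pi * (x + (n + 1 / 2) * τ)))⁻¹‖ ≤ M) := by
  obtain ⟨R, hR⟩ := exists_nat_gt ((|x₀.im| + 2) / τ.im + 1)
  have hfar : ∀ n : ℤ, n ∉ Finset.Icc (-(R : ℤ)) R → ∀ x ∈ Metric.ball x₀ 1,
      1 ≤ |(x + ((n : ℂ) + 1 / 2) * τ).im| := by
    intro n hn x hx
    have h1 : (R : ℝ) ≤ |(n : ℝ)| := by
      rw [Finset.mem_Icc, not_and_or] at hn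
      have : (R : ℤ) ≤ |n| := by
        rcases hn with hn | hn
        · rw [le_abs]; right; omega
        · rw [le_abs]; left; omega
      exact_mod_cast this
    have h2 : |x.im| ≤ |x₀.im| + 1 := by
      have h3 : |(x - x₀).im| ≤ ‖x - x₀‖ := abs_im_le_norm _
      rw [Metric.mem_ball, dist_eq] at hx
      rw [sub_im] at h3
      have := abs_sub_abs_le_abs_sub x.im x₀.im
      linarith
    have h4 : (x + ((n : ℂ) + 1 / 2) * τ).im = x.im + ((n : ℝ) + 1 / 2) * τ.im := by
      have : ((n : ℂ) + 1 / 2) = (((n : ℝ) + 1 / 2 : ℝ) : ℂ) := by push_cast; rfl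
      rw [add_im, this, im_ofReal_mul]
    rw [h4]
    have h5 : |x₀.im| + 2 ≤ |((n : ℝ) + 1 / 2) * τ.im| := by
      rw [abs_mul, abs_of_pos hτ]
      have h6 : |(n : ℝ)| - 1 ≤ |(n : ℝ) + 1 / 2| := by
        have := abs_sub_abs_le_abs_sub (n : ℝ) (-(1 / 2))
        rw [abs_neg, sub_neg_eq_add, abs_of_pos (by norm_num : (0 : ℝ) < 1 / 2)] at this
        linarith
      have h7 : (|x₀.im| + 2) / τ.im ≤ |(n : ℝ) + 1 / 2| := by linarith
      rwa [div_le_iff₀ hτ] at h7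
    have h8 := abs_sub_abs_le_abs_sub (((n : ℝ) + 1 / 2) * τ.im) (-x.im)
    rw [abs_neg, sub_neg_eq_add, add_comm (_ * _)] at h8
    linarith
  have hnear : ∀ n : ℤ, ∃ M : ℝ, ∀ᶠ x in 𝓝 x₀, c n = 0 ∨
      (Complex.sin (Real.pi * (x + (n + 1 / 2) * τ)) ≠ 0 ∧
        ‖(Complex.sin (Real.pi * (x + (n + 1 / 2) * τ)))⁻¹‖ ≤ M) := by
    intro n
    rcases h n with h0 | h0
    · exact ⟨0, Eventually.of_forall fun x => Or.inl h0⟩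
    · have hc : ContinuousAt (fun x => Complex.sin (Real.pi * (x + (n + 1 / 2) * τ))) x₀ := by
        fun_prop
      have hc2 := (hc.inv₀ h0).norm
      refine ⟨‖(Complex.sin (Real.pi * (x₀ + (n + 1 / 2) * τ)))⁻¹‖ + 1, ?_⟩
      filter_upwards [hc.eventually_ne h0, hc2.eventually_le_const (lt_add_one _)] with x h1 h2
      exact Or.inr ⟨h1, h2⟩
  choose M hM using hnear
  have hall : ∀ᶠ x in 𝓝 x₀, ∀ n ∈ Finset.Icc (-(R : ℤ)) R, c n = 0 ∨
      (Complex.sin (Real.pi * (x + (n + 1 / 2) * τ)) ≠ 0 ∧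
        ‖(Complex.sin (Real.pi * (x + (n + 1 / 2) * τ)))⁻¹‖ ≤ M n) := by
    rw [Filter.eventually_all_finset]
    exact fun n _ => hM n
  refine ⟨1 + ∑ n ∈ Finset.Icc (-(R : ℤ)) R, |M n|, by positivity, ?_⟩
  filter_upwards [hall, Metric.ball_mem_nhds x₀ one_pos] with x h1 h2 n
  by_cases hn : n ∈ Finset.Icc (-(R : ℤ)) R
  · refine (h1 n hn).imp_right fun h3 => ⟨h3.1, h3.2.trans ?_⟩
    have := Finset.single_le_sum (f := fun n => |M n|) (fun i _ => abs_nonneg _) hn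
    have h4 := le_abs_self (M n)
    linarith
  · right
    have h3 := one_le_norm_sin (hfar n hn x h2)
    refine ⟨fun h0 => by rw [h0, norm_zero] at h3; linarith, ?_⟩
    rw [norm_inv]
    have h4 : ‖Complex.sin (Real.pi * (x + (n + 1 / 2) * τ))‖⁻¹ ≤ 1 := inv_le_one_of_one_le₀ h3
    have h5 : 0 ≤ ∑ n ∈ Finset.Icc (-(R : ℤ)) R, |M n| := Finset.sum_nonneg fun i _ => abs_nonneg _
    linarith

lemma isOpen_regular {τ : ℂ} (hτ : 0 < τ.im) {x : ℂ} (hx : Regular τ x) :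
    ∀ᶠ y in 𝓝 x, Regular τ y := by
  obtain ⟨M, _, hM⟩ := eventually_sin_bound hτ (c := fun _ => 1) (x₀ := x) fun n => Or.inr (hx n)
  filter_upwards [hM] with y hy n
  exact ((hy n).resolve_left one_ne_zero).1

lemma differentiableAt_sinSeries {τ : ℂ} (hτ : 0 < τ.im) {c : ℤ → ℂ} {r : ℤ → ℝ}
    (hr : Summable r) (hc : ∀ n, ‖c n‖ ≤ r n) {x₀ : ℂ}
    (h : ∀ n : ℤ, c n = 0 ∨ Complex.sin (Real.pi * (x₀ + (n + 1 / 2) * τ)) ≠ 0) :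
    DifferentiableAt ℂ (fun x => ∑' n : ℤ, c n / Complex.sin (Real.pi * (x + (n + 1 / 2) * τ))) x₀ ∧
    ∀ᶠ x in 𝓝 x₀, Summable fun n : ℤ => c n / Complex.sin (Real.pi * (x + (n + 1 / 2) * τ)) := by
  obtain ⟨M, hM0, hM⟩ := eventually_sin_bound hτ h
  obtain ⟨ε, hε, hball⟩ := Metric.eventually_nhds_iff_ball.1 hM
  have hbd : ∀ n : ℤ, ∀ x ∈ Metric.ball x₀ ε,
      ‖c n / Complex.sin (Real.pi * (x + (n + 1 / 2) * τ))‖ ≤ M * r n := by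
    intro n x hx
    rcases hball x hx n with h0 | ⟨_, h0⟩
    · rw [h0, zero_div, norm_zero]
      exact mul_nonneg hM0 ((norm_nonneg _).trans (hc n))
    · rw [div_eq_mul_inv, norm_mul, mul_comm M]
      exact mul_le_mul (hc n) h0 (norm_nonneg _) ((norm_nonneg _).trans (hc n))
  constructor
  · have := differentiableOn_tsum_of_summable_norm (hr.mul_left M)
      (F := fun (n : ℤ) x => c n / Complex.sin (Real.pi * (x + (n + 1 / 2) * τ)))
      (U := Metric.ball x₀ ε) (fun n => ?_) Metric.isOpen_ball hbd
    · exact this.differentiableAt (Metric.ball_mem_nhds x₀ hε)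
    · intro x hx
      rcases hball x hx n with h0 | ⟨h0, _⟩
      · simp only [h0, zero_div]
        exact differentiableWithinAt_const _
      · refine DifferentiableAt.differentiableWithinAt ?_
        refine DifferentiableAt.div (differentiableAt_const _) ?_ h0
        fun_prop
  · filter_upwards [Metric.ball_mem_nhds x₀ hε] with x hx
    exact Summable.of_norm_bounded (hr.mul_left M) fun n => hbd n x hx

lemma norm_cexp_half (n : ℤ) (τ : ℂ) :
    ‖cexp (Real.pi * I * ((n : ℂ) + 1 / 2) ^ 2 * τ)‖ =
      Real.exp (-Real.pi * τ.im * ((n : ℝ) + 1 / 2) ^ 2) := by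
  rw [norm_exp]
  congr 1
  have : Real.pi * I * ((n : ℂ) + 1 / 2) ^ 2 * τ =
      ((Real.pi * ((n : ℝ) + 1 / 2) ^ 2 : ℝ) : ℂ) * (I * τ) := by push_cast; ring
  rw [this, re_ofReal_mul]
  simp
  ring

lemma summable_exp_half {y : ℝ} (hy : 0 < y) :
    Summable fun n : ℤ => Real.exp (-Real.pi * y * ((n : ℝ) + 1 / 2) ^ 2) := by
  have := ((summable_jacobiTheta₂_term_iff (y * I / 2) (y * I)).2 (by simpa using hy)).norm.mul_left
    (Real.exp (-Real.pi * y / 4))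
  refine this.congr fun n => ?_
  rw [norm_jacobiTheta₂_term, ← Real.exp_add]
  congr 1
  simp
  ring

lemma norm_sinSum_coeff (n : ℤ) (τ : ℂ) :
    ‖(-1 : ℂ) ^ n * cexp (Real.pi * I * ((n : ℂ) + 1 / 2) ^ 2 * τ)‖ ≤
      Real.exp (-Real.pi * τ.im * ((n : ℝ) + 1 / 2) ^ 2) := by
  rw [norm_mul, norm_neg_one_zpow, one_mul, norm_cexp_half]

lemma differentiableAt_sinSum {τ x : ℂ} (hτ : 0 < τ.im) (hx : Regular τ x) :
    DifferentiableAt ℂ (fun x => sinSum x τ) x :=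
  (differentiableAt_sinSeries hτ (summable_exp_half hτ) (fun n => norm_sinSum_coeff n τ)
    fun n => Or.inr (hx n)).1

lemma summable_sinSum {τ x : ℂ} (hτ : 0 < τ.im) (hx : Regular τ x) :
    Summable fun n : ℤ => (-1 : ℂ) ^ n * cexp (Real.pi * I * ((n : ℂ) + 1 / 2) ^ 2 * τ) /
      Complex.sin (Real.pi * (x + (n + 1 / 2) * τ)) :=
  (differentiableAt_sinSeries hτ (summable_exp_half hτ) (fun n => norm_sinSum_coeff n τ)
    fun n => Or.inr (hx n)).2.self_of_nhds

lemma tendsto_mul_inv_sin :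
    Tendsto (fun y : ℂ => y / Complex.sin (Real.pi * y)) (𝓝[≠] 0) (𝓝 (Real.pi : ℂ)⁻¹) := by
  have h1 : HasDerivAt (fun y : ℂ => Complex.sin (Real.pi * y)) (Real.pi : ℂ) 0 := by
    have h2 : HasDerivAt (fun y : ℂ => Real.pi * y) ((Real.pi : ℂ) * 1) 0 :=
      (hasDerivAt_id' (0 : ℂ)).const_mul _
    simpa using h2.csin
  have h3 := hasDerivAt_iff_tendsto_slope.1 h1
  have h4 := h3.inv₀ (by exact_mod_cast Real.pi_ne_zero)
  refine h4.congr fun y => ?_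
  simp [slope_def_field]

/-- Only the term n = 0 is singular at -τ/2. The remaining series is differentiable there and is
killed by the factor x + τ/2. -/
lemma tendsto_sinSum_pole {τ : ℂ} (hτ : 0 < τ.im) :
    Tendsto (fun x => (x + τ / 2) * sinSum x τ) (𝓝[≠] (-(τ / 2)))
      (𝓝 (cexp (Real.pi * I * τ / 4) / Real.pi)) := by
  set c : ℤ → ℂ := fun n => (-1 : ℂ) ^ n * cexp (Real.pi * I * ((n : ℂ) + 1 / 2) ^ 2 * τ) with hc
  set c' : ℤ → ℂ := fun n => if n = 0 then 0 else c n with hc'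
  have hb : ∀ n, ‖c' n‖ ≤ Real.exp (-Real.pi * τ.im * ((n : ℝ) + 1 / 2) ^ 2) := fun n => by
    simp only [hc']
    split_ifs
    · simpa using (Real.exp_pos _).le
    · exact norm_sinSum_coeff n τ
  have hreg : ∀ n : ℤ, c' n = 0 ∨
      Complex.sin (Real.pi * (-(τ / 2) + (n + 1 / 2) * τ)) ≠ 0 := fun n => by
    by_cases hn : n = 0
    · left; simp [hc', hn]
    · right
      apply sin_pi_ne_zero_of_im
      have : -(τ / 2) + ((n : ℂ) + 1 / 2) * τ = ((n : ℝ) : ℂ) * τ := by push_cast; ring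
      rw [this, im_ofReal_mul]
      exact mul_ne_zero (by exact_mod_cast hn) hτ.ne'
  obtain ⟨hd, hs⟩ := differentiableAt_sinSeries hτ (summable_exp_half hτ) hb hreg
  have hval : ∀ᶠ x in 𝓝[≠] (-(τ / 2)), (x + τ / 2) * sinSum x τ =
      cexp (Real.pi * I * τ / 4) * ((x + τ / 2) / Complex.sin (Real.pi * (x + τ / 2))) +
      (x + τ / 2) * ∑' n : ℤ, c' n / Complex.sin (Real.pi * (x + (n + 1 / 2) * τ)) := by
    filter_upwards [hs.filter_mono nhdsWithin_le_nhds] with x hx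
    have h1 := (hasSum_ite_eq (0 : ℤ) (c 0 / Complex.sin (Real.pi * (x + τ / 2)))).add hx.hasSum
    have h2 : sinSum x τ = c 0 / Complex.sin (Real.pi * (x + τ / 2)) +
        ∑' n : ℤ, c' n / Complex.sin (Real.pi * (x + (n + 1 / 2) * τ)) := by
      rw [← h1.tsum_eq, sinSum]
      refine tsum_congr fun n => ?_
      by_cases hn : n = 0
      · subst hn
        simp only [hc', hc]
        simp
        ring_nf
      · simp [hc', hc, hn]
    have h3 : c 0 = cexp (Real.pi * I * τ / 4) := by
      simp only [hc]
      simp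
      ring_nf
    rw [h2, h3]
    ring
  refine Tendsto.congr' (hval.mono fun x hx => hx.symm) ?_
  have t1 : Tendsto (fun x : ℂ => x + τ / 2) (𝓝[≠] (-(τ / 2))) (𝓝[≠] 0) := by
    refine tendsto_nhdsWithin_iff.2 ⟨?_, ?_⟩
    · have hcont : Continuous fun x : ℂ => x + τ / 2 := by fun_prop
      have := hcont.tendsto (-(τ / 2))
      rw [neg_add_cancel] at this
      exact this.mono_left nhdsWithin_le_nhds
    · filter_upwards [self_mem_nhdsWithin] with x hx h0
      exact hx (eq_neg_of_add_eq_zero_left h0)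
  have t2 := (tendsto_mul_inv_sin.comp t1).const_mul (cexp (Real.pi * I * τ / 4))
  have t3 : Tendsto (fun x : ℂ => (x + τ / 2) *
      ∑' n : ℤ, c' n / Complex.sin (Real.pi * (x + (n + 1 / 2) * τ))) (𝓝[≠] (-(τ / 2))) (𝓝 0) := by
    have h5 := (t1.mono_right nhdsWithin_le_nhds).mul
      (hd.continuousAt.tendsto.mono_left (nhdsWithin_le_nhds (s := {-(τ / 2)}ᶜ)))
    rwa [zero_mul] at h5
  have := t2.add t3
  rw [add_zero, ← div_eq_mul_inv] at this
  exact this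

lemma Regular.add_one {τ x : ℂ} (h : Regular τ x) : Regular τ (x + 1) := fun n => by
  have : Real.pi * (x + 1 + (n + 1 / 2) * τ) = Real.pi * (x + (n + 1 / 2) * τ) + Real.pi := by ring
  rw [this, Complex.sin_add_pi]
  exact neg_ne_zero.2 (h n)

lemma Regular.sub_one {τ x : ℂ} (h : Regular τ x) : Regular τ (x - 1) := fun n => by
  have : Real.pi * (x - 1 + (n + 1 / 2) * τ) = Real.pi * (x + (n + 1 / 2) * τ) - Real.pi := by ring
  rw [this, Complex.sin_sub_pi]
  exact neg_ne_zero.2 (h n)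

lemma Regular.add_tau {τ x : ℂ} (h : Regular τ x) : Regular τ (x + τ) := fun n => by
  have := h (n + 1)
  push_cast at this
  convert this using 3
  ring

lemma Regular.sub_tau {τ x : ℂ} (h : Regular τ x) : Regular τ (x - τ) := fun n => by
  have := h (n - 1)
  push_cast at this
  convert this using 3
  ring

lemma regular_add_one_iff {τ x : ℂ} : Regular τ (x + 1) ↔ Regular τ x :=
  ⟨fun h => by simpa using h.sub_one, Regular.add_one⟩

lemma regular_add_tau_iff {τ x : ℂ} : Regular τ (x + τ) ↔ Regular τ x :=
  ⟨fun h => by simpa using h.sub_tau, Regular.add_tau⟩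

lemma sinSum_add_one (x τ : ℂ) : sinSum (x + 1) τ = -sinSum x τ := by
  rw [sinSum, sinSum, ← tsum_neg]
  refine tsum_congr fun n => ?_
  have : Real.pi * (x + 1 + (n + 1 / 2) * τ) = Real.pi * (x + (n + 1 / 2) * τ) + Real.pi := by ring
  rw [this, Complex.sin_add_pi, div_neg]

lemma summable_theta4 {τ : ℂ} (hτ : 0 < τ.im) :
    Summable fun n : ℤ => (-1 : ℂ) ^ n * cexp (Real.pi * I * (n : ℂ) ^ 2 * τ) :=
  Summable.of_norm_bounded (summable_exp_neg_mul_int_sq hτ) fun n => by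
    rw [norm_mul, norm_neg_one_zpow, one_mul, norm_cexp_quadratic]

/-- After a shift of the index, the two numerators belonging to the same sine differ by a Gaussian
times that sine. The sine cancels and the series of `theta4` remains. -/
lemma sinSum_add_tau {x τ : ℂ} (hτ : 0 < τ.im) (hx : Regular τ x) :
    sinSum (x + τ) τ = -cexp (2 * Real.pi * I * x + Real.pi * I * τ) * sinSum x τ +
      2 * I * cexp (Real.pi * I * x + 3 * Real.pi * I * τ / 4) * theta4 τ := by
  have h1 : sinSum (x + τ) τ = ∑' n : ℤ, -((-1 : ℂ) ^ n *
      cexp (Real.pi * I * ((n : ℂ) - 1 / 2) ^ 2 * τ) /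
      Complex.sin (Real.pi * (x + (n + 1 / 2) * τ))) := by
    rw [sinSum, ← (Equiv.subRight (1 : ℤ)).tsum_eq]
    refine tsum_congr fun n => ?_
    simp only [Equiv.subRight_apply]
    have e1 : x + τ + (((n - 1 : ℤ) : ℂ) + 1 / 2) * τ = x + (n + 1 / 2) * τ := by push_cast; ring
    have e2 : (((n - 1 : ℤ) : ℂ) + 1 / 2) = n - 1 / 2 := by push_cast; ring
    rw [e1, e2, zpow_sub₀ (by norm_num : (-1 : ℂ) ≠ 0)]
    norm_num
    ring
  rw [h1, sinSum, theta4, ← tsum_mul_left, ← tsum_mul_left,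
    ← ((summable_sinSum hτ hx).mul_left _).tsum_add ((summable_theta4 hτ).mul_left _)]
  refine tsum_congr fun n => ?_
  have hn := hx n
  set y := x + (n + 1 / 2) * τ with hy
  have e3 : 2 * I * cexp (Real.pi * I * x + 3 * Real.pi * I * τ / 4) *
      cexp (Real.pi * I * (n : ℂ) ^ 2 * τ) * Complex.sin (Real.pi * y) =
      cexp (2 * Real.pi * I * x + Real.pi * I * τ) *
        cexp (Real.pi * I * ((n : ℂ) + 1 / 2) ^ 2 * τ) -
      cexp (Real.pi * I * ((n : ℂ) - 1 / 2) ^ 2 * τ) := by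
    have f1 : cexp (Real.pi * I * x + 3 * Real.pi * I * τ / 4) *
      cexp (Real.pi * I * (n : ℂ) ^ 2 * τ) * cexp (-(Real.pi * y) * I) =
        cexp (Real.pi * I * ((n : ℂ) - 1 / 2) ^ 2 * τ) := by
      rw [← Complex.exp_add, ← Complex.exp_add, hy]; congr 1; ring
    have f2 : cexp (Real.pi * I * x + 3 * Real.pi * I * τ / 4) *
      cexp (Real.pi * I * (n : ℂ) ^ 2 * τ) * cexp (Real.pi * y * I) =
        cexp (2 * Real.pi * I * x + Real.pi * I * τ) *
        cexp (Real.pi * I * ((n : ℂ) + 1 / 2) ^ 2 * τ) := by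
      rw [← Complex.exp_add, ← Complex.exp_add, ← Complex.exp_add, hy]; congr 1; ring
    rw [← f1, ← f2, Complex.sin]
    linear_combination (cexp (Real.pi * I * x + 3 * Real.pi * I * τ / 4) *
      cexp (Real.pi * I * (n : ℂ) ^ 2 * τ) * (cexp (-(Real.pi * y) * I) -
        cexp (Real.pi * y * I))) * I_sq
  generalize Complex.sin (Real.pi * y) = S at *
  rw [← mul_div_assoc, ← neg_div, div_add' _ _ _ hn]
  congr 1
  linear_combination (-(-1 : ℂ) ^ n) * e3

/-! ### Uniqueness of solutions of the elliptic functional equations -/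

/-- The zeroth Fourier coefficient. It serves to show that the theta function does not vanish
identically. -/
lemma integral_jacobiTheta₂ {τ : ℂ} (hτ : 0 < τ.im) :
    ∫ x in (0 : ℝ)..1, jacobiTheta₂ x τ = 1 := by
  have hterm : ∀ n : ℤ, ∫ x in (0 : ℝ)..1, jacobiTheta₂_term n x τ = if n = 0 then 1 else 0 := by
    intro n
    have h1 : ∀ x : ℝ, jacobiTheta₂_term n x τ =
        cexp (Real.pi * I * n ^ 2 * τ) * cexp (2 * Real.pi * I * n * x) := fun x => by
      rw [jacobiTheta₂_term, Complex.exp_add, mul_comm]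
    simp_rw [h1]
    rw [intervalIntegral.integral_const_mul]
    split_ifs with hn
    · subst hn; simp
    · have h2 : 2 * Real.pi * I * (n : ℂ) ≠ 0 := by
        simp [Real.pi_ne_zero, hn]
      rw [integral_exp_mul_complex h2]
      have h3 : cexp (2 * Real.pi * I * n * (1 : ℝ)) = 1 := by
        rw [← Complex.exp_int_mul_two_pi_mul_I n]; congr 1; push_cast; ring
      rw [h3]
      simp
  have hcont : ∀ n : ℤ, Continuous fun x : ℝ => jacobiTheta₂_term n x τ := fun n => by
    unfold jacobiTheta₂_term; fun_prop
  have hnorm : ∀ (n : ℤ) (x : ℝ), ‖jacobiTheta₂_term n x τ‖ =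
      Real.exp (-Real.pi * n ^ 2 * τ.im) := fun n x => by
    rw [norm_jacobiTheta₂_term]; simp
  have hsum : Summable fun n : ℤ => Real.exp (-Real.pi * n ^ 2 * τ.im) := by
    have := ((summable_jacobiTheta₂_term_iff 0 τ).2 hτ).norm
    refine this.congr fun n => ?_
    simpa using hnorm n 0
  have h := hasSum_integral_of_summable_integral_norm (μ := volume.restrict (Set.Ioc (0 : ℝ) 1))
    (F := fun (n : ℤ) (x : ℝ) => jacobiTheta₂_term n x τ)
    (fun n => (hcont n).integrableOn_Ioc) (by simpa [hnorm] using hsum)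
  rw [intervalIntegral.integral_of_le zero_le_one]
  unfold jacobiTheta₂
  rw [← h.tsum_eq]
  simp_rw [← intervalIntegral.integral_of_le zero_le_one, hterm]
  simp

/-- An odd theta function in the variable `x`, vanishing at the origin. -/
def oddTheta (τ x : ℂ) : ℂ := cexp (Real.pi * I * x) * jacobiTheta₂ (x + 1 / 2 + τ / 2) τ

lemma oddTheta_add_one (τ x : ℂ) : oddTheta τ (x + 1) = -oddTheta τ x := by
  have h1 : x + 1 + 1 / 2 + τ / 2 = (x + 1 / 2 + τ / 2) + 1 := by ring
  rw [oddTheta, oddTheta, h1, jacobiTheta₂_add_left, mul_add, Complex.exp_add, mul_one,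
    mul_comm (Real.pi : ℂ) I, mul_comm I, Complex.exp_pi_mul_I]
  ring

lemma oddTheta_add_tau (τ x : ℂ) :
    cexp (2 * Real.pi * I * x + Real.pi * I * τ) * oddTheta τ (x + τ) = -oddTheta τ x := by
  have h1 : x + τ + 1 / 2 + τ / 2 = (x + 1 / 2 + τ / 2) + τ := by ring
  rw [oddTheta, oddTheta, h1, jacobiTheta₂_add_left', ← mul_assoc, ← mul_assoc, ← neg_mul,
    ← Complex.exp_add, ← Complex.exp_add]
  congr 1
  have h2 : -cexp (Real.pi * I * x) = cexp (-(Real.pi * I)) * cexp (Real.pi * I * x) := by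
    rw [Complex.exp_neg_pi_mul_I, neg_one_mul]
  rw [h2, ← Complex.exp_add]
  congr 1
  ring

/-- The points ±(1/2 + τ/2) differ by a period. Evenness and quasi-periodicity give equal and
opposite theta values there. -/
lemma oddTheta_zero (τ : ℂ) : oddTheta τ 0 = 0 := by
  have h1 := jacobiTheta₂_add_left' (-(1 / 2 + τ / 2)) τ
  have h2 : -(1 / 2 + τ / 2) + τ + 1 = 1 / 2 + τ / 2 := by ring
  rw [← jacobiTheta₂_add_left, h2, jacobiTheta₂_neg_left] at h1
  have h3 : -Real.pi * I * (τ + 2 * -(1 / 2 + τ / 2)) = Real.pi * I := by ring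
  rw [h3, Complex.exp_pi_mul_I] at h1
  have h4 : jacobiTheta₂ (1 / 2 + τ / 2) τ = 0 := by linear_combination h1 / 2
  rw [oddTheta, zero_add, h4, mul_zero]

lemma oddTheta_pole (τ : ℂ) :
    oddTheta τ (-(τ / 2)) = cexp (Real.pi * I * (-(τ / 2))) * theta4 τ := by
  rw [oddTheta, theta4_eq_jacobiTheta₂]
  congr 2
  ring

lemma differentiable_oddTheta {τ : ℂ} (hτ : 0 < τ.im) : Differentiable ℂ (oddTheta τ) := fun x => by
  refine DifferentiableAt.mul (by fun_prop) ?_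
  exact (differentiableAt_jacobiTheta₂_fst (x + 1 / 2 + τ / 2) hτ).comp x
    (f := fun x => x + 1 / 2 + τ / 2) (by fun_prop)

lemma eventually_oddTheta_ne_zero {τ : ℂ} (hτ : 0 < τ.im) (x : ℂ) :
    ∀ᶠ y in 𝓝[≠] x, oddTheta τ y ≠ 0 := by
  by_contra h
  have h0 : oddTheta τ = fun _ => 0 :=
    AnalyticOnNhd.eq_of_frequently_eq (z₀ := x)
      (fun z _ => (differentiable_oddTheta hτ).analyticAt z) (fun z _ => analyticAt_const)
      (fun h' => h h')
  have h1 : ∀ z, jacobiTheta₂ z τ = 0 := fun z => by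
    have := congrFun h0 (z - 1 / 2 - τ / 2)
    rw [oddTheta] at this
    have h2 := (mul_eq_zero.1 this).resolve_left (exp_ne_zero _)
    rwa [show z - 1 / 2 - τ / 2 + 1 / 2 + τ / 2 = z by ring] at h2
  have := integral_jacobiTheta₂ hτ
  simp [h1] at this

lemma regular_zero {τ : ℂ} (hτ : 0 < τ.im) : Regular τ 0 := fun n => by
  apply sin_pi_ne_zero_of_im
  have : (0 : ℂ) + ((n : ℂ) + 1 / 2) * τ = (((n : ℝ) + 1 / 2 : ℝ) : ℂ) * τ := by push_cast; ring
  rw [this, im_ofReal_mul]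
  refine mul_ne_zero (fun h => ?_) hτ.ne'
  have h2 : (2 * n + 1 : ℤ) = 0 := by
    have : ((2 * n + 1 : ℤ) : ℝ) = 0 := by push_cast; linarith
    exact_mod_cast this
  omega

lemma eventually_regular_pole {τ : ℂ} (hτ : 0 < τ.im) :
    ∀ᶠ x in 𝓝[≠] (-(τ / 2)), Regular τ x := by
  have hreg : ∀ n : ℤ, (if n = 0 then (0 : ℂ) else 1) = 0 ∨
      Complex.sin (Real.pi * (-(τ / 2) + (n + 1 / 2) * τ)) ≠ 0 := fun n => by
    by_cases hn : n = 0
    · left; simp [hn]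
    · right
      apply sin_pi_ne_zero_of_im
      have : -(τ / 2) + ((n : ℂ) + 1 / 2) * τ = ((n : ℝ) : ℂ) * τ := by push_cast; ring
      rw [this, im_ofReal_mul]
      exact mul_ne_zero (by exact_mod_cast hn) hτ.ne'
  obtain ⟨M, _, hM⟩ := eventually_sin_bound hτ hreg
  have hball : ∀ᶠ x in 𝓝[≠] (-(τ / 2)), ‖x + τ / 2‖ < 1 := by
    have : Metric.ball (-(τ / 2)) 1 ∈ 𝓝 (-(τ / 2)) := Metric.ball_mem_nhds _ one_pos
    filter_upwards [nhdsWithin_le_nhds this] with x hx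
    rwa [Metric.mem_ball, dist_eq, sub_neg_eq_add] at hx
  filter_upwards [hM.filter_mono nhdsWithin_le_nhds, hball, self_mem_nhdsWithin] with x hx hb hne n
  by_cases hn : n = 0
  · subst hn
    intro h0
    obtain ⟨k, hk⟩ := Complex.sin_eq_zero_iff.1 h0
    have hx2 : x + τ / 2 = k := by
      have : (Real.pi : ℂ) ≠ 0 := by exact_mod_cast Real.pi_ne_zero
      apply mul_left_cancel₀ this
      push_cast at hk
      linear_combination hk
    rw [hx2, Complex.norm_intCast] at hb
    have : |k| < 1 := by exact_mod_cast hb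
    rw [Int.abs_lt_one_iff] at this
    subst this
    apply hne
    rw [Set.mem_singleton_iff]
    push_cast at hx2
    linear_combination hx2
  · have := hx n
    simp only [hn, if_false] at this
    exact (this.resolve_left one_ne_zero).1

lemma exists_of_not_regular {τ x : ℂ} (h : ¬ Regular τ x) :
    ∃ m n : ℤ, x = -(τ / 2) + m * 1 + n * τ := by
  unfold Regular at h
  push Not at h
  obtain ⟨n, hn⟩ := h
  obtain ⟨k, hk⟩ := Complex.sin_eq_zero_iff.1 hn
  refine ⟨k, -n, ?_⟩
  have : (Real.pi : ℂ) ≠ 0 := by exact_mod_cast Real.pi_ne_zero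
  apply mul_left_cancel₀ this
  push_cast
  linear_combination hk

lemma bounded_of_doubly_periodic {τ : ℂ} (hτ : 0 < τ.im) {G : ℂ → ℂ} (hG : Continuous G)
    (h1 : Function.Periodic G 1) (h2 : Function.Periodic G τ) :
    Bornology.IsBounded (Set.range G) := by
  have hK : IsCompact ((fun p : ℝ × ℝ => G (p.1 + p.2 * τ)) '' (Set.Icc 0 1 ×ˢ Set.Icc 0 1)) :=
    (isCompact_Icc.prod isCompact_Icc).image (by fun_prop)
  refine hK.isBounded.subset ?_
  rintro _ ⟨x, rfl⟩
  set v : ℝ := x.im / τ.im with hv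
  set u : ℝ := x.re - v * τ.re with hu
  have hx : x = u + v * τ := by
    apply Complex.ext
    · simp [hu]
    · simp [hv]; field_simp
  refine ⟨(Int.fract u, Int.fract v), ⟨⟨Int.fract_nonneg _, (Int.fract_lt_one _).le⟩,
    ⟨Int.fract_nonneg _, (Int.fract_lt_one _).le⟩⟩, ?_⟩
  have e1 : x = ((Int.fract u : ℝ) : ℂ) + (Int.fract v : ℝ) * τ + (⌊u⌋ : ℤ) * 1 + (⌊v⌋ : ℤ) * τ := by
    have hu2 : (u : ℂ) = (⌊u⌋ : ℤ) + ((Int.fract u : ℝ) : ℂ) := by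
      exact_mod_cast (Int.floor_add_fract u).symm
    have hv2 : (v : ℂ) = (⌊v⌋ : ℤ) + ((Int.fract v : ℝ) : ℂ) := by
      exact_mod_cast (Int.floor_add_fract v).symm
    rw [hx]
    linear_combination hu2 + τ * hv2
  conv_rhs => rw [e1]
  rw [h2.int_mul _, h1.int_mul _]

/-- Multiplication by `oddTheta` cancels the multipliers of D, and the hypothesis at -τ/2 makes the
singularity there removable. The product extends to a bounded entire function, constant by
Liouville, and the constant is 0 because `oddTheta` vanishes at the regular point 0. -/
lemma eq_zero_of_elliptic {τ : ℂ} (hτ : 0 < τ.im) {D : ℂ → ℂ}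
    (hD : ∀ x, Regular τ x → DifferentiableAt ℂ D x)
    (hD1 : ∀ x, Regular τ x → D (x + 1) = -D x)
    (hDτ : ∀ x, Regular τ x → D (x + τ) = -cexp (2 * Real.pi * I * x + Real.pi * I * τ) * D x)
    (hp : Tendsto (fun x => (x + τ / 2) * D x * oddTheta τ x) (𝓝[≠] (-(τ / 2))) (𝓝 0)) :
    ∀ x, Regular τ x → D x = 0 := by
  classical
  set p := -(τ / 2) with hpdef
  set F : ℂ → ℂ := fun x => D x * oddTheta τ x with hF
  set L := limUnder (𝓝[≠] p) F with hL
  set G : ℂ → ℂ := fun x => if Regular τ x then F x else L with hG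
  have hFd : ∀ x, Regular τ x → DifferentiableAt ℂ F x := fun x hx =>
    (hD x hx).mul (differentiable_oddTheta hτ x)
  have hG1 : Function.Periodic G 1 := fun x => by
    simp only [hG, regular_add_one_iff]
    split_ifs with h
    · simp only [hF, hD1 x h, oddTheta_add_one]; ring
    · rfl
  have hGτ : Function.Periodic G τ := fun x => by
    simp only [hG, regular_add_tau_iff]
    split_ifs with h
    · simp only [hF, hDτ x h]
      linear_combination (-D x) * oddTheta_add_tau τ x
    · rfl
  have hnp : ¬ Regular τ p := fun h => by
    have := h 0
    rw [hpdef] at this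
    apply this
    push_cast
    rw [show -(τ / 2) + (0 + 1 / 2) * τ = 0 by ring, mul_zero, Complex.sin_zero]
  have hev := eventually_regular_pole hτ
  rw [← hpdef] at hev
  -- The singularity is removable because F is o(1/(z - p)); the extended value is the limit L.
  have hGp : DifferentiableAt ℂ G p := by
    obtain ⟨s, hs, hsub⟩ := eventually_nhdsWithin_iff.1 hev |>.exists_mem
    have hd : DifferentiableOn ℂ F (s \ {p}) := fun x hx =>
      (hFd x (hsub x hx.1 hx.2)).differentiableWithinAt
    have ho : (fun z => F z - F p) =o[𝓝[≠] p] fun z => (z - p)⁻¹ := by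
      rw [Asymptotics.isLittleO_iff_tendsto']
      · have h1 : Tendsto (fun x => x - p) (𝓝[≠] p) (𝓝 0) := by
          have : Continuous fun x : ℂ => x - p := by fun_prop
          have h2 := this.tendsto p
          rw [sub_self] at h2
          exact h2.mono_left nhdsWithin_le_nhds
        have h2 := hp.sub (h1.mul_const (F p))
        rw [zero_mul, sub_zero] at h2
        refine h2.congr fun x => ?_
        simp only [hF, hpdef]
        rw [div_inv_eq_mul]
        ring
      · filter_upwards [self_mem_nhdsWithin] with x hx h0
        exact absurd (inv_eq_zero.1 h0) (sub_ne_zero.2 hx)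
    have := (Complex.differentiableOn_update_limUnder_of_isLittleO hs hd ho).differentiableAt hs
    refine this.congr_of_eventuallyEq ?_
    filter_upwards [hs] with x hx
    by_cases h : x = p
    · subst h
      simp only [hG, if_neg hnp, Function.update_self, hL]
    · simp only [hG, if_pos (hsub x hx h), Function.update_of_ne h]
  have hGd : Differentiable ℂ G := fun x => by
    by_cases hx : Regular τ x
    · refine (hFd x hx).congr_of_eventuallyEq ?_
      filter_upwards [isOpen_regular hτ hx] with y hy
      simp only [hG, if_pos hy]
    · obtain ⟨m, n, hmn⟩ := exists_of_not_regular hx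
      -- Every other singular point is a lattice translate of p, so periodicity carries the
      -- extension over.
      have hshift : G = fun y => G (y - (m * 1 + n * τ)) := by
        funext y
        have e1 := hGτ.int_mul n (y - (m * 1 + n * τ) + m * 1)
        have e2 := hG1.int_mul m (y - (m * 1 + n * τ))
        rw [← e2, ← e1]
        congr 1
        ring
      rw [hshift]
      have hxp : x - (m * 1 + n * τ) = p := by rw [hmn, hpdef]; ring
      have h2 : DifferentiableAt ℂ (fun y : ℂ => y - (m * 1 + n * τ)) x := by fun_prop
      exact DifferentiableAt.comp x (by rw [hxp]; exact hGp) h2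
  have hconst : ∀ x, G x = 0 := fun x => by
    rw [hGd.apply_eq_apply_of_bounded (bounded_of_doubly_periodic hτ hGd.continuous hG1 hGτ) x 0]
    simp only [hG, if_pos (regular_zero hτ), hF, oddTheta_zero, mul_zero]
  intro x hx
  have hlim : Tendsto D (𝓝[≠] x) (𝓝 (D x)) :=
    (hD x hx).continuousAt.tendsto.mono_left nhdsWithin_le_nhds
  refine tendsto_nhds_unique hlim (tendsto_const_nhds.congr' ?_)
  filter_upwards [eventually_oddTheta_ne_zero hτ x,
    (isOpen_regular hτ hx).filter_mono nhdsWithin_le_nhds] with y hy hr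
  have := hconst y
  simp only [hG, if_pos hr, hF] at this
  exact ((mul_eq_zero.1 this).resolve_right hy).symm

/-- If `theta4` vanished, `sinSum` would satisfy the homogeneous equations, and `oddTheta` would
vanish at -τ/2 and cancel the pole. Then `sinSum` would be zero, against its nonzero residue. -/
lemma theta4_ne_zero {τ : ℂ} (hτ : 0 < τ.im) : theta4 τ ≠ 0 := by
  intro h0
  have hlim := tendsto_sinSum_pole hτ
  have hodd : Tendsto (oddTheta τ) (𝓝[≠] (-(τ / 2))) (𝓝 0) := by
    have := (differentiable_oddTheta hτ).continuous.tendsto (-(τ / 2))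
    rw [oddTheta_pole, h0, mul_zero] at this
    exact this.mono_left nhdsWithin_le_nhds
  have hz := eq_zero_of_elliptic hτ (D := fun x => sinSum x τ)
    (fun x hx => differentiableAt_sinSum hτ hx) (fun x _ => sinSum_add_one x τ)
    (fun x hx => by simp only [sinSum_add_tau hτ hx, h0]; ring)
    (by simpa using hlim.mul hodd)
  have h1 : Tendsto (fun x => (x + τ / 2) * sinSum x τ) (𝓝[≠] (-(τ / 2))) (𝓝 0) := by
    refine tendsto_const_nhds.congr' ?_
    filter_upwards [eventually_regular_pole hτ] with x hx
    rw [hz x hx, mul_zero]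
  have h2 := tendsto_nhds_unique hlim h1
  rw [div_eq_zero_iff] at h2
  rcases h2 with h2 | h2
  · exact exp_ne_zero _ h2
  · exact Real.pi_ne_zero (by exact_mod_cast h2)

/-! ### Holomorphic parametric integrals and contour shifts -/

/-- A bound on F alone suffices: Cauchy's estimate on a smaller disc dominates the derivative in the
parameter. -/
lemma differentiableAt_integral {α : Type*} [MeasurableSpace α] {μ : Measure α}
    {F : ℂ → α → ℂ} {z₀ : ℂ} {ε : ℝ} (hε : 0 < ε) {bound : α → ℝ}
    (hm : ∀ z ∈ Metric.ball z₀ ε, AEStronglyMeasurable (F z) μ)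
    (hb : ∀ᵐ t ∂μ, ∀ z ∈ Metric.ball z₀ ε, ‖F z t‖ ≤ bound t) (hi : Integrable bound μ)
    (hd : ∀ᵐ t ∂μ, DifferentiableOn ℂ (fun z => F z t) (Metric.ball z₀ ε)) :
    DifferentiableAt ℂ (fun z => ∫ t, F z t ∂μ) z₀ := by
  have hz₀ : z₀ ∈ Metric.ball z₀ ε := Metric.mem_ball_self hε
  have hF : ∀ᶠ z in 𝓝 z₀, AEStronglyMeasurable (F z) μ := by
    filter_upwards [Metric.ball_mem_nhds z₀ hε] with z hz using hm z hz
  have hF0 : Integrable (F z₀) μ := hi.mono' (hm z₀ hz₀) (hb.mono fun t ht => ht z₀ hz₀)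
  have hsub : ∀ x ∈ Metric.ball z₀ (ε / 2), Metric.closedBall x (ε / 4) ⊆ Metric.ball z₀ ε := by
    intro x hx
    refine (Metric.closedBall_subset_ball' (ε₂ := ε) ?_)
    rw [Metric.mem_ball] at hx
    linarith
  have hhd : ∀ᵐ t ∂μ, ∀ x ∈ Metric.ball z₀ (ε / 2),
      HasDerivAt (fun z => F z t) (deriv (fun z => F z t) x) x := by
    filter_upwards [hd] with t ht x hx
    refine (ht.differentiableAt ?_).hasDerivAt
    exact Metric.isOpen_ball.mem_nhds (Metric.ball_subset_ball (by linarith) hx)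
  have hbd : ∀ᵐ t ∂μ, ∀ x ∈ Metric.ball z₀ (ε / 2),
      ‖deriv (fun z => F z t) x‖ ≤ bound t / (ε / 4) := by
    filter_upwards [hd, hb] with t ht hbt x hx
    refine norm_deriv_le_of_forall_mem_sphere_norm_le (by positivity) ?_ fun z hz =>
      hbt z (hsub x hx (Metric.sphere_subset_closedBall hz))
    exact (ht.mono (hsub x hx)).diffContOnCl_ball subset_rfl
  -- The derivative is measurable as a pointwise limit of difference quotients.
  have hmeas : AEStronglyMeasurable (fun t => deriv (fun z => F z t) z₀) μ := by
    have hseq : Tendsto (fun n : ℕ => z₀ + ((ε / (n + 2) : ℝ) : ℂ)) atTop (𝓝[≠] z₀) := by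
      refine tendsto_nhdsWithin_iff.2 ⟨?_, Eventually.of_forall fun n => ?_⟩
      · have h1 : Tendsto (fun n : ℕ => (n : ℝ) + 2) atTop atTop :=
          tendsto_atTop_add_const_right _ _ tendsto_natCast_atTop_atTop
        have h2 := h1.const_div_atTop ε
        have h3 := (continuous_ofReal.tendsto 0).comp h2
        simpa using h3.const_add z₀
      · have : ((ε / ((n : ℝ) + 2) : ℝ) : ℂ) ≠ 0 := ofReal_ne_zero.2 (by positivity)
        rw [Set.mem_compl_singleton_iff, Ne, add_eq_left]
        exact this
    refine aestronglyMeasurable_of_tendsto_ae atTop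
      (f := fun n : ℕ => fun t => slope (fun z => F z t) z₀ (z₀ + ((ε / (n + 2) : ℝ) : ℂ)))
      (fun n => ?_) ?_
    · simp only [slope_def_field]
      have hmem : z₀ + ((ε / (n + 2) : ℝ) : ℂ) ∈ Metric.ball z₀ ε := by
        rw [Metric.mem_ball, dist_eq, add_sub_cancel_left, norm_real, Real.norm_eq_abs,
          abs_of_pos (by positivity)]
        rw [div_lt_iff₀ (by positivity)]
        nlinarith [(Nat.cast_nonneg n : (0 : ℝ) ≤ n)]
      simp_rw [div_eq_mul_inv]
      exact ((hm _ hmem).sub (hm z₀ hz₀)).mul_const _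
    · filter_upwards [hhd] with t ht
      exact (hasDerivAt_iff_tendsto_slope.1 (ht z₀ (Metric.mem_ball_self (by positivity)))).comp
        hseq
  exact (hasDerivAt_integral_of_dominated_loc_of_deriv_le
    (Metric.ball_mem_nhds z₀ (by positivity : 0 < ε / 2)) hF hF0 hmeas hbd (hi.div_const _)
    hhd).2.differentiableAt

lemma integral_contour_shift {f : ℂ → ℂ} {c : ℝ} {B : ℝ → ℝ}
    (hd : ∀ z : ℂ, z.im ∈ Set.uIcc 0 c → DifferentiableAt ℂ f z)
    (hB : Tendsto B (cocompact ℝ) (𝓝 0))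
    (hf : ∀ᶠ x : ℝ in cocompact ℝ, ∀ y ∈ Set.uIcc 0 c, ‖f (x + y * I)‖ ≤ B x)
    (i1 : Integrable fun x : ℝ => f x) (i2 : Integrable fun x : ℝ => f (x + c * I)) :
    ∫ x : ℝ, f x = ∫ x : ℝ, f (x + c * I) := by
  have hrect : ∀ R : ℝ, (∫ x : ℝ in -R..R, f x) - (∫ x : ℝ in -R..R, f (x + c * I)) +
      I • (∫ y : ℝ in 0..c, f (R + y * I)) - I • (∫ y : ℝ in 0..c, f ((-R : ℝ) + y * I)) = 0 := by
    intro R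
    have := Complex.integral_boundary_rect_eq_zero_of_differentiableOn f ((-R : ℝ) : ℂ)
      ((R : ℝ) + c * I) (fun z hz => (hd z ?_).differentiableWithinAt)
    · simpa using this
    · have := hz.2
      simpa using this
  have hside : ∀ g : ℝ → ℝ, Tendsto g atTop (cocompact ℝ) →
      Tendsto (fun R => ∫ y : ℝ in 0..c, f (g R + y * I)) atTop (𝓝 0) := by
    intro g hg
    have h1 : ∀ᶠ R in atTop, ‖∫ y : ℝ in 0..c, f (g R + y * I)‖ ≤ B (g R) * |c - 0| := by
      filter_upwards [hg.eventually hf] with R hR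
      refine intervalIntegral.norm_integral_le_of_norm_le_const fun y hy => ?_
      exact hR y (Set.uIoc_subset_uIcc hy)
    refine squeeze_zero_norm' h1 ?_
    simpa using (hB.comp hg).mul_const |c - 0|
  have hR : Tendsto (fun R : ℝ => R) atTop (cocompact ℝ) := by
    rw [cocompact_eq_atBot_atTop]; exact tendsto_id.mono_right le_sup_right
  have hnR : Tendsto (fun R : ℝ => -R) atTop (cocompact ℝ) := by
    rw [cocompact_eq_atBot_atTop]; exact tendsto_neg_atTop_atBot.mono_right le_sup_left
  have l1 := intervalIntegral_tendsto_integral i1 tendsto_neg_atTop_atBot tendsto_id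
  have l2 := intervalIntegral_tendsto_integral i2 tendsto_neg_atTop_atBot tendsto_id
  have l3 := ((l1.sub l2).add ((hside _ hR).const_smul I)).sub ((hside _ hnR).const_smul I)
  have l4 := tendsto_nhds_unique (l3.congr fun R => hrect R) tendsto_const_nhds
  simp only [smul_zero, add_zero, sub_zero] at l4
  exact sub_eq_zero.1 l4

/-! ### The Mordell integral -/

lemma norm_cexp_quadratic_le (α : ℂ) (hα : α.re < 0) (b c : ℝ) :
    ∃ K : ℝ, 0 ≤ K ∧ ∀ β : ℂ, ‖β‖ ≤ b → ∀ x y : ℝ, |y| ≤ c →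
      ‖cexp (α * (x + y * I) ^ 2 + β * (x + y * I))‖ ≤ K * Real.exp (-(-α.re / 2) * x ^ 2) := by
  set d := -α.re with hdd
  have hd : 0 < d := by rw [hdd]; linarith
  set m := 2 * |α.im| * c + b with hm
  refine ⟨Real.exp (d * c ^ 2 + m ^ 2 / (2 * d) + b * c), (Real.exp_pos _).le, ?_⟩
  intro β hβ x y hy
  have hc : 0 ≤ c := (abs_nonneg _).trans hy
  have hb : 0 ≤ b := (norm_nonneg _).trans hβ
  rw [norm_exp, ← Real.exp_add, Real.exp_le_exp]
  have hre : (α * (x + y * I) ^ 2 + β * (x + y * I)).re =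
      -d * (x ^ 2 - y ^ 2) - 2 * α.im * x * y + β.re * x - β.im * y := by
    simp [pow_two, hdd]; ring
  rw [hre]
  have h1 : -(2 * α.im * x * y) ≤ 2 * |α.im| * c * |x| := by
    have := neg_abs_le (2 * α.im * x * y)
    rw [abs_mul, abs_mul, abs_mul, abs_two] at this
    have h2 : 2 * |α.im| * |x| * |y| ≤ 2 * |α.im| * |x| * c := by gcongr
    linarith
  have h2 : β.re * x ≤ b * |x| := by
    refine (le_abs_self _).trans ?_
    rw [abs_mul]
    gcongr
    exact (abs_re_le_norm β).trans hβ
  have h3 : -(β.im * y) ≤ b * c := by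
    refine (neg_le_abs _).trans ?_
    rw [abs_mul]
    exact mul_le_mul ((abs_im_le_norm β).trans hβ) hy (abs_nonneg _) hb
  have h4 : d * y ^ 2 ≤ d * c ^ 2 := by
    have : y ^ 2 ≤ c ^ 2 := sq_le_sq' (by linarith [neg_abs_le y]) ((le_abs_self y).trans hy)
    gcongr
  have h5 : m * |x| ≤ d / 2 * x ^ 2 + m ^ 2 / (2 * d) := by
    rw [← sq_abs x]
    have : d / 2 * |x| ^ 2 + m ^ 2 / (2 * d) - m * |x| = (d * |x| - m) ^ 2 / (2 * d) := by
      field_simp; ring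
    have h6 : 0 ≤ (d * |x| - m) ^ 2 / (2 * d) := by positivity
    linarith
  rw [hm] at h5
  rw [hm]
  nlinarith

lemma integrable_gauss {d : ℝ} (hd : 0 < d) (K : ℝ) :
    Integrable fun x : ℝ => K * Real.exp (-d * x ^ 2) :=
  (integrable_exp_neg_mul_sq hd).const_mul K

lemma tendsto_gauss {d : ℝ} (hd : 0 < d) (K : ℝ) :
    Tendsto (fun x : ℝ => K * Real.exp (-d * x ^ 2)) (cocompact ℝ) (𝓝 0) := by
  simpa using (tendsto_rpow_abs_mul_exp_neg_mul_sq_cocompact hd 0).const_mul K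

lemma cosh_eq_sin (w : ℂ) : Complex.cosh w = Complex.sin (w * I + Real.pi / 2) := by
  rw [Complex.sin_add_pi_div_two, Complex.cos_mul_I]

lemma abs_re_le_norm_cosh (w : ℂ) : |w.re| ≤ ‖Complex.cosh w‖ := by
  have := abs_im_le_norm_sin (w * I + Real.pi / 2)
  rw [← cosh_eq_sin] at this
  have h : (w * I + Real.pi / 2).im = w.re := by
    have : ((Real.pi : ℂ) / 2) = ((Real.pi / 2 : ℝ) : ℂ) := by push_cast; rfl
    rw [this, add_im, ofReal_im]; simp
  rwa [h] at this

lemma cos_le_norm_cosh (x y : ℝ) : Real.cos y ≤ ‖Complex.cosh (x + y * I)‖ := by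
  have h : (Complex.cosh (x + y * I)).re = Real.cosh x * Real.cos y := by
    rw [Complex.cosh_add, Complex.cosh_mul_I, Complex.sinh_mul_I, ← ofReal_cosh, ← ofReal_sinh,
      ← ofReal_cos, ← ofReal_sin]
    simp only [add_re, mul_re, ofReal_re, ofReal_im, I_re, I_im, mul_im]
    ring
  rcases le_total 0 (Real.cos y) with h0 | h0
  · refine le_trans ?_ (re_le_norm _)
    rw [h]
    nlinarith [Real.one_le_cosh x]
  · exact h0.trans (norm_nonneg _)

/-- Mordell's integral `∫ e^{π i T w² - 2 π z w} / cosh (π w) dw`. -/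
def mordell (z T : ℂ) : ℂ :=
  ∫ w : ℝ, cexp (Real.pi * I * T * (w : ℂ) ^ 2 + -2 * Real.pi * z * w) / Complex.cosh (Real.pi * w)

lemma re_pi_I_mul (T : ℂ) : (Real.pi * I * T).re = -(Real.pi * T.im) := by
  rw [mul_assoc, re_ofReal_mul]; simp

/-- On |Im w| ≤ |c| < 1/2 the function cosh(πw) is at least cos(π|c|) in absolute value, and the
numerator is Gaussian because Im T > 0. -/
lemma norm_mordell_integrand_le {T : ℂ} (hT : 0 < T.im) (b : ℝ) {c : ℝ} (hc : |c| < 1 / 2) :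
    ∃ K d : ℝ, 0 < d ∧ ∀ z : ℂ, ‖z‖ ≤ b → ∀ x y : ℝ, |y| ≤ |c| →
      Complex.cosh (Real.pi * (x + y * I)) ≠ 0 ∧
      ‖cexp (Real.pi * I * T * ((x : ℂ) + y * I) ^ 2 + -2 * Real.pi * z * (x + y * I)) /
        Complex.cosh (Real.pi * (x + y * I))‖ ≤ K * Real.exp (-d * x ^ 2) := by
  have hα : (Real.pi * I * T).re < 0 := by
    rw [re_pi_I_mul]; have := Real.pi_pos; nlinarith [mul_pos this hT]
  obtain ⟨K, hK0, hK⟩ := norm_cexp_quadratic_le _ hα (2 * Real.pi * b) |c|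
  have hcos : 0 < Real.cos (Real.pi * |c|) := by
    apply Real.cos_pos_of_mem_Ioo
    constructor <;> nlinarith [Real.pi_pos, abs_nonneg c]
  refine ⟨K / Real.cos (Real.pi * |c|), -(Real.pi * I * T).re / 2, by linarith, ?_⟩
  intro z hz x y hy
  have h1 : Real.cos (Real.pi * |c|) ≤ ‖Complex.cosh (Real.pi * (x + y * I))‖ := by
    have h2 := cos_le_norm_cosh (Real.pi * x) (Real.pi * y)
    have h3 : Real.cos (Real.pi * |c|) ≤ Real.cos (Real.pi * y) := by
      rw [← Real.cos_abs (Real.pi * y), abs_mul, abs_of_pos Real.pi_pos]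
      apply Real.cos_le_cos_of_nonneg_of_le_pi
      · have := Real.pi_pos; positivity
      · nlinarith [Real.pi_pos]
      · have := Real.pi_pos; gcongr
    have h4 : (Real.pi : ℂ) * (x + y * I) = ((Real.pi * x : ℝ) : ℂ) + ((Real.pi * y : ℝ) : ℂ) * I := by
      push_cast; ring
    rw [h4]
    exact h3.trans h2
  constructor
  · intro h0
    rw [h0, norm_zero] at h1
    linarith
  · rw [norm_div, div_mul_eq_mul_div]
    have h5 := hK (-2 * Real.pi * z) (by
      rw [norm_mul, norm_mul]
      simp only [norm_neg, norm_ofNat, norm_real, Real.norm_eq_abs, abs_of_pos Real.pi_pos]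
      have := Real.pi_pos
      gcongr) x y hy
    exact div_le_div₀ (by positivity) h5 hcos h1

lemma continuous_mordell_line {T z : ℂ} (hT : 0 < T.im) {c : ℝ} (hc : |c| < 1 / 2) :
    Continuous fun x : ℝ =>
      cexp (Real.pi * I * T * ((x : ℂ) + c * I) ^ 2 + -2 * Real.pi * z * (x + c * I)) /
        Complex.cosh (Real.pi * (x + c * I)) := by
  obtain ⟨K, d, _, h⟩ := norm_mordell_integrand_le hT ‖z‖ hc
  refine Continuous.div (by fun_prop) ?_ fun x => (h z le_rfl x c le_rfl).1
  exact Complex.continuous_cosh.comp (by fun_prop)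

lemma integrable_mordell_line {T z : ℂ} (hT : 0 < T.im) {c : ℝ} (hc : |c| < 1 / 2) :
    Integrable fun x : ℝ =>
      cexp (Real.pi * I * T * ((x : ℂ) + c * I) ^ 2 + -2 * Real.pi * z * (x + c * I)) /
        Complex.cosh (Real.pi * (x + c * I)) := by
  obtain ⟨K, d, hd, h⟩ := norm_mordell_integrand_le hT ‖z‖ hc
  refine (integrable_gauss hd K).mono' (continuous_mordell_line hT hc).aestronglyMeasurable ?_
  exact Eventually.of_forall fun x => (h z le_rfl x c le_rfl).2

lemma integrable_mordell {T z : ℂ} (hT : 0 < T.im) : Integrable fun w : ℝ =>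
    cexp (Real.pi * I * T * (w : ℂ) ^ 2 + -2 * Real.pi * z * w) / Complex.cosh (Real.pi * w) := by
  simpa using integrable_mordell_line (z := z) hT (c := 0) (by simp)

lemma mordell_shift {T z : ℂ} (hT : 0 < T.im) {c : ℝ} (hc : |c| < 1 / 2) :
    mordell z T = ∫ x : ℝ,
      cexp (Real.pi * I * T * ((x : ℂ) + c * I) ^ 2 + -2 * Real.pi * z * (x + c * I)) /
        Complex.cosh (Real.pi * (x + c * I)) := by
  obtain ⟨K, d, hd, h⟩ := norm_mordell_integrand_le hT ‖z‖ hc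
  have hy : ∀ y ∈ Set.uIcc 0 c, |y| ≤ |c| := fun y hy => by
    simpa using Set.abs_sub_left_of_mem_uIcc hy
  refine integral_contour_shift (f := fun w => cexp (Real.pi * I * T * w ^ 2 +
    -2 * Real.pi * z * w) / Complex.cosh (Real.pi * w)) (fun w hw => ?_) (tendsto_gauss hd K)
    (Eventually.of_forall fun x y hyc => (h z le_rfl x y (hy y hyc)).2)
    (integrable_mordell hT) (integrable_mordell_line hT hc)
  have := (h z le_rfl w.re w.im (hy _ hw)).1
  rw [re_add_im] at this
  refine DifferentiableAt.div (by fun_prop) ?_ this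
  fun_prop

lemma differentiable_mordell {T : ℂ} (hT : 0 < T.im) : Differentiable ℂ fun z => mordell z T := by
  intro z₀
  obtain ⟨K, d, hd, h⟩ := norm_mordell_integrand_le hT (‖z₀‖ + 1) (c := 0) (by simp)
  refine differentiableAt_integral one_pos
    (fun z _ => (integrable_mordell hT).aestronglyMeasurable) (Eventually.of_forall fun w z hz => ?_)
    (integrable_gauss hd K) (Eventually.of_forall fun w => ?_)
  · have hz' : ‖z‖ ≤ ‖z₀‖ + 1 := by
      have := norm_sub_norm_le z z₀
      rw [Metric.mem_ball, dist_eq] at hz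
      linarith
    simpa using (h z hz' w 0 (by simp)).2
  · fun_prop

/-- In the sum of the two integrals the numerators combine to 2cosh(πw) times a Gaussian, so the
denominator cancels. -/
lemma mordell_add_one {T : ℂ} (hT : 0 < T.im) (z : ℂ) :
    mordell (z + 1) T = -mordell z T +
      2 / (-I * T) ^ (1 / 2 : ℂ) * cexp (Real.pi * I * (z + 1 / 2) ^ 2 / T) := by
  have hT0 : T ≠ 0 := fun h => by simp [h] at hT
  have hre : (Real.pi * I * T).re < 0 := by
    rw [re_pi_I_mul]; have := Real.pi_pos; nlinarith [mul_pos this hT]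
  have h1 : mordell (z + 1) T + mordell z T =
      ∫ w : ℝ, 2 * cexp (Real.pi * I * T * (w : ℂ) ^ 2 + (-2 * Real.pi * (z + 1 / 2)) * w + 0) := by
    rw [mordell, mordell, ← integral_add (integrable_mordell hT) (integrable_mordell hT)]
    refine integral_congr_ae (Eventually.of_forall fun w => ?_)
    have hc : Complex.cosh (Real.pi * w) ≠ 0 := by
      rw [← ofReal_mul, ← ofReal_cosh]
      exact_mod_cast (Real.cosh_pos _).ne'
    simp only
    rw [← add_div, div_eq_iff hc, Complex.cosh]
    have e1 : cexp (Real.pi * I * T * (w : ℂ) ^ 2 + -2 * Real.pi * (z + 1) * w) =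
        cexp (Real.pi * I * T * (w : ℂ) ^ 2 + (-2 * Real.pi * (z + 1 / 2)) * w + 0) *
          cexp (-(Real.pi * w)) := by
      rw [← Complex.exp_add]; congr 1; ring
    have e2 : cexp (Real.pi * I * T * (w : ℂ) ^ 2 + -2 * Real.pi * z * w) =
        cexp (Real.pi * I * T * (w : ℂ) ^ 2 + (-2 * Real.pi * (z + 1 / 2)) * w + 0) *
          cexp (Real.pi * w) := by
      rw [← Complex.exp_add]; congr 1; ring
    rw [e1, e2]
    ring
  rw [integral_const_mul, integral_cexp_quadratic hre] at h1
  have hpi : (Real.pi : ℂ) ≠ 0 := by exact_mod_cast Real.pi_ne_zero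
  have e3 : (Real.pi : ℂ) / -(Real.pi * I * T) = (-I * T)⁻¹ := by
    field_simp
  have e4 : 0 - (-2 * Real.pi * (z + 1 / 2)) ^ 2 / (4 * (Real.pi * I * T)) =
      Real.pi * I * (z + 1 / 2) ^ 2 / T := by
    field_simp
    linear_combination (-(16 : ℂ) * Real.pi * (z + 1 / 2) ^ 2) * I_sq
  have e5 : ((-I * T)⁻¹) ^ (1 / 2 : ℂ) = ((-I * T) ^ (1 / 2 : ℂ))⁻¹ := by
    rw [inv_cpow]
    intro h
    have h6 := (Complex.arg_eq_pi_iff.1 h).1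
    simp at h6
    linarith
  rw [e3, e4, e5] at h1
  rw [div_eq_mul_inv]
  linear_combination h1

lemma one_add_sq_le_cosh_pi (w : ℝ) : 1 + w ^ 2 ≤ Real.cosh (Real.pi * w) := by
  have h1 : Real.cosh (Real.pi * w) = 1 + 2 * Real.sinh (Real.pi * w / 2) ^ 2 := by
    have := Real.cosh_two_mul (Real.pi * w / 2)
    rw [show 2 * (Real.pi * w / 2) = Real.pi * w by ring] at this
    rw [this, Real.cosh_sq]
    ring
  have h2 : |w| ≤ |Real.sinh (Real.pi * w / 2)| := by
    rw [Real.abs_sinh]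
    have h3 : |w| ≤ |Real.pi * w / 2| := by
      rw [abs_div, abs_mul, abs_of_pos Real.pi_pos, abs_two]
      nlinarith [Real.pi_gt_three, abs_nonneg w]
    exact h3.trans (Real.self_le_sinh_iff.2 (abs_nonneg _))
  have h3 := sq_le_sq.2 h2
  rw [h1]
  nlinarith [sq_nonneg (Real.sinh (Real.pi * w / 2))]

lemma integrable_inv_cosh : Integrable fun w : ℝ => (Real.cosh (Real.pi * w))⁻¹ := by
  refine integrable_inv_one_add_sq.mono' ?_ (Eventually.of_forall fun w => ?_)
  · refine Continuous.aestronglyMeasurable ?_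
    exact (Real.continuous_cosh.comp (by fun_prop)).inv₀ fun w => (Real.cosh_pos _).ne'
  · rw [Real.norm_eq_abs, abs_of_pos (inv_pos.2 (Real.cosh_pos _))]
    exact inv_anti₀ (by positivity) (one_add_sq_le_cosh_pi w)

/-- An antiderivative is (2/π) arctan e^{πw}. -/
lemma integral_inv_cosh : ∫ w : ℝ, (Real.cosh (Real.pi * w))⁻¹ = 1 := by
  have hpi := Real.pi_pos
  have hd : ∀ w : ℝ, HasDerivAt (fun w => 2 / Real.pi * Real.arctan (Real.exp (Real.pi * w)))
      (Real.cosh (Real.pi * w))⁻¹ w := by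
    intro w
    have h1 : HasDerivAt (fun w : ℝ => Real.pi * w) (Real.pi * 1) w :=
      (hasDerivAt_id' w).const_mul _
    have h2 := (h1.exp.arctan).const_mul (2 / Real.pi)
    refine h2.congr_deriv ?_
    rw [Real.cosh_eq, Real.exp_neg]
    have := Real.exp_pos (Real.pi * w)
    field_simp
    ring
  have hbot : Tendsto (fun w => 2 / Real.pi * Real.arctan (Real.exp (Real.pi * w))) atBot
      (𝓝 (2 / Real.pi * Real.arctan 0)) := by
    refine ((Real.continuous_arctan.tendsto 0).comp ?_).const_mul _
    exact Real.tendsto_exp_atBot.comp (tendsto_id.const_mul_atBot hpi)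
  have htop : Tendsto (fun w => 2 / Real.pi * Real.arctan (Real.exp (Real.pi * w))) atTop
      (𝓝 (2 / Real.pi * (Real.pi / 2))) := by
    refine Tendsto.const_mul _ ?_
    refine (Real.tendsto_arctan_atTop.mono_right nhdsWithin_le_nhds).comp ?_
    exact Real.tendsto_exp_atTop.comp (tendsto_id.const_mul_atTop hpi)
  rw [integral_of_hasDerivAt_of_tendsto hd integrable_inv_cosh hbot htop, Real.arctan_zero]
  field_simp
  ring

lemma cosh_pi_eq_zero {w : ℂ} (h : Complex.cosh (Real.pi * w) = 0) (hw : w.im ∈ Set.Icc (0 : ℝ) 1) :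
    w = I / 2 := by
  rw [← Complex.cos_mul_I, Complex.cos_eq_zero_iff] at h
  obtain ⟨k, hk⟩ := h
  have hpi : (Real.pi : ℂ) ≠ 0 := by exact_mod_cast Real.pi_ne_zero
  have h1 : w * I = (2 * k + 1) / 2 := by
    apply mul_left_cancel₀ hpi
    linear_combination hk
  have h2 : w = -((2 * k + 1) / 2) * I := by
    linear_combination (-I) * h1 + w * I_sq
  have h3 : w.im = -((2 * k + 1) / 2) := by
    have : w = ((-((2 * k + 1) / 2) : ℝ) : ℂ) * I := by rw [h2]; push_cast; ring
    rw [this]; simp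
  rw [h3, Set.mem_Icc] at hw
  have h4 : (k : ℝ) < 0 := by linarith [hw.1]
  have h5 : (-2 : ℝ) < k := by linarith [hw.2]
  have h6 : k = -1 := by
    have h7 : k < 0 := by exact_mod_cast h4
    have h8 : -2 < k := by exact_mod_cast h5
    omega
  rw [h2, h6]
  push_cast
  ring

/-- Shifting the contour by i replaces z by z + T but crosses the pole i/2 of 1/cosh(πw).
Subtracting the value of the numerator at i/2 removes the pole, so Cauchy's theorem applies without
residues; `integral_inv_cosh` accounts for the subtracted constant on both lines. -/
lemma mordell_add_tau {T : ℂ} (hT : 0 < T.im) (z : ℂ) :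
    mordell (z + T) T = -cexp (2 * Real.pi * I * z + Real.pi * I * T) * mordell z T +
      2 * cexp (Real.pi * I * z + 3 * Real.pi * I * T / 4) := by
  have hpi : (Real.pi : ℂ) ≠ 0 := by exact_mod_cast Real.pi_ne_zero
  set G : ℂ → ℂ := fun w => cexp (Real.pi * I * T * w ^ 2 + -2 * Real.pi * z * w) with hG
  set K : ℂ → ℂ := fun w => Complex.cosh (Real.pi * w) with hK
  set a : ℂ := I / 2 with ha
  have haim : a.im = 1 / 2 := by simp [ha]
  -- This is (G - G(a))/K with the common factor w - a cancelled, hence also defined at a.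
  set f : ℂ → ℂ := fun w => dslope G a w / dslope K a w with hf
  have hGd : Differentiable ℂ G := by simp only [hG]; fun_prop
  have hKd : Differentiable ℂ K := by simp only [hK]; fun_prop
  have hds : ∀ g : ℂ → ℂ, Differentiable ℂ g → Differentiable ℂ (dslope g a) := fun g hg =>
    differentiableOn_univ.1 ((Complex.differentiableOn_dslope univ_mem).2 hg.differentiableOn)
  have hKa : K a = 0 := by
    simp only [hK, ha]
    rw [show Real.pi * (I / 2) = (Real.pi / 2 : ℂ) * I by ring, Complex.cosh_mul_I,
      Complex.cos_pi_div_two]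
  have hK' : HasDerivAt K (Real.pi * I) a := by
    have h1 : HasDerivAt (fun w : ℂ => Real.pi * w) (Real.pi * 1) a :=
      (hasDerivAt_id' a).const_mul _
    have h2 := h1.ccosh
    convert h2 using 1
    rw [ha, show Real.pi * (I / 2) = (Real.pi / 2 : ℂ) * I by ring, Complex.sinh_mul_I,
      Complex.sin_pi_div_two]
    ring
  have hfne : ∀ w, w ≠ a → f w = (G w - G a) / K w := fun w hw => by
    have := sub_ne_zero.2 hw
    simp only [hf, dslope_of_ne _ hw, slope_def_field, hKa, sub_zero]
    rw [div_div_div_cancel_right₀ this]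
  have hfd : ∀ w : ℂ, w.im ∈ Set.uIcc (0 : ℝ) 1 → DifferentiableAt ℂ f w := fun w hw => by
    rw [Set.uIcc_of_le zero_le_one] at hw
    refine (hds G hGd w).div (hds K hKd w) ?_
    by_cases hwa : w = a
    · rw [hwa, dslope_same, hK'.deriv]
      exact mul_ne_zero hpi I_ne_zero
    · rw [dslope_of_ne _ hwa, slope_def_field, hKa, sub_zero]
      exact div_ne_zero (fun h => hwa (cosh_pi_eq_zero h hw)) (sub_ne_zero.2 hwa)
  have hline0 : ∀ x : ℝ, f x = G x / K x - G a * ((Real.cosh (Real.pi * x))⁻¹ : ℝ) := fun x => by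
    rw [hfne x (fun h => by rw [← h] at haim; simp at haim), sub_div]
    simp only [hK]
    push_cast
    rw [div_eq_mul_inv (G a)]
  have hGshift : ∀ x : ℝ, G (x + (1 : ℝ) * I) =
      cexp (-(2 * Real.pi * I * z + Real.pi * I * T)) *
        cexp (Real.pi * I * T * (x : ℂ) ^ 2 + -2 * Real.pi * (z + T) * x) := fun x => by
    simp only [hG]
    rw [← Complex.exp_add]
    congr 1
    push_cast
    linear_combination (Real.pi * I * T + 2 * Real.pi * T * x) * I_sq
  have hKshift : ∀ x : ℝ, K (x + (1 : ℝ) * I) = -K x := fun x => by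
    simp only [hK]
    rw [← Complex.cosh_add_pi_mul_I]
    congr 1
    push_cast
    ring
  have hline1 : ∀ x : ℝ, f (x + (1 : ℝ) * I) =
      G a * ((Real.cosh (Real.pi * x))⁻¹ : ℝ) -
        cexp (-(2 * Real.pi * I * z + Real.pi * I * T)) *
        (cexp (Real.pi * I * T * (x : ℂ) ^ 2 + -2 * Real.pi * (z + T) * x) /
          Complex.cosh (Real.pi * x)) := fun x => by
    rw [hfne _ (fun h => by rw [← h] at haim; simp at haim), sub_div, hGshift, hKshift]
    simp only [hK]
    push_cast
    rw [div_eq_mul_inv, div_eq_mul_inv, div_eq_mul_inv, inv_neg]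
    ring
  have hα : (Real.pi * I * T).re < 0 := by
    rw [re_pi_I_mul]; have := Real.pi_pos; nlinarith [mul_pos this hT]
  obtain ⟨M, hM0, hM⟩ := norm_cexp_quadratic_le _ hα ‖-2 * Real.pi * z‖ 1
  have ic : Integrable fun x : ℝ => G a * ((Real.cosh (Real.pi * x))⁻¹ : ℝ) :=
    integrable_inv_cosh.ofReal.const_mul _
  have icv : ∫ x : ℝ, G a * ((Real.cosh (Real.pi * x))⁻¹ : ℝ) = G a := by
    rw [integral_const_mul, integral_complex_ofReal, integral_inv_cosh]; simp
  have i0 : Integrable fun x : ℝ => f x := by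
    simp_rw [hline0]
    exact (integrable_mordell hT).sub ic
  have i1 : Integrable fun x : ℝ => f (x + (1 : ℝ) * I) := by
    simp_rw [hline1]
    exact ic.sub ((integrable_mordell hT).const_mul _)
  -- The subtracted constant spoils the Gaussian decay on the vertical sides. The weaker bound |cosh
  -- w| ≥ |Re w| still makes them tend to 0.
  have hB : Tendsto (fun x : ℝ => (M + ‖G a‖) * |x|⁻¹) (cocompact ℝ) (𝓝 0) := by
    have h1 : Tendsto (fun x : ℝ => |x|⁻¹) (cocompact ℝ) (𝓝 0) :=
      (tendsto_norm_cocompact_atTop (E := ℝ)).inv_tendsto_atTop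
    simpa using h1.const_mul (M + ‖G a‖)
  have hbd : ∀ᶠ x : ℝ in cocompact ℝ, ∀ y ∈ Set.uIcc (0 : ℝ) 1,
      ‖f (x + y * I)‖ ≤ (M + ‖G a‖) * |x|⁻¹ := by
    have h1 : ∀ᶠ x : ℝ in cocompact ℝ, 1 ≤ ‖x‖ :=
      (tendsto_norm_cocompact_atTop (E := ℝ)).eventually_ge_atTop 1
    filter_upwards [h1] with x hx y hy
    rw [Real.norm_eq_abs] at hx
    rw [Set.uIcc_of_le zero_le_one] at hy
    have hne : (x : ℂ) + y * I ≠ a := fun h => by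
      have h2 := congrArg Complex.re h
      simp [ha] at h2
      rw [h2] at hx
      simp at hx
      linarith
    rw [hfne _ hne, norm_div, ← div_eq_mul_inv]
    have h3 : |x| ≤ ‖K (x + y * I)‖ := by
      have h4 := abs_re_le_norm_cosh (Real.pi * (x + y * I))
      have h5 : (Real.pi * ((x : ℂ) + y * I)).re = Real.pi * x := by simp
      rw [h5, abs_mul, abs_of_pos Real.pi_pos] at h4
      refine le_trans ?_ h4
      nlinarith [Real.pi_gt_three]
    refine div_le_div₀ (by positivity) ?_ (by linarith) h3
    refine (norm_sub_le _ _).trans (add_le_add ?_ le_rfl)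
    refine (hM _ le_rfl x y (abs_le.2 ⟨by linarith [hy.1], hy.2⟩)).trans ?_
    refine mul_le_of_le_one_right hM0 (Real.exp_le_one_iff.2 ?_)
    nlinarith [sq_nonneg x]
  have key := integral_contour_shift hfd hB hbd i0 i1
  simp_rw [hline0, hline1] at key
  rw [integral_sub (integrable_mordell hT) ic,
    integral_sub ic ((integrable_mordell hT).const_mul _), icv, integral_const_mul] at key
  change mordell z T - G a = G a - _ * mordell (z + T) T at key
  have e1 : cexp (2 * Real.pi * I * z + Real.pi * I * T) *
      cexp (-(2 * Real.pi * I * z + Real.pi * I * T)) = 1 := by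
    rw [← Complex.exp_add, add_neg_cancel, Complex.exp_zero]
  have e2 : cexp (2 * Real.pi * I * z + Real.pi * I * T) * G a =
      cexp (Real.pi * I * z + 3 * Real.pi * I * T / 4) := by
    simp only [hG, ha]
    rw [← Complex.exp_add]
    congr 1
    linear_combination (Real.pi * I * T / 4) * I_sq
  rw [← e2]
  linear_combination (-mordell (z + T) T) * e1 +
    cexp (2 * Real.pi * I * z + Real.pi * I * T) * key

/-! ### An inverse Gaussian integral -/

/-- The error function, normalized by `∫ e^{-π y²} dy = 1`. -/
def gaussInt (x : ℝ) : ℝ := ∫ y in (0 : ℝ)..x, Real.exp (-Real.pi * y ^ 2)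

lemma hasDerivAt_gaussInt (x : ℝ) : HasDerivAt gaussInt (Real.exp (-Real.pi * x ^ 2)) x := by
  have hc : Continuous fun y : ℝ => Real.exp (-Real.pi * y ^ 2) := by fun_prop
  exact intervalIntegral.integral_hasDerivAt_right (hc.intervalIntegrable _ _)
    hc.stronglyMeasurable.stronglyMeasurableAtFilter hc.continuousAt

lemma tendsto_gaussInt_atTop : Tendsto gaussInt atTop (𝓝 (1 / 2)) := by
  have h := intervalIntegral_tendsto_integral_Ioi (μ := volume) (b := fun x : ℝ => x) 0
    (integrable_exp_neg_mul_sq Real.pi_pos).integrableOn tendsto_id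
  rwa [integral_gaussian_Ioi, div_self Real.pi_ne_zero, Real.sqrt_one] at h

lemma gaussInt_neg (x : ℝ) : gaussInt (-x) = -gaussInt x := by
  have h := intervalIntegral.integral_comp_neg (a := 0) (b := x)
    (fun y => Real.exp (-Real.pi * y ^ 2))
  simp only [neg_sq, neg_zero] at h
  rw [gaussInt, gaussInt, intervalIntegral.integral_symm, ← h]

lemma tendsto_gaussInt_atBot : Tendsto gaussInt atBot (𝓝 (-(1 / 2))) := by
  have h := (tendsto_gaussInt_atTop.comp tendsto_neg_atBot_atTop).neg
  refine h.congr fun x => ?_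
  simp [gaussInt_neg]

/-- There is an explicit antiderivative. Multiplied by e^{∓2πab}, the Gaussians in a/√t ∓ b√t become
the same exponential, and in the sum of the derivatives the b-terms cancel while the a-terms add. -/
lemma inverse_gaussian {a b : ℝ} (ha : 0 < a) (hb : 0 < b) :
    IntegrableOn (fun t => a * (√t * t)⁻¹ * Real.exp (-Real.pi * (a ^ 2 / t + b ^ 2 * t)))
      (Set.Ioi 0) ∧
    ∫ t in Set.Ioi (0 : ℝ), a * (√t * t)⁻¹ * Real.exp (-Real.pi * (a ^ 2 / t + b ^ 2 * t)) =
      Real.exp (-2 * Real.pi * (a * b)) := by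
  set P : ℝ → ℝ := fun t => -(Real.exp (-2 * Real.pi * (a * b)) * gaussInt (a / √t - b * √t) +
    Real.exp (2 * Real.pi * (a * b)) * gaussInt (a / √t + b * √t)) with hP
  set L : ℝ := -(Real.exp (-2 * Real.pi * (a * b)) * (1 / 2) +
    Real.exp (2 * Real.pi * (a * b)) * (1 / 2)) with hL
  -- The value L is the limit of P at 0⁺, so g is right-continuous at 0 and the fundamental theorem
  -- applies on the half-line.
  set g : ℝ → ℝ := fun t => if t ≤ 0 then L else P t with hg
  have hsq0 : Tendsto (fun t : ℝ => √t) (𝓝[>] 0) (𝓝[>] 0) := by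
    refine tendsto_nhdsWithin_iff.2 ⟨?_, ?_⟩
    · have := Real.continuous_sqrt.tendsto 0
      rw [Real.sqrt_zero] at this
      exact this.mono_left nhdsWithin_le_nhds
    · filter_upwards [self_mem_nhdsWithin] with t ht using Real.sqrt_pos.2 ht
  have hsqtop : Tendsto (fun t : ℝ => √t) atTop atTop := Real.tendsto_sqrt_atTop
  have hbs0 : Tendsto (fun t : ℝ => b * √t) (𝓝[>] 0) (𝓝 0) := by
    simpa using (hsq0.mono_right nhdsWithin_le_nhds).const_mul b
  have has0 : Tendsto (fun t : ℝ => a / √t) (𝓝[>] 0) atTop := by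
    simp_rw [div_eq_mul_inv]
    exact (tendsto_inv_nhdsGT_zero.comp hsq0).const_mul_atTop ha
  have hastop : Tendsto (fun t : ℝ => a / √t) atTop (𝓝 0) := hsqtop.const_div_atTop a
  have hbstop : Tendsto (fun t : ℝ => b * √t) atTop atTop := hsqtop.const_mul_atTop hb
  have hP0 : Tendsto P (𝓝[>] 0) (𝓝 L) := by
    refine ((Tendsto.const_mul _ (tendsto_gaussInt_atTop.comp ?_)).add
      (Tendsto.const_mul _ (tendsto_gaussInt_atTop.comp ?_))).neg
    · simp_rw [sub_eq_add_neg]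
      exact has0.atTop_add hbs0.neg
    · exact has0.atTop_add hbs0
  have hPtop : Tendsto P atTop (𝓝 (-(Real.exp (-2 * Real.pi * (a * b)) * (-(1 / 2)) +
      Real.exp (2 * Real.pi * (a * b)) * (1 / 2)))) := by
    refine ((Tendsto.const_mul _ (tendsto_gaussInt_atBot.comp ?_)).add
      (Tendsto.const_mul _ (tendsto_gaussInt_atTop.comp ?_))).neg
    · simp_rw [sub_eq_add_neg]
      exact hastop.add_atBot (tendsto_neg_atTop_atBot.comp hbstop)
    · exact hastop.add_atTop hbstop
  have hgtop : Tendsto g atTop (𝓝 (-(Real.exp (-2 * Real.pi * (a * b)) * (-(1 / 2)) +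
      Real.exp (2 * Real.pi * (a * b)) * (1 / 2)))) := by
    refine hPtop.congr' ?_
    filter_upwards [eventually_gt_atTop 0] with t ht
    simp only [hg, if_neg (not_le.2 ht)]
  have hg0 : g 0 = L := by simp [hg]
  have hcont : ContinuousWithinAt g (Set.Ici 0) 0 := by
    rw [← continuousWithinAt_Ioi_iff_Ici]
    change Tendsto g (𝓝[>] 0) (𝓝 (g 0))
    rw [hg0]
    refine hP0.congr' ?_
    filter_upwards [self_mem_nhdsWithin] with t ht
    simp only [hg, if_neg (not_le.2 (Set.mem_Ioi.1 ht))]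
  have hderiv : ∀ t ∈ Set.Ioi (0 : ℝ), HasDerivAt g
      (a * (√t * t)⁻¹ * Real.exp (-Real.pi * (a ^ 2 / t + b ^ 2 * t))) t := by
    intro t ht
    have ht0 : 0 < t := ht
    have hs : 0 < √t := Real.sqrt_pos.2 ht0
    have hst : √t ^ 2 = t := Real.sq_sqrt ht0.le
    have h1 : HasDerivAt (fun t : ℝ => √t) (1 / (2 * √t)) t := Real.hasDerivAt_sqrt ht0.ne'
    have h2 : HasDerivAt (fun t : ℝ => a / √t) (-(a * (1 / (2 * √t))) / √t ^ 2) t := by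
      exact ((hasDerivAt_const t a).div h1 hs.ne').congr_deriv (by simp)
    have h3 := h1.const_mul b
    have hu := ((hasDerivAt_gaussInt _).comp t (h2.sub h3)).const_mul
      (Real.exp (-2 * Real.pi * (a * b)))
    have hv := ((hasDerivAt_gaussInt _).comp t (h2.add h3)).const_mul
      (Real.exp (2 * Real.pi * (a * b)))
    have hPd := (hu.add hv).neg
    have hPg : g =ᶠ[𝓝 t] P := by
      filter_upwards [lt_mem_nhds ht0] with y hy
      simp only [hg, if_neg (not_le.2 hy)]
    refine HasDerivAt.congr_of_eventuallyEq (HasDerivAt.congr_deriv hPd ?_) hPg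
    have e1 : Real.exp (-2 * Real.pi * (a * b)) *
        Real.exp (-Real.pi * (a / √t - b * √t) ^ 2) =
        Real.exp (-Real.pi * (a ^ 2 / t + b ^ 2 * t)) := by
      rw [← Real.exp_add]; congr 1; rw [← hst, Real.sqrt_sq hs.le]; field_simp; ring
    have e2 : Real.exp (2 * Real.pi * (a * b)) *
        Real.exp (-Real.pi * (a / √t + b * √t) ^ 2) =
        Real.exp (-Real.pi * (a ^ 2 / t + b ^ 2 * t)) := by
      rw [← Real.exp_add]; congr 1; rw [← hst, Real.sqrt_sq hs.le]; field_simp; ring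
    have e3 : a * (√t * t)⁻¹ = a * (1 / (2 * √t)) / √t ^ 2 * 2 := by
      rw [hst]; field_simp
    simp only [Pi.sub_apply, Pi.add_apply]
    linear_combination (-(-(a * (1 / (2 * √t))) / √t ^ 2 - b * (1 / (2 * √t)))) * e1 -
      (-(a * (1 / (2 * √t))) / √t ^ 2 + b * (1 / (2 * √t))) * e2 -
      Real.exp (-Real.pi * (a ^ 2 / t + b ^ 2 * t)) * e3
  have hpos : ∀ t ∈ Set.Ioi (0 : ℝ),
      0 ≤ a * (√t * t)⁻¹ * Real.exp (-Real.pi * (a ^ 2 / t + b ^ 2 * t)) := fun t ht => by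
    have : 0 < t := ht
    positivity
  refine ⟨integrableOn_Ioi_deriv_of_nonneg hcont hderiv hpos hgtop, ?_⟩
  rw [integral_Ioi_of_hasDerivAt_of_nonneg hcont hderiv hpos hgtop, hg0, hL]
  ring

/-! ### Unary theta functions on a vertical line -/

/-- `∑ (n + s) e^{2 π i n β} e^{-π (n + s)² t}`. -/
def lineTheta (s β t : ℝ) : ℂ :=
  ∑' n : ℤ, ((n : ℂ) + s) * cexp (2 * Real.pi * I * n * β) *
    cexp (-Real.pi * ((n : ℂ) + s) ^ 2 * t)

lemma hasSum_linear_theta (s : ℝ) (z : ℂ) {τ : ℂ} (hτ : 0 < τ.im) :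
    HasSum (fun n : ℤ => ((n : ℂ) + s) * jacobiTheta₂_term n z τ)
      (jacobiTheta₂' z τ / (2 * Real.pi * I) + s * jacobiTheta₂ z τ) := by
  have h1 := (hasSum_jacobiTheta₂'_term z hτ).div_const (2 * Real.pi * I)
  have h2 := (hasSum_jacobiTheta₂_term z hτ).mul_left (s : ℂ)
  refine (h1.add h2).congr_fun ?_
  intro n
  rw [jacobiTheta₂'_term]
  have : (2 * Real.pi * I : ℂ) ≠ 0 := two_pi_I_ne_zero
  field_simp

lemma hasSum_lineTheta (s β : ℝ) {t : ℝ} (ht : 0 < t) :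
    HasSum (fun n : ℤ => ((n : ℂ) + s) * cexp (2 * Real.pi * I * n * β) *
      cexp (-Real.pi * ((n : ℂ) + s) ^ 2 * t))
      (cexp (-Real.pi * s ^ 2 * t) *
        (jacobiTheta₂' (β + I * s * t) (I * t) / (2 * Real.pi * I) +
          s * jacobiTheta₂ (β + I * s * t) (I * t))) := by
  have hτ : 0 < (I * (t : ℂ)).im := by simpa using ht
  refine ((hasSum_linear_theta s (β + I * s * t) hτ).mul_left _).congr_fun ?_
  intro n
  have e1 : cexp (2 * Real.pi * I * n * β) * cexp (-Real.pi * ((n : ℂ) + s) ^ 2 * t) =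
      cexp (-Real.pi * s ^ 2 * t) * jacobiTheta₂_term n (β + I * s * t) (I * t) := by
    rw [jacobiTheta₂_term, ← Complex.exp_add, ← Complex.exp_add]
    congr 1
    linear_combination (-2 * Real.pi * n * s * t - Real.pi * n ^ 2 * t) * I_sq
  linear_combination (n + s : ℂ) * e1

lemma continuousOn_lineTheta (s β : ℝ) : ContinuousOn (lineTheta s β) (Set.Ioi 0) := by
  have : ContinuousOn (fun t : ℝ => cexp (-Real.pi * s ^ 2 * t) *
        (jacobiTheta₂' (β + I * s * t) (I * t) / (2 * Real.pi * I) +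
          s * jacobiTheta₂ (β + I * s * t) (I * t))) (Set.Ioi 0) := by
    intro t ht
    have hτ : 0 < (I * (t : ℂ)).im := by simpa using ht
    have hc : ContinuousAt (fun t : ℝ => ((β + I * s * t : ℂ), I * (t : ℂ))) t := by fun_prop
    have h1 := ContinuousAt.comp (f := fun t : ℝ => ((β + I * s * t : ℂ), I * (t : ℂ)))
      (continuousAt_jacobiTheta₂ (β + I * s * t) hτ) hc
    have h2 := ContinuousAt.comp (f := fun t : ℝ => ((β + I * s * t : ℂ), I * (t : ℂ)))
      (continuousAt_jacobiTheta₂' (β + I * s * t) hτ) hc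
    refine ContinuousAt.continuousWithinAt ?_
    exact ContinuousAt.mul (by fun_prop) ((h2.div_const _).add (h1.const_mul _))
  refine this.congr fun t ht => ?_
  rw [lineTheta, (hasSum_lineTheta s β ht).tsum_eq]

/-- Jacobi inversion of theta and of its derivative in z, regrouped as a series in n - β. It
controls t → 0 and allows term-by-term Laplace transforms. -/
lemma hasSum_lineTheta_dual (s β : ℝ) {t : ℝ} (ht : 0 < t) :
    HasSum (fun n : ℤ => -I * cexp (-2 * Real.pi * I * β * s) *
      (((n : ℂ) - β) * cexp (2 * Real.pi * I * n * s) * (((√t * t)⁻¹ : ℝ) : ℂ) *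
        cexp (-Real.pi * ((n : ℂ) - β) ^ 2 / t))) (lineTheta s β t) := by
  have ht0 : (t : ℂ) ≠ 0 := by exact_mod_cast ht.ne'
  have hτ : 0 < (I / (t : ℂ)).im := by
    rw [div_ofReal_im]; simpa using ht
  have h := ((hasSum_linear_theta (-β) (s - I * β / t) hτ).mul_left
    (-I * cexp (-2 * Real.pi * I * β * s) * (((√t * t)⁻¹ : ℝ) : ℂ) * cexp (-Real.pi * β ^ 2 / t)))
  rw [lineTheta, (hasSum_lineTheta s β ht).tsum_eq]
  refine (congrArg (fun v => HasSum _ v) ?_).mpr (h.congr_fun ?_)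
  · have hsq : (-I * (I * (t : ℂ))) ^ (1 / 2 : ℂ) = ((√t : ℝ) : ℂ) := by
      rw [show -I * (I * (t : ℂ)) = t by linear_combination (-(t : ℂ)) * I_sq]
      rw [Real.sqrt_eq_rpow, ofReal_cpow ht.le]
      norm_num
    have e1 : (β + I * s * t) / (I * t) = s - I * β / t := by
      have h5 : I * β / t * (I * t) = I ^ 2 * β := by field_simp
      rw [div_eq_iff (mul_ne_zero I_ne_zero ht0)]
      linear_combination h5 + (β : ℂ) * I_sq
    have e2 : -1 / (I * (t : ℂ)) = I / t := by
      field_simp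
      linear_combination -I_sq
    rw [jacobiTheta₂_functional_equation, jacobiTheta₂'_functional_equation, hsq, e1, e2]
    generalize jacobiTheta₂' (s - I * β / t) (I / t) = X
    generalize jacobiTheta₂ (s - I * β / t) (I / t) = Y
    have e3 : cexp (-Real.pi * s ^ 2 * t) * cexp (-Real.pi * I * (β + I * s * t) ^ 2 / (I * t)) =
        cexp (-2 * Real.pi * I * β * s) * cexp (-Real.pi * β ^ 2 / t) := by
      rw [← Complex.exp_add, ← Complex.exp_add]
      congr 1
      field_simp
      linear_combination (-(s : ℂ) ^ 2 * t ^ 2) * I_sq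
    have hs0 : ((√t : ℝ) : ℂ) ≠ 0 := by
      exact_mod_cast (Real.sqrt_pos.2 ht).ne'
    have hpi : (Real.pi : ℂ) ≠ 0 := by exact_mod_cast Real.pi_ne_zero
    push_cast
    generalize cexp (-Real.pi * I * (β + I * s * t) ^ 2 / (I * t)) = E1 at *
    generalize cexp (-Real.pi * s ^ 2 * t) = E0 at *
    generalize cexp (-2 * Real.pi * I * β * s) = E2 at *
    generalize cexp (-Real.pi * β ^ 2 / t) = E3 at *
    have e4 : E0 * (1 / (√t : ℝ) * E1 / (I * t) * (X - 2 * Real.pi * I * (β + I * s * t) * Y) /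
        (2 * Real.pi * I) + s * (1 / (√t : ℝ) * E1 * Y)) =
        (E0 * E1) * (-I * ((√t : ℝ) * t : ℂ)⁻¹ * (X / (2 * Real.pi * I) + -β * Y)) := by
      field_simp
      ring_nf
      simp only [I_sq, I_pow_three]
      ring
    rw [e4, e3]
    ring
  · intro n
    rw [jacobiTheta₂_term]
    have e5 : cexp (-Real.pi * β ^ 2 / t) * cexp (2 * Real.pi * I * n * (s - I * β / t) +
        Real.pi * I * n ^ 2 * (I / t)) =
        cexp (2 * Real.pi * I * n * s) * cexp (-Real.pi * ((n : ℂ) - β) ^ 2 / t) := by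
      rw [← Complex.exp_add, ← Complex.exp_add]
      congr 1
      field_simp
      linear_combination ((n : ℂ) ^ 2 - 2 * n * β) * I_sq
    push_cast
    linear_combination (I * cexp (-2 * Real.pi * I * β * s) * ((√t : ℝ) * t : ℂ)⁻¹ *
      (n - β)) * e5

lemma min_le_abs_int_add (s : ℝ) (n : ℤ) :
    min s (1 - s) ≤ |(n : ℝ) + s| := by
  rcases le_or_gt 0 n with hn | hn
  · have : (0 : ℝ) ≤ n := by exact_mod_cast hn
    refine (min_le_left _ _).trans (le_trans ?_ (le_abs_self _))
    linarith
  · have : (n : ℝ) ≤ -1 := by exact_mod_cast (by omega : n ≤ -1)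
    refine (min_le_right _ _).trans (le_trans ?_ (neg_le_abs _))
    linarith

lemma norm_lineTheta_term (s β t : ℝ) (n : ℤ) :
    ‖((n : ℂ) + s) * cexp (2 * Real.pi * I * n * β) * cexp (-Real.pi * ((n : ℂ) + s) ^ 2 * t)‖ =
      |(n : ℝ) + s| * Real.exp (-Real.pi * ((n : ℝ) + s) ^ 2 * t) := by
  have h1 : ((n : ℂ) + s) = (((n : ℝ) + s : ℝ) : ℂ) := by push_cast; rfl
  have h2 : 2 * Real.pi * I * n * β = ((2 * Real.pi * n * β : ℝ) : ℂ) * I := by push_cast; ring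
  have h3 : -Real.pi * ((n : ℂ) + s) ^ 2 * t =
      ((-Real.pi * ((n : ℝ) + s) ^ 2 * t : ℝ) : ℂ) := by push_cast; rfl
  rw [norm_mul, norm_mul, h2, norm_exp_ofReal_mul_I, mul_one, h3, ← ofReal_exp, norm_real,
    Real.norm_eq_abs, Real.abs_exp, h1, norm_real, Real.norm_eq_abs]

lemma summable_lineTheta_norm (s : ℝ) {t : ℝ} (ht : 0 < t) :
    Summable fun n : ℤ => |(n : ℝ) + s| * Real.exp (-Real.pi * ((n : ℝ) + s) ^ 2 * t) :=
  (hasSum_lineTheta s 0 ht).summable.norm.congr fun n => norm_lineTheta_term s 0 t n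

lemma norm_lineTheta_le_of_one_le {s : ℝ} (h0 : 0 < s) (h1 : s < 1) (β : ℝ) {t : ℝ} (ht : 1 ≤ t) :
    ‖lineTheta s β t‖ ≤ (∑' n : ℤ, |(n : ℝ) + s| * Real.exp (-Real.pi * ((n : ℝ) + s) ^ 2 * 1)) *
      Real.exp (-Real.pi * min s (1 - s) ^ 2 * (t - 1)) := by
  have ht0 : 0 < t := by linarith
  refine tsum_of_norm_bounded ((summable_lineTheta_norm s one_pos).hasSum.mul_right _) fun n => ?_
  rw [norm_lineTheta_term, mul_assoc |(n : ℝ) + s|, ← Real.exp_add]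
  refine mul_le_mul_of_nonneg_left (Real.exp_le_exp.2 ?_) (abs_nonneg _)
  have h2 : min s (1 - s) ^ 2 ≤ ((n : ℝ) + s) ^ 2 := by
    rw [← sq_abs ((n : ℝ) + s)]
    exact pow_le_pow_left₀ (le_min h0.le (by linarith)) (min_le_abs_int_add s n) 2
  have h3 := mul_le_mul_of_nonneg_right h2 (mul_nonneg Real.pi_pos.le (by linarith : 0 ≤ t - 1))
  nlinarith

lemma norm_dual_term (s β t : ℝ) (n : ℤ) :
    ‖-I * cexp (-2 * Real.pi * I * β * s) *
      (((n : ℂ) - β) * cexp (2 * Real.pi * I * n * s) * (((√t * t)⁻¹ : ℝ) : ℂ) *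
        cexp (-Real.pi * ((n : ℂ) - β) ^ 2 / t))‖ =
      |(n : ℝ) - β| * |(√t * t)⁻¹| * Real.exp (-Real.pi * ((n : ℝ) - β) ^ 2 / t) := by
  have h1 : ((n : ℂ) - β) = (((n : ℝ) - β : ℝ) : ℂ) := by push_cast; rfl
  have h2 : 2 * Real.pi * I * n * s = ((2 * Real.pi * n * s : ℝ) : ℂ) * I := by push_cast; ring
  have h2' : -2 * Real.pi * I * β * s = ((-2 * Real.pi * β * s : ℝ) : ℂ) * I := by push_cast; ring
  have h3 : -Real.pi * ((n : ℂ) - β) ^ 2 / t =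
      ((-Real.pi * ((n : ℝ) - β) ^ 2 / t : ℝ) : ℂ) := by push_cast; rfl
  rw [norm_mul, norm_mul, norm_mul, norm_mul, norm_mul, h2, h2', norm_exp_ofReal_mul_I,
    norm_exp_ofReal_mul_I, h3, ← ofReal_exp, norm_real, norm_real, Real.norm_eq_abs,
    Real.norm_eq_abs, Real.abs_exp, h1, norm_real, Real.norm_eq_abs]
  simp

/-- As 0 < β < 1, no n - β vanishes, so each term of the inverted series contains a factor e^{-c/t}
that beats the power of t. -/
lemma norm_lineTheta_le_of_le_one (s : ℝ) {β : ℝ} (h0 : 0 < β) (h1 : β < 1) :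
    ∃ K : ℝ, ∀ t : ℝ, 0 < t → t ≤ 1 → ‖lineTheta s β t‖ ≤ K := by
  set m := min β (1 - β) with hm
  have hm0 : 0 < m := lt_min h0 (by linarith)
  have hmn : ∀ n : ℤ, m ^ 2 ≤ ((n : ℝ) - β) ^ 2 := fun n => by
    have h2 := min_le_abs_int_add β (-n)
    have h3 : |((-n : ℤ) : ℝ) + β| = |(n : ℝ) - β| := by
      rw [← abs_neg]; congr 1; push_cast; ring
    rw [h3] at h2
    rw [← sq_abs ((n : ℝ) - β)]
    exact pow_le_pow_left₀ hm0.le h2 2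
  set c := Real.pi * m ^ 2 / 2 with hc
  have hc0 : 0 < c := by have := Real.pi_pos; positivity
  have hs : Summable fun n : ℤ =>
      |(n : ℝ) - β| * Real.exp (-Real.pi * ((n : ℝ) - β) ^ 2 * (1 / 2)) := by
    simpa [sub_eq_add_neg] using summable_lineTheta_norm (-β) (by norm_num : (0 : ℝ) < 1 / 2)
  refine ⟨(∑' n : ℤ, |(n : ℝ) - β| * Real.exp (-Real.pi * ((n : ℝ) - β) ^ 2 * (1 / 2))) *
    (2 / c ^ 2), fun t ht ht1 => ?_⟩
  rw [← (hasSum_lineTheta_dual s β ht).tsum_eq]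
  refine tsum_of_norm_bounded (hs.hasSum.mul_right _) fun n => ?_
  rw [norm_dual_term]
  have hst : 0 < √t := Real.sqrt_pos.2 ht
  have hsq : √t ^ 2 = t := Real.sq_sqrt ht.le
  have hs1 : √t ≤ 1 := Real.sqrt_le_one.2 ht1
  have e1 : |(√t * t)⁻¹| ≤ (t ^ 2)⁻¹ := by
    rw [abs_of_pos (by positivity)]
    apply inv_anti₀ (by positivity)
    nlinarith
  -- Half of the exponent, with 1/t ≥ 1, keeps the series summable; the other half is at least c/t.
  have e2 : Real.exp (-Real.pi * ((n : ℝ) - β) ^ 2 / t) ≤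
      Real.exp (-Real.pi * ((n : ℝ) - β) ^ 2 * (1 / 2)) * Real.exp (-(c / t)) := by
    rw [← Real.exp_add, Real.exp_le_exp]
    have h5 : (1 : ℝ) ≤ t⁻¹ := (one_le_inv₀ ht).2 ht1
    have h8 : c / t = Real.pi * m ^ 2 / 2 * t⁻¹ := by rw [hc, div_eq_mul_inv]
    rw [div_eq_mul_inv, h8]
    have h6 := mul_le_mul_of_nonneg_right (hmn n) (mul_nonneg Real.pi_pos.le (by linarith : 0 ≤ t⁻¹))
    have h7 := mul_le_mul_of_nonneg_left h5 (mul_nonneg Real.pi_pos.le (sq_nonneg ((n : ℝ) - β)))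
    nlinarith
  have e3 : (t ^ 2)⁻¹ * Real.exp (-(c / t)) ≤ 2 / c ^ 2 := by
    have h8 := Real.quadratic_le_exp_of_nonneg (x := c / t) (by positivity)
    have h9 : (c / t) ^ 2 / 2 ≤ Real.exp (c / t) := by
      have : 0 < c / t := by positivity
      linarith
    rw [Real.exp_neg, ← mul_inv, inv_le_comm₀ (by positivity) (by positivity), inv_div]
    calc c ^ 2 / 2 = t ^ 2 * ((c / t) ^ 2 / 2) := by field_simp
      _ ≤ t ^ 2 * Real.exp (c / t) := by gcongr
  calc |(n : ℝ) - β| * |(√t * t)⁻¹| * Real.exp (-Real.pi * ((n : ℝ) - β) ^ 2 / t)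
      ≤ |(n : ℝ) - β| * (t ^ 2)⁻¹ *
        (Real.exp (-Real.pi * ((n : ℝ) - β) ^ 2 * (1 / 2)) * Real.exp (-(c / t))) := by
        gcongr
    _ = |(n : ℝ) - β| * Real.exp (-Real.pi * ((n : ℝ) - β) ^ 2 * (1 / 2)) *
        ((t ^ 2)⁻¹ * Real.exp (-(c / t))) := by ring
    _ ≤ _ := by gcongr

lemma integrableOn_lineTheta {s β : ℝ} (hs0 : 0 < s) (hs1 : s < 1) (hβ0 : 0 < β) (hβ1 : β < 1) :
    IntegrableOn (lineTheta s β) (Set.Ioi 0) := by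
  rw [← Set.Ioc_union_Ioi_eq_Ioi (zero_le_one (α := ℝ))]
  have hm : AEStronglyMeasurable (lineTheta s β) (volume.restrict (Set.Ioi 0)) :=
    (continuousOn_lineTheta s β).aestronglyMeasurable measurableSet_Ioi
  refine IntegrableOn.union ?_ ?_
  · obtain ⟨K, hK⟩ := norm_lineTheta_le_of_le_one s hβ0 hβ1
    refine Integrable.of_bound (hm.mono_set Set.Ioc_subset_Ioi_self) K ?_
    exact (ae_restrict_iff' measurableSet_Ioc).2 (Eventually.of_forall fun t ht => hK t ht.1 ht.2)
  · have hc : 0 < Real.pi * min s (1 - s) ^ 2 := by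
      have := Real.pi_pos
      have : 0 < min s (1 - s) := lt_min hs0 (by linarith)
      positivity
    set δ := Real.pi * min s (1 - s) ^ 2
    set K := ∑' n : ℤ, |(n : ℝ) + s| * Real.exp (-Real.pi * ((n : ℝ) + s) ^ 2 * 1)
    have hi : IntegrableOn (fun t : ℝ => K * Real.exp δ * Real.exp (-δ * t)) (Set.Ioi 1) :=
      (integrableOn_exp_mul_Ioi (by linarith : -δ < 0) 1).const_mul _
    refine hi.mono' (hm.mono_set (Set.Ioi_subset_Ioi zero_le_one)) ?_
    refine (ae_restrict_iff' measurableSet_Ioi).2 (Eventually.of_forall fun t ht => ?_)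
    refine (norm_lineTheta_le_of_one_le hs0 hs1 β (le_of_lt ht)).trans (le_of_eq ?_)
    rw [mul_assoc K, ← Real.exp_add]
    congr 2
    simp only [δ]
    ring

/-- The kernel `e^{2 π β w} / (e^{2 π (w - i s)} - 1)`. -/
def expKernel (s β w : ℝ) : ℂ := cexp (2 * Real.pi * β * w) / (cexp (2 * Real.pi * (w - I * s)) - 1)

/-- Two geometric series: the indices n ≥ 1 sum to the kernel at w, the indices n ≤ 0 to the kernel
at -w. -/
lemma hasSum_expKernel {s β w : ℝ} (h0 : 0 < β) (h1 : β < 1) (hw : 0 < w) :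
    HasSum (fun n : ℤ => (((n : ℝ) - β) / |(n : ℝ) - β| : ℝ) * cexp (2 * Real.pi * I * n * s) *
      (Real.exp (-2 * Real.pi * (|(n : ℝ) - β| * w)) : ℝ))
      (expKernel s β w + expKernel s β (-w)) := by
  have hpi := Real.pi_pos
  have hnorm : ∀ x : ℝ, ‖cexp (-2 * Real.pi * w + x * I)‖ < 1 := fun x => by
    rw [norm_exp]
    have : (-2 * Real.pi * w + x * I : ℂ).re = -(2 * Real.pi * w) := by simp
    rw [this, Real.exp_lt_one_iff]
    have : 0 < 2 * Real.pi * w := by positivity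
    linarith
  rw [← (Equiv.neg ℤ).hasSum_iff, add_comm]
  refine HasSum.of_nat_of_neg_add_one ?_ ?_
  · set Y := cexp (-2 * Real.pi * w + ((-(2 * Real.pi * s) : ℝ) : ℂ) * I) with hY
    have hg := (hasSum_geometric_of_norm_lt_one (hnorm (-(2 * Real.pi * s)))).mul_left
      (-cexp (2 * Real.pi * β * (-w : ℝ)))
    rw [← hY] at hg
    have hval : expKernel s β (-w) = -cexp (2 * Real.pi * β * (-w : ℝ)) * (1 - Y)⁻¹ := by
      have h2 : cexp (2 * Real.pi * ((-w : ℝ) - I * s)) = Y := by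
        rw [hY]; congr 1; push_cast; ring
      rw [expKernel, h2, div_eq_mul_inv, ← neg_sub 1 Y, inv_neg]
      ring
    rw [hval]
    refine hg.congr_fun fun n => ?_
    have hn : (((-(n : ℤ) : ℤ) : ℝ) - β) < 0 := by
      push_cast
      have : (0 : ℝ) ≤ n := Nat.cast_nonneg n
      linarith
    simp only [Function.comp_apply, Equiv.neg_apply]
    rw [abs_of_neg hn, div_neg, div_self hn.ne, hY, ← Complex.exp_nat_mul, ofReal_exp]
    push_cast
    rw [neg_one_mul, neg_mul (cexp _), ← Complex.exp_add, neg_mul (cexp _), ← Complex.exp_add]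
    congr 2
    ring
  · set X := cexp (-2 * Real.pi * w + ((2 * Real.pi * s : ℝ) : ℂ) * I) with hX
    have hg := (hasSum_geometric_of_norm_lt_one (hnorm (2 * Real.pi * s))).mul_left
      (cexp (2 * Real.pi * β * w) * X)
    rw [← hX] at hg
    have hX1 : 1 - X ≠ 0 := fun h => by
      have := hnorm (2 * Real.pi * s)
      rw [← hX, ← sub_eq_zero.1 h, norm_one] at this
      exact lt_irrefl _ this
    have hX0 : X ≠ 0 := exp_ne_zero _
    have hval : expKernel s β w = cexp (2 * Real.pi * β * w) * X * (1 - X)⁻¹ := by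
      have h2 : cexp (2 * Real.pi * (w - I * s)) = X⁻¹ := by
        rw [hX, ← Complex.exp_neg]; congr 1; push_cast; ring
      rw [expKernel, h2]
      have : X⁻¹ - 1 ≠ 0 := by
        rw [sub_ne_zero]
        intro h
        exact hX1 (by rw [inv_eq_one.1 h, sub_self])
      field_simp
    rw [hval]
    refine hg.congr_fun fun n => ?_
    have hn : 0 < (((n : ℤ) + 1 : ℤ) : ℝ) - β := by
      push_cast
      have : (0 : ℝ) ≤ n := Nat.cast_nonneg n
      linarith
    simp only [Function.comp_apply, Equiv.neg_apply, neg_neg]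
    rw [abs_of_pos hn, div_self hn.ne', hX, ← Complex.exp_nat_mul, ofReal_exp]
    push_cast
    rw [one_mul, ← Complex.exp_add, ← Complex.exp_add, ← Complex.exp_add]
    congr 1
    ring

/-- The inverted series is integrated term by term with `inverse_gaussian`. The resulting
e^{-2π|n-β|w} are summable and recombine through `hasSum_expKernel`. -/
lemma laplace_lineTheta {s β w : ℝ} (h0 : 0 < β) (h1 : β < 1) (hw : 0 < w) :
    ∫ t in Set.Ioi (0 : ℝ), lineTheta s β t * cexp (-Real.pi * w ^ 2 * t) =
      -I * cexp (-2 * Real.pi * I * β * s) * (expKernel s β w + expKernel s β (-w)) := by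
  set c := -I * cexp (-2 * Real.pi * I * β * s) with hc
  have hm : ∀ n : ℤ, 0 < |(n : ℝ) - β| := fun n => by
    have h2 := min_le_abs_int_add β (-n)
    have h3 : |((-n : ℤ) : ℝ) + β| = |(n : ℝ) - β| := by
      rw [← abs_neg]; congr 1; push_cast; ring
    rw [h3] at h2
    exact (lt_min h0 (by linarith)).trans_le h2
  set f : ℤ → ℝ → ℝ := fun n t => |(n : ℝ) - β| * (√t * t)⁻¹ *
    Real.exp (-Real.pi * (|(n : ℝ) - β| ^ 2 / t + w ^ 2 * t)) with hf
  set d : ℤ → ℂ := fun n => c * ((((n : ℝ) - β) / |(n : ℝ) - β| : ℝ) *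
    cexp (2 * Real.pi * I * n * s)) with hd
  have hcn : ‖c‖ = 1 := by
    have : -2 * Real.pi * I * β * s = ((-2 * Real.pi * β * s : ℝ) : ℂ) * I := by push_cast; ring
    rw [hc, norm_mul, this, norm_exp_ofReal_mul_I]; simp
  have hdn : ∀ n, ‖d n‖ = 1 := fun n => by
    have : 2 * Real.pi * I * n * s = ((2 * Real.pi * n * s : ℝ) : ℂ) * I := by push_cast; ring
    simp only [hd]
    rw [norm_mul, hcn, norm_mul, this, norm_exp_ofReal_mul_I, norm_real, Real.norm_eq_abs, abs_div,
      abs_abs, div_self (hm n).ne']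
    simp
  have hintg : ∀ n, IntegrableOn (fun t => d n * (f n t : ℂ)) (Set.Ioi 0) := fun n =>
    ((inverse_gaussian (hm n) hw).1.ofReal).const_mul _
  have hval : ∀ n, ∫ t in Set.Ioi (0 : ℝ), d n * (f n t : ℂ) =
      d n * (Real.exp (-2 * Real.pi * (|(n : ℝ) - β| * w)) : ℝ) := fun n => by
    rw [integral_const_mul, integral_complex_ofReal, (inverse_gaussian (hm n) hw).2]
  have hnv : ∀ n, ∫ t in Set.Ioi (0 : ℝ), ‖d n * (f n t : ℂ)‖ =
      Real.exp (-2 * Real.pi * (|(n : ℝ) - β| * w)) := fun n => by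
    rw [← (inverse_gaussian (hm n) hw).2]
    refine setIntegral_congr_fun measurableSet_Ioi fun t ht => ?_
    have ht0 : (0 : ℝ) < t := ht
    rw [norm_mul, hdn, one_mul, norm_real, Real.norm_eq_abs, abs_of_nonneg]
    have := hm n
    positivity
  have hK := hasSum_expKernel (s := s) h0 h1 hw
  have hsum : Summable fun n : ℤ => Real.exp (-2 * Real.pi * (|(n : ℝ) - β| * w)) := by
    refine hK.summable.norm.congr fun n => ?_
    have h := hdn n
    simp only [hd] at h
    rw [norm_mul, hcn, one_mul] at h
    rw [norm_mul, h, one_mul, norm_real, Real.norm_eq_abs, Real.abs_exp]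
  have key := hasSum_integral_of_summable_integral_norm hintg (by simpa only [hnv] using hsum)
  have key2 : HasSum (fun n => ∫ t in Set.Ioi (0 : ℝ), d n * (f n t : ℂ))
      (c * (expKernel s β w + expKernel s β (-w))) := by
    simp_rw [hval]
    refine (hK.mul_left c).congr_fun fun n => ?_
    simp only [hd]
    ring
  rw [key2.unique key]
  refine setIntegral_congr_fun measurableSet_Ioi fun t ht => ?_
  have ht0 : (0 : ℝ) < t := ht
  have h3 := (hasSum_lineTheta_dual s β ht0).mul_right (cexp (-Real.pi * w ^ 2 * t))
  rw [← h3.tsum_eq]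
  refine tsum_congr fun n => ?_
  simp only [hd, hf, sq_abs]
  have e1 : cexp (-Real.pi * ((n : ℂ) - β) ^ 2 / t) * cexp (-Real.pi * w ^ 2 * t) =
      ((Real.exp (-Real.pi * (((n : ℝ) - β) ^ 2 / t + w ^ 2 * t)) : ℝ) : ℂ) := by
    rw [← Complex.exp_add, ofReal_exp]; congr 1; push_cast; ring
  have e2 : ((((n : ℝ) - β) / |(n : ℝ) - β| : ℝ) : ℂ) * (|(n : ℝ) - β| : ℝ) = (n : ℂ) - β := by
    rw [← ofReal_mul, div_mul_cancel₀ _ (hm n).ne']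
    push_cast; rfl
  rw [ofReal_mul, ofReal_mul, ← e1, ← e2, ← hc]
  ring

lemma laplace_lineTheta_of_ne {s β w : ℝ} (h0 : 0 < β) (h1 : β < 1) (hw : w ≠ 0) :
    ∫ t in Set.Ioi (0 : ℝ), lineTheta s β t * cexp (-Real.pi * w ^ 2 * t) =
      -I * cexp (-2 * Real.pi * I * β * s) * (expKernel s β w + expKernel s β (-w)) := by
  rcases lt_or_gt_of_ne hw with h | h
  · have := laplace_lineTheta (s := s) h0 h1 (neg_pos.2 h)
    rw [neg_neg, add_comm] at this
    rw [← this]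
    push_cast
    simp only [neg_sq]
  · exact laplace_lineTheta h0 h1 h

/-- On the line Im w = 1/2 - s the hyperbolic cosine becomes e^{2π(w-is)} - 1 times an exponential.
The kernel is therefore a Mordell integrand on a displaced line. -/
lemma expKernel_eq (s β w : ℝ) (T : ℂ) :
    cexp (Real.pi * I * T * ((w : ℂ) + (-(s - 1 / 2) : ℝ) * I) ^ 2 +
      -2 * Real.pi * ((s - 1 / 2) * T - (β - 1 / 2)) * (w + (-(s - 1 / 2) : ℝ) * I)) /
        Complex.cosh (Real.pi * (w + (-(s - 1 / 2) : ℝ) * I)) =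
    -2 * cexp (Real.pi * I * (s - 1 / 2) ^ 2 * T + Real.pi * I * β - 2 * Real.pi * I * β * s) *
      (cexp (Real.pi * I * T * w ^ 2) * expKernel s β w) := by
  have hc : Complex.cosh (Real.pi * (w + (-(s - 1 / 2) : ℝ) * I)) =
      I / 2 * cexp (-(Real.pi * (w - I * s))) * (cexp (2 * Real.pi * (w - I * s)) - 1) := by
    have e1 : Real.pi * ((w : ℂ) + (-(s - 1 / 2) : ℝ) * I) =
        Real.pi * (w - I * s) + Real.pi / 2 * I := by push_cast; ring
    have e2 : cexp (-(Real.pi / 2 * I)) = -I := by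
      rw [Complex.exp_neg, exp_pi_div_two_mul_I, inv_I]
    have e3 : cexp (2 * Real.pi * (w - I * s)) =
        cexp (Real.pi * (w - I * s)) * cexp (Real.pi * (w - I * s)) := by
      rw [← Complex.exp_add]; congr 1; ring
    have e4 : cexp (-(Real.pi * (w - I * s))) * cexp (Real.pi * (w - I * s)) = 1 := by
      rw [← Complex.exp_add, neg_add_cancel, Complex.exp_zero]
    rw [Complex.cosh, e1, Complex.exp_add, exp_pi_div_two_mul_I, neg_add, Complex.exp_add, e2, e3]
    linear_combination (-(I / 2 * cexp (Real.pi * (w - I * s)))) * e4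
  have hN : cexp (Real.pi * I * T * ((w : ℂ) + (-(s - 1 / 2) : ℝ) * I) ^ 2 +
      -2 * Real.pi * ((s - 1 / 2) * T - (β - 1 / 2)) * (w + (-(s - 1 / 2) : ℝ) * I)) =
      -I * cexp (Real.pi * I * (s - 1 / 2) ^ 2 * T + Real.pi * I * β - 2 * Real.pi * I * β * s) *
        cexp (Real.pi * I * T * w ^ 2) * cexp (2 * Real.pi * β * w) *
        cexp (-(Real.pi * (w - I * s))) := by
    have e2 : -I = cexp (-(Real.pi / 2 * I)) := by
      rw [Complex.exp_neg, exp_pi_div_two_mul_I, inv_I]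
    rw [e2, ← Complex.exp_add, ← Complex.exp_add, ← Complex.exp_add, ← Complex.exp_add]
    congr 1
    push_cast
    linear_combination (Real.pi * I * T * (s - 1 / 2) ^ 2 - 2 * Real.pi * T * w * (s - 1 / 2)) * I_sq
  rw [hc, hN, expKernel]
  have h1 : cexp (-(Real.pi * (w - I * s))) ≠ 0 := exp_ne_zero _
  generalize cexp (-(Real.pi * (w - I * s))) = y at *
  generalize cexp (2 * Real.pi * (w - I * s)) - 1 = D at *
  rcases eq_or_ne D 0 with rfl | hD
  · simp
  rw [← mul_div_assoc, ← mul_div_assoc, div_eq_div_iff (by simp [h1, hD]) hD]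
  ring

lemma gaussian_integral_eq {a : ℂ} (ha : 0 < a.re) :
    ∫ w : ℝ, cexp (-(Real.pi * a) * (w : ℂ) ^ 2) = (a ^ (1 / 2 : ℂ))⁻¹ := by
  have h0 : 0 < (Real.pi * a).re := by rw [re_ofReal_mul]; exact mul_pos Real.pi_pos ha
  have hpi : (Real.pi : ℂ) ≠ 0 := by exact_mod_cast Real.pi_ne_zero
  rw [integral_gaussian_complex h0, ← inv_cpow]
  · congr 1
    rw [← div_div, div_self hpi, one_div]
  · intro h
    have := (Complex.arg_eq_pi_iff.1 h).1
    linarith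

/-- The weight is the Gaussian integral of e^{-π(t-iT)w²} over w. Exchanging the integrations leaves
the Laplace transform of the theta series, whose two kernels contribute equally by w → -w. The
contour may be moved back to the real line because 0 < s < 1 keeps it away from the poles of 1/cosh.
-/
theorem integral_lineTheta_eq_mordell {s β : ℝ} (hs0 : 0 < s) (hs1 : s < 1) (hβ0 : 0 < β)
    (hβ1 : β < 1) {T : ℂ} (hT : 0 < T.im) :
    ∫ t in Set.Ioi (0 : ℝ), lineTheta s β t / ((t : ℂ) - I * T) ^ (1 / 2 : ℂ) =
      I * cexp (-(Real.pi * I * β)) * cexp (-(Real.pi * I * (s - 1 / 2) ^ 2 * T)) *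
        mordell ((s - 1 / 2) * T - (β - 1 / 2)) T := by
  set f : ℝ → ℝ → ℂ := fun t w => lineTheta s β t *
    (cexp (Real.pi * I * T * w ^ 2) * cexp (-Real.pi * w ^ 2 * t)) with hf
  have hre : (Real.pi * I * T).re < 0 := by
    rw [re_pi_I_mul]; have := Real.pi_pos; nlinarith [mul_pos this hT]
  have hgauss : Integrable fun w : ℝ => cexp (Real.pi * I * T * (w : ℂ) ^ 2) := by
    obtain ⟨K, _, hK⟩ := norm_cexp_quadratic_le _ hre 0 0
    refine (integrable_gauss (by linarith : 0 < -(Real.pi * I * T).re / 2) K).mono'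
      (by fun_prop) (Eventually.of_forall fun w => ?_)
    simpa using hK 0 (by simp) w 0 (by simp)
  have h1 : ∀ t ∈ Set.Ioi (0 : ℝ), lineTheta s β t / ((t : ℂ) - I * T) ^ (1 / 2 : ℂ) =
      ∫ w : ℝ, f t w := fun t ht => by
    have ht0 : (0 : ℝ) < t := ht
    have ha : 0 < ((t : ℂ) - I * T).re := by
      simp; linarith
    simp only [hf]
    rw [integral_const_mul, div_eq_mul_inv, ← gaussian_integral_eq ha]
    congr 2
    funext w
    rw [← Complex.exp_add]
    congr 1
    ring
  -- For t > 0 the factor e^{-πw²t} has modulus at most 1, so the product of the integrable theta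
  -- line and a Gaussian in w dominates.
  have hprod : Integrable (Function.uncurry f)
      ((volume.restrict (Set.Ioi (0 : ℝ))).prod volume) := by
    have h2 := Integrable.mul_prod (integrableOn_lineTheta hs0 hs1 hβ0 hβ1) hgauss
    refine h2.mono ?_ ?_
    · have h3 : (Function.uncurry f) = fun p : ℝ × ℝ =>
          (lineTheta s β p.1 * cexp (Real.pi * I * T * (p.2 : ℂ) ^ 2)) *
            cexp (-Real.pi * (p.2 : ℂ) ^ 2 * p.1) := by
        funext p
        simp only [Function.uncurry, hf]
        ring
      rw [h3]
      refine h2.aestronglyMeasurable.mul (Continuous.aestronglyMeasurable ?_)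
      fun_prop
    · have h4 : ∀ᵐ p : ℝ × ℝ ∂((volume.restrict (Set.Ioi (0 : ℝ))).prod volume), 0 < p.1 := by
        refine Measure.ae_prod_mem_iff_ae_ae_mem ?_ |>.2 ?_
        · exact measurableSet_lt measurable_const measurable_fst
        · filter_upwards [ae_restrict_mem measurableSet_Ioi] with t ht
          exact Eventually.of_forall fun w => ht
      filter_upwards [h4] with p hp
      simp only [Function.uncurry, hf]
      rw [← mul_assoc, norm_mul]
      refine mul_le_of_le_one_right (norm_nonneg _) ?_
      have h5 : -Real.pi * (p.2 : ℂ) ^ 2 * p.1 = ((-(Real.pi * p.2 ^ 2 * p.1) : ℝ) : ℂ) := by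
        push_cast; ring
      rw [h5, ← ofReal_exp, norm_real, Real.norm_eq_abs, Real.abs_exp, Real.exp_le_one_iff]
      have := Real.pi_pos
      have : 0 ≤ Real.pi * p.2 ^ 2 * p.1 := by positivity
      linarith
  rw [setIntegral_congr_fun measurableSet_Ioi h1, integral_integral_swap hprod]
  have hb : |-(s - 1 / 2)| < 1 / 2 := by rw [abs_lt]; constructor <;> linarith
  have hker : ∀ w : ℝ, cexp (Real.pi * I * T * w ^ 2) * expKernel s β w =
      -(1 / 2) * cexp (-(Real.pi * I * (s - 1 / 2) ^ 2 * T + Real.pi * I * β -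
        2 * Real.pi * I * β * s)) *
      (cexp (Real.pi * I * T * ((w : ℂ) + (-(s - 1 / 2) : ℝ) * I) ^ 2 +
      -2 * Real.pi * ((s - 1 / 2) * T - (β - 1 / 2)) * (w + (-(s - 1 / 2) : ℝ) * I)) /
        Complex.cosh (Real.pi * (w + (-(s - 1 / 2) : ℝ) * I))) := fun w => by
    rw [expKernel_eq, Complex.exp_neg]
    have := exp_ne_zero (Real.pi * I * (s - 1 / 2) ^ 2 * T + Real.pi * I * β -
        2 * Real.pi * I * β * s)
    field_simp
    try ring
  have hik : Integrable fun w : ℝ => cexp (Real.pi * I * T * w ^ 2) * expKernel s β w := by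
    simp_rw [hker]
    exact (integrable_mordell_line hT hb).const_mul _
  have hvk : ∫ w : ℝ, cexp (Real.pi * I * T * w ^ 2) * expKernel s β w =
      -(1 / 2) * cexp (-(Real.pi * I * (s - 1 / 2) ^ 2 * T + Real.pi * I * β -
        2 * Real.pi * I * β * s)) * mordell ((s - 1 / 2) * T - (β - 1 / 2)) T := by
    simp_rw [hker]
    rw [integral_const_mul, mordell_shift hT hb]
  have hin : (fun w : ℝ => ∫ t in Set.Ioi (0 : ℝ), f t w) =ᵐ[volume] fun w : ℝ =>
      -I * cexp (-2 * Real.pi * I * β * s) *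
        (cexp (Real.pi * I * T * w ^ 2) * expKernel s β w +
          cexp (Real.pi * I * T * ((-w : ℝ) : ℂ) ^ 2) * expKernel s β (-w)) := by
    -- The Laplace formula excludes w = 0, a null set.
    have h0 : ∀ᵐ w : ℝ, w ≠ 0 := by
      simp [ae_iff, measure_singleton]
    filter_upwards [h0] with w hw
    have h6 : ∀ t : ℝ, f t w = cexp (Real.pi * I * T * w ^ 2) *
        (lineTheta s β t * cexp (-Real.pi * w ^ 2 * t)) := fun t => by
      simp only [hf]; ring
    simp_rw [h6]
    rw [integral_const_mul, laplace_lineTheta_of_ne hβ0 hβ1 hw]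
    push_cast
    rw [neg_sq]
    ring
  rw [integral_congr_ae hin, integral_const_mul, integral_add hik hik.comp_neg,
    integral_neg_eq_self (fun w : ℝ => cexp (Real.pi * I * T * (w : ℂ) ^ 2) * expKernel s β w), hvk]
  have e5 : cexp (-2 * Real.pi * I * β * s) * cexp (-(Real.pi * I * (s - 1 / 2) ^ 2 * T +
      Real.pi * I * β - 2 * Real.pi * I * β * s)) =
      cexp (-(Real.pi * I * β)) * cexp (-(Real.pi * I * (s - 1 / 2) ^ 2 * T)) := by
    rw [← Complex.exp_add, ← Complex.exp_add]; congr 1; ring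
  linear_combination (I * mordell ((s - 1 / 2) * T - (β - 1 / 2)) T) * e5

section

/-! ### The action of lower triangular matrices -/

/-- With arg x in (-π/2, π/2) and arg y in [0, π], the sum of the arguments could leave the
principal range only above π, where xy would have negative real part. -/
lemma mul_cpow_of_re {x y : ℂ} (hx : 0 < x.re) (hy : 0 < y.im) (hxy : 0 < (x * y).re) (r : ℂ) :
    (x * y) ^ r = x ^ r * y ^ r := by
  have hx0 : x ≠ 0 := fun h => by simp [h] at hx
  have hy0 : y ≠ 0 := fun h => by simp [h] at hy
  have h1 : |x.arg| < Real.pi / 2 := abs_arg_lt_pi_div_two_iff.2 (Or.inl hx)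
  have h2 : 0 ≤ y.arg := arg_nonneg_iff.2 hy.le
  have h3 := arg_le_pi y
  rw [abs_lt] at h1
  refine mul_cpow_of_arg hx0 hy0 ⟨by linarith [Real.pi_pos], ?_⟩ r
  by_contra h
  push Not at h
  have h4 : Real.cos (x.arg + y.arg) < 0 :=
    Real.cos_neg_of_pi_div_two_lt_of_lt (by linarith [Real.pi_pos]) (by linarith [Real.pi_pos])
  have h5 : (x * y).re = ‖x‖ * ‖y‖ * Real.cos (x.arg + y.arg) := by
    have e1 : x * y = ((‖x‖ * ‖y‖ : ℝ) : ℂ) * cexp (((x.arg + y.arg : ℝ) : ℂ) * I) := by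
      conv_lhs => rw [← norm_mul_exp_arg_mul_I x, ← norm_mul_exp_arg_mul_I y]
      push_cast
      rw [add_mul, Complex.exp_add]
      ring
    rw [e1, re_ofReal_mul, exp_ofReal_mul_I_re]
  rw [h5] at hxy
  have h6 : 0 < ‖x‖ * ‖y‖ := mul_pos (norm_pos_iff.2 hx0) (norm_pos_iff.2 hy0)
  nlinarith

lemma neg_I_mul_cpow {σ : ℂ} (hσ : 0 < σ.im) :
    (-I * σ) ^ (1 / 2 : ℂ) = cexp (-(Real.pi * I / 4)) * σ ^ (1 / 2 : ℂ) := by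
  have hσ0 : σ ≠ 0 := fun h => by simp [h] at hσ
  have h2 : 0 ≤ σ.arg := arg_nonneg_iff.2 hσ.le
  have h3 := arg_le_pi σ
  rw [mul_cpow_of_arg (neg_ne_zero.2 I_ne_zero) hσ0 (by
    rw [arg_neg_I]; constructor <;> linarith [Real.pi_pos])]
  congr 1
  rw [cpow_def_of_ne_zero (neg_ne_zero.2 I_ne_zero), log_neg_I]
  congr 1
  ring

section lower

variable {r : ℕ} {τ : ℂ}

lemma im_lower (hr : 0 < r) (hτ : 0 < τ.im) : 0 < ((r : ℂ) * τ + 1).im := by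
  have : ((r : ℂ) * τ + 1).im = r * τ.im := by simp
  rw [this]
  positivity

lemma lower_ne_zero (hr : 0 < r) (hτ : 0 < τ.im) : (r : ℂ) * τ + 1 ≠ 0 := fun h => by
  have := im_lower hr hτ
  simp [h] at this

lemma im_div_lower (hr : 0 < r) (hτ : 0 < τ.im) : 0 < (τ / ((r : ℂ) * τ + 1)).im := by
  have h0 := lower_ne_zero hr hτ
  have h1 : (τ / ((r : ℂ) * τ + 1)).im = τ.im / normSq ((r : ℂ) * τ + 1) := by
    rw [div_im]
    simp
    ring
  rw [h1]
  exact div_pos hτ (normSq_pos.2 h0)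

/-- The n-th terms differ by e^{-πirn(n-1)}, and n(n-1) is even. -/
lemma jacobiTheta₂_sub_nat (r : ℕ) (z T : ℂ) :
    jacobiTheta₂ (r / 2 + z) (T - r) = jacobiTheta₂ z T := by
  refine tsum_congr fun n => ?_
  rw [jacobiTheta₂_term, jacobiTheta₂_term]
  obtain ⟨k, hk⟩ := Int.even_mul_pred_self n
  have hk2 : (n : ℂ) * (n - 1) = k + k := by exact_mod_cast hk
  have : 2 * Real.pi * I * n * (r / 2 + z) + Real.pi * I * n ^ 2 * (T - r) =
      (2 * Real.pi * I * n * z + Real.pi * I * n ^ 2 * T) +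
        ((-(r * k) : ℤ) : ℂ) * (2 * Real.pi * I) := by
    push_cast
    linear_combination (-(Real.pi * I * r)) * hk2
  rw [this, Complex.exp_add, Complex.exp_int_mul_two_pi_mul_I, mul_one]

/-- Inversion turns τ/(rτ+1) into -1/τ - r. There the translation lemma applies, and a second
inversion leads back to τ. -/
lemma theta4_lower (hr : 0 < r) (hτ : 0 < τ.im) :
    theta4 (τ / ((r : ℂ) * τ + 1)) =
      cexp (-(Real.pi * I * r / 4)) * ((r : ℂ) * τ + 1) ^ (1 / 2 : ℂ) * theta4 τ := by
  have h0 := lower_ne_zero hr hτ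
  have hτ0 : τ ≠ 0 := fun h => by simp [h] at hτ
  set σ := (r : ℂ) * τ + 1 with hσ
  have hi := im_div_lower hr hτ
  rw [← hσ] at hi
  have hsq : (-I * τ) ^ (1 / 2 : ℂ) = (-I * (τ / σ)) ^ (1 / 2 : ℂ) * σ ^ (1 / 2 : ℂ) := by
    have e1 : -I * τ = (-I * (τ / σ)) * σ := by field_simp
    rw [e1]
    refine mul_cpow_of_re (by simpa using hi) (im_lower hr hτ) ?_ _
    rw [← e1]
    simpa using hτ
  have hne : (-I * (τ / σ)) ^ (1 / 2 : ℂ) ≠ 0 := by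
    rw [Ne, cpow_eq_zero_iff]
    simp [hτ0, h0]
  have hneσ : σ ^ (1 / 2 : ℂ) ≠ 0 := by
    rw [Ne, cpow_eq_zero_iff]
    simp [h0]
  have e2 : (1 / 2 : ℂ) / (τ / σ) = r / 2 + (1 / 2) / τ := by
    rw [hσ]; field_simp
  have e3 : -1 / (τ / σ) = -1 / τ - r := by
    rw [hσ]; field_simp; ring
  rw [theta4_eq_jacobiTheta₂, theta4_eq_jacobiTheta₂, jacobiTheta₂_functional_equation (1 / 2),
    jacobiTheta₂_functional_equation (1 / 2) τ, e2, e3, jacobiTheta₂_sub_nat, hsq]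
  have e4 : cexp (-Real.pi * I * (1 / 2) ^ 2 / (τ / σ)) =
      cexp (-(Real.pi * I * r / 4)) * cexp (-Real.pi * I * (1 / 2) ^ 2 / τ) := by
    rw [← Complex.exp_add]; congr 1; rw [hσ]; field_simp; ring
  rw [e4]
  field_simp

/-- The function `μ(x + τ/2, τ/2; τ)` expressed by reciprocal sines. -/
def bFun (x τ : ℂ) : ℂ := -(1 / 2) * sinSum x τ / theta4 τ

lemma bFun_add_one (x τ : ℂ) : bFun (x + 1) τ = -bFun x τ := by
  rw [bFun, bFun, sinSum_add_one]; ring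

lemma bFun_add_tau {x : ℂ} (hτ : 0 < τ.im) (hx : Regular τ x) :
    bFun (x + τ) τ = -cexp (2 * Real.pi * I * x + Real.pi * I * τ) * bFun x τ -
      I * cexp (Real.pi * I * x + 3 * Real.pi * I * τ / 4) := by
  have := theta4_ne_zero hτ
  rw [bFun, bFun, sinSum_add_tau hτ hx]
  generalize cexp (2 * Real.pi * I * x + Real.pi * I * τ) = E1
  generalize cexp (Real.pi * I * x + 3 * Real.pi * I * τ / 4) = E2
  field_simp
  ring

lemma differentiableAt_bFun {x : ℂ} (hτ : 0 < τ.im) (hx : Regular τ x) :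
    DifferentiableAt ℂ (fun x => bFun x τ) x :=
  ((differentiableAt_sinSum hτ hx).const_mul _).div_const _

lemma tendsto_bFun_pole (hτ : 0 < τ.im) :
    Tendsto (fun x => (x + τ / 2) * bFun x τ) (𝓝[≠] (-(τ / 2)))
      (𝓝 (-(1 / 2) * (cexp (Real.pi * I * τ / 4) / Real.pi) / theta4 τ)) := by
  refine (((tendsto_sinSum_pole hτ).const_mul (-(1 / 2))).div_const (theta4 τ)).congr fun x => ?_
  rw [bFun]; ring

/-- `(r τ + 1)^{-1/2} e^{π i r x² / (r τ + 1)} B(x / (r τ + 1); τ / (r τ + 1))`. -/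
def bSlash (r : ℕ) (x τ : ℂ) : ℂ :=
  (((r : ℂ) * τ + 1) ^ (1 / 2 : ℂ))⁻¹ * cexp (Real.pi * I * r * x ^ 2 / ((r : ℂ) * τ + 1)) *
    bFun (x / ((r : ℂ) * τ + 1)) (τ / ((r : ℂ) * τ + 1))

lemma Regular.lower {x : ℂ} (hr : 0 < r) (hτ : 0 < τ.im) (hx : Regular τ x) :
    Regular (τ / ((r : ℂ) * τ + 1)) (x / ((r : ℂ) * τ + 1)) := fun n h => by
  have h0 := lower_ne_zero hr hτ
  have hpi : (Real.pi : ℂ) ≠ 0 := by exact_mod_cast Real.pi_ne_zero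
  obtain ⟨k, hk⟩ := Complex.sin_eq_zero_iff.1 h
  have h1 : x + (n + 1 / 2) * τ = k * (r * τ + 1) := by
    have h2 : x / ((r : ℂ) * τ + 1) + (n + 1 / 2) * (τ / ((r : ℂ) * τ + 1)) = k := by
      apply mul_left_cancel₀ hpi
      linear_combination hk
    field_simp at h2
    linear_combination h2 / 2
  refine hx (n - k * r) (Complex.sin_eq_zero_iff.2 ⟨k, ?_⟩)
  push_cast
  linear_combination (Real.pi : ℂ) * h1

lemma differentiableAt_bSlash {x : ℂ} (hr : 0 < r) (hτ : 0 < τ.im) (hx : Regular τ x) :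
    DifferentiableAt ℂ (fun x => bSlash r x τ) x := by
  refine DifferentiableAt.mul (by fun_prop) ?_
  exact (differentiableAt_bFun (im_div_lower hr hτ) (hx.lower hr hτ)).comp x
    (f := fun x => x / ((r : ℂ) * τ + 1)) (by fun_prop)

lemma bSlash_add_tau {x : ℂ} (hr : 0 < r) (hτ : 0 < τ.im) (hx : Regular τ x) :
    bSlash r (x + τ) τ = -cexp (2 * Real.pi * I * x + Real.pi * I * τ) * bSlash r x τ -
      I * (((r : ℂ) * τ + 1) ^ (1 / 2 : ℂ))⁻¹ *
        cexp (Real.pi * I * (r * (x + τ) ^ 2 + x + 3 * τ / 4) / ((r : ℂ) * τ + 1)) := by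
  have h0 := lower_ne_zero hr hτ
  have h1 := bFun_add_tau (im_div_lower hr hτ) (hx.lower hr hτ)
  rw [bSlash, bSlash, add_div, h1]
  set σ := (r : ℂ) * τ + 1 with hσ
  have e1 : cexp (Real.pi * I * r * (x + τ) ^ 2 / σ) *
      cexp (2 * Real.pi * I * (x / σ) + Real.pi * I * (τ / σ)) =
      cexp (2 * Real.pi * I * x + Real.pi * I * τ) * cexp (Real.pi * I * r * x ^ 2 / σ) := by
    rw [← Complex.exp_add, ← Complex.exp_add]; congr 1; field_simp; rw [hσ]; ring
  have e2 : cexp (Real.pi * I * r * (x + τ) ^ 2 / σ) *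
      cexp (Real.pi * I * (x / σ) + 3 * Real.pi * I * (τ / σ) / 4) =
      cexp (Real.pi * I * (r * (x + τ) ^ 2 + x + 3 * τ / 4) / σ) := by
    rw [← Complex.exp_add]; congr 1; field_simp; ring
  linear_combination (-(σ ^ (1 / 2 : ℂ))⁻¹ * bFun (x / σ) (τ / σ)) * e1 -
    (I * (σ ^ (1 / 2 : ℂ))⁻¹) * e2

lemma bSlash_add_lower {x : ℂ} (hr : 0 < r) (hτ : 0 < τ.im) :
    bSlash r (x + (r * τ + 1)) τ =
      -cexp (Real.pi * I * r * (2 * x + (r * τ + 1))) * bSlash r x τ := by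
  have h0 := lower_ne_zero hr hτ
  rw [bSlash, bSlash, add_div, div_self h0, bFun_add_one]
  set σ := (r : ℂ) * τ + 1 with hσ
  have e1 : cexp (Real.pi * I * r * (x + σ) ^ 2 / σ) =
      cexp (Real.pi * I * r * (2 * x + σ)) * cexp (Real.pi * I * r * x ^ 2 / σ) := by
    rw [← Complex.exp_add]; congr 1; field_simp; ring
  rw [e1]
  ring

/-- Both functions have simple poles at -τ/2. By `theta4_lower` the stated constant makes the
residues equal. -/
lemma tendsto_bFun_sub_bSlash (hr : 0 < r) (hτ : 0 < τ.im) :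
    Tendsto (fun x => (x + τ / 2) * (bFun x τ - cexp (-(Real.pi * I * r / 4)) * bSlash r x τ))
      (𝓝[≠] (-(τ / 2))) (𝓝 0) := by
  have h0 := lower_ne_zero hr hτ
  have hi := im_div_lower hr hτ
  set σ := (r : ℂ) * τ + 1 with hσ
  have t1 : Tendsto (fun x : ℂ => x / σ) (𝓝[≠] (-(τ / 2))) (𝓝[≠] (-(τ / σ / 2))) := by
    refine tendsto_nhdsWithin_iff.2 ⟨?_, ?_⟩
    · have hc : Continuous fun x : ℂ => x / σ := by fun_prop
      have := hc.tendsto (-(τ / 2))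
      rw [show -(τ / 2) / σ = -(τ / σ / 2) by ring] at this
      exact this.mono_left nhdsWithin_le_nhds
    · filter_upwards [self_mem_nhdsWithin] with x hx h
      apply hx
      rw [Set.mem_singleton_iff] at h ⊢
      field_simp at h
      linear_combination h / 2
  have t2 := (tendsto_bFun_pole hi).comp t1
  have t3 : Tendsto (fun x : ℂ => cexp (-(Real.pi * I * r / 4)) * σ * ((σ ^ (1 / 2 : ℂ))⁻¹ *
      cexp (Real.pi * I * r * x ^ 2 / σ))) (𝓝[≠] (-(τ / 2)))
      (𝓝 (cexp (-(Real.pi * I * r / 4)) * σ * ((σ ^ (1 / 2 : ℂ))⁻¹ *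
        cexp (Real.pi * I * r * (-(τ / 2)) ^ 2 / σ)))) := by
    have hc : Continuous fun x : ℂ => cexp (-(Real.pi * I * r / 4)) * σ * ((σ ^ (1 / 2 : ℂ))⁻¹ *
      cexp (Real.pi * I * r * x ^ 2 / σ)) := by fun_prop
    exact (hc.tendsto _).mono_left nhdsWithin_le_nhds
  have t4 := (tendsto_bFun_pole hτ).sub (t3.mul t2)
  have hlim : -(1 / 2) * (cexp (Real.pi * I * τ / 4) / Real.pi) / theta4 τ -
      cexp (-(Real.pi * I * r / 4)) * σ * ((σ ^ (1 / 2 : ℂ))⁻¹ *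
        cexp (Real.pi * I * r * (-(τ / 2)) ^ 2 / σ)) *
      (-(1 / 2) * (cexp (Real.pi * I * (τ / σ) / 4) / Real.pi) / theta4 (τ / σ)) = 0 := by
    have hth := theta4_ne_zero hτ
    have e1 : cexp (Real.pi * I * r * (-(τ / 2)) ^ 2 / σ) * cexp (Real.pi * I * (τ / σ) / 4) =
        cexp (Real.pi * I * τ / 4) := by
      rw [← Complex.exp_add]; congr 1; field_simp; rw [hσ]; ring
    have hneσ : σ ^ (1 / 2 : ℂ) ≠ 0 := by
      rw [Ne, cpow_eq_zero_iff]
      simp [h0]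
    have e2 : σ ^ (1 / 2 : ℂ) * σ ^ (1 / 2 : ℂ) = σ := by
      rw [← cpow_add _ _ h0]; norm_num
    have hE : cexp (-(Real.pi * I * r / 4)) ≠ 0 := exp_ne_zero _
    have hpi : (Real.pi : ℂ) ≠ 0 := by exact_mod_cast Real.pi_ne_zero
    rw [hσ, theta4_lower hr hτ, ← hσ, ← e1]
    generalize σ ^ (1 / 2 : ℂ) = w at *
    generalize cexp (-(Real.pi * I * r / 4)) = E at *
    generalize cexp (Real.pi * I * r * (-(τ / 2)) ^ 2 / σ) = E1 at *
    generalize cexp (Real.pi * I * (τ / σ) / 4) = E2 at *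
    rw [← e2]
    field_simp
    ring
  rw [hlim] at t4
  refine t4.congr fun x => ?_
  rw [bSlash, ← hσ]
  simp only [Function.comp_apply]
  have e3 : x + τ / 2 = σ * (x / σ + τ / σ / 2) := by field_simp
  rw [mul_sub]
  congr 1
  conv_rhs => rw [e3]
  ring

end lower

end

/-! ### Comparison of B with its lower triangular transforms: the error is a Mordell integral -/

lemma cexp_eq_of_two_pi {a b : ℂ} (h : a = b + 2 * Real.pi * I) : cexp a = cexp b := by
  rw [h, Complex.exp_add, Complex.exp_two_pi_mul_I, mul_one]

lemma cexp_eq_neg_of_pi {a b : ℂ} (h : a = b + Real.pi * I) : cexp a = -cexp b := by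
  rw [h, Complex.exp_add, Complex.exp_pi_mul_I, mul_neg_one]

lemma cexp_eq_neg_of_neg_pi {a b : ℂ} (h : a = b - Real.pi * I) : cexp a = -cexp b := by
  rw [h, Complex.exp_sub, Complex.exp_pi_mul_I, div_neg, div_one]

lemma cexp_eq_I_mul {a b : ℂ} (h : a = b + Real.pi / 2 * I) : cexp a = I * cexp b := by
  rw [h, Complex.exp_add, exp_pi_div_two_mul_I, mul_comm]

lemma cexp_neg_pi_div_two : cexp (-(Real.pi / 2 * I)) = -I := by
  rw [Complex.exp_neg, exp_pi_div_two_mul_I, inv_I]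

lemma exp_neg_pi_four_sq : cexp (-(Real.pi * I / 4)) ^ 2 = -I := by
  rw [← Complex.exp_nat_mul, ← cexp_neg_pi_div_two]
  congr 1; push_cast; ring

lemma sqrt_two_sq : ((√2 : ℝ) : ℂ) ^ 2 = 2 := by
  rw [← ofReal_pow, Real.sq_sqrt (by norm_num)]; norm_num

lemma sqrt_two_mul_exp : ((√2 : ℝ) : ℂ) * cexp (-(Real.pi * I / 4)) = 1 - I := by
  have h : -(Real.pi * I / 4) = ((-(Real.pi / 4) : ℝ) : ℂ) * I := by push_cast; ring
  rw [h, Complex.exp_mul_I, ← ofReal_cos, ← ofReal_sin, Real.cos_neg, Real.sin_neg,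
    Real.cos_pi_div_four, Real.sin_pi_div_four]
  push_cast
  linear_combination (1 - I) / 2 * sqrt_two_sq

lemma tendsto_mul_oddTheta {τ : ℂ} (hτ : 0 < τ.im) {f g : ℂ → ℂ} (hg : Continuous g)
    (hf : Tendsto (fun x => (x + τ / 2) * f x) (𝓝[≠] (-(τ / 2))) (𝓝 0)) :
    Tendsto (fun x => (x + τ / 2) * (f x - g x) * oddTheta τ x) (𝓝[≠] (-(τ / 2))) (𝓝 0) := by
  have h1 : Tendsto (fun x : ℂ => (x + τ / 2) * g x) (𝓝[≠] (-(τ / 2))) (𝓝 0) := by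
    have hc : Continuous fun x : ℂ => (x + τ / 2) * g x := by fun_prop
    have := hc.tendsto (-(τ / 2))
    rw [neg_add_cancel, zero_mul] at this
    exact this.mono_left nhdsWithin_le_nhds
  have h2 : Tendsto (oddTheta τ) (𝓝[≠] (-(τ / 2))) (𝓝 (oddTheta τ (-(τ / 2)))) :=
    ((differentiable_oddTheta hτ).continuous.tendsto _).mono_left nhdsWithin_le_nhds
  have h3 := (hf.sub h1).mul h2
  rw [sub_zero, zero_mul] at h3
  refine h3.congr fun x => ?_
  ring

/-- Both sides satisfy the same inhomogeneous equations under x → x + 1 and x → x + τ, and the poles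
cancel on the left, so `eq_zero_of_elliptic` applies to their difference. -/
theorem bFun_sub_bSlash_one {τ x : ℂ} (hτ : 0 < τ.im) (hx : Regular τ x) :
    bFun x τ - cexp (-(Real.pi * I / 4)) * bSlash 1 x τ =
      1 / 2 * cexp (-(Real.pi * I / 4)) * mordell x (τ + 1) := by
  have hσi : 0 < (τ + 1).im := by simpa using hτ
  have h0 : τ + 1 ≠ 0 := fun h => by simp [h] at hσi
  set ζ := cexp (-(Real.pi * I / 4)) with hζ
  have hζ2 : ζ ^ 2 = -I := exp_neg_pi_four_sq
  set Q := ((τ + 1) ^ (1 / 2 : ℂ))⁻¹ with hQ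
  set G : ℂ → ℂ := fun y => cexp (Real.pi * I * y ^ 2 / (τ + 1)) with hG
  have hM : ∀ y, mordell (y + 1) (τ + 1) = -mordell y (τ + 1) + 2 * I * ζ * Q * G (y + 1 / 2) := by
    intro y
    rw [mordell_add_one hσi, neg_I_mul_cpow hσi, ← hζ]
    have : (ζ * (τ + 1) ^ (1 / 2 : ℂ))⁻¹ = I * ζ * Q := by
      rw [mul_inv, ← hQ]
      congr 1
      exact inv_eq_of_mul_eq_one_left (by linear_combination I * hζ2 - I_sq)
    rw [div_eq_mul_inv, this]
    simp only [hG]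
    ring
  -- The natural shifts of `bSlash` are τ and τ + 1. Evaluating at y + 1 + τ in both ways isolates
  -- the shift by 1.
  have hS1 : ∀ y, Regular τ y → bSlash 1 (y + 1) τ =
      -bSlash 1 y τ - I * ζ * Q * G (y + 1 / 2) := by
    intro y hy
    have a1 := bSlash_add_tau (r := 1) one_pos hτ hy.add_one
    have a2 := bSlash_add_lower (r := 1) (x := y) one_pos hτ
    simp only [Nat.cast_one, one_mul, mul_one] at a1 a2
    rw [show y + 1 + τ = y + (τ + 1) by ring, a2] at a1
    have e1 : cexp (2 * Real.pi * I * (y + 1) + Real.pi * I * τ) =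
        cexp (2 * Real.pi * I * y + Real.pi * I * τ) := cexp_eq_of_two_pi (by ring)
    have e2 : cexp (Real.pi * I * (2 * y + (τ + 1))) =
        -cexp (2 * Real.pi * I * y + Real.pi * I * τ) := cexp_eq_neg_of_pi (by ring)
    have e3 : cexp (Real.pi * I * ((y + (τ + 1)) ^ 2 + (y + 1) + 3 * τ / 4) / (τ + 1)) =
        cexp (2 * Real.pi * I * y + Real.pi * I * τ) * ζ * G (y + 1 / 2) := by
      simp only [hG, hζ]
      rw [← Complex.exp_add, ← Complex.exp_add]
      exact cexp_eq_of_two_pi (by field_simp; ring)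
    rw [e1, e2, e3] at a1
    have hP : cexp (2 * Real.pi * I * y + Real.pi * I * τ) ≠ 0 := exp_ne_zero _
    apply mul_left_cancel₀ hP
    rw [← hQ] at a1
    linear_combination a1
  have hS2 : ∀ y, Regular τ y → bSlash 1 (y + τ) τ =
      -cexp (2 * Real.pi * I * y + Real.pi * I * τ) * bSlash 1 y τ -
        I * Q * ζ * G (y + τ + 1 / 2) := by
    intro y hy
    have a1 := bSlash_add_tau (r := 1) one_pos hτ hy
    simp only [Nat.cast_one, one_mul] at a1
    have e3 : cexp (Real.pi * I * ((y + τ) ^ 2 + y + 3 * τ / 4) / (τ + 1)) =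
        ζ * G (y + τ + 1 / 2) := by
      rw [hζ]
      simp only [hG]
      rw [← Complex.exp_add]
      congr 1
      field_simp
      ring
    rw [e3, ← hQ] at a1
    linear_combination a1
  -- The shift by τ is the shift by the parameter τ + 1 followed by the shift by -1.
  have hM2 : ∀ y, mordell (y + τ) (τ + 1) =
      -cexp (2 * Real.pi * I * y + Real.pi * I * τ) * mordell y (τ + 1) +
        2 * ζ * cexp (Real.pi * I * y + 3 * Real.pi * I * τ / 4) +
        2 * I * ζ * Q * G (y + τ + 1 / 2) := by
    intro y
    have a1 := mordell_add_tau hσi y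
    have a2 := hM (y + τ)
    rw [show y + τ + 1 = y + (τ + 1) by ring, a1] at a2
    have e1 : cexp (2 * Real.pi * I * y + Real.pi * I * (τ + 1)) =
        -cexp (2 * Real.pi * I * y + Real.pi * I * τ) := cexp_eq_neg_of_pi (by ring)
    have e2 : cexp (Real.pi * I * y + 3 * Real.pi * I * (τ + 1) / 4) =
        -(ζ * cexp (Real.pi * I * y + 3 * Real.pi * I * τ / 4)) := by
      rw [hζ, ← Complex.exp_add]
      exact cexp_eq_neg_of_pi (by ring)
    rw [e1, e2] at a2
    linear_combination a2
  have key := eq_zero_of_elliptic hτ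
    (D := fun x => bFun x τ - ζ * bSlash 1 x τ - 1 / 2 * ζ * mordell x (τ + 1)) ?_ ?_ ?_ ?_ x hx
  · exact sub_eq_zero.1 key
  · intro y hy
    exact ((differentiableAt_bFun hτ hy).sub ((differentiableAt_bSlash one_pos hτ hy).const_mul _)).sub
      ((differentiable_mordell hσi y).const_mul _)
  · intro y hy
    simp only [bFun_add_one, hS1 y hy, hM]
    linear_combination (I * ζ * 0) * hζ2
  · intro y hy
    simp only [bFun_add_tau hτ hy, hS2 y hy, hM2]
    linear_combination (-cexp (Real.pi * I * y + 3 * Real.pi * I * τ / 4)) * hζ2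
  · have h1 := tendsto_bFun_sub_bSlash (r := 1) one_pos hτ
    simp only [Nat.cast_one, mul_one] at h1
    exact tendsto_mul_oddTheta hτ ((differentiable_mordell hσi).continuous.const_mul _) h1

/-- The strategy is that of the case r = 1 with parameter T = τ + 1/2, where 2τ + 1 = 2T. Two
Mordell integrals are needed because the shift by τ exchanges the arguments x - 1/4 and x - 3/4. -/
theorem bFun_sub_bSlash_two {τ x : ℂ} (hτ : 0 < τ.im) (hx : Regular τ x) :
    bFun x τ - I * cexp (-(2 * Real.pi * I * x + Real.pi * I * τ)) * bSlash 2 (x + τ) τ =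
      (√2 : ℝ) / 4 * cexp (-(3 * Real.pi * I / 8)) *
        (mordell (x - 1 / 4) (τ + 1 / 2) - mordell (x - 3 / 4) (τ + 1 / 2)) := by
  have hTi : 0 < (τ + 1 / 2).im := by simpa using hτ
  have h0 : τ + 1 / 2 ≠ 0 := fun h => by rw [h, zero_im] at hTi; exact lt_irrefl _ hTi
  set T := τ + 1 / 2 with hT
  have hσT : 2 * τ + 1 = 2 * T := by rw [hT]; ring
  have hσ0 : 2 * τ + 1 ≠ 0 := by rw [hσT]; exact mul_ne_zero two_ne_zero h0
  set ζ := cexp (-(Real.pi * I / 4)) with hζ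
  have hζ2 : ζ ^ 2 = -I := exp_neg_pi_four_sq
  set η := cexp (-(Real.pi * I / 8)) with hη
  have hη2 : η ^ 2 = ζ := by
    rw [hη, hζ, ← Complex.exp_nat_mul]; congr 1; push_cast; ring
  have hη3 : cexp (-(3 * Real.pi * I / 8)) = η ^ 3 := by
    rw [hη, ← Complex.exp_nat_mul]; congr 1; push_cast; ring
  set w : ℂ := ((√2 : ℝ) : ℂ) with hw
  have hw2 : w ^ 2 = 2 := sqrt_two_sq
  have hwζ : w * ζ = 1 - I := sqrt_two_mul_exp
  have hw0 : w ≠ 0 := fun h => by rw [h] at hw2; norm_num at hw2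
  set Q := ((2 * τ + 1) ^ (1 / 2 : ℂ))⁻¹ with hQ
  set G : ℂ → ℂ := fun y => cexp (Real.pi * I * y ^ 2 / T) with hG
  set P : ℂ → ℂ := fun y => cexp (2 * Real.pi * I * y + Real.pi * I * τ) with hP
  have hP0 : ∀ y, P y ≠ 0 := fun y => exp_ne_zero _
  have hσw : (2 * τ + 1) ^ (1 / 2 : ℂ) = w * T ^ (1 / 2 : ℂ) := by
    have h2 : ((2 : ℝ) : ℂ) ^ (1 / 2 : ℂ) = w := by
      have := ofReal_sq_cpow_half (Real.sqrt_nonneg 2)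
      rwa [Real.sq_sqrt (by norm_num)] at this
    rw [hσT, ← h2, ← ofReal_mul_cpow (by norm_num : (0 : ℝ) < 2)]
    norm_num
  have hM : ∀ y, mordell (y + 1) T = -mordell y T + 2 * w * I * ζ * Q * G (y + 1 / 2) := by
    intro y
    rw [mordell_add_one hTi, neg_I_mul_cpow hTi, ← hζ]
    have : (ζ * T ^ (1 / 2 : ℂ))⁻¹ = w * (I * ζ) * Q := by
      have h5 : ζ⁻¹ = I * ζ := inv_eq_of_mul_eq_one_left (by linear_combination I * hζ2 - I_sq)
      rw [mul_inv, hQ, hσw, mul_inv, h5]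
      field_simp
    rw [div_eq_mul_inv, this]
    simp only [hG]
    ring
  have hP1 : ∀ y, P (y + 1) = P y := fun y => by
    exact cexp_eq_of_two_pi (by ring)
  have hPτ : ∀ y, P (y + τ) = P y * cexp (2 * Real.pi * I * τ) := fun y => by
    simp only [hP]
    rw [← Complex.exp_add]
    congr 1; ring
  have hG1 : ∀ y, G (y + τ + 1 / 4) = P y * G (y - 1 / 4) := fun y => by
    simp only [hP, hG]
    rw [← Complex.exp_add]
    congr 1; field_simp; rw [hT]; ring
  have hG2 : ∀ y, G (y + τ + 3 / 4) = -(P y * G (y + 1 / 4)) := fun y => by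
    simp only [hP, hG]
    rw [← Complex.exp_add]
    exact cexp_eq_neg_of_pi (by field_simp; rw [hT]; ring)
  -- W is the transformed function occurring in the theorem: by `hS2` it equals i P(y)⁻¹ times
  -- `bSlash` at y + τ. In this form its singular part at -τ/2 is visible.
  set W : ℂ → ℂ := fun y => -I * bSlash 2 y τ + η * Q * G (y - 1 / 4) with hW
  have hS2 : ∀ y, Regular τ y → bSlash 2 (y + τ) τ = -I * P y * W y := by
    intro y hy
    have a1 := bSlash_add_tau (r := 2) two_pos hτ hy
    simp only [Nat.cast_ofNat] at a1
    have e3 : cexp (Real.pi * I * (2 * (y + τ) ^ 2 + y + 3 * τ / 4) / (2 * τ + 1)) =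
        η * G (y + τ + 1 / 4) := by
      rw [hη, hσT]
      simp only [hG]
      rw [← Complex.exp_add]
      congr 1
      field_simp
      rw [hT]
      ring
    rw [e3, ← hQ, hG1] at a1
    simp only [hW]
    rw [a1]
    linear_combination (-(P y * bSlash 2 y τ)) * I_sq
  have hWτ : ∀ y, Regular τ y → W (y + τ) = -P y * W y + η * Q * G (y + τ - 1 / 4) := by
    intro y hy
    have : W (y + τ) = -I * bSlash 2 (y + τ) τ + η * Q * G (y + τ - 1 / 4) := rfl
    rw [this, hS2 y hy]
    linear_combination (P y * W y) * I_sq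
  -- The point y + 1 + 2τ is reached by the shift 2τ + 1, and also from y + 1 by two shifts by τ.
  -- Comparing gives the shift by 1.
  have hW1 : ∀ y, Regular τ y → W (y + 1) = -W y + η * Q * (G (y - 1 / 4) - G (y + 1 / 4)) := by
    intro y hy
    have a1 := hS2 (y + 1 + τ) hy.add_one.add_tau
    have a2 := hWτ (y + 1) hy.add_one
    have a3 := bSlash_add_lower (r := 2) (x := y) two_pos hτ
    simp only [Nat.cast_ofNat] at a3
    have e1 : cexp (Real.pi * I * 2 * (2 * y + (2 * τ + 1))) =
        P y * (P y * cexp (2 * Real.pi * I * τ)) := by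
      simp only [hP]
      rw [← Complex.exp_add, ← Complex.exp_add]
      exact cexp_eq_of_two_pi (by ring)
    rw [show y + 1 + τ + τ = y + (2 * τ + 1) by ring, a3, e1, a2, hPτ, hP1,
      show y + 1 + τ - 1 / 4 = y + τ + 3 / 4 by ring, hG2] at a1
    have hq : P y * (P y * cexp (2 * Real.pi * I * τ)) ≠ 0 :=
      mul_ne_zero (hP0 y) (mul_ne_zero (hP0 y) (exp_ne_zero _))
    apply mul_left_cancel₀ hq
    have hWy : W y = -I * bSlash 2 y τ + η * Q * G (y - 1 / 4) := rfl
    rw [hWy]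
    linear_combination I * a1 + P y * (P y * cexp (2 * Real.pi * I * τ)) *
      (W (y + 1) + η * Q * G (y + 1 / 4)) * I_sq
  have hM1 : ∀ y, mordell (y + 1 - 1 / 4) T =
      -mordell (y - 1 / 4) T + 2 * w * I * ζ * Q * G (y + 1 / 4) := fun y => by
    have := hM (y - 1 / 4)
    rw [show y - 1 / 4 + 1 = y + 1 - 1 / 4 by ring, show y - 1 / 4 + 1 / 2 = y + 1 / 4 by ring] at this
    exact this
  have hM3 : ∀ y, mordell (y + 1 - 3 / 4) T =
      -mordell (y - 3 / 4) T + 2 * w * I * ζ * Q * G (y - 1 / 4) := fun y => by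
    have := hM (y - 3 / 4)
    rw [show y - 3 / 4 + 1 = y + 1 - 3 / 4 by ring, show y - 3 / 4 + 1 / 2 = y - 1 / 4 by ring] at this
    exact this
  have hMτ1 : ∀ y, mordell (y + τ - 1 / 4) T = P y * mordell (y - 3 / 4) T +
      2 * η ^ 3 * cexp (Real.pi * I * y + 3 * Real.pi * I * τ / 4) := fun y => by
    have a1 := mordell_add_tau hTi (y - 3 / 4)
    rw [show y - 3 / 4 + T = y + τ - 1 / 4 by rw [hT]; ring] at a1
    have e1 : cexp (2 * Real.pi * I * (y - 3 / 4) + Real.pi * I * T) = -P y := by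
      simp only [hP]
      exact cexp_eq_neg_of_neg_pi (by rw [hT]; ring)
    have e2 : cexp (Real.pi * I * (y - 3 / 4) + 3 * Real.pi * I * T / 4) =
        η ^ 3 * cexp (Real.pi * I * y + 3 * Real.pi * I * τ / 4) := by
      rw [← hη3, ← Complex.exp_add]
      congr 1; rw [hT]; ring
    rw [a1, e1, e2]
    ring
  have hMτ3 : ∀ y, mordell (y + τ - 3 / 4) T = P y * mordell (y - 1 / 4) T -
      2 * (I * η ^ 3) * cexp (Real.pi * I * y + 3 * Real.pi * I * τ / 4) +
      2 * w * I * ζ * Q * G (y + τ - 1 / 4) := fun y => by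
    have a1 := mordell_add_tau hTi (y - 1 / 4)
    have a2 := hM3 (y + τ)
    rw [show y + τ + 1 - 3 / 4 = y - 1 / 4 + T by rw [hT]; ring, a1] at a2
    have e1 : cexp (2 * Real.pi * I * (y - 1 / 4) + Real.pi * I * T) = P y := by
      simp only [hP]
      congr 1; rw [hT]; ring
    have e2 : cexp (Real.pi * I * (y - 1 / 4) + 3 * Real.pi * I * T / 4) =
        I * η ^ 3 * cexp (Real.pi * I * y + 3 * Real.pi * I * τ / 4) := by
      rw [← hη3, mul_assoc I, ← Complex.exp_add]
      exact cexp_eq_I_mul (by rw [hT]; ring)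
    rw [e1, e2] at a2
    linear_combination a2
  have hη4 : η ^ 4 = -I := by rw [← hζ2, ← hη2]; ring
  have hwη : w * η ^ 2 = 1 - I := by rw [hη2]; exact hwζ
  have key := eq_zero_of_elliptic hτ
    (D := fun x => bFun x τ - W x - w / 4 * η ^ 3 * (mordell (x - 1 / 4) T - mordell (x - 3 / 4) T))
    ?_ ?_ ?_ ?_ x hx
  · have hne : cexp (-(2 * Real.pi * I * x + Real.pi * I * τ)) * P x = 1 := by
      simp only [hP]
      rw [← Complex.exp_add, neg_add_cancel, Complex.exp_zero]
    rw [hS2 x hx, hη3]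
    linear_combination key + I ^ 2 * W x * hne + W x * I_sq
  · intro y hy
    have hd : ∀ c : ℂ, DifferentiableAt ℂ (fun y => mordell (y - c) T) y := fun c =>
      (differentiable_mordell hTi (y - c)).comp y (f := fun y => y - c) (by fun_prop)
    refine ((differentiableAt_bFun hτ hy).sub ?_).sub (((hd _).sub (hd _)).const_mul _)
    refine ((differentiableAt_bSlash two_pos hτ hy).const_mul _).add ?_
    simp only [hG]
    fun_prop
  · intro y hy
    simp only [bFun_add_one, hW1 y hy, hM1, hM3]
    rw [← hη2]
    linear_combination (-(Q * (G (y + 1 / 4) - G (y - 1 / 4)) * I * η ^ 5 / 2)) * hw2 -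
      (Q * η * (G (y + 1 / 4) - G (y - 1 / 4)) * I) * hη4 +
      (Q * η * (G (y + 1 / 4) - G (y - 1 / 4))) * I_sq
  · intro y hy
    simp only [bFun_add_tau hτ hy, hWτ y hy, hMτ1, hMτ3]
    change _ = -P y * _
    change -P y * _ - _ - _ - _ = _
    rw [← hη2]
    generalize cexp (Real.pi * I * y + 3 * Real.pi * I * τ / 4) = F
    linear_combination (-(F / 2 * η ^ 4 * (1 + I))) * hwη - 1 / 2 * (1 - I ^ 2) * F * hη4 -
      I / 2 * F * I_sq + (I * η ^ 5 / 2) * Q * G (y + τ - 1 / 4) * hw2 +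
      Q * G (y + τ - 1 / 4) * I * η * hη4 - Q * G (y + τ - 1 / 4) * η * I_sq
  · have h1 := tendsto_bFun_sub_bSlash (r := 2) two_pos hτ
    have e1 : cexp (-(Real.pi * I * (2 : ℕ) / 4)) = -I := by
      rw [← cexp_neg_pi_div_two]
      congr 1; push_cast; ring
    rw [e1] at h1
    have hc : Continuous fun y => η * Q * G (y - 1 / 4) + w / 4 * η ^ 3 *
        (mordell (y - 1 / 4) T - mordell (y - 3 / 4) T) := by
      have hmc := (differentiable_mordell hTi).continuous
      have h2 : ∀ c : ℂ, Continuous fun y => mordell (y - c) T := fun c => hmc.comp (by fun_prop)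
      refine Continuous.add ?_ (((h2 _).sub (h2 _)).const_mul _)
      simp only [hG]
      fun_prop
    refine (tendsto_mul_oddTheta hτ hc h1).congr fun y => ?_
    simp only [hW]
    ring

section

/-! ### The transformation of `V` on the upper half-plane -/

lemma V_eq_bFun (A : ℤ) {C : ℕ} (hC : 0 < C) (a : ℕ) {τ : ℂ} (hτ : 0 < τ.im) :
    V A C a τ = I ^ (a + 1) * cexp (-(Real.pi * I * (((A / C : ℝ) : ℂ) - 1 / 2) ^ 2 * τ)) *
      bFun ((((A / C : ℝ) : ℂ) - 1 / 2) * τ + a / 2) τ := by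
  have hC0 : (C : ℂ) ≠ 0 := by exact_mod_cast hC.ne'
  have h : 2 * alpha A C a τ = ((((A / C : ℝ) : ℂ) - 1 / 2) * τ + a / 2) + τ / 2 := by
    rw [alpha]; push_cast; ring
  rw [V, muAlpha, if_pos hτ, h, mu_half_eq_sinSum, e, bFun]
  congr 3
  push_cast
  field_simp
  ring

/-- Raising a by 2 moves x by 1, and the sign change of B cancels i² = -1. Only a = 0 and a = 1 then
need treatment. -/
lemma V_add_two (A : ℤ) {C : ℕ} (hC : 0 < C) (a : ℕ) {τ : ℂ} (hτ : 0 < τ.im) :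
    V A C (a + 2) τ = V A C a τ := by
  rw [V_eq_bFun A hC _ hτ, V_eq_bFun A hC _ hτ]
  have : (((A / C : ℝ) : ℂ) - 1 / 2) * τ + ((a + 2 : ℕ) : ℂ) / 2 =
      ((((A / C : ℝ) : ℂ) - 1 / 2) * τ + a / 2) + 1 := by push_cast; ring
  rw [this, bFun_add_one, show a + 2 + 1 = a + 1 + 2 by ring, pow_add _ _ 2, I_sq]
  ring

lemma regular_of_mem_Ioo {s : ℝ} (h0 : 0 < s) (h1 : s < 1) (c : ℝ) {τ : ℂ} (hτ : 0 < τ.im) :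
    Regular τ (((s : ℂ) - 1 / 2) * τ + c) := fun n => by
  have h : ((s : ℂ) - 1 / 2) * τ + c + (n + 1 / 2) * τ = ((n + s : ℝ) : ℂ) * τ + c := by
    push_cast; ring
  rw [h]
  refine sin_pi_ne_zero_of_im ?_
  have h2 : (n : ℝ) + s ≠ 0 := fun h => by
    have := min_le_abs_int_add s n
    rw [h, abs_zero] at this
    exact absurd this (not_le.2 (lt_min h0 (by linarith)))
  simp only [add_im, im_ofReal_mul, ofReal_im, add_zero]
  exact mul_ne_zero h2 hτ.ne'

/-! ### Period integrals along vertical lines as Mordell integrals -/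

/-- Since n² + n is even, the phases on the line Re z = 1 become a single linear character, with β =
s. -/
lemma gTheta_one (s t : ℝ) : gTheta s (1 / 2) ((1 : ℝ) + t * I) =
    cexp (Real.pi * I * (s ^ 2 + s)) * lineTheta s s t := by
  rw [gTheta, lineTheta, ← tsum_mul_left]
  refine tsum_congr fun n => ?_
  obtain ⟨m, hm⟩ := Int.even_mul_succ_self n
  have hm' : (n : ℂ) * (n + 1) = m + m := by exact_mod_cast hm
  have : Real.pi * I * ((s : ℂ) + n) ^ 2 * ((1 : ℝ) + t * I) +
      2 * Real.pi * I * ((s : ℂ) + n) * ((1 / 2 : ℝ) : ℂ) = Real.pi * I * (s ^ 2 + s) +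
        2 * Real.pi * I * n * s + -Real.pi * ((n : ℂ) + s) ^ 2 * t + (m : ℂ) * (2 * Real.pi * I) := by
    push_cast
    linear_combination (Real.pi * I) * hm' + (Real.pi * ((n : ℂ) + s) ^ 2 * t) * I_sq
  rw [this, Complex.exp_add, exp_int_mul_two_pi_mul_I, Complex.exp_add, Complex.exp_add]
  ring

lemma summable_lineTheta (s β : ℝ) {t : ℝ} (ht : 0 < t) :
    Summable (fun n : ℤ => ((n : ℂ) + s) * cexp (2 * Real.pi * I * n * β) *
      cexp (-Real.pi * ((n : ℂ) + s) ^ 2 * t)) := (hasSum_lineTheta s β ht).summable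

/-- On Re z = 1/2 the phase e^{πin²/2} depends only on the parity of n, hence is a combination of 1
and (-1)ⁿ. This produces two line theta functions whose parameters β differ by 1/2. -/
lemma gTheta_half (s : ℝ) {t : ℝ} (ht : 0 < t) : gTheta s 0 ((1 / 2 : ℝ) + t * I) =
    cexp (Real.pi * I * s ^ 2 / 2) * ((1 + I) / 2 * lineTheta s (s / 2) t +
      (1 - I) / 2 * lineTheta s ((s + 1) / 2) t) := by
  rw [gTheta, lineTheta, lineTheta, ← tsum_mul_left, ← tsum_mul_left,
    ← ((summable_lineTheta s _ ht).mul_left _).tsum_add ((summable_lineTheta s _ ht).mul_left _),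
    ← tsum_mul_left]
  refine tsum_congr fun n => ?_
  have h1 : Real.pi * I * ((s : ℂ) + n) ^ 2 * ((1 / 2 : ℝ) + t * I) +
      2 * Real.pi * I * ((s : ℂ) + n) * ((0 : ℝ) : ℂ) = Real.pi * I * s ^ 2 / 2 +
        Real.pi * I * n * s + -Real.pi * ((n : ℂ) + s) ^ 2 * t + Real.pi / 2 * I * n ^ 2 := by
    push_cast
    linear_combination (Real.pi * ((n : ℂ) + s) ^ 2 * t) * I_sq
  have h2 : 2 * Real.pi * I * n * ((s / 2 : ℝ) : ℂ) = Real.pi * I * n * s := by push_cast; ring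
  have h3 : 2 * Real.pi * I * n * (((s + 1) / 2 : ℝ) : ℂ) = Real.pi * I * n * s + Real.pi * I * n := by
    push_cast; ring
  rw [h1, h2, h3, Complex.exp_add, Complex.exp_add, Complex.exp_add, Complex.exp_add,
    exp_pi_mul_I_mul_int]
  have h4 : cexp (Real.pi / 2 * I * (n : ℂ) ^ 2) = (1 + I) / 2 + (1 - I) / 2 * (-1) ^ n := by
    rcases Int.even_or_odd n with h | h
    · rw [h.neg_one_zpow]
      obtain ⟨m, rfl⟩ := h
      have : (Real.pi / 2 * I * ((m + m : ℤ) : ℂ) ^ 2) = ((m ^ 2 : ℤ) : ℂ) * (2 * Real.pi * I) := by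
        push_cast; ring
      rw [this, exp_int_mul_two_pi_mul_I]; ring
    · rw [h.neg_one_zpow]
      obtain ⟨m, rfl⟩ := h
      have : (Real.pi / 2 * I * ((2 * m + 1 : ℤ) : ℂ) ^ 2) =
          ((m ^ 2 + m : ℤ) : ℂ) * (2 * Real.pi * I) + Real.pi / 2 * I := by
        push_cast; ring
      rw [this, Complex.exp_add, exp_int_mul_two_pi_mul_I, exp_pi_div_two_mul_I]; ring
  rw [h4]
  ring

lemma neg_I_mul_vertical (p t : ℝ) (τ : ℂ) : -I * ((p + t * I) + τ) = (t : ℂ) - I * (τ + p) := by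
  linear_combination (-t : ℂ) * I_sq

/-- For `T ≠ 0` with `Im T ≥ 0`, the weight `(t - iT)^{-1/2}` is bounded on `t > 0`. -/
lemma norm_weight_le {T : ℂ} (hT0 : T ≠ 0) (hT : 0 ≤ T.im) {t : ℝ} (ht : 0 < t) :
    ‖((t : ℂ) - I * T) ^ (1 / 2 : ℂ)‖⁻¹ ≤ (√‖T‖)⁻¹ := by
  have h : (t : ℂ) - I * T = -I * (t * I + T) := by linear_combination (t : ℂ) * I_sq
  rw [h, norm_cpow_half]
  have : ‖T‖ ≤ ‖t * I + T‖ := by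
    rw [Complex.norm_def, Complex.norm_def]
    refine Real.sqrt_le_sqrt ?_
    simp only [normSq_apply, add_re, mul_re, ofReal_re, I_re, mul_zero, ofReal_im, I_im, mul_one,
      sub_self, zero_add, add_im, mul_im, add_zero]
    nlinarith
  have h0 : 0 < ‖T‖ := norm_pos_iff.2 hT0
  gcongr

lemma aestronglyMeasurable_weight (T : ℂ) (μ : Measure ℝ) :
    AEStronglyMeasurable (fun t : ℝ => ((t : ℂ) - I * T) ^ (1 / 2 : ℂ)) μ := by
  have : Measurable fun t : ℝ => ((t : ℂ) - I * T) ^ (1 / 2 : ℂ) := by fun_prop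
  exact this.aestronglyMeasurable

lemma integrableOn_div_weight {f : ℝ → ℂ} (hf : IntegrableOn f (Set.Ioi 0)) {T : ℂ}
    (hT0 : T ≠ 0) (hT : 0 ≤ T.im) :
    IntegrableOn (fun t => f t / ((t : ℂ) - I * T) ^ (1 / 2 : ℂ)) (Set.Ioi 0) := by
  refine (hf.norm.mul_const (√‖T‖)⁻¹).mono'
    (hf.aestronglyMeasurable.div₀ (aestronglyMeasurable_weight T _)) ?_
  filter_upwards [ae_restrict_mem measurableSet_Ioi] with t ht
  rw [norm_div, div_eq_mul_inv]
  exact mul_le_mul_of_nonneg_left (norm_weight_le hT0 hT ht) (norm_nonneg _)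

lemma periodIntegrand_eq (p s β : ℝ) (τ : ℂ) (t : ℝ) : periodIntegrand p s β τ t =
    gTheta s β (p + t * I) / ((t : ℂ) - I * (τ + p)) ^ (1 / 2 : ℂ) * I := by
  rw [periodIntegrand, neg_I_mul_vertical]

variable {s : ℝ}

lemma integrableOn_gTheta_one (h0 : 0 < s) (h1 : s < 1) :
    IntegrableOn (fun t : ℝ => gTheta s (1 / 2) ((1 : ℝ) + t * I)) (Set.Ioi 0) := by
  simp only [gTheta_one]
  exact (integrableOn_lineTheta h0 h1 h0 h1).const_mul _

lemma integrableOn_gTheta_half (h0 : 0 < s) (h1 : s < 1) :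
    IntegrableOn (fun t : ℝ => gTheta s 0 ((1 / 2 : ℝ) + t * I)) (Set.Ioi 0) := by
  have h := (((integrableOn_lineTheta h0 h1 (β := s / 2) (by linarith) (by linarith)).const_mul
    ((1 + I) / 2)).add ((integrableOn_lineTheta h0 h1 (β := (s + 1) / 2) (by linarith)
      (by linarith)).const_mul ((1 - I) / 2))).const_mul (cexp (Real.pi * I * s ^ 2 / 2))
  refine IntegrableOn.congr_fun h (fun t ht => ?_) measurableSet_Ioi
  exact (gTheta_half s (Set.mem_Ioi.1 ht)).symm

lemma integrableOn_periodIntegrand {p β : ℝ}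
    (h : IntegrableOn (fun t : ℝ => gTheta s β (p + t * I)) (Set.Ioi 0)) {τ : ℂ} (hτ0 : τ + p ≠ 0)
    (hτ : 0 ≤ τ.im) : IntegrableOn (periodIntegrand p s β τ) (Set.Ioi 0) := by
  have := (integrableOn_div_weight h hτ0 (by simpa using hτ)).mul_const I
  exact IntegrableOn.congr_fun this (fun t _ => (periodIntegrand_eq p s β τ t).symm) measurableSet_Ioi

lemma periodIntegral_one (h0 : 0 < s) (h1 : s < 1) {τ : ℂ} (hτ : 0 < τ.im) :
    periodIntegral 1 s (1 / 2) τ = -(cexp (Real.pi * I * s ^ 2) *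
      cexp (-(Real.pi * I * (s - 1 / 2) ^ 2 * (τ + 1))) * mordell ((s - 1 / 2) * τ) (τ + 1)) := by
  have hT : 0 < (τ + 1).im := by simpa using hτ
  have hz := integral_lineTheta_eq_mordell h0 h1 h0 h1 hT
  have h : ∀ t : ℝ, periodIntegrand 1 s (1 / 2) τ t = I * cexp (Real.pi * I * (s ^ 2 + s)) *
      (lineTheta s s t / ((t : ℂ) - I * (τ + 1)) ^ (1 / 2 : ℂ)) := fun t => by
    rw [periodIntegrand_eq, gTheta_one, ofReal_one]; ring
  have h2 : ((s : ℂ) - 1 / 2) * (τ + 1) - (s - 1 / 2) = (s - 1 / 2) * τ := by ring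
  simp only [periodIntegral, h]
  rw [integral_const_mul, hz, h2, show (Real.pi * I * ((s : ℂ) ^ 2 + s)) =
    Real.pi * I * s ^ 2 + Real.pi * I * s by ring, Complex.exp_add, Complex.exp_neg (Real.pi * I * s)]
  have := Complex.exp_ne_zero (Real.pi * I * s)
  field_simp
  rw [I_sq, neg_one_mul]

lemma periodIntegral_half (h0 : 0 < s) (h1 : s < 1) {τ : ℂ} (hτ : 0 < τ.im) :
    periodIntegral (1 / 2) s 0 τ = -((1 + I) / 2 * cexp (-(Real.pi * I / 8)) *
      cexp (-(Real.pi * I * (s - 1 / 2) ^ 2 * τ)) *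
        (mordell ((s - 1 / 2) * τ + 1 / 4) (τ + 1 / 2) -
          mordell ((s - 1 / 2) * τ - 1 / 4) (τ + 1 / 2))) := by
  have hT : 0 < (τ + 1 / 2).im := by simpa using hτ
  have hT0 : τ + 1 / 2 ≠ 0 := fun h => by rw [h] at hT; exact lt_irrefl 0 hT
  have hz1 := integral_lineTheta_eq_mordell h0 h1 (β := s / 2) (by linarith) (by linarith) hT
  have hz2 := integral_lineTheta_eq_mordell h0 h1 (β := (s + 1) / 2) (by linarith) (by linarith) hT
  have i1 := integrableOn_div_weight (integrableOn_lineTheta h0 h1 (β := s / 2) (by linarith)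
    (by linarith)) hT0 hT.le
  have i2 := integrableOn_div_weight (integrableOn_lineTheta h0 h1 (β := (s + 1) / 2) (by linarith)
    (by linarith)) hT0 hT.le
  have h : ∀ t ∈ Set.Ioi (0 : ℝ), periodIntegrand (1 / 2) s 0 τ t =
      I * cexp (Real.pi * I * s ^ 2 / 2) * ((1 + I) / 2 *
        (lineTheta s (s / 2) t / ((t : ℂ) - I * (τ + 1 / 2)) ^ (1 / 2 : ℂ)) + (1 - I) / 2 *
        (lineTheta s ((s + 1) / 2) t / ((t : ℂ) - I * (τ + 1 / 2)) ^ (1 / 2 : ℂ))) := fun t ht => by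
    rw [periodIntegrand_eq, gTheta_half s ht, show ((1 / 2 : ℝ) : ℂ) = 1 / 2 by push_cast; rfl]
    ring
  have h2 : ((s : ℂ) - 1 / 2) * (τ + 1 / 2) - (((s / 2 : ℝ) : ℂ) - 1 / 2) =
      (s - 1 / 2) * τ + 1 / 4 := by push_cast; ring
  have h3 : ((s : ℂ) - 1 / 2) * (τ + 1 / 2) - ((((s + 1) / 2 : ℝ) : ℂ) - 1 / 2) =
      (s - 1 / 2) * τ - 1 / 4 := by push_cast; ring
  rw [periodIntegral, setIntegral_congr_fun measurableSet_Ioi h, integral_const_mul,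
    integral_add (i1.const_mul _) (i2.const_mul _), integral_const_mul, integral_const_mul,
    hz1, hz2, h2, h3]
  have e1 : cexp (Real.pi * I * s ^ 2 / 2) * cexp (-(Real.pi * I * ((s / 2 : ℝ) : ℂ))) *
      cexp (-(Real.pi * I * ((s : ℂ) - 1 / 2) ^ 2 * (τ + 1 / 2))) =
      cexp (-(Real.pi * I / 8)) * cexp (-(Real.pi * I * (s - 1 / 2) ^ 2 * τ)) := by
    rw [← Complex.exp_add, ← Complex.exp_add, ← Complex.exp_add]
    congr 1; push_cast; ring
  have e2 : cexp (-(Real.pi * I * (((s + 1) / 2 : ℝ) : ℂ))) =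
      -I * cexp (-(Real.pi * I * ((s / 2 : ℝ) : ℂ))) := by
    rw [← cexp_neg_pi_div_two, ← Complex.exp_add]
    congr 1; push_cast; ring
  rw [e2]
  generalize mordell _ _ = M1
  generalize mordell _ _ = M2
  rw [mul_assoc _ _ (cexp (-(Real.pi * I * ((s : ℂ) - 1 / 2) ^ 2 * τ))), ← e1]
  linear_combination ((cexp (Real.pi * I * s ^ 2 / 2) * cexp (-(Real.pi * I * ((s / 2 : ℝ) : ℂ))) *
      cexp (-(Real.pi * I * ((s : ℂ) - 1 / 2) ^ 2 * (τ + 1 / 2)))) *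
        ((1 + I) / 2 * M1 - (I + 1 - I ^ 2) / 2 * M2)) * I_sq

end

/-! ### The transformations (1) and (2) on the upper half-plane -/

section

variable {A : ℤ} {C a : ℕ}

/-- `bFun_sub_bSlash_one` at x = (s - 1/2)τ with s = A/C; 0 < s < 1 makes this point regular. -/
lemma V_zero_lower (hC : 0 < C) (h0 : 0 < (A / C : ℝ)) (h1 : (A / C : ℝ) < 1) {τ : ℂ}
    (hτ : 0 < τ.im) :
    V A C 0 τ - (e (1 / 8))⁻¹ * (τ + 1) ^ (-(1 / 2) : ℂ) * V A C 0 (τ / (τ + 1)) =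
      -I / 2 * e (-A / (2 * C)) * periodIntegral 1 (A / C) (1 / 2) τ := by
  have hσ : 0 < (τ + 1).im := by simpa using hτ
  have hσ0 : τ + 1 ≠ 0 := fun h => by rw [h] at hσ; exact lt_irrefl 0 hσ
  have hL : 0 < (τ / (τ + 1)).im := by simpa using im_div_lower one_pos hτ
  rw [periodIntegral_one h0 h1 hτ, V_eq_bFun A hC 0 hτ, V_eq_bFun A hC 0 hL]
  have hA : e (-A / (2 * C)) = cexp (-(Real.pi * I * ((A / C : ℝ) : ℂ))) := by
    have hC0 : (C : ℂ) ≠ 0 := by exact_mod_cast hC.ne'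
    rw [e]; congr 1; push_cast; field_simp
  rw [hA]
  generalize (A / C : ℝ) = s at *
  have hz : (e (1 / 8))⁻¹ = cexp (-(Real.pi * I / 4)) := by
    rw [e, ← Complex.exp_neg]; congr 1; ring
  have hreg := regular_of_mem_Ioo h0 h1 0 hτ
  simp only [ofReal_zero, add_zero] at hreg
  have key := bFun_sub_bSlash_one hτ hreg
  simp only [bSlash, Nat.cast_one, one_mul, mul_one] at key
  simp only [CharP.cast_eq_zero, zero_div, add_zero, zero_add, pow_one]
  rw [hz, Complex.cpow_neg]
  have e1 : cexp (-(Real.pi * I * ((s : ℂ) - 1 / 2) ^ 2 * (τ / (τ + 1)))) =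
      cexp (-(Real.pi * I * ((s : ℂ) - 1 / 2) ^ 2 * τ)) *
        cexp (Real.pi * I * (((s : ℂ) - 1 / 2) * τ) ^ 2 / (τ + 1)) := by
    rw [← Complex.exp_add]; congr 1; field_simp; ring
  have e2 : cexp (-(Real.pi * I * (s : ℂ))) * (cexp (Real.pi * I * (s : ℂ) ^ 2) *
      cexp (-(Real.pi * I * ((s : ℂ) - 1 / 2) ^ 2 * (τ + 1)))) =
      cexp (-(Real.pi * I * ((s : ℂ) - 1 / 2) ^ 2 * τ)) * cexp (-(Real.pi * I / 4)) := by
    rw [← Complex.exp_add, ← Complex.exp_add, ← Complex.exp_add]; congr 1; ring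
  rw [e1]
  have h3 : ((s : ℂ) - 1 / 2) * (τ / (τ + 1)) = ((s : ℂ) - 1 / 2) * τ / (τ + 1) := by ring
  rw [h3]
  linear_combination (I * cexp (-(Real.pi * I * ((s : ℂ) - 1 / 2) ^ 2 * τ))) * key -
    (I / 2 * mordell (((s : ℂ) - 1 / 2) * τ) (τ + 1)) * e2

/-- `bFun_sub_bSlash_two` at x = (s - 1/2)τ + 1/2, where the two Mordell arguments become those of
`periodIntegral_half`. -/
lemma V_one_lower (hC : 0 < C) (h0 : 0 < (A / C : ℝ)) (h1 : (A / C : ℝ) < 1) {τ : ℂ}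
    (hτ : 0 < τ.im) :
    V A C 1 τ - (2 * τ + 1) ^ (-(1 / 2) : ℂ) * V A C 1 (τ / (2 * τ + 1)) =
      -I / 2 * periodIntegral (1 / 2) (A / C) 0 τ := by
  have hσ : 0 < (2 * τ + 1).im := by simpa using hτ
  have hσ0 : 2 * τ + 1 ≠ 0 := fun h => by rw [h] at hσ; exact lt_irrefl 0 hσ
  have hL : 0 < (τ / (2 * τ + 1)).im := by simpa using im_div_lower two_pos hτ
  rw [periodIntegral_half h0 h1 hτ, V_eq_bFun A hC 1 hτ, V_eq_bFun A hC 1 hL]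
  generalize (A / C : ℝ) = s at *
  have hreg := regular_of_mem_Ioo h0 h1 (1 / 2) hτ
  rw [show ((1 / 2 : ℝ) : ℂ) = 1 / 2 by push_cast; rfl] at hreg
  have key := bFun_sub_bSlash_two hτ hreg
  simp only [bSlash, Nat.cast_ofNat] at key
  simp only [Nat.cast_one, Nat.reduceAdd, I_sq]
  rw [Complex.cpow_neg]
  have h3 : ((s : ℂ) - 1 / 2) * (τ / (2 * τ + 1)) + 1 / 2 =
      (((s : ℂ) - 1 / 2) * τ + 1 / 2 + τ) / (2 * τ + 1) := by field_simp; ring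
  have h4 : ((s : ℂ) - 1 / 2) * τ + 1 / 2 - 1 / 4 = ((s : ℂ) - 1 / 2) * τ + 1 / 4 := by ring
  have h5 : ((s : ℂ) - 1 / 2) * τ + 1 / 2 - 3 / 4 = ((s : ℂ) - 1 / 2) * τ - 1 / 4 := by ring
  rw [h4, h5] at key
  rw [h3]
  have e1 : cexp (-(Real.pi * I * ((s : ℂ) - 1 / 2) ^ 2 * (τ / (2 * τ + 1)))) =
      cexp (-(Real.pi * I * ((s : ℂ) - 1 / 2) ^ 2 * τ)) *
        (I * cexp (-(2 * Real.pi * I * (((s : ℂ) - 1 / 2) * τ + 1 / 2) + Real.pi * I * τ)) *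
        cexp (Real.pi * I * 2 * (((s : ℂ) - 1 / 2) * τ + 1 / 2 + τ) ^ 2 / (2 * τ + 1))) := by
    rw [mul_assoc I, ← Complex.exp_add, mul_left_comm, ← Complex.exp_add]
    refine cexp_eq_I_mul ?_
    field_simp; ring
  have e2 : cexp (-(3 * Real.pi * I / 8)) = cexp (-(Real.pi * I / 8)) * cexp (-(Real.pi * I / 4)) := by
    rw [← Complex.exp_add]; congr 1; ring
  rw [e2] at key
  rw [e1]
  have h6 := sqrt_two_mul_exp
  generalize mordell _ _ = M1 at *
  generalize mordell _ _ = M2 at *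
  linear_combination (-cexp (-(Real.pi * I * ((s : ℂ) - 1 / 2) ^ 2 * τ))) * key -
    (cexp (-(Real.pi * I * ((s : ℂ) - 1 / 2) ^ 2 * τ)) * cexp (-(Real.pi * I / 8)) *
      (M1 - M2) / 4) * h6 - (cexp (-(Real.pi * I * ((s : ℂ) - 1 / 2) ^ 2 * τ)) *
      cexp (-(Real.pi * I / 8)) * (M1 - M2) / 4) * I_sq

lemma V_lower_of_even (hC : 0 < C) (ha : a ≤ 3) (hae : Even a) (h0 : 0 < (A / C : ℝ))
    (h1 : (A / C : ℝ) < 1) {τ : ℂ} (hτ : 0 < τ.im) :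
    V A C a τ - (e (1 / 8))⁻¹ * (τ + 1) ^ (-(1 / 2) : ℂ) * V A C a (τ / (τ + 1)) =
      -I / 2 * e (-A / (2 * C)) * periodIntegral 1 (A / C) (1 / 2) τ := by
  have hL : 0 < (τ / (τ + 1)).im := by simpa using im_div_lower one_pos hτ
  have : a = 0 ∨ a = 0 + 2 := by obtain ⟨m, rfl⟩ := hae; omega
  rcases this with rfl | rfl
  · exact V_zero_lower hC h0 h1 hτ
  · rw [V_add_two A hC 0 hτ, V_add_two A hC 0 hL]
    exact V_zero_lower hC h0 h1 hτ

lemma V_lower_of_odd (hC : 0 < C) (ha : a ≤ 3) (hao : Odd a) (h0 : 0 < (A / C : ℝ))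
    (h1 : (A / C : ℝ) < 1) {τ : ℂ} (hτ : 0 < τ.im) :
    V A C a τ - (2 * τ + 1) ^ (-(1 / 2) : ℂ) * V A C a (τ / (2 * τ + 1)) =
      -I / 2 * periodIntegral (1 / 2) (A / C) 0 τ := by
  have hL : 0 < (τ / (2 * τ + 1)).im := by simpa using im_div_lower two_pos hτ
  have : a = 1 ∨ a = 1 + 2 := by obtain ⟨m, rfl⟩ := hao; omega
  rcases this with rfl | rfl
  · exact V_one_lower hC h0 h1 hτ
  · rw [V_add_two A hC 1 hτ, V_add_two A hC 1 hL]
    exact V_one_lower hC h0 h1 hτ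

/-! ### Boundary values -/

/-- The automorphy factor `c τ + d`. -/
def jFac (γ : SL(2, ℤ)) (τ : ℂ) : ℂ := γ 1 0 * τ + γ 1 1

/-- The fractional linear action on `ℂ`. -/
def mob (γ : SL(2, ℤ)) (τ : ℂ) : ℂ := (γ 0 0 * τ + γ 0 1) / jFac γ τ

lemma det_eq (γ : SL(2, ℤ)) : γ 0 0 * γ 1 1 - γ 0 1 * γ 1 0 = 1 := by
  have := γ.det_coe
  rwa [Matrix.det_fin_two] at this

lemma det_eq_complex (γ : SL(2, ℤ)) :
    (γ 0 0 : ℂ) * γ 1 1 - γ 0 1 * γ 1 0 = 1 := by exact_mod_cast det_eq γ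

lemma jFac_ne_zero (γ : SL(2, ℤ)) {τ : ℂ} (hτ : 0 < τ.im) : jFac γ τ ≠ 0 := fun h => by
  have h1 := congrArg Complex.im h
  have h2 : (γ 1 0 : ℝ) * τ.im = 0 := by simpa [jFac] using h1
  have h3 : γ 1 0 = 0 := by exact_mod_cast (mul_eq_zero.1 h2).resolve_right hτ.ne'
  have h4 : γ 1 1 = 0 := by simpa [jFac, h3] using h
  have := det_eq γ
  simp [h3, h4] at this

lemma im_mob (γ : SL(2, ℤ)) (τ : ℂ) : (mob γ τ).im = τ.im / normSq (jFac γ τ) := by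
  have hd : (γ 0 0 : ℝ) * γ 1 1 - γ 0 1 * γ 1 0 = 1 := by exact_mod_cast det_eq γ
  rw [mob, Complex.div_im, ← sub_div]
  congr 1
  simp only [jFac, add_im, add_re, mul_im, mul_re, intCast_re, intCast_im, zero_mul, add_zero,
    sub_zero]
  linear_combination τ.im * hd

lemma im_mob_pos (γ : SL(2, ℤ)) {τ : ℂ} (hτ : 0 < τ.im) : 0 < (mob γ τ).im := by
  rw [im_mob]
  exact div_pos hτ (normSq_pos.2 (jFac_ne_zero γ hτ))

lemma jFac_ratCast (γ : SL(2, ℤ)) (x : ℚ) : jFac γ (x : ℂ) = (den γ x : ℚ) := by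
  simp [jFac, den]

lemma mob_ratCast (γ : SL(2, ℤ)) (x : ℚ) : mob γ (x : ℂ) = (moeb γ x : ℚ) := by
  simp [mob, moeb, jFac_ratCast]

lemma mob_sub_mob (γ : SL(2, ℤ)) {τ z : ℂ} (hτ : jFac γ τ ≠ 0) (hz : jFac γ z ≠ 0) :
    mob γ τ - mob γ z = (τ - z) / (jFac γ τ * jFac γ z) := by
  have hd := det_eq_complex γ
  rw [mob, mob, div_sub_div _ _ hτ hz]
  congr 1
  simp only [jFac]
  linear_combination (τ - z) * hd

/-- Fractional linear maps preserve nontangential approach. -/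
lemma tendsto_mob (γ : SL(2, ℤ)) {x : ℚ} (hx : den γ x ≠ 0) :
    ∃ K : ℝ, 0 < K ∧
      Tendsto (fun y : ℝ => mob γ ((x : ℂ) + y * I)) (𝓝[>] 0) (stolz (moeb γ x : ℚ) K) := by
  have hjx : jFac γ (x : ℂ) ≠ 0 := by rw [jFac_ratCast]; exact_mod_cast hx
  set D := ‖jFac γ (x : ℂ)‖ with hD
  have hDpos : 0 < D := norm_pos_iff.2 hjx
  have hc : Continuous fun y : ℝ => jFac γ ((x : ℂ) + y * I) := by unfold jFac; fun_prop
  have ht0 : Tendsto (fun y : ℝ => jFac γ ((x : ℂ) + y * I)) (𝓝[>] 0) (𝓝 (jFac γ x)) := by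
    have := (hc.tendsto 0).mono_left (nhdsWithin_le_nhds (s := Set.Ioi 0))
    simpa using this
  -- The aperture at the image is |jFac γ τ|/|jFac γ x|, which tends to 1; any bound above 1 would
  -- do.
  refine ⟨2, two_pos, tendsto_stolz ?_ ?_⟩
  · have h1 : Tendsto (fun y : ℝ => (γ 0 0 : ℂ) * ((x : ℂ) + y * I) + γ 0 1) (𝓝[>] 0)
        (𝓝 (γ 0 0 * x + γ 0 1)) := by
      have hc' : Continuous fun y : ℝ => (γ 0 0 : ℂ) * ((x : ℂ) + y * I) + γ 0 1 := by fun_prop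
      have := (hc'.tendsto 0).mono_left (nhdsWithin_le_nhds (s := Set.Ioi 0))
      simpa using this
    have := h1.div ht0 hjx
    rw [show ((γ 0 0 : ℂ) * x + γ 0 1) / jFac γ x = ((moeb γ x : ℚ) : ℂ) from mob_ratCast γ x] at this
    simpa [mob, Pi.div_def] using this
  · have h2 : ∀ᶠ y : ℝ in 𝓝[>] 0, ‖jFac γ ((x : ℂ) + y * I)‖ < 2 * D :=
      ht0.norm.eventually_lt_const (by linarith)
    filter_upwards [self_mem_nhdsWithin, h2] with y hy h3
    have hy' : 0 < y := hy
    have him : 0 < ((x : ℂ) + y * I).im := by simpa using hy'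
    have hj := jFac_ne_zero γ him
    refine ⟨im_mob_pos γ him, ?_⟩
    have h4 : (((moeb γ x : ℚ) : ℝ) : ℂ) = mob γ x := by rw [mob_ratCast]; simp
    rw [h4, mob_sub_mob γ hj hjx, im_mob, normSq_eq_norm_sq, norm_div, norm_mul, ← hD]
    have h5 : ‖(x : ℂ) + y * I - x‖ = y := by simp [abs_of_pos hy']
    have h6 : ((x : ℂ) + y * I).im = y := by simp
    rw [h5, h6]
    set N := ‖jFac γ ((x : ℂ) + y * I)‖ with hN
    have hNpos : 0 < N := norm_pos_iff.2 hj
    have : y / (N * D) = (N * y) / (N ^ 2 * D) := by field_simp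
    rw [this, show 2 * (y / N ^ 2) = (2 * D * y) / (N ^ 2 * D) by field_simp]
    gcongr

lemma tendsto_V_mob (hC : 0 < C) (hAC : Int.gcd A C = 1) {γ : SL(2, ℤ)} (hγ : GCong C a γ) {x : ℚ}
    (hx : x ∈ Salpha C a) (hd : den γ x ≠ 0) :
    Tendsto (fun y : ℝ => V A C a (mob γ ((x : ℂ) + y * I))) (𝓝[>] 0)
      (𝓝 (V A C a (moeb γ x : ℚ))) := by
  obtain ⟨K, hK, h⟩ := tendsto_mob γ hd
  exact (tendsto_V hC hAC (moeb_mem hγ hx hd) hK).comp h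

/-- The limit of `(c τ + d)^{-1/2}` at a rational point is the prescribed automorphy factor. -/
lemma tendsto_jFac_cpow (k : ℝ) (γ : SL(2, ℤ)) {x : ℚ} (hx : den γ x ≠ 0) :
    Tendsto (fun y : ℝ => jFac γ ((x : ℂ) + y * I) ^ (-k : ℂ)) (𝓝[>] 0)
      (𝓝 (autFactor k γ x)) := by
  have hform : ∀ y : ℝ, jFac γ ((x : ℂ) + y * I) = ((den γ x : ℝ) : ℂ) + ((γ 1 0 * y : ℝ) : ℂ) * I := by
    intro y
    simp only [jFac, den]
    push_cast
    ring
  simp only [hform]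
  have hcast : (den γ x : ℂ) = ((den γ x : ℝ) : ℂ) := by simp
  rw [autFactor, hcast]
  have hdR : (den γ x : ℝ) ≠ 0 := by exact_mod_cast hx
  set d : ℝ := (den γ x : ℝ) with hd
  set c : ℝ := (γ 1 0 : ℝ) with hc
  have hcsign : (γ 1 0 < 0) ↔ c < 0 := by rw [hc]; exact_mod_cast Iff.rfl
  have htend : Tendsto (fun y : ℝ => (d : ℂ) + ((c * y : ℝ) : ℂ) * I) (𝓝[>] 0) (𝓝 d) := by
    have hcont : Continuous fun y : ℝ => (d : ℂ) + ((c * y : ℝ) : ℂ) * I := by fun_prop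
    have := (hcont.tendsto 0).mono_left (nhdsWithin_le_nhds (s := Set.Ioi 0))
    simpa using this
  have hup : ∀ {c : ℝ}, 0 ≤ c → Tendsto (fun y : ℝ => (d : ℂ) + ((c * y : ℝ) : ℂ) * I) (𝓝[>] 0) (𝓝 d) →
      Tendsto (fun y : ℝ => ((d : ℂ) + ((c * y : ℝ) : ℂ) * I) ^ (-k : ℂ)) (𝓝[>] 0)
      (𝓝 ((d : ℂ) ^ (-k : ℂ))) := by
    intro c hc htend
    rcases lt_or_gt_of_ne hdR with hneg | hpos
    · have hd0 : (d : ℂ) ≠ 0 := by exact_mod_cast hdR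
      have hlog : Tendsto (fun y : ℝ => Complex.log ((d : ℂ) + ((c * y : ℝ) : ℂ) * I)) (𝓝[>] 0)
          (𝓝 (Complex.log d)) := by
        have h1 := continuousWithinAt_log_of_re_neg_of_im_zero (z := (d : ℂ)) (by simpa using hneg)
          (by simp)
        refine Tendsto.comp (f := fun y : ℝ => (d : ℂ) + ((c * y : ℝ) : ℂ) * I)
          (g := Complex.log) h1 (tendsto_nhdsWithin_iff.2 ⟨htend, ?_⟩)
        filter_upwards [self_mem_nhdsWithin] with y hy
        have hy' : 0 < y := hy
        have : 0 ≤ c * y := by positivity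
        simpa using this
      have h2 := (Complex.continuous_exp.tendsto _).comp (hlog.mul_const (-k : ℂ))
      rw [Complex.cpow_def_of_ne_zero hd0]
      refine h2.congr' ?_
      filter_upwards [htend.eventually_ne hd0] with y hy
      rw [Complex.cpow_def_of_ne_zero hy]
      rfl
    · exact ((continuousAt_cpow_const (b := (-k : ℂ)) (a := (d : ℂ))
        (Or.inl (by simpa using hpos))).tendsto).comp htend
  by_cases hs : c < 0
  · rw [if_pos (hcsign.2 hs)]
    -- For c < 0 the approach is from below the branch cut, so the upper case is applied to the
    -- conjugate.
    have htend' : Tendsto (fun y : ℝ => (d : ℂ) + ((-c * y : ℝ) : ℂ) * I) (𝓝[>] 0) (𝓝 d) := by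
      have := (Complex.continuous_conj.tendsto _).comp htend
      rw [conj_ofReal] at this
      refine this.congr fun y => ?_
      simp
    have h := (Complex.continuous_conj.tendsto _).comp (hup (by linarith : 0 ≤ -c) htend')
    refine h.congr' ?_
    filter_upwards [self_mem_nhdsWithin] with y hy
    have hy' : 0 < y := hy
    have him : ((d : ℂ) + ((-c * y : ℝ) : ℂ) * I).arg ≠ Real.pi := by
      intro h
      have := (Complex.arg_eq_pi_iff.1 h).2
      simp at this
      rcases this with h | h <;> linarith
    simp only [Function.comp]
    have h7 := Complex.cpow_conj ((d : ℂ) + ((-c * y : ℝ) : ℂ) * I) (-k : ℂ) him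
    rw [← ofReal_neg, conj_ofReal] at h7
    rw [← ofReal_neg, h7, Complex.conj_conj]
    simp
  · rw [if_neg (fun h => hs (hcsign.1 h))]
    exact hup (not_lt.1 hs) htend

end

section

variable {A : ℤ} {C a : ℕ} {s : ℝ}

/-- Along the vertical line the weight is bounded by |x + p|^(-1/2) uniformly, so dominated
convergence applies. -/
lemma tendsto_periodIntegral {p β : ℝ}
    (h : IntegrableOn (fun t : ℝ => gTheta s β (p + t * I)) (Set.Ioi 0)) {x : ℝ} (hx : x + p ≠ 0) :
    Tendsto (fun y : ℝ => periodIntegral p s β ((x : ℂ) + y * I)) (𝓝[>] 0)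
      (𝓝 (periodIntegral p s β x)) := by
  unfold periodIntegral
  refine tendsto_integral_filter_of_dominated_convergence
    (fun t => ‖gTheta s β (p + t * I)‖ * (√|x + p|)⁻¹) ?_ ?_ (h.norm.mul_const _) ?_
  · filter_upwards [self_mem_nhdsWithin] with y hy
    have hy' : 0 < y := hy
    refine (integrableOn_periodIntegrand h (fun h0 => ?_) (by simpa using hy'.le)).aestronglyMeasurable
    have := congrArg Complex.im h0
    simp at this
    exact hy'.ne' this
  · filter_upwards [self_mem_nhdsWithin] with y hy
    have hy' : 0 < y := hy
    filter_upwards [ae_restrict_mem measurableSet_Ioi] with t ht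
    have hT0 : ((x : ℂ) + y * I) + p ≠ 0 := fun h0 => by
      have := congrArg Complex.im h0
      simp at this
      exact hy'.ne' this
    have h1 := norm_weight_le hT0 (by simpa using hy'.le) ht
    rw [periodIntegrand_eq, norm_mul, norm_I, mul_one, norm_div, div_eq_mul_inv]
    refine mul_le_mul_of_nonneg_left (h1.trans ?_) (norm_nonneg _)
    have h2 : |x + p| ≤ ‖((x : ℂ) + y * I) + p‖ := by
      have := abs_re_le_norm (((x : ℂ) + y * I) + p)
      simpa using this
    have h3 : 0 < |x + p| := abs_pos.2 hx
    gcongr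
  · filter_upwards [ae_restrict_mem measurableSet_Ioi] with t ht
    have ht' : 0 < t := ht
    simp only [periodIntegrand_eq]
    have hre : 0 < ((t : ℂ) - I * ((x : ℂ) + p)).re := by simpa using ht'
    have h1 : Tendsto (fun y : ℝ => (t : ℂ) - I * ((x : ℂ) + y * I + p)) (𝓝[>] 0)
        (𝓝 ((t : ℂ) - I * ((x : ℂ) + p))) := by
      have hc : Continuous fun y : ℝ => (t : ℂ) - I * ((x : ℂ) + y * I + p) := by fun_prop
      have := (hc.tendsto 0).mono_left (nhdsWithin_le_nhds (s := Set.Ioi 0))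
      simpa using this
    have h2 := ((continuousAt_cpow_const (b := (1 / 2 : ℂ)) (Or.inl hre)).tendsto).comp h1
    refine (tendsto_const_nhds.div h2 ?_).mul_const I
    rw [Complex.cpow_ne_zero_iff]
    left
    intro h0
    rw [h0] at hre
    exact lt_irrefl 0 hre

/-- Every term of the identity has a limit as τ descends to x; the transformed argument approaches
its limit nontangentially. Since rp = 1, the condition x + p ≠ 0 says that rx + 1 ≠ 0. -/
lemma V_lower_boundary (hC : 0 < C) (hAC : Int.gcd A C = 1) {r : ℕ}
    (hr : (r : ℤ) = if Even a then 1 else 2) {κ c : ℂ} {p β : ℝ}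
    (hp : (r : ℝ) * p = 1)
    (h : IntegrableOn (fun t : ℝ => gTheta s β (p + t * I)) (Set.Ioi 0))
    (hV : ∀ τ : ℂ, 0 < τ.im → V A C a τ - κ * ((r : ℂ) * τ + 1) ^ (-(1 / 2) : ℂ) *
      V A C a (τ / (r * τ + 1)) = c * periodIntegral p s β τ) {x : ℚ} (hx : x ∈ Salpha C a)
    (hxp : (x : ℝ) + p ≠ 0) :
    V A C a x - κ * ((r : ℂ) * x + 1) ^ (-(1 / 2) : ℂ) * V A C a (x / (r * x + 1)) =
      c * periodIntegral p s β x := by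
  set γ : SL(2, ℤ) := lowerMat r with hγ
  have hmem : γ ∈ Galpha C a := by rw [hγ, hr]; exact lowerMat_mem C a
  have hd : den γ x ≠ 0 := by
    intro h0
    have h1 : (r : ℚ) * x + 1 = 0 := by simpa [den, hγ, lowerMat] using h0
    have h2 : (r : ℝ) * x + 1 = 0 := by exact_mod_cast h1
    have hr0 : (r : ℝ) ≠ 0 := by rintro h; rw [h] at hp; simp at hp
    exact hxp (mul_left_cancel₀ hr0 (by linear_combination h2 + hp))
  have hjf : ∀ τ, jFac γ τ = r * τ + 1 := fun τ => by simp [jFac, hγ, lowerMat]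
  have hmb : ∀ τ, mob γ τ = τ / (r * τ + 1) := fun τ => by simp [mob, hjf]; simp [hγ, lowerMat]
  have t1 := tendsto_V_vertical hC hAC hx
  have t2 := tendsto_V_mob hC hAC (GCong_of_mem hmem) hx hd
  have t3 := tendsto_jFac_cpow (1 / 2) γ hd
  have t4 := (tendsto_periodIntegral h hxp).const_mul c
  rw [ofReal_ratCast] at t4
  have t5 := t1.sub ((t3.const_mul κ).mul t2)
  have haut : autFactor (1 / 2) γ x = ((r : ℂ) * x + 1) ^ (-(1 / 2) : ℂ) := by
    have hneg : ¬ γ 1 0 < 0 := by simp [hγ, lowerMat]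
    rw [autFactor, if_neg hneg]
    simp [den, hγ, lowerMat]
  rw [haut, ← mob_ratCast, hmb] at t5
  refine tendsto_nhds_unique t5 (t4.congr' ?_)
  filter_upwards [self_mem_nhdsWithin] with y hy
  have hy' : 0 < y := hy
  rw [← hV _ (by simpa using hy'), hmb, hjf]
  norm_num

theorem V_period_of_even (hC : 0 < C) (hAC : Int.gcd A C = 1) (ha : a ≤ 3) (hae : Even a)
    (h0 : 0 < (A / C : ℝ)) (h1 : (A / C : ℝ) < 1) {τ : ℂ} (hτ : τ ∈ domain C a \ {-1}) :
    IntegrableOn (periodIntegrand 1 (A / C) (1 / 2) τ) (Set.Ioi 0) ∧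
    V A C a τ - (e (1 / 8))⁻¹ * (τ + 1) ^ (-(1 / 2) : ℂ) * V A C a (τ / (τ + 1)) =
      -I / 2 * e (-A / (2 * C)) * periodIntegral 1 (A / C) (1 / 2) τ := by
  have hne : τ + ((1 : ℝ) : ℂ) ≠ 0 := fun h => hτ.2 (by
    rw [Set.mem_singleton_iff]; push_cast at h; exact eq_neg_of_add_eq_zero_left h)
  have him : 0 ≤ τ.im := by
    rcases hτ.1 with h | ⟨x, -, rfl⟩
    · exact le_of_lt h
    · simp
  refine ⟨integrableOn_periodIntegrand (integrableOn_gTheta_one h0 h1) hne him, ?_⟩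
  rcases hτ.1 with h | ⟨x, hx, rfl⟩
  · exact V_lower_of_even hC ha hae h0 h1 h
  · have := V_lower_boundary (A := A) (C := C) (a := a) (r := 1) (p := 1) hC hAC (by simp [hae])
      (by simp) (integrableOn_gTheta_one h0 h1)
      (fun τ hτ => by simpa using V_lower_of_even hC ha hae h0 h1 hτ) hx
      (by intro h; apply hne; beta_reduce; rw [← ofReal_ratCast, ← ofReal_add, h, ofReal_zero])
    simpa using this

theorem V_period_of_odd (hC : 0 < C) (hAC : Int.gcd A C = 1) (ha : a ≤ 3) (hao : Odd a)
    (h0 : 0 < (A / C : ℝ)) (h1 : (A / C : ℝ) < 1) {τ : ℂ} (hτ : τ ∈ domain C a \ {-(1 / 2)}) :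
    IntegrableOn (periodIntegrand (1 / 2) (A / C) 0 τ) (Set.Ioi 0) ∧
    V A C a τ - (2 * τ + 1) ^ (-(1 / 2) : ℂ) * V A C a (τ / (2 * τ + 1)) =
      -I / 2 * periodIntegral (1 / 2) (A / C) 0 τ := by
  have hne : τ + ((1 / 2 : ℝ) : ℂ) ≠ 0 := fun h => hτ.2 (by
    rw [Set.mem_singleton_iff]; push_cast at h; exact eq_neg_of_add_eq_zero_left h)
  have him : 0 ≤ τ.im := by
    rcases hτ.1 with h | ⟨x, -, rfl⟩
    · exact le_of_lt h
    · simp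
  refine ⟨integrableOn_periodIntegrand (integrableOn_gTheta_half h0 h1) hne him, ?_⟩
  rcases hτ.1 with h | ⟨x, hx, rfl⟩
  · exact V_lower_of_odd hC ha hao h0 h1 h
  · have := V_lower_boundary (A := A) (C := C) (a := a) (r := 2) (p := 1 / 2) (κ := 1) hC hAC
      (by simp [Nat.not_even_iff_odd.2 hao]) (by norm_num) (integrableOn_gTheta_half h0 h1)
      (fun τ hτ => by simpa using V_lower_of_odd hC ha hao h0 h1 hτ) hx
      (by intro h; apply hne; beta_reduce; rw [← ofReal_ratCast, ← ofReal_add, h, ofReal_zero])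
    simpa using this

end

/-! ### The weight `1/2` action and functions that extend across the real line -/

/-- The upper half-plane as a subset of `ℂ`. -/
def uhp : Set ℂ := {τ | 0 < τ.im}

lemma convex_uhp : Convex ℝ uhp := convex_halfSpace_im_gt 0

lemma tendsto_vertical_uhp (x : ℝ) :
    Tendsto (fun y : ℝ => (x : ℂ) + y * I) (𝓝[>] 0) (𝓝[uhp] (x : ℂ)) := by
  refine tendsto_nhdsWithin_iff.2 ⟨?_, ?_⟩
  · have hc : Continuous fun y : ℝ => (x : ℂ) + y * I := by fun_prop
    have := (hc.tendsto 0).mono_left (nhdsWithin_le_nhds (s := Set.Ioi 0))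
    simpa using this
  · filter_upwards [self_mem_nhdsWithin] with y hy
    simpa [uhp] using hy

instance neBot_uhp (x : ℝ) : NeBot (𝓝[uhp] (x : ℂ)) := (tendsto_vertical_uhp x).neBot

lemma jFac_mul (γ δ : SL(2, ℤ)) {τ : ℂ} (hτ : 0 < τ.im) :
    jFac (γ * δ) τ = jFac γ (mob δ τ) * jFac δ τ := by
  have h := jFac_ne_zero δ hτ
  rw [jFac, jFac, mob]
  field_simp
  simp only [jFac, Matrix.SpecialLinearGroup.coe_mul, Matrix.mul_apply, Fin.sum_univ_two]
  push_cast
  ring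

lemma mob_mul (γ δ : SL(2, ℤ)) {τ : ℂ} (hτ : 0 < τ.im) : mob (γ * δ) τ = mob γ (mob δ τ) := by
  have h := jFac_ne_zero δ hτ
  have h2 := jFac_ne_zero γ (im_mob_pos δ hτ)
  rw [mob, jFac_mul γ δ hτ, div_eq_iff (mul_ne_zero h2 h)]
  rw [mob.eq_def γ, div_mul_eq_mul_div, mul_comm (jFac γ _), ← mul_assoc, mul_div_cancel_right₀ _ h2,
    mob.eq_def δ]
  field_simp
  simp only [jFac, Matrix.SpecialLinearGroup.coe_mul, Matrix.mul_apply, Fin.sum_univ_two]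
  push_cast
  ring

lemma continuousOn_jFac_cpow (γ : SL(2, ℤ)) (r : ℂ) : ContinuousOn (fun τ => jFac γ τ ^ r) uhp := by
  by_cases hc : γ 1 0 = 0
  · simp only [jFac, hc, Int.cast_zero, zero_mul, zero_add]
    exact continuousOn_const
  · intro τ hτ
    have h0 : ContinuousAt (jFac γ) τ := by unfold jFac; fun_prop
    refine ((continuousAt_cpow_const (Or.inr ?_)).comp h0).continuousWithinAt
    have h : (jFac γ τ).im = γ 1 0 * τ.im := by simp [jFac]
    rw [h]
    exact mul_ne_zero (by exact_mod_cast hc) (ne_of_gt hτ)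

lemma continuousOn_mob (γ : SL(2, ℤ)) : ContinuousOn (mob γ) uhp := by
  intro τ hτ
  refine ContinuousAt.continuousWithinAt ?_
  unfold mob
  refine ContinuousAt.div (by fun_prop) (by unfold jFac; fun_prop) (jFac_ne_zero γ hτ)

/-- The weight `1/2` action, with the principal branch. -/
def slash (γ : SL(2, ℤ)) (f : ℂ → ℂ) (τ : ℂ) : ℂ := (jFac γ τ ^ (1 / 2 : ℂ))⁻¹ * f (mob γ τ)

lemma cpow_half_sq (z : ℂ) : (z ^ (1 / 2 : ℂ)) ^ 2 = z := by
  rw [← Complex.cpow_nat_mul]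
  norm_num

/-- Both sides involve continuous square roots of the same nonvanishing function on the connected
upper half-plane, so they differ by a constant sign. -/
lemma slash_mul (γ δ : SL(2, ℤ)) : ∃ u : ℂ, ‖u‖ = 1 ∧ ∀ (f : ℂ → ℂ) (τ : ℂ), 0 < τ.im →
    slash δ (slash γ f) τ = u * slash (γ * δ) f τ := by
  have h1 : ContinuousOn (fun τ => jFac δ τ ^ (1 / 2 : ℂ) * jFac γ (mob δ τ) ^ (1 / 2 : ℂ)) uhp :=
    (continuousOn_jFac_cpow δ _).mul ((continuousOn_jFac_cpow γ _).comp (continuousOn_mob δ)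
      fun τ hτ => im_mob_pos δ hτ)
  have h2 := continuousOn_jFac_cpow (γ * δ) (1 / 2)
  have h3 := convex_uhp.isPreconnected.eq_or_eq_neg_of_sq_eq h1 h2 (fun τ hτ => by
    simp only [Pi.pow_apply]
    rw [mul_pow, cpow_half_sq, cpow_half_sq, cpow_half_sq, jFac_mul γ δ hτ, mul_comm])
    (fun {τ} hτ => by
      rw [Complex.cpow_ne_zero_iff]
      exact Or.inl (jFac_ne_zero _ hτ))
  rcases h3 with h3 | h3
  · refine ⟨1, by simp, fun f τ hτ => ?_⟩
    have := h3 hτ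
    simp only at this
    rw [slash, slash, slash, ← mul_assoc, ← mul_inv, this, mob_mul γ δ hτ, one_mul]
  · refine ⟨-1, by simp, fun f τ hτ => ?_⟩
    have := h3 hτ
    simp only [Pi.neg_apply] at this
    rw [slash, slash, slash, ← mul_assoc, ← mul_inv, this, mob_mul γ δ hτ, inv_neg]
    ring

lemma slash_one (f : ℂ → ℂ) (τ : ℂ) : slash 1 f τ = f τ := by simp [slash, jFac, mob]

/-- All translates of `R` under the weight `1/2` action extend analytically across each real
point. -/
def EdgeAnalytic (R : ℂ → ℂ) : Prop := ∀ (γ : SL(2, ℤ)) (x : ℝ), ∃ G : ℂ → ℂ,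
  AnalyticAt ℂ G x ∧ ∀ᶠ τ in 𝓝[uhp] (x : ℂ), slash γ R τ = G τ

lemma EdgeAnalytic.zero : EdgeAnalytic fun _ => 0 := fun γ x =>
  ⟨fun _ => 0, analyticAt_const, by simp [slash]⟩

lemma EdgeAnalytic.add {R₁ R₂ : ℂ → ℂ} (h₁ : EdgeAnalytic R₁) (h₂ : EdgeAnalytic R₂) :
    EdgeAnalytic fun τ => R₁ τ + R₂ τ := fun γ x => by
  obtain ⟨G₁, a₁, e₁⟩ := h₁ γ x
  obtain ⟨G₂, a₂, e₂⟩ := h₂ γ x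
  refine ⟨fun τ => G₁ τ + G₂ τ, a₁.add a₂, ?_⟩
  filter_upwards [e₁, e₂] with τ t₁ t₂
  rw [← t₁, ← t₂, slash, slash, slash, mul_add]

lemma EdgeAnalytic.const_mul {R : ℂ → ℂ} (h : EdgeAnalytic R) (c : ℂ) :
    EdgeAnalytic fun τ => c * R τ := fun γ x => by
  obtain ⟨G, a, e⟩ := h γ x
  refine ⟨fun τ => c * G τ, analyticAt_const.mul a, ?_⟩
  filter_upwards [e] with τ t
  rw [← t, slash, slash, mul_left_comm]

lemma EdgeAnalytic.slash {R : ℂ → ℂ} (h : EdgeAnalytic R) (γ : SL(2, ℤ)) :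
    EdgeAnalytic (slash γ R) := fun δ x => by
  obtain ⟨G, a, e⟩ := h (γ * δ) x
  obtain ⟨u, -, hu⟩ := slash_mul γ δ
  refine ⟨fun τ => u * G τ, analyticAt_const.mul a, ?_⟩
  filter_upwards [e, self_mem_nhdsWithin] with τ t hτ
  rw [← t, hu R τ hτ]

/-- `W` is invariant under `γ` up to a constant of absolute value one and an error term that
extends across the real line. -/
def AlmostInvariant (W : ℂ → ℂ) (γ : SL(2, ℤ)) : Prop := ∃ ε : ℂ, ‖ε‖ = 1 ∧ ∃ R : ℂ → ℂ,
  EdgeAnalytic R ∧ ∀ τ : ℂ, 0 < τ.im → W τ = ε * slash γ W τ + R τ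

lemma AlmostInvariant.mul {W : ℂ → ℂ} {γ δ : SL(2, ℤ)} (hγ : AlmostInvariant W γ)
    (hδ : AlmostInvariant W δ) : AlmostInvariant W (γ * δ) := by
  obtain ⟨ε₁, h₁, R₁, e₁, w₁⟩ := hγ
  obtain ⟨ε₂, h₂, R₂, e₂, w₂⟩ := hδ
  obtain ⟨u, hu, hs⟩ := slash_mul γ δ
  refine ⟨ε₂ * ε₁ * u, by simp [h₁, h₂, hu], fun τ => ε₂ * slash δ R₁ τ + R₂ τ,
    ((e₁.slash δ).const_mul ε₂).add e₂, fun τ hτ => ?_⟩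
  have h3 := hs W τ hτ
  rw [w₂ τ hτ, slash.eq_def δ W, w₁ _ (im_mob_pos δ hτ)]
  rw [slash.eq_def δ] at h3
  beta_reduce
  rw [slash.eq_def δ R₁]
  linear_combination (ε₁ * ε₂) * h3

lemma AlmostInvariant.inv {W : ℂ → ℂ} {γ : SL(2, ℤ)} (hγ : AlmostInvariant W γ) :
    AlmostInvariant W γ⁻¹ := by
  obtain ⟨ε, h, R, e, w⟩ := hγ
  obtain ⟨u, hu, hs⟩ := slash_mul γ γ⁻¹
  have hε : ε * u ≠ 0 := by
    rw [← norm_ne_zero_iff, norm_mul, h, hu]; simp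
  refine ⟨(ε * u)⁻¹, by simp [h, hu], fun τ => -(ε * u)⁻¹ * slash γ⁻¹ R τ,
    (e.slash γ⁻¹).const_mul _, fun τ hτ => ?_⟩
  have h3 := hs W τ hτ
  rw [mul_inv_cancel, slash_one, slash.eq_def γ⁻¹] at h3
  rw [slash.eq_def γ⁻¹ W, w _ (im_mob_pos _ hτ)]
  beta_reduce
  rw [slash.eq_def γ⁻¹ R]
  linear_combination (-(ε * u)⁻¹ * ε) * h3 - W τ * inv_mul_cancel₀ hε

lemma AlmostInvariant.one (W : ℂ → ℂ) : AlmostInvariant W 1 :=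
  ⟨1, by simp, fun _ => 0, EdgeAnalytic.zero, fun τ _ => by simp [slash_one]⟩

lemma almostInvariant_of_mem_closure {W : ℂ → ℂ} {T : Set SL(2, ℤ)}
    (h : ∀ γ ∈ T, AlmostInvariant W γ) {γ : SL(2, ℤ)} (hγ : γ ∈ Subgroup.closure T) :
    AlmostInvariant W γ := by
  induction hγ using Subgroup.closure_induction with
  | mem γ hγ => exact h γ hγ
  | one => exact AlmostInvariant.one W
  | mul γ δ _ _ h1 h2 => exact h1.mul h2
  | inv γ _ h1 => exact h1.inv

/-- A function on the upper half-plane that extends analytically across every point of `D` has a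
real analytic boundary function on `D`. -/
lemma exists_boundary_function {F : ℂ → ℂ} {D : Set ℝ} (h : ∀ x ∈ D, ∃ G : ℂ → ℂ,
    AnalyticAt ℂ G x ∧ ∀ᶠ τ in 𝓝[uhp] (x : ℂ), F τ = G τ) :
    ∃ Φ : ℝ → ℂ, AnalyticOnNhd ℝ Φ D ∧ ∀ x ∈ D, Tendsto F (𝓝[uhp] (x : ℂ)) (𝓝 (Φ x)) := by
  have hlim : ∀ x ∈ D, ∃ G : ℂ → ℂ, AnalyticAt ℂ G x ∧
      ∀ᶠ y : ℝ in 𝓝 x, Tendsto F (𝓝[uhp] (y : ℂ)) (𝓝 (G y)) := by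
    intro x hx
    obtain ⟨G, hG, hFG⟩ := h x hx
    refine ⟨G, hG, ?_⟩
    -- Agreement of F and G near x is an open condition, so one G describes the boundary values on a
    -- whole real neighbourhood of x.
    have h1 : ∀ᶠ z in 𝓝 (x : ℂ), ∀ᶠ τ in 𝓝[uhp] z, F τ = G τ := by
      rw [eventually_nhdsWithin_iff] at hFG
      filter_upwards [hFG.eventually_nhds] with z hz
      rwa [eventually_nhdsWithin_iff]
    have h2 := Complex.continuous_ofReal.continuousAt.eventually (h1.and hG.eventually_analyticAt)
    filter_upwards [h2] with y hy
    exact (hy.2.continuousAt.tendsto.mono_left nhdsWithin_le_nhds).congr' (hy.1.mono fun τ h => h.symm)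
  refine ⟨fun x => limUnder (𝓝[uhp] (x : ℂ)) F, fun x hx => ?_, fun x hx => ?_⟩
  · obtain ⟨G, hG, hFG⟩ := hlim x hx
    have h1 : AnalyticAt ℝ (fun y : ℝ => G y) x :=
      (hG.restrictScalars (𝕜 := ℝ)).comp (Complex.ofRealCLM.analyticAt x)
    refine h1.congr ?_
    filter_upwards [hFG] with y hy
    exact hy.limUnder_eq.symm
  · obtain ⟨G, hG, hFG⟩ := hlim x hx
    have h1 := hFG.self_of_nhds
    beta_reduce
    rwa [h1.limUnder_eq]

section

/-! ### The theta function on the upper half-plane and its tail integrals -/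

variable {s : ℝ}

lemma norm_gTheta_term (s β : ℝ) (n : ℤ) (z : ℂ) :
    ‖((s : ℂ) + n) * cexp (Real.pi * I * ((s : ℂ) + n) ^ 2 * z
      + 2 * Real.pi * I * ((s : ℂ) + n) * β)‖ =
      |(n : ℝ) + s| * Real.exp (-Real.pi * ((n : ℝ) + s) ^ 2 * z.im) := by
  have h1 : (s : ℂ) + n = ((n + s : ℝ) : ℂ) := by push_cast; ring
  have h2 : Real.pi * I * (((n + s : ℝ) : ℂ)) ^ 2 * z + 2 * Real.pi * I * ((n + s : ℝ) : ℂ) * β =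
      ((Real.pi * (n + s) ^ 2 : ℝ) : ℂ) * (I * z) + ((2 * Real.pi * (n + s) * β : ℝ) : ℂ) * I := by
    push_cast; ring
  rw [h1, norm_mul, norm_real, Real.norm_eq_abs, h2, norm_exp]
  congr 2
  simp only [add_re, re_ofReal_mul, I_mul_re, I_re, mul_zero, add_zero]
  ring

lemma differentiableOn_gTheta (s β : ℝ) : DifferentiableOn ℂ (gTheta s β) uhp := by
  intro z hz
  have hz' : 0 < z.im := hz
  have hU : IsOpen {w : ℂ | z.im / 2 < w.im} := isOpen_lt continuous_const Complex.continuous_im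
  refine DifferentiableAt.differentiableWithinAt ?_
  refine (differentiableOn_tsum_of_summable_norm
    (summable_lineTheta_norm s (half_pos hz')) (fun n => ?_) hU (fun n w hw => ?_)).differentiableAt
    (hU.mem_nhds (by simp only [Set.mem_ofPred_eq]; linarith))
  · fun_prop
  · rw [norm_gTheta_term]
    have hw' : z.im / 2 < w.im := hw
    refine mul_le_mul_of_nonneg_left (Real.exp_le_exp.2 ?_) (abs_nonneg _)
    have := mul_le_mul_of_nonneg_left hw'.le (mul_nonneg Real.pi_pos.le (sq_nonneg ((n : ℝ) + s)))
    linarith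

lemma norm_gTheta_le (h0 : 0 < s) (h1 : s < 1) (β : ℝ) {t₀ : ℝ} (ht₀ : 0 < t₀) {z : ℂ}
    (hz : t₀ ≤ z.im) :
    ‖gTheta s β z‖ ≤ (∑' n : ℤ, |(n : ℝ) + s| * Real.exp (-Real.pi * ((n : ℝ) + s) ^ 2 * t₀)) *
      Real.exp (-Real.pi * min s (1 - s) ^ 2 * (z.im - t₀)) := by
  refine tsum_of_norm_bounded ((summable_lineTheta_norm s ht₀).hasSum.mul_right _) fun n => ?_
  rw [norm_gTheta_term, mul_assoc |(n : ℝ) + s|, ← Real.exp_add]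
  refine mul_le_mul_of_nonneg_left (Real.exp_le_exp.2 ?_) (abs_nonneg _)
  have h2 : min s (1 - s) ^ 2 ≤ ((n : ℝ) + s) ^ 2 := by
    rw [← sq_abs ((n : ℝ) + s)]
    exact pow_le_pow_left₀ (le_min h0.le (by linarith)) (min_le_abs_int_add s n) 2
  have h3 := mul_le_mul_of_nonneg_right h2
    (mul_nonneg Real.pi_pos.le (by linarith : 0 ≤ z.im - t₀))
  nlinarith

lemma gTheta_add_int (s β : ℝ) {N M : ℤ} (hN : Even N) (hM : s * N = M) (z : ℂ) :
    gTheta s β (z + N) = cexp (Real.pi * I * s ^ 2 * N) * gTheta s β z := by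
  rw [gTheta, gTheta, ← tsum_mul_left]
  refine tsum_congr fun n => ?_
  obtain ⟨L, rfl⟩ := hN
  have hM' : (s : ℂ) * (L + L) = M := by exact_mod_cast hM
  have : Real.pi * I * ((s : ℂ) + n) ^ 2 * (z + ((L + L : ℤ) : ℂ)) +
      2 * Real.pi * I * ((s : ℂ) + n) * β =
      Real.pi * I * s ^ 2 * ((L + L : ℤ) : ℂ) + (Real.pi * I * ((s : ℂ) + n) ^ 2 * z +
        2 * Real.pi * I * ((s : ℂ) + n) * β) + ((n * M + n ^ 2 * L : ℤ) : ℂ) * (2 * Real.pi * I) := by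
    push_cast
    linear_combination (2 * Real.pi * I * n) * hM'
  rw [this, Complex.exp_add, exp_int_mul_two_pi_mul_I, Complex.exp_add]
  ring

/-- Deforming two vertical half-lines into one another. -/
lemma integral_vertical_sub {f : ℂ → ℂ} (hf : DifferentiableOn ℂ f uhp) {t₀ K c : ℝ} (ht₀ : 0 < t₀)
    (hc : 0 < c) (hb : ∀ z : ℂ, t₀ ≤ z.im → ‖f z‖ ≤ K * Real.exp (-c * z.im)) (p₁ p₂ : ℝ) :
    (∫ t in Set.Ioi t₀, f (p₁ + t * I) * I) - ∫ t in Set.Ioi t₀, f (p₂ + t * I) * I =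
      ∫ y in p₁..p₂, f (y + t₀ * I) := by
  have hcont : ∀ p : ℝ, ContinuousOn (fun t : ℝ => f (p + t * I)) (Set.Ici t₀) := fun p =>
    hf.continuousOn.comp (by fun_prop) fun t ht => by
      have : t₀ ≤ t := ht
      simp only [uhp, Set.mem_ofPred_eq, add_im, ofReal_im, mul_im, ofReal_re, I_im, mul_one, I_re,
        mul_zero, add_zero, zero_add]
      linarith
  have hintg : ∀ p : ℝ, IntegrableOn (fun t : ℝ => f (p + t * I)) (Set.Ioi t₀) := fun p => by
    have h1 : IntegrableOn (fun t : ℝ => K * Real.exp (-c * t)) (Set.Ioi t₀) :=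
      (exp_neg_integrableOn_Ioi t₀ hc).const_mul K
    refine Integrable.mono' h1
      (((hcont p).mono Set.Ioi_subset_Ici_self).aestronglyMeasurable measurableSet_Ioi) ?_
    filter_upwards [ae_restrict_mem measurableSet_Ioi] with t ht
    have h2 := hb (p + t * I) (by simpa using (Set.mem_Ioi.1 ht).le)
    simpa using h2
  have hlim : ∀ p : ℝ, Tendsto (fun T : ℝ => I • ∫ t in t₀..T, f (p + t * I)) atTop
      (𝓝 (∫ t in Set.Ioi t₀, f (p + t * I) * I)) := fun p => by
    have := (intervalIntegral_tendsto_integral_Ioi t₀ (hintg p) tendsto_id).const_smul I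
    rwa [integral_mul_const, mul_comm]
  have htop : Tendsto (fun T : ℝ => ∫ x in p₁..p₂, f (x + T * I)) atTop (𝓝 0) := by
    rw [tendsto_zero_iff_norm_tendsto_zero]
    have h1 : Tendsto (fun T : ℝ => K * Real.exp (-c * T) * |p₂ - p₁|) atTop (𝓝 0) := by
      have : Tendsto (fun T : ℝ => Real.exp (-c * T)) atTop (𝓝 0) :=
        Real.tendsto_exp_atBot.comp (tendsto_id.const_mul_atTop_of_neg (by linarith))
      simpa using (this.const_mul K).mul_const |p₂ - p₁|
    refine squeeze_zero' (Eventually.of_forall fun T => norm_nonneg _) ?_ h1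
    filter_upwards [eventually_ge_atTop t₀] with T hT
    refine intervalIntegral.norm_integral_le_of_norm_le_const fun x _ => ?_
    have h2 := hb (x + T * I) (by simpa using hT)
    simpa using h2
  have hrect : ∀ T : ℝ, t₀ ≤ T → (∫ x in p₁..p₂, f (x + t₀ * I)) - (∫ x in p₁..p₂, f (x + T * I)) +
      (I • ∫ y in t₀..T, f (p₂ + y * I)) - I • ∫ y in t₀..T, f (p₁ + y * I) = 0 := fun T hT => by
    have := integral_boundary_rect_eq_zero_of_differentiableOn f (p₁ + t₀ * I) (p₂ + T * I)
      (hf.mono fun z hz => by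
        have := hz.2
        simp only [add_im, ofReal_im, mul_im, ofReal_re, I_im, mul_one, I_re, mul_zero, add_zero,
          zero_add, Set.uIcc_of_le hT] at this
        have h3 : t₀ ≤ z.im := this.1
        simp only [uhp, Set.mem_ofPred_eq]
        linarith)
    simpa using this
  have h4 := (((tendsto_const_nhds (x := ∫ x in p₁..p₂, f (x + t₀ * I))).sub htop).add
    (hlim p₂)).sub (hlim p₁)
  have h5 := tendsto_nhds_unique (h4.congr' (by
    filter_upwards [eventually_ge_atTop t₀] with T hT
    exact hrect T hT)) tendsto_const_nhds
  linear_combination -h5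

/-- The part `t > t₀` of the period integral. -/
def tailIntegral (t₀ p s β : ℝ) (τ : ℂ) : ℂ := ∫ t in Set.Ioi t₀, periodIntegrand p s β τ t

lemma re_neg_I_mul (z : ℂ) : (-I * z).re = z.im := by simp

/-- The horizontal integral `∫ g(z) (-i(z+τ))^{-1/2} dz` from `p₁ + i t₀` to `p₂ + i t₀`. -/
def segmentIntegral (t₀ p₁ p₂ s β : ℝ) (τ : ℂ) : ℂ :=
  ∫ y in p₁..p₂, gTheta s β (y + t₀ * I) / (-I * ((y + t₀ * I) + τ)) ^ (1 / 2 : ℂ)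

lemma norm_weight_inv_le {w : ℂ} {m : ℝ} (hm : 0 < m) (h : m ≤ ‖w‖) :
    ‖(-I * w) ^ (1 / 2 : ℂ)‖⁻¹ ≤ (√m)⁻¹ := by
  rw [norm_cpow_half]
  gcongr

/-- As 0 < s < 1, no frequency vanishes, so g decays exponentially at i∞ and Cauchy's theorem moves
one ray to the other at the cost of the bottom segment. -/
lemma tailIntegral_sub (h0 : 0 < s) (h1 : s < 1) (β : ℝ) {t₀ : ℝ} (ht₀ : 0 < t₀) (p₁ p₂ : ℝ)
    {τ : ℂ} (hτ : 0 < τ.im) :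
    tailIntegral t₀ p₁ s β τ - tailIntegral t₀ p₂ s β τ = segmentIntegral t₀ p₁ p₂ s β τ := by
  have hm : 0 < min s (1 - s) := lt_min h0 (by linarith)
  have hc : 0 < Real.pi * min s (1 - s) ^ 2 := by have := Real.pi_pos; positivity
  set c := Real.pi * min s (1 - s) ^ 2
  set K := ∑' n : ℤ, |(n : ℝ) + s| * Real.exp (-Real.pi * ((n : ℝ) + s) ^ 2 * t₀)
  have hK : 0 ≤ K := tsum_nonneg fun n => by positivity
  refine integral_vertical_sub
    (f := fun z => gTheta s β z / (-I * (z + τ)) ^ (1 / 2 : ℂ)) ?_ ht₀ hc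
    (K := K * Real.exp (c * t₀) * (√t₀)⁻¹) ?_ p₁ p₂
  · refine (differentiableOn_gTheta s β).div ?_ ?_
    · refine DifferentiableOn.cpow_const (by fun_prop) fun z hz => Or.inl ?_
      rw [re_neg_I_mul]
      have : 0 < z.im := hz
      simp only [add_im]
      linarith
    · intro z hz
      rw [Complex.cpow_ne_zero_iff]
      left
      intro h
      have := congrArg Complex.re h
      rw [re_neg_I_mul] at this
      have h2 : 0 < z.im := hz
      simp only [add_im, zero_re] at this
      linarith
  · intro z hz
    have hn : t₀ ≤ ‖z + τ‖ := by
      refine le_trans ?_ ((le_abs_self _).trans (abs_im_le_norm (z + τ)))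
      simp only [add_im]; linarith
    rw [norm_div, div_eq_mul_inv]
    calc _ ≤ (K * Real.exp (-Real.pi * min s (1 - s) ^ 2 * (z.im - t₀))) * (√t₀)⁻¹ :=
          mul_le_mul (norm_gTheta_le h0 h1 β ht₀ hz) (norm_weight_inv_le ht₀ hn) (by positivity)
            (by positivity)
      _ = _ := by
          rw [show -Real.pi * min s (1 - s) ^ 2 * (z.im - t₀) = c * t₀ + -c * z.im by
            simp only [c]; ring, Real.exp_add]
          ring

lemma integrableOn_gTheta_tail (h0 : 0 < s) (h1 : s < 1) (β : ℝ) {t₀ : ℝ} (ht₀ : 0 < t₀) (p : ℝ) :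
    IntegrableOn (fun t : ℝ => gTheta s β (p + t * I)) (Set.Ioi t₀) := by
  have hm : 0 < min s (1 - s) := lt_min h0 (by linarith)
  have hc : 0 < Real.pi * min s (1 - s) ^ 2 := by have := Real.pi_pos; positivity
  set c := Real.pi * min s (1 - s) ^ 2
  set K := ∑' n : ℤ, |(n : ℝ) + s| * Real.exp (-Real.pi * ((n : ℝ) + s) ^ 2 * t₀)
  refine Integrable.mono' (g := fun t => K * Real.exp (c * t₀) * Real.exp (-c * t))
    ((exp_neg_integrableOn_Ioi t₀ hc).const_mul _) ?_ ?_
  · refine ContinuousOn.aestronglyMeasurable ?_ measurableSet_Ioi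
    refine (differentiableOn_gTheta s β).continuousOn.comp (by fun_prop) fun t ht => ?_
    have : t₀ < t := ht
    simpa [uhp] using ht₀.trans this
  · filter_upwards [ae_restrict_mem measurableSet_Ioi] with t ht
    have h2 := norm_gTheta_le h0 h1 β ht₀ (z := p + t * I) (by simpa using (Set.mem_Ioi.1 ht).le)
    refine h2.trans (le_of_eq ?_)
    have : ((p : ℂ) + t * I).im = t := by simp
    rw [this, mul_assoc K, ← Real.exp_add]
    congr 2
    simp only [c]
    ring

/-- The ray stays above height t₀, so the integrand is holomorphic in τ and dominated on all of Im τ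
> -t₀/2. -/
lemma analyticAt_tailIntegral (h0 : 0 < s) (h1 : s < 1) (β : ℝ) {t₀ : ℝ} (ht₀ : 0 < t₀) (p x : ℝ) :
    AnalyticAt ℂ (tailIntegral t₀ p s β) x := by
  have hU : IsOpen {τ : ℂ | -(t₀ / 2) < τ.im} := isOpen_lt continuous_const Complex.continuous_im
  refine DifferentiableOn.analyticAt (s := {τ : ℂ | -(t₀ / 2) < τ.im}) ?_
    (hU.mem_nhds (by simp [ht₀]))
  intro τ₀ hτ₀
  refine DifferentiableAt.differentiableWithinAt ?_
  obtain ⟨ε, hε, hball⟩ := Metric.isOpen_iff.1 hU τ₀ hτ₀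
  have him : ∀ t ∈ Set.Ioi t₀, ∀ τ ∈ Metric.ball τ₀ ε, t₀ / 2 < ((p + t * I : ℂ) + τ).im := by
    intro t ht τ hτ
    have h2 : -(t₀ / 2) < τ.im := hball hτ
    have h3 : t₀ < t := ht
    simp only [add_im, ofReal_im, mul_im, ofReal_re, I_im, mul_one, I_re, mul_zero, add_zero,
      zero_add]
    linarith
  have hg := integrableOn_gTheta_tail h0 h1 β ht₀ p
  refine differentiableAt_integral hε (bound := fun t => ‖gTheta s β (p + t * I)‖ * (√(t₀ / 2))⁻¹)
    ?_ ?_ (hg.norm.mul_const _) ?_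
  · intro τ hτ
    have hw : Measurable fun t : ℝ => (-I * (((p : ℂ) + t * I) + τ)) ^ (1 / 2 : ℂ) := by fun_prop
    exact (hg.aestronglyMeasurable.div₀ hw.aestronglyMeasurable).mul_const I
  · filter_upwards [ae_restrict_mem measurableSet_Ioi] with t ht τ hτ
    have h2 := him t ht τ hτ
    have hn : t₀ / 2 ≤ ‖(p + t * I : ℂ) + τ‖ :=
      h2.le.trans ((le_abs_self _).trans (abs_im_le_norm _))
    rw [periodIntegrand, norm_mul, norm_I, mul_one, norm_div, div_eq_mul_inv]
    exact mul_le_mul_of_nonneg_left (norm_weight_inv_le (half_pos ht₀) hn) (norm_nonneg _)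
  · filter_upwards [ae_restrict_mem measurableSet_Ioi] with t ht τ hτ
    have h2 := him t ht τ hτ
    have hre : 0 < (-I * (((p : ℂ) + t * I) + τ)).re := by rw [re_neg_I_mul]; linarith
    refine DifferentiableAt.differentiableWithinAt ?_
    unfold periodIntegrand
    have hw : DifferentiableAt ℂ (fun τ : ℂ => (-I * (((p : ℂ) + t * I) + τ)) ^ (1 / 2 : ℂ)) τ :=
      DifferentiableAt.cpow_const (by fun_prop) (Or.inl hre)
    have hd := (differentiableAt_const (gTheta s β (p + t * I))).div hw ?_
    · exact hd.mul_const I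
    rw [Complex.cpow_ne_zero_iff]
    left
    intro h
    rw [h] at hre
    exact lt_irrefl 0 hre

end

/-! ### Segment integrals extend across the real line -/

lemma cpow_half_ne_zero {z : ℂ} (hz : z ≠ 0) : z ^ (1 / 2 : ℂ) ≠ 0 :=
  (Complex.cpow_ne_zero_iff).2 (Or.inl hz)

lemma ne_zero_of_re_pos {z : ℂ} (hz : 0 < z.re) : z ≠ 0 := fun h => by
  rw [h] at hz; exact lt_irrefl 0 hz

lemma continuousOn_cpow_half {X : Type*} [TopologicalSpace X] {f : X → ℂ} {U : Set X}
    (hf : ContinuousOn f U) (h : ∀ q ∈ U, 0 < (f q).re) :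
    ContinuousOn (fun q => f q ^ (1 / 2 : ℂ)) U := fun q hq =>
  ContinuousAt.comp_continuousWithinAt (g := fun z : ℂ => z ^ (1 / 2 : ℂ)) (f := f)
    (continuousAt_cpow_const (Or.inl (h q hq))) (hf q hq)

/-- The numerator of `z + γ τ`. -/
def numer (γ : SL(2, ℤ)) (z τ : ℂ) : ℂ := jFac γ τ * z + (γ 0 0 * τ + γ 0 1)

lemma jFac_mul_add_mob (γ : SL(2, ℤ)) (z : ℂ) {τ : ℂ} (hτ : jFac γ τ ≠ 0) :
    jFac γ τ * (z + mob γ τ) = numer γ z τ := by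
  rw [mob, numer, mul_add, mul_div_cancel₀ _ hτ]

/-- At a real point, the numerators along a horizontal segment lie in a half-plane. -/
lemma exists_rotation (γ : SL(2, ℤ)) (x : ℝ) {t₀ : ℝ} (ht₀ : 0 < t₀) :
    ∃ ω : ℂ, ω ≠ 0 ∧ ∀ y : ℝ, 0 < (ω * numer γ (y + t₀ * I) x).re := by
  have hform : ∀ y : ℝ, numer γ (y + t₀ * I) x =
      (((γ 1 0 * x + γ 1 1) * y + (γ 0 0 * x + γ 0 1) : ℝ) : ℂ) +
        (((γ 1 0 * x + γ 1 1) * t₀ : ℝ) : ℂ) * I := fun y => by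
    simp only [numer, jFac]; push_cast; ring
  set D : ℝ := γ 1 0 * x + γ 1 1 with hD
  rcases lt_trichotomy D 0 with h | h | h
  · refine ⟨I, I_ne_zero, fun y => ?_⟩
    rw [hform]
    simp only [I_mul_re, add_im, ofReal_im, im_ofReal_mul, I_im, mul_one, zero_add]
    nlinarith
  · have hd : (γ 0 0 : ℝ) * γ 1 1 - γ 0 1 * γ 1 0 = 1 := by exact_mod_cast det_eq γ
    have hne : (γ 0 0 * x + γ 0 1 : ℝ) ≠ 0 := fun h2 => by
      have : (γ 1 0 : ℝ) * (γ 0 0 * x + γ 0 1) - γ 0 0 * (γ 1 0 * x + γ 1 1) = -1 := by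
        linear_combination -hd
      rw [h2, ← hD, h] at this
      norm_num at this
    refine ⟨((γ 0 0 * x + γ 0 1 : ℝ) : ℂ), by exact_mod_cast hne, fun y => ?_⟩
    rw [hform, h]
    simp only [zero_mul, zero_add, ofReal_zero, add_zero, re_ofReal_mul, ofReal_re]
    exact mul_self_pos.2 hne
  · refine ⟨-I, neg_ne_zero.2 I_ne_zero, fun y => ?_⟩
    rw [hform, re_neg_I_mul]
    simp only [add_im, ofReal_im, im_ofReal_mul, I_im, mul_one, zero_add]
    positivity

lemma continuous_numer (γ : SL(2, ℤ)) (t₀ : ℝ) :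
    Continuous fun q : ℂ × ℝ => numer γ (q.2 + t₀ * I) q.1 := by
  unfold numer jFac
  fun_prop

/-- After slashing, the integrand is g(z) times the inverse square root of a multiple of `numer γ z
τ`. At a real point this numerator is nonzero for all z on the segment, even at the pole of γ, and a
rotation puts it into the right half-plane, where the principal root is holomorphic. -/
lemma edgeAnalytic_segmentIntegral {t₀ : ℝ} (ht₀ : 0 < t₀) (p₁ p₂ s β : ℝ) :
    EdgeAnalytic (segmentIntegral t₀ p₁ p₂ s β) := fun γ x => by
  obtain ⟨ω, hω, hpos⟩ := exists_rotation γ x ht₀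
  have hnear : ∀ᶠ τ in 𝓝 (x : ℂ), ∀ y ∈ Set.uIcc p₁ p₂, 0 < (ω * numer γ (y + t₀ * I) τ).re := by
    refine isCompact_uIcc.eventually_forall_of_forall_eventually
      (P := fun (τ : ℂ) (y : ℝ) => 0 < (ω * numer γ (y + t₀ * I) τ).re) fun y _ => ?_
    have hc : Continuous fun q : ℂ × ℝ => (ω * numer γ (q.2 + t₀ * I) q.1).re :=
      Complex.continuous_re.comp (continuous_const.mul (continuous_numer γ t₀))
    exact hc.continuousAt.eventually (lt_mem_nhds (hpos y))
  obtain ⟨δ, hδ, hball⟩ := Metric.eventually_nhds_iff_ball.1 hnear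
  -- Chosen so that κ(ω·`numer`)^(1/2) squares to -i·`numer`, like the product of the two original
  -- roots. On the connected set U the two expressions then differ by one global sign.
  set κ : ℂ := (-I / ω) ^ (1 / 2 : ℂ) with hκ
  have hκ0 : κ ≠ 0 := cpow_half_ne_zero (div_ne_zero (neg_ne_zero.2 I_ne_zero) hω)
  set U : Set (ℂ × ℝ) := (Metric.ball (x : ℂ) δ ∩ uhp) ×ˢ Set.uIcc p₁ p₂ with hU
  have hUconn : IsPreconnected U :=
    (((convex_ball (x : ℂ) δ).inter convex_uhp).prod (convex_uIcc p₁ p₂)).isPreconnected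
  have him : ∀ q ∈ U, 0 < ((q.2 + t₀ * I : ℂ) + mob γ q.1).im := fun q hq => by
    have := im_mob_pos γ hq.1.2
    simp only [add_im, ofReal_im, mul_im, ofReal_re, I_im, mul_one, I_re, mul_zero, add_zero,
      zero_add]
    linarith
  have hf : ContinuousOn (fun q : ℂ × ℝ => jFac γ q.1 ^ (1 / 2 : ℂ) *
      (-I * ((q.2 + t₀ * I : ℂ) + mob γ q.1)) ^ (1 / 2 : ℂ)) U := by
    refine ((continuousOn_jFac_cpow γ _).comp continuousOn_fst fun q hq => hq.1.2).mul ?_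
    have hm : ContinuousOn (fun q : ℂ × ℝ => mob γ q.1) U :=
      (continuousOn_mob γ).comp continuousOn_fst fun q hq => hq.1.2
    refine continuousOn_cpow_half (continuousOn_const.mul (ContinuousOn.add (by fun_prop) hm))
      fun q hq => ?_
    rw [re_neg_I_mul]
    exact him q hq
  have hgc : ContinuousOn (fun q : ℂ × ℝ => κ * (ω * numer γ (q.2 + t₀ * I) q.1) ^ (1 / 2 : ℂ)) U := by
    exact continuousOn_const.mul (continuousOn_cpow_half (continuous_const.mul
      (continuous_numer γ t₀)).continuousOn fun q hq => hball q.1 hq.1.1 q.2 hq.2)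
  have hsq := hUconn.eq_or_eq_neg_of_sq_eq hf hgc (fun q hq => by
    simp only [Pi.pow_apply]
    rw [mul_pow, mul_pow, cpow_half_sq, cpow_half_sq, hκ, cpow_half_sq, cpow_half_sq,
      ← jFac_mul_add_mob γ _ (jFac_ne_zero γ hq.1.2)]
    field_simp) (fun {q} hq => mul_ne_zero hκ0
      (cpow_half_ne_zero (ne_zero_of_re_pos (hball q.1 hq.1.1 q.2 hq.2))))
  set G : ℂ → ℂ := fun τ => ∫ y in p₁..p₂, gTheta s β (y + t₀ * I) /
    (ω * numer γ (y + t₀ * I) τ) ^ (1 / 2 : ℂ) with hG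
  have hgl : Continuous fun y : ℝ => gTheta s β (y + t₀ * I) := by
    rw [← continuousOn_univ]
    refine (differentiableOn_gTheta s β).continuousOn.comp (by fun_prop) fun y _ => ?_
    simpa [uhp] using ht₀
  have hGd : DifferentiableOn ℂ G (Metric.ball (x : ℂ) δ) := by
    intro τ₀ hτ₀
    refine DifferentiableAt.differentiableWithinAt ?_
    have hcontG : ContinuousOn (fun q : ℂ × ℝ => gTheta s β (q.2 + t₀ * I) /
        (ω * numer γ (q.2 + t₀ * I) q.1) ^ (1 / 2 : ℂ)) (Metric.ball (x : ℂ) δ ×ˢ Set.uIcc p₁ p₂) := by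
      exact (hgl.comp continuous_snd).continuousOn.div (continuousOn_cpow_half (continuous_const.mul
        (continuous_numer γ t₀)).continuousOn fun q hq => hball q.1 hq.1 q.2 hq.2) fun q hq =>
        cpow_half_ne_zero (ne_zero_of_re_pos (hball q.1 hq.1 q.2 hq.2))
    obtain ⟨ρ, hρ, hρs⟩ := Metric.nhds_basis_closedBall.mem_iff.1
      (Metric.isOpen_ball.mem_nhds hτ₀)
    have hcomp : IsCompact (Metric.closedBall τ₀ ρ ×ˢ Set.uIcc p₁ p₂) :=
      (isCompact_closedBall τ₀ ρ).prod isCompact_uIcc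
    obtain ⟨M, hM⟩ := hcomp.exists_bound_of_continuousOn
      (hcontG.mono (Set.prod_mono hρs subset_rfl))
    have hmain : ∀ a b : ℝ, Set.Ioc a b ⊆ Set.uIcc p₁ p₂ → DifferentiableAt ℂ (fun τ =>
        ∫ y in Set.Ioc a b, gTheta s β (y + t₀ * I) /
          (ω * numer γ (y + t₀ * I) τ) ^ (1 / 2 : ℂ)) τ₀ := by
      intro a b hab
      refine differentiableAt_integral hρ (bound := fun _ => M) ?_ ?_
        (integrableOn_const (by simp)) ?_
      · intro τ hτ
        refine ContinuousOn.aestronglyMeasurable ?_ measurableSet_Ioc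
        exact hcontG.comp (f := fun y : ℝ => ((τ : ℂ), y)) (by fun_prop) fun y hy =>
          ⟨hρs (Metric.ball_subset_closedBall hτ), hab hy⟩
      · filter_upwards [ae_restrict_mem measurableSet_Ioc] with y hy τ hτ
        exact hM (τ, y) ⟨Metric.ball_subset_closedBall hτ, hab hy⟩
      · filter_upwards [ae_restrict_mem measurableSet_Ioc] with y hy τ hτ
        have hre := hball τ (hρs (Metric.ball_subset_closedBall hτ)) y (hab hy)
        refine DifferentiableAt.differentiableWithinAt ?_
        have hw : DifferentiableAt ℂ (fun τ : ℂ => (ω * numer γ (y + t₀ * I) τ) ^ (1 / 2 : ℂ)) τ :=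
          DifferentiableAt.cpow_const (by unfold numer jFac; fun_prop) (Or.inl hre)
        exact (differentiableAt_const (gTheta s β (y + t₀ * I))).div hw
          (cpow_half_ne_zero (ne_zero_of_re_pos hre))
    simp only [hG, intervalIntegral]
    refine (hmain _ _ ?_).sub (hmain _ _ ?_)
    · exact Set.Ioc_subset_Icc_self.trans Set.Icc_subset_uIcc
    · exact Set.Ioc_subset_Icc_self.trans Set.Icc_subset_uIcc'
  have hGa : AnalyticAt ℂ G x := hGd.analyticAt (Metric.ball_mem_nhds _ hδ)
  have hslash : ∃ c : ℂ, ∀ τ ∈ Metric.ball (x : ℂ) δ ∩ uhp,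
      slash γ (segmentIntegral t₀ p₁ p₂ s β) τ = c * G τ := by
    have hkey : ∃ c : ℂ, c ≠ 0 ∧ ∀ q ∈ U, jFac γ q.1 ^ (1 / 2 : ℂ) *
      (-I * ((q.2 + t₀ * I : ℂ) + mob γ q.1)) ^ (1 / 2 : ℂ) =
        c * (ω * numer γ (q.2 + t₀ * I) q.1) ^ (1 / 2 : ℂ) := by
      rcases hsq with h | h
      · exact ⟨κ, hκ0, fun q hq => h hq⟩
      · exact ⟨-κ, neg_ne_zero.2 hκ0, fun q hq => by simpa using h hq⟩
    obtain ⟨c, hc, hcq⟩ := hkey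
    refine ⟨c⁻¹, fun τ hτ => ?_⟩
    simp only [slash, segmentIntegral, hG]
    rw [← intervalIntegral.integral_const_mul, ← intervalIntegral.integral_const_mul]
    refine intervalIntegral.integral_congr fun y hy => ?_
    have h1 := hcq (τ, y) ⟨hτ, hy⟩
    simp only at h1 ⊢
    rw [div_eq_mul_inv (gTheta _ _ _), div_eq_mul_inv (gTheta _ _ _), mul_left_comm, ← mul_inv, h1,
      mul_inv]
    ring
  obtain ⟨c, hc⟩ := hslash
  refine ⟨fun τ => c * G τ, analyticAt_const.mul hGa, ?_⟩
  filter_upwards [self_mem_nhdsWithin, nhdsWithin_le_nhds (Metric.ball_mem_nhds (x : ℂ) hδ)]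
    with τ h1 h2
  exact hc τ ⟨h2, h1⟩

/-- Away from the pole, the weight `1/2` action preserves extendability across the real line. -/
lemma exists_analyticAt_slash (γ : SL(2, ℤ)) {x : ℝ} (hx : (γ 1 0 : ℝ) * x + γ 1 1 ≠ 0) {H : ℂ → ℂ}
    (hH : ∀ y : ℝ, AnalyticAt ℂ H y) :
    ∃ G : ℂ → ℂ, AnalyticAt ℂ G x ∧ ∀ᶠ τ in 𝓝[uhp] (x : ℂ), slash γ H τ = G τ := by
  set D : ℝ := γ 1 0 * x + γ 1 1 with hD
  have hjx : jFac γ x = D := by simp [jFac, hD]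
  have hω : 0 < ((D : ℂ) * jFac γ x).re := by
    rw [hjx, re_ofReal_mul, ofReal_re]; exact mul_self_pos.2 hx
  have hD0 : (D : ℂ) ≠ 0 := by exact_mod_cast hx
  have hjc : Continuous (jFac γ) := by unfold jFac; fun_prop
  have hnear : ∀ᶠ τ in 𝓝 (x : ℂ), 0 < ((D : ℂ) * jFac γ τ).re :=
    (Complex.continuous_re.comp (continuous_const.mul hjc)).continuousAt.eventually (lt_mem_nhds hω)
  obtain ⟨δ, hδ, hball⟩ := Metric.eventually_nhds_iff_ball.1 hnear
  set κ : ℂ := ((D : ℂ)⁻¹) ^ (1 / 2 : ℂ) with hκ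
  have hκ0 : κ ≠ 0 := cpow_half_ne_zero (inv_ne_zero hD0)
  have hconn : IsPreconnected (Metric.ball (x : ℂ) δ ∩ uhp) :=
    ((convex_ball (x : ℂ) δ).inter convex_uhp).isPreconnected
  have hg : ContinuousOn (fun τ => κ * ((D : ℂ) * jFac γ τ) ^ (1 / 2 : ℂ))
      (Metric.ball (x : ℂ) δ ∩ uhp) := by
    exact continuousOn_const.mul (continuousOn_cpow_half (continuous_const.mul hjc).continuousOn
      fun τ hτ => hball τ hτ.1)
  have hsq := hconn.eq_or_eq_neg_of_sq_eq
    ((continuousOn_jFac_cpow γ (1 / 2)).mono Set.inter_subset_right) hg (fun τ hτ => by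
    simp only [Pi.pow_apply]
    rw [mul_pow, cpow_half_sq, hκ, cpow_half_sq, cpow_half_sq, inv_mul_cancel_left₀ hD0])
    (fun {τ} hτ => mul_ne_zero hκ0 (cpow_half_ne_zero (ne_zero_of_re_pos (hball τ hτ.1))))
  have hkey : ∃ c : ℂ, c ≠ 0 ∧ ∀ τ ∈ Metric.ball (x : ℂ) δ ∩ uhp,
      jFac γ τ ^ (1 / 2 : ℂ) = c * ((D : ℂ) * jFac γ τ) ^ (1 / 2 : ℂ) := by
    rcases hsq with h | h
    · exact ⟨κ, hκ0, fun τ hτ => h hτ⟩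
    · exact ⟨-κ, neg_ne_zero.2 hκ0, fun τ hτ => by simpa using h hτ⟩
  obtain ⟨c, hc, hcq⟩ := hkey
  have hja : AnalyticAt ℂ (jFac γ) x := by unfold jFac; fun_prop
  have hm : AnalyticAt ℂ (mob γ) x := by
    exact AnalyticAt.div (f := fun τ : ℂ => (γ 0 0 : ℂ) * τ + γ 0 1) (by fun_prop) hja
      (by rw [hjx]; exact hD0)
  have hmx : mob γ x = (((γ 0 0 * x + γ 0 1) / D : ℝ) : ℂ) := by
    rw [mob, hjx]; push_cast; rfl
  refine ⟨fun τ => (c * ((D : ℂ) * jFac γ τ) ^ (1 / 2 : ℂ))⁻¹ * H (mob γ τ), ?_, ?_⟩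
  · refine ((analyticAt_const.mul ((analyticAt_const.mul hja).cpow analyticAt_const
      (Or.inl hω))).inv (mul_ne_zero hc (cpow_half_ne_zero (ne_zero_of_re_pos hω)))).mul ?_
    refine AnalyticAt.comp ?_ hm
    rw [hmx]
    exact hH _
  · filter_upwards [self_mem_nhdsWithin, nhdsWithin_le_nhds (Metric.ball_mem_nhds (x : ℂ) hδ)]
      with τ h1 h2
    rw [slash, hcq τ ⟨h2, h1⟩]

section

/-! ### The inversion of the theta function along vertical lines -/

variable {s β p : ℝ}

lemma hasSum_int_even_add_odd {f : ℤ → ℂ} {a b : ℂ} (h0 : HasSum (fun n : ℤ => f (2 * n)) a)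
    (h1 : HasSum (fun n : ℤ => f (2 * n - 1)) b) : HasSum f (a + b) := by
  have i0 : Function.Injective fun n : ℤ => 2 * n := fun m n h => by simp only at h; omega
  have i1 : Function.Injective fun n : ℤ => 2 * n - 1 := fun m n h => by simp only at h; omega
  refine HasSum.add_isCompl (s := Set.range fun n : ℤ => 2 * n) (t := Set.range fun n : ℤ => 2 * n - 1)
    ?_ (i0.hasSum_range_iff.2 h0) (i1.hasSum_range_iff.2 h1)
  have e0 : Set.range (fun n : ℤ => 2 * n) = {n | Even n} := by
    ext m
    simp only [Set.mem_range, Set.mem_ofPred_eq, Int.even_iff]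
    exact ⟨fun ⟨n, hn⟩ => by omega, fun h => ⟨m / 2, by omega⟩⟩
  have e1 : Set.range (fun n : ℤ => 2 * n - 1) = {n | Odd n} := by
    ext m
    simp only [Set.mem_range, Set.mem_ofPred_eq, Int.odd_iff]
    exact ⟨fun ⟨n, hn⟩ => by omega, fun h => ⟨(m + 1) / 2, by omega⟩⟩
  rw [e0, e1]
  exact Int.isCompl_even_odd

/-- The map z → z/(z+1) sends -1 + it to 1 + i/t, and this is the weight 3/2 transformation of g
restricted to that line. -/
lemma gTheta_neg_one (s : ℝ) {t : ℝ} (ht : 0 < t) : gTheta s (1 / 2) ((-1 : ℝ) + t * I) =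
    -I * (((√t * t)⁻¹ : ℝ) : ℂ) * gTheta s (1 / 2) ((1 : ℝ) + (1 ^ 2 / t : ℝ) * I) := by
  have h1 : gTheta s (1 / 2) ((-1 : ℝ) + t * I) =
      cexp (Real.pi * I * (s - s ^ 2)) * lineTheta s (-s) t := by
    rw [gTheta, lineTheta, ← tsum_mul_left]
    refine tsum_congr fun n => ?_
    obtain ⟨m, hm⟩ := Int.even_mul_succ_self (n - 1)
    have hm' : ((n : ℂ) - 1) * n = m + m := by
      rw [sub_add_cancel] at hm
      exact_mod_cast hm
    have : Real.pi * I * ((s : ℂ) + n) ^ 2 * ((-1 : ℝ) + t * I) +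
        2 * Real.pi * I * ((s : ℂ) + n) * ((1 / 2 : ℝ) : ℂ) = Real.pi * I * (s - s ^ 2) +
          2 * Real.pi * I * n * ((-s : ℝ) : ℂ) + -Real.pi * ((n : ℂ) + s) ^ 2 * t +
            ((-m : ℤ) : ℂ) * (2 * Real.pi * I) := by
      push_cast
      linear_combination (-Real.pi * I) * hm' + (Real.pi * ((n : ℂ) + s) ^ 2 * t) * I_sq
    rw [this, Complex.exp_add, exp_int_mul_two_pi_mul_I, Complex.exp_add, Complex.exp_add]
    ring
  have h2 : lineTheta s (-s) t = -I * cexp (2 * Real.pi * I * s ^ 2) * (((√t * t)⁻¹ : ℝ) : ℂ) *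
      lineTheta s s (1 ^ 2 / t) := by
    rw [← (hasSum_lineTheta_dual s (-s) ht).tsum_eq, lineTheta.eq_def s s, ← tsum_mul_left]
    refine tsum_congr fun n => ?_
    have e1 : -2 * Real.pi * I * ((-s : ℝ) : ℂ) * s = 2 * Real.pi * I * s ^ 2 := by push_cast; ring
    have e2 : -Real.pi * ((n : ℂ) - ((-s : ℝ) : ℂ)) ^ 2 / t =
        -Real.pi * ((n : ℂ) + s) ^ 2 * ((1 ^ 2 / t : ℝ) : ℂ) := by push_cast; ring
    rw [e1, e2]
    push_cast
    ring
  rw [h1, h2, gTheta_one]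
  have e3 : cexp (Real.pi * I * (s - s ^ 2)) * cexp (2 * Real.pi * I * s ^ 2) =
      cexp (Real.pi * I * (s ^ 2 + s)) := by rw [← Complex.exp_add]; congr 1; ring
  rw [← e3]
  ring

/-- The analogue for z → z/(2z+1), which sends -1/2 + it to 1/2 + i/(4t). -/
lemma gTheta_neg_half (s : ℝ) {t : ℝ} (ht : 0 < t) : gTheta s 0 ((-(1 / 2) : ℝ) + t * I) =
    -(1 + I) / 4 * (((√t * t)⁻¹ : ℝ) : ℂ) *
      gTheta s 0 ((1 / 2 : ℝ) + ((1 / 2) ^ 2 / t : ℝ) * I) := by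
  have ht0 : (t : ℂ) ≠ 0 := by exact_mod_cast ht.ne'
  have hpar : ∀ n : ℤ, cexp (Real.pi / 2 * I * ((2 * n : ℤ) : ℂ) ^ 2) = 1 ∧
      cexp (Real.pi / 2 * I * ((2 * n - 1 : ℤ) : ℂ) ^ 2) = I := fun n => by
    constructor
    · have : (Real.pi / 2 * I * ((2 * n : ℤ) : ℂ) ^ 2) = ((n ^ 2 : ℤ) : ℂ) * (2 * Real.pi * I) := by
        push_cast; ring
      rw [this, exp_int_mul_two_pi_mul_I]
    · have : (Real.pi / 2 * I * ((2 * n - 1 : ℤ) : ℂ) ^ 2) =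
          ((n ^ 2 - n : ℤ) : ℂ) * (2 * Real.pi * I) + Real.pi / 2 * I := by
        push_cast; ring
      rw [this, Complex.exp_add, exp_int_mul_two_pi_mul_I, exp_pi_div_two_mul_I, one_mul]
  -- Up to constants, the inversions of the two line theta functions on Re z = -1/2 are the even and
  -- the odd part of this series, whose total is g on Re z = 1/2.
  set f : ℤ → ℂ := fun m => ((m : ℂ) + s) * cexp (Real.pi * I * m * s) *
    cexp (-Real.pi * ((m : ℂ) + s) ^ 2 / (4 * t)) * cexp (Real.pi / 2 * I * (m : ℂ) ^ 2) with hf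
  set Q : ℂ := (((√t * t)⁻¹ : ℝ) : ℂ) with hQ
  have hQ0 : Q ≠ 0 := by
    rw [hQ]
    have : (√t * t)⁻¹ ≠ 0 := by positivity
    exact_mod_cast this
  set X : ℂ := -I * cexp (Real.pi * I * s ^ 2) * Q / 2 with hX
  have hX0 : X ≠ 0 := by
    rw [hX]
    exact div_ne_zero (mul_ne_zero (mul_ne_zero (neg_ne_zero.2 I_ne_zero) (Complex.exp_ne_zero _))
      hQ0) two_ne_zero
  have hev : HasSum (fun n : ℤ => f (2 * n)) (X⁻¹ * lineTheta s (-s / 2) t) := by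
    refine ((hasSum_lineTheta_dual s (-s / 2) ht).mul_left X⁻¹).congr_fun fun n => ?_
    rw [eq_inv_mul_iff_mul_eq₀ hX0, hX, ← hQ]
    simp only [hf]
    rw [(hpar n).1]
    have e1 : -2 * Real.pi * I * ((-s / 2 : ℝ) : ℂ) * s = Real.pi * I * s ^ 2 := by push_cast; ring
    have e2 : -Real.pi * ((n : ℂ) - ((-s / 2 : ℝ) : ℂ)) ^ 2 / t =
        -Real.pi * (((2 * n : ℤ) : ℂ) + s) ^ 2 / (4 * t) := by push_cast; field_simp; ring
    have e3 : 2 * Real.pi * I * n * s = Real.pi * I * ((2 * n : ℤ) : ℂ) * s := by push_cast; ring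
    rw [e1, e2, e3]
    push_cast
    ring
  have hod : HasSum (fun n : ℤ => f (2 * n - 1)) (X⁻¹ * (I * lineTheta s ((1 - s) / 2) t)) := by
    refine (((hasSum_lineTheta_dual s ((1 - s) / 2) ht).mul_left I).mul_left X⁻¹).congr_fun
      fun n => ?_
    rw [eq_inv_mul_iff_mul_eq₀ hX0, hX, ← hQ]
    simp only [hf]
    rw [(hpar n).2]
    have e1 : cexp (-2 * Real.pi * I * (((1 - s) / 2 : ℝ) : ℂ) * s) * cexp (2 * Real.pi * I * n * s) =
        cexp (Real.pi * I * s ^ 2) * cexp (Real.pi * I * ((2 * n - 1 : ℤ) : ℂ) * s) := by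
      rw [← Complex.exp_add, ← Complex.exp_add]; congr 1; push_cast; ring
    have e2 : -Real.pi * ((n : ℂ) - (((1 - s) / 2 : ℝ) : ℂ)) ^ 2 / t =
        -Real.pi * (((2 * n - 1 : ℤ) : ℂ) + s) ^ 2 / (4 * t) := by push_cast; field_simp; ring
    rw [e2]
    have e3 : ((n : ℂ) - (((1 - s) / 2 : ℝ) : ℂ)) = (((2 * n - 1 : ℤ) : ℂ) + s) / 2 := by
      push_cast; ring
    rw [e3]
    linear_combination (I * I * Q * ((((2 * n - 1 : ℤ) : ℂ) + s) / 2) *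
      cexp (-Real.pi * (((2 * n - 1 : ℤ) : ℂ) + s) ^ 2 / (4 * t))) * e1
  have hsum := hasSum_int_even_add_odd hev hod
  have hr : gTheta s 0 ((1 / 2 : ℝ) + ((1 / 2) ^ 2 / t : ℝ) * I) =
      cexp (Real.pi * I * s ^ 2 / 2) * (X⁻¹ * lineTheta s (-s / 2) t +
        X⁻¹ * (I * lineTheta s ((1 - s) / 2) t)) := by
    rw [← hsum.tsum_eq, gTheta, ← tsum_mul_left]
    refine tsum_congr fun n => ?_
    simp only [hf]
    have : Real.pi * I * ((s : ℂ) + n) ^ 2 * ((1 / 2 : ℝ) + ((1 / 2) ^ 2 / t : ℝ) * I) +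
        2 * Real.pi * I * ((s : ℂ) + n) * ((0 : ℝ) : ℂ) = Real.pi * I * s ^ 2 / 2 +
          (Real.pi * I * n * s + -Real.pi * ((n : ℂ) + s) ^ 2 / (4 * t) +
            Real.pi / 2 * I * (n : ℂ) ^ 2) := by
      push_cast
      field_simp
      linear_combination (4 * ((n : ℂ) + s) ^ 2) * I_sq
    rw [this, Complex.exp_add, Complex.exp_add, Complex.exp_add]
    ring
  have hl : gTheta s 0 ((-(1 / 2) : ℝ) + t * I) = cexp (-(Real.pi * I * s ^ 2 / 2)) *
      ((1 - I) / 2 * lineTheta s (-s / 2) t + (1 + I) / 2 * lineTheta s ((1 - s) / 2) t) := by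
    rw [gTheta, lineTheta, lineTheta, ← tsum_mul_left, ← tsum_mul_left,
      ← ((summable_lineTheta s _ ht).mul_left _).tsum_add ((summable_lineTheta s _ ht).mul_left _),
      ← tsum_mul_left]
    refine tsum_congr fun n => ?_
    have h1 : Real.pi * I * ((s : ℂ) + n) ^ 2 * ((-(1 / 2) : ℝ) + t * I) +
        2 * Real.pi * I * ((s : ℂ) + n) * ((0 : ℝ) : ℂ) = -(Real.pi * I * s ^ 2 / 2) +
          -(Real.pi * I * n * s) + -Real.pi * ((n : ℂ) + s) ^ 2 * t + -(Real.pi / 2 * I * n ^ 2) := by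
      push_cast
      linear_combination (Real.pi * ((n : ℂ) + s) ^ 2 * t) * I_sq
    have h2 : 2 * Real.pi * I * n * ((-s / 2 : ℝ) : ℂ) = -(Real.pi * I * n * s) := by push_cast; ring
    have h3 : 2 * Real.pi * I * n * (((1 - s) / 2 : ℝ) : ℂ) =
        -(Real.pi * I * n * s) + Real.pi * I * n := by
      push_cast; ring
    have h4 : cexp (-(Real.pi / 2 * I * (n : ℂ) ^ 2)) = (1 - I) / 2 + (1 + I) / 2 * (-1) ^ n := by
      rw [Complex.exp_neg]
      rcases Int.even_or_odd n with h | h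
      · rw [h.neg_one_zpow]
        obtain ⟨m, rfl⟩ := h
        rw [← two_mul, (hpar m).1]; ring
      · rw [h.neg_one_zpow]
        obtain ⟨m, rfl⟩ := h
        rw [show 2 * m + 1 = 2 * (m + 1) - 1 by ring, (hpar (m + 1)).2, Complex.inv_I]; ring
    rw [h1, h2, h3, Complex.exp_add, Complex.exp_add, Complex.exp_add, Complex.exp_add,
      exp_pi_mul_I_mul_int, h4]
    ring
  rw [hl, hr, hX]
  have e5 : cexp (Real.pi * I * s ^ 2 / 2) * cexp (Real.pi * I * s ^ 2 / 2) =
      cexp (Real.pi * I * s ^ 2) := by rw [← Complex.exp_add]; congr 1; ring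
  rw [← e5, Complex.exp_neg]
  have hE := Complex.exp_ne_zero (Real.pi * I * (s : ℂ) ^ 2 / 2)
  set E := cexp (Real.pi * I * (s : ℂ) ^ 2 / 2)
  have hI := I_ne_zero
  generalize lineTheta s (-s / 2) t = L1
  generalize lineTheta s ((1 - s) / 2) t = L2
  field_simp
  linear_combination (-4 * L1) * I_sq

/-! ### Transformation of the tail integrals -/

/-- Both factors lie in the right half-plane, so their arguments add without leaving (-π, π). -/
lemma neg_I_cpow_quotient {X Y Z : ℂ} {c : ℝ} (hc : 0 < c) (hX : 0 < X.re) (hY : 0 < Y.re)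
    (h : X * Y = c ^ 2 * Z) :
    X ^ (1 / 2 : ℂ) * Y ^ (1 / 2 : ℂ) = c * Z ^ (1 / 2 : ℂ) := by
  have h1 := abs_lt.1 (abs_arg_lt_pi_div_two_iff.2 (Or.inl hX))
  have h2 := abs_lt.1 (abs_arg_lt_pi_div_two_iff.2 (Or.inl hY))
  rw [← mul_cpow_of_arg (ne_zero_of_re_pos hX) (ne_zero_of_re_pos hY)
    ⟨by linarith [h1.1, h2.1], by linarith [h1.2, h2.2]⟩, h, ← ofReal_pow,
    ofReal_mul_cpow (by positivity), ofReal_sq_cpow_half hc.le]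

/-- The substitution t = p²/u, combined with the inversion of g from Re z = -p to Re z = p, carries
the slashed tail at -p to the missing lower part of the period integral at p. -/
lemma slash_lower_tailIntegral {r : ℕ} (hp : 0 < p) (hr : (r : ℝ) * p = 1) {k : ℂ}
    (hg : ∀ t : ℝ, 0 < t → gTheta s β ((-p : ℝ) + t * I) =
      k * (((√t * t)⁻¹ : ℝ) : ℂ) * gTheta s β (p + (p ^ 2 / t : ℝ) * I)) {τ : ℂ} (hτ : 0 < τ.im) :
    slash (lowerMat r) (tailIntegral p (-p) s β) τ =
      k * (((√p * p)⁻¹ : ℝ) : ℂ) * cexp (-(Real.pi * I / 4)) *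
        ∫ u in Set.Ioo 0 p, periodIntegrand p s β τ u := by
  have hr0 : 0 < r := by
    rcases Nat.eq_zero_or_pos r with rfl | h
    · simp at hr
    · exact h
  have hσim := im_lower hr0 hτ
  have hσ0 := lower_ne_zero hr0 hτ
  have hL := im_div_lower hr0 hτ
  have hrc : (r : ℂ) * p = 1 := by exact_mod_cast hr
  set σ : ℂ := (r : ℂ) * τ + 1 with hσ
  have himage : (fun u : ℝ => p ^ 2 / u) '' Set.Ioo 0 p = Set.Ioi p := by
    ext t
    constructor
    · rintro ⟨u, ⟨hu0, hup⟩, rfl⟩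
      show p < p ^ 2 / u
      rw [lt_div_iff₀ hu0]
      nlinarith
    · intro ht
      have ht' : p < t := ht
      have ht0 : 0 < t := hp.trans ht'
      refine ⟨p ^ 2 / t, ⟨by positivity, ?_⟩, ?_⟩
      · rw [div_lt_iff₀ ht0]
        nlinarith
      · field_simp
  have hinj : Set.InjOn (fun u : ℝ => p ^ 2 / u) (Set.Ioo 0 p) := by
    intro u hu v hv h
    have hu0 := hu.1.ne'
    have hv0 := hv.1.ne'
    simp only at h
    field_simp at h
    exact h.symm
  have hder : ∀ u ∈ Set.Ioo 0 p, HasDerivWithinAt (fun u : ℝ => p ^ 2 / u) (-(p ^ 2 / u ^ 2))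
      (Set.Ioo 0 p) u := fun u hu => by
    have h1 := ((hasDerivAt_inv hu.1.ne').const_mul (p ^ 2)).hasDerivWithinAt (s := Set.Ioo 0 p)
    simp only [div_eq_mul_inv] at h1 ⊢
    exact h1.congr_deriv (by ring)
  have hmob : mob (lowerMat r) τ = τ / σ := by simp [mob, jFac, lowerMat, hσ]
  have hj : jFac (lowerMat r) τ = σ := by simp [jFac, lowerMat, hσ]
  rw [slash, hmob, hj, tailIntegral, ← himage,
    integral_image_eq_integral_abs_deriv_smul measurableSet_Ioo hder hinj, ← integral_const_mul,
    ← integral_const_mul]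
  refine setIntegral_congr_fun measurableSet_Ioo fun u hu => ?_
  have hu0 : 0 < u := hu.1
  have hu0' : (u : ℂ) ≠ 0 := by exact_mod_cast hu0.ne'
  have hp0' : (p : ℂ) ≠ 0 := by exact_mod_cast hp.ne'
  have htpos : 0 < p ^ 2 / u := by positivity
  have hback : p ^ 2 / (p ^ 2 / u) = u := by field_simp
  simp only [periodIntegrand]
  rw [hg _ htpos, hback]
  set X : ℂ := -I * (((-p : ℝ) : ℂ) + ((p ^ 2 / u : ℝ) : ℂ) * I + τ / σ) with hX
  set Z : ℂ := -I * ((p : ℂ) + u * I + τ) with hZ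
  have hXre : 0 < X.re := by
    rw [hX, re_neg_I_mul]
    simp only [add_im, ofReal_im, im_ofReal_mul, I_im, mul_one, zero_add]
    linarith
  have hYre : 0 < (-I * σ).re := by rw [re_neg_I_mul]; exact hσim
  have hZre : 0 < Z.re := by
    rw [hZ, re_neg_I_mul]
    simp only [add_im, ofReal_im, im_ofReal_mul, I_im, mul_one, zero_add]
    linarith
  have hprod : X * (-I * σ) = ((√(p / u) : ℝ) : ℂ) ^ 2 * Z := by
    -- The scaling p/u relates the weight at the image point to the weight at p + iu; clearing
    -- denominators uses rp = 1.
    have : ((√(p / u) : ℝ) : ℂ) ^ 2 = p / u := by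
      rw [← ofReal_pow, Real.sq_sqrt (by positivity)]; push_cast; rfl
    rw [this, hX, hZ]
    push_cast
    field_simp
    rw [hσ]
    linear_combination (-I * u * τ + p * τ * I ^ 2) * hrc + (p ^ 2 + p * τ : ℂ) * I_sq
  have hq := neg_I_cpow_quotient (by positivity) hXre hYre hprod
  rw [neg_I_mul_cpow hσim] at hq
  have hsσ := cpow_half_ne_zero hσ0
  have hsX := cpow_half_ne_zero (ne_zero_of_re_pos hXre)
  have hsZ := cpow_half_ne_zero (ne_zero_of_re_pos hZre)
  have habs : |-(p ^ 2 / u ^ 2)| = p ^ 2 / u ^ 2 := by rw [abs_neg, abs_of_pos (by positivity)]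
  rw [habs, real_smul]
  have hreal : p ^ 2 / u ^ 2 * (√(p ^ 2 / u) * (p ^ 2 / u))⁻¹ = (√p * p)⁻¹ * √(p / u) := by
    rw [Real.sqrt_div (by positivity), Real.sqrt_sq hp.le, Real.sqrt_div hp.le]
    have h1 : 0 < √u := Real.sqrt_pos.2 hu0
    have h2 : 0 < √p := Real.sqrt_pos.2 hp
    field_simp
    rw [Real.sq_sqrt hu0.le]
  have hrealc : ((p ^ 2 / u ^ 2 : ℝ) : ℂ) * (((√(p ^ 2 / u) * (p ^ 2 / u))⁻¹ : ℝ) : ℂ) =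
      (((√p * p)⁻¹ : ℝ) : ℂ) * ((√(p / u) : ℝ) : ℂ) := by
    rw [← ofReal_mul, hreal, ofReal_mul]
  have hinv : ((√(p / u) : ℝ) : ℂ) * (σ ^ (1 / 2 : ℂ))⁻¹ * (X ^ (1 / 2 : ℂ))⁻¹ =
      cexp (-(Real.pi * I / 4)) * (Z ^ (1 / 2 : ℂ))⁻¹ := by
    field_simp
    linear_combination -hq
  rw [div_eq_mul_inv (k * _ * _), div_eq_mul_inv (gTheta _ _ _)]
  linear_combination (k * (σ ^ (1 / 2 : ℂ))⁻¹ * (X ^ (1 / 2 : ℂ))⁻¹ * gTheta s β (p + u * I) * I) *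
    hrealc + (k * (((√p * p)⁻¹ : ℝ) : ℂ) * gTheta s β (p + u * I) * I) * hinv

lemma periodIntegral_eq_head_add_tail (hp : 0 < p)
    (h : IntegrableOn (fun t : ℝ => gTheta s β (p + t * I)) (Set.Ioi 0)) {τ : ℂ} (hτ : 0 < τ.im) :
    periodIntegral p s β τ =
      (∫ u in Set.Ioo 0 p, periodIntegrand p s β τ u) + tailIntegral p p s β τ := by
  have hi := integrableOn_periodIntegrand h (τ := τ) (fun h0 => by
    have := congrArg Complex.im h0
    simp at this
    exact hτ.ne' this) hτ.le
  rw [periodIntegral, tailIntegral, ← integral_Ioc_eq_integral_Ioo, ← Set.Ioc_union_Ioi_eq_Ioi hp.le]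
  exact setIntegral_union (Set.Ioc_disjoint_Ioi le_rfl) measurableSet_Ioi
    (hi.mono_set Set.Ioc_subset_Ioi_self) (hi.mono_set (Set.Ioi_subset_Ioi hp.le))

lemma tailIntegral_add_int (t₀ q : ℝ) {N M : ℤ} (hN : Even N) (hM : s * N = M) (τ : ℂ) :
    tailIntegral t₀ (q + N) s β τ = cexp (Real.pi * I * s ^ 2 * N) * tailIntegral t₀ q s β (τ + N) := by
  rw [tailIntegral, tailIntegral, ← integral_const_mul]
  congr 1
  ext t
  simp only [periodIntegrand]
  have h1 : ((q + N : ℝ) : ℂ) + t * I = ((q : ℂ) + t * I) + N := by push_cast; ring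
  rw [h1, gTheta_add_int s β hN hM, show (q : ℂ) + t * I + N + τ = (q : ℂ) + t * I + (τ + N) by ring]
  ring

end

section

/-! ### Quantum modularity of `V` -/

variable {A : ℤ} {C a : ℕ} {s β p : ℝ}

/-- The error of F is c times head plus tail at p. By `hk`, the slashed tail at -p cancels the head
exactly, leaving the difference of the tails at p and -p, which is a segment integral. -/
lemma almostInvariant_lower {F : ℂ → ℂ} (h0 : 0 < s) (h1 : s < 1) {r : ℕ} (hp : 0 < p)
    (hr : (r : ℝ) * p = 1)
    (hi : IntegrableOn (fun t : ℝ => gTheta s β (p + t * I)) (Set.Ioi 0)) {k κ c : ℂ}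
    (hg : ∀ t : ℝ, 0 < t → gTheta s β ((-p : ℝ) + t * I) =
      k * (((√t * t)⁻¹ : ℝ) : ℂ) * gTheta s β (p + (p ^ 2 / t : ℝ) * I))
    (hκ : ‖κ‖ = 1) (hk : κ * (k * (((√p * p)⁻¹ : ℝ) : ℂ) * cexp (-(Real.pi * I / 4))) = -1)
    (hF : ∀ τ : ℂ, 0 < τ.im → F τ - κ * ((r : ℂ) * τ + 1) ^ (-(1 / 2) : ℂ) * F (τ / (r * τ + 1)) =
      c * periodIntegral p s β τ) :
    AlmostInvariant (fun τ => F τ - c * tailIntegral p (-p) s β τ) (lowerMat r) := by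
  refine ⟨κ, hκ, fun τ => c * segmentIntegral p p (-p) s β τ,
    (edgeAnalytic_segmentIntegral hp p (-p) s β).const_mul c, fun τ hτ => ?_⟩
  have t1 := hF τ hτ
  have t2 := slash_lower_tailIntegral hp hr hg hτ
  have t3 := periodIntegral_eq_head_add_tail hp hi hτ
  have t4 := tailIntegral_sub h0 h1 β hp p (-p) hτ
  have hmob : mob (lowerMat r) τ = τ / (r * τ + 1) := by simp [mob, jFac, lowerMat]
  have hj : jFac (lowerMat r) τ = r * τ + 1 := by simp [jFac, lowerMat]
  rw [Complex.cpow_neg] at t1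
  simp only [slash, hmob, hj] at t2 ⊢
  rw [t3] at t1
  rw [← t4]
  linear_combination t1 + (κ * c) * t2 +
    (c * ∫ u in Set.Ioo 0 p, periodIntegrand p s β τ u) * hk

lemma width_mul (A : ℤ) (hC : 0 < C) : ∃ M : ℤ, (A / C : ℝ) * width C = M := by
  have hC0 : (C : ℝ) ≠ 0 := by exact_mod_cast hC.ne'
  obtain ⟨m, hm⟩ := dvd_width C
  refine ⟨A * m, ?_⟩
  rw [hm]
  push_cast
  field_simp

/-- The translation factor is put in the form in which g changes in `gTheta_add_int`, so that V and
the tail integral transform alike. -/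
lemma V_add_width (A : ℤ) (hC : 0 < C) (a : ℕ) {τ : ℂ} (hτ : 0 < τ.im) :
    V A C a τ = cexp (Real.pi * I * ((A / C : ℝ) : ℂ) ^ 2 * width C) * V A C a (τ + width C) := by
  obtain ⟨M, hM⟩ := width_mul A hC
  have hM' : (A / C : ℂ) * width C = M := by exact_mod_cast hM
  rw [V_add_even A C a (even_width C) hM' hτ, e, ← mul_assoc, ← Complex.exp_add, ← Complex.exp_add,
    ← Complex.exp_add]
  have hC0 : (C : ℂ) ≠ 0 := by exact_mod_cast hC.ne'
  have : Real.pi * I * ((A / C : ℝ) : ℂ) ^ 2 * width C +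
      (2 * Real.pi * I * (-((2 * A - C : ℂ) ^ 2 / (8 * C ^ 2)) * width C) +
        Real.pi * I * width C / 4 + Real.pi * I * M) = (M : ℂ) * (2 * Real.pi * I) := by
    rw [← hM']
    push_cast
    field_simp
    ring
  rw [this, exp_int_mul_two_pi_mul_I, one_mul]

/-- V and the tail acquire the same phase under translation, except that the foot of the ray moves
by `width C`; the discrepancy is again a segment integral. -/
lemma almostInvariant_upper (hC : 0 < C) (h0 : 0 < (A / C : ℝ)) (h1 : (A / C : ℝ) < 1) (hp : 0 < p)
    (c : ℂ) : AlmostInvariant (fun τ => V A C a τ - c * tailIntegral p (-p) (A / C) β τ)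
      (upperMat (width C)) := by
  obtain ⟨M, hM⟩ := width_mul A hC
  refine ⟨cexp (Real.pi * I * ((A / C : ℝ) : ℂ) ^ 2 * width C), ?_,
    fun τ => c * segmentIntegral p (-p + width C) (-p) (A / C) β τ,
    (edgeAnalytic_segmentIntegral hp _ _ _ _).const_mul c, fun τ hτ => ?_⟩
  · have : Real.pi * I * ((A / C : ℝ) : ℂ) ^ 2 * width C =
        ((Real.pi * (A / C : ℝ) ^ 2 * width C : ℝ) : ℂ) * I := by push_cast; ring
    rw [this, norm_exp_ofReal_mul_I]
  · have t1 := V_add_width A hC a hτ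
    have t2 := tailIntegral_add_int (β := β) p (-p) (even_width C) hM τ
    have t4 := tailIntegral_sub h0 h1 β hp (-p + width C) (-p) hτ
    have hmob : mob (upperMat (width C)) τ = τ + width C := by simp [mob, jFac, upperMat]
    have hj : jFac (upperMat (width C)) τ = 1 := by simp [jFac, upperMat]
    simp only [slash, hmob, hj, Complex.one_cpow, inv_one, one_mul]
    rw [← t4]
    linear_combination t1 - c * t2

lemma almostInvariant_of_mem (hC : 0 < C) (h0 : 0 < (A / C : ℝ)) (h1 : (A / C : ℝ) < 1) (hp : 0 < p)
    (c : ℂ) (hL : AlmostInvariant (fun τ => V A C a τ - c * tailIntegral p (-p) (A / C) β τ)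
      (lowerMat (if Even a then 1 else 2))) {γ : SL(2, ℤ)} (hγ : γ ∈ Galpha C a) :
    AlmostInvariant (fun τ => V A C a τ - c * tailIntegral p (-p) (A / C) β τ) γ := by
  refine almostInvariant_of_mem_closure (fun δ hδ => ?_) hγ
  rcases hδ with rfl | rfl
  · exact hL
  · exact almostInvariant_upper hC h0 h1 hp c

/-- The corrected function is almost invariant under all of `G_α`. -/
lemma exists_almostInvariant (hC : 0 < C) (ha : a ≤ 3) (h0 : 0 < (A / C : ℝ))
    (h1 : (A / C : ℝ) < 1) : ∃ H : ℂ → ℂ, (∀ y : ℝ, AnalyticAt ℂ H y) ∧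
      ∀ γ ∈ Galpha C a, AlmostInvariant (fun τ => V A C a τ - H τ) γ := by
  have hexp : cexp (-(Real.pi * I / 4)) ≠ 0 := Complex.exp_ne_zero _
  by_cases hae : Even a
  · refine ⟨fun τ => (-I / 2 * e (-A / (2 * C))) * tailIntegral 1 (-1) (A / C) (1 / 2) τ, fun y =>
      analyticAt_const.mul (analyticAt_tailIntegral h0 h1 _ one_pos _ y), fun γ hγ =>
      almostInvariant_of_mem hC h0 h1 one_pos _ ?_ hγ⟩
    rw [if_pos hae]
    refine almostInvariant_lower (r := 1) (κ := (e (1 / 8))⁻¹) (k := -I) h0 h1 one_pos (by simp)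
      (integrableOn_gTheta_one h0 h1) (fun t ht => gTheta_neg_one _ ht) ?_ ?_ fun τ hτ => ?_
    · have : 2 * Real.pi * I * (1 / 8 : ℂ) = ((Real.pi / 4 : ℝ) : ℂ) * I := by push_cast; ring
      rw [e, this, norm_inv, norm_exp_ofReal_mul_I, inv_one]
    · have hz : (e (1 / 8))⁻¹ = cexp (-(Real.pi * I / 4)) := by
        rw [e, ← Complex.exp_neg]; congr 1; ring
      rw [hz]
      simp only [Real.sqrt_one, mul_one, inv_one, ofReal_one]
      linear_combination (-I) * exp_neg_pi_four_sq + I_sq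
    · simpa using V_lower_of_even hC ha hae h0 h1 hτ
  · have hao : Odd a := Nat.not_even_iff_odd.1 hae
    refine ⟨fun τ => (-I / 2) * tailIntegral (1 / 2) (-(1 / 2)) (A / C) 0 τ, fun y =>
      analyticAt_const.mul (analyticAt_tailIntegral h0 h1 _ one_half_pos _ y), fun γ hγ =>
      almostInvariant_of_mem hC h0 h1 one_half_pos _ ?_ hγ⟩
    rw [if_neg hae]
    refine almostInvariant_lower (r := 2) (κ := 1) (k := -(1 + I) / 4) h0 h1 one_half_pos
      (by norm_num) (integrableOn_gTheta_half h0 h1) (fun t ht => gTheta_neg_half _ ht) (by simp) ?_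
      fun τ hτ => ?_
    · have h2 : (√(1 / 2 : ℝ) * (1 / 2))⁻¹ = 2 * √2 := by
        rw [Real.sqrt_div zero_le_one, Real.sqrt_one]
        have : 0 < √(2 : ℝ) := by positivity
        field_simp
      rw [h2]
      push_cast
      linear_combination (-(1 + I) / 2) * sqrt_two_mul_exp + (1 / 2) * I_sq
    · simpa using V_lower_of_odd hC ha hao h0 h1 hτ

theorem isQuantumSet_V (hC : 0 < C) (hAC : Int.gcd A C = 1) :
    IsQuantumSet (V A C a) (Salpha C a) (Galpha C a) :=
  ⟨fun _ hx => tendsto_V_vertical hC hAC hx, fun _ hγ _ hx hd => moeb_mem (GCong_of_mem hγ) hx hd⟩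

/-- The error of V is the edge-analytic error of V - H plus H minus ε times the slashed H. The
slashed H extends across the real line wherever cx + d ≠ 0. Comparing limits along vertical lines
identifies its boundary values with the error at points of S_α. -/
lemma exists_error_function (hC : 0 < C) (hAC : Int.gcd A C = 1) (ha : a ≤ 3)
    (h0 : 0 < (A / C : ℝ)) (h1 : (A / C : ℝ) < 1) {γ : SL(2, ℤ)} (hγ : γ ∈ Galpha C a) :
    ∃ ε : ℂ, ‖ε‖ = 1 ∧ ∃ Φ : ℝ → ℂ,
      AnalyticOnNhd ℝ Φ {x : ℝ | (γ 1 0 : ℝ) * x + γ 1 1 ≠ 0} ∧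
      ∀ x ∈ Salpha C a, den γ x ≠ 0 →
        V A C a x - ε⁻¹ * autFactor (1 / 2) γ x * V A C a (moeb γ x) = Φ x := by
  obtain ⟨H, hH, hinv⟩ := exists_almostInvariant hC ha h0 h1 (A := A) (a := a)
  obtain ⟨ε, hε, R, hR, hW⟩ := hinv γ hγ
  have hext : ∀ x ∈ {x : ℝ | (γ 1 0 : ℝ) * x + γ 1 1 ≠ 0}, ∃ G : ℂ → ℂ, AnalyticAt ℂ G x ∧
      ∀ᶠ τ in 𝓝[uhp] (x : ℂ), V A C a τ - ε * slash γ (V A C a) τ = G τ := fun x hx => by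
    obtain ⟨G₁, a₁, e₁⟩ := hR 1 x
    obtain ⟨G₂, a₂, e₂⟩ := exists_analyticAt_slash γ hx hH
    refine ⟨fun τ => G₁ τ + H τ - ε * G₂ τ, (a₁.add (hH x)).sub (analyticAt_const.mul a₂), ?_⟩
    filter_upwards [e₁, e₂, self_mem_nhdsWithin] with τ t₁ t₂ hτ
    have t₃ := hW τ hτ
    rw [slash_one] at t₁
    rw [← t₁, ← t₂]
    simp only [slash] at t₃ ⊢
    linear_combination t₃
  obtain ⟨Φ, hΦ, hlim⟩ := exists_boundary_function hext
  -- The multiplier enters the definition of quantum modularity through its inverse.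
  refine ⟨ε⁻¹, by simp [hε], Φ, hΦ, fun x hx hd => ?_⟩
  have hd' : (γ 1 0 : ℝ) * (x : ℝ) + γ 1 1 ≠ 0 := by
    have : ((den γ x : ℚ) : ℝ) ≠ 0 := by exact_mod_cast hd
    simpa [den] using this
  have t0 := (hlim x hd').comp (tendsto_vertical_uhp x)
  have t1 := tendsto_V_vertical hC hAC hx
  have t2 := tendsto_V_mob hC hAC (GCong_of_mem hγ) hx hd
  have t3 := tendsto_jFac_cpow (1 / 2) γ hd
  rw [inv_inv]
  refine tendsto_nhds_unique (t1.sub ((t3.const_mul ε).mul t2)) (t0.congr fun y => ?_)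
  simp only [Function.comp, slash, ofReal_ratCast]
  rw [show (-((1 / 2 : ℝ) : ℂ)) = -(1 / 2 : ℂ) by push_cast; rfl, Complex.cpow_neg]
  ring

theorem isQuantumModularForm_V (hC : 0 < C) (hAC : Int.gcd A C = 1) (ha : a ≤ 3)
    (h0 : 0 < (A / C : ℝ)) (h1 : (A / C : ℝ) < 1) :
    IsQuantumModularForm (1 / 2) (Salpha C a) (Galpha C a) (fun x => V A C a x) := by
  refine ⟨fun _ hγ _ hx hd => moeb_mem (GCong_of_mem hγ) hx hd, ?_⟩
  have h : ∀ γ : SL(2, ℤ), ∃ ε : ℂ, γ ∈ Galpha C a → ‖ε‖ = 1 ∧ ∃ Φ : ℝ → ℂ,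
      AnalyticOnNhd ℝ Φ {x : ℝ | (γ 1 0 : ℝ) * x + γ 1 1 ≠ 0} ∧ ∀ x ∈ Salpha C a, den γ x ≠ 0 →
        V A C a x - ε⁻¹ * autFactor (1 / 2) γ x * V A C a (moeb γ x) = Φ x := fun γ => by
    by_cases hγ : γ ∈ Galpha C a
    · obtain ⟨ε, hε⟩ := exists_error_function hC hAC ha h0 h1 hγ
      exact ⟨ε, fun _ => hε⟩
    · exact ⟨1, fun h => absurd h hγ⟩
  choose ε hε using h
  exact ⟨ε, hε⟩

end

end QuantumV

end

/-! ### Assembly of the theorem -/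

theorem theorem1p2 (A : ℤ) (C a : ℕ) (hC : 0 < C) (ha : a ≤ 3) (hAC : Int.gcd A C = 1)
    (h0 : (0 : ℚ) < A / C) (h1 : (A / C : ℚ) < 1) (hodd : Odd a → (A / C : ℚ) ≠ 1 / 2) :
    (∀ x ∈ QuantumV.Salpha C a, QuantumV.G2WellDefined
      (QuantumV.e (QuantumV.alpha A C a x)) (Complex.exp (Real.pi * Complex.I * x))) ∧
    QuantumV.IsQuantumSet (QuantumV.V A C a) (QuantumV.Salpha C a) (QuantumV.Galpha C a) ∧
    QuantumV.IsQuantumModularForm (1 / 2) (QuantumV.Salpha C a) (QuantumV.Galpha C a)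
      (fun x => QuantumV.V A C a x) ∧
    (Even a → ∀ τ ∈ QuantumV.domain C a \ {-1},
      MeasureTheory.IntegrableOn (QuantumV.periodIntegrand 1 (A / C) (1 / 2) τ) (Set.Ioi 0) ∧
      QuantumV.V A C a τ
          - (QuantumV.e (1 / 8))⁻¹ * (τ + 1) ^ (-(1 / 2) : ℂ) * QuantumV.V A C a (τ / (τ + 1))
        = -Complex.I / 2 * QuantumV.e (-A / (2 * C))
          * QuantumV.periodIntegral 1 (A / C) (1 / 2) τ) ∧
    (Odd a → ∀ τ ∈ QuantumV.domain C a \ {-(1 / 2)},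
      MeasureTheory.IntegrableOn (QuantumV.periodIntegrand (1 / 2) (A / C) 0 τ) (Set.Ioi 0) ∧
      QuantumV.V A C a τ
          - (2 * τ + 1) ^ (-(1 / 2) : ℂ) * QuantumV.V A C a (τ / (2 * τ + 1))
        = -Complex.I / 2 * QuantumV.periodIntegral (1 / 2) (A / C) 0 τ) ∧
    (∀ τ ∈ QuantumV.domain C a,
      (Even C → QuantumV.V A C a τ
          - (-1 : ℂ) ^ (A + (C : ℤ) / 2) * QuantumV.e (C / 8)
            * QuantumV.e (C * (2 * A - C) ^ 2 / (8 * C ^ 2)) * QuantumV.V A C a (τ + C) = 0) ∧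
      (Odd C → QuantumV.V A C a τ
          + QuantumV.e (C / 4) * QuantumV.e ((2 * A - C) ^ 2 / (4 * C))
            * QuantumV.V A C a (τ + 2 * C) = 0)) := by
  have hlt : (0 : ℝ) < A / C := by exact_mod_cast h0
  have hgt : (A / C : ℝ) < 1 := by exact_mod_cast h1
  exact ⟨fun x hx => QuantumV.g2WellDefined hC hAC hx, QuantumV.isQuantumSet_V hC hAC,
    QuantumV.isQuantumModularForm_V hC hAC ha hlt hgt,
    fun hae τ hτ => QuantumV.V_period_of_even hC hAC ha hae hlt hgt hτ,
    fun hao τ hτ => QuantumV.V_period_of_odd hC hAC ha hao hlt hgt hτ,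
    fun τ hτ => QuantumV.V_translation hC hAC hτ⟩
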